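/- Let $n\ge 2$, let $a$, $b_k$, $c_k$ ($k=1,\dots,n$) and $m_\mu$ ($\mu=1,\dots,n$) be real constants with $b_n=a\,c_n$, and use coordinates $(x_1,\dots,x_n,\psi_0,\dots,\psi_{n-1})$ on $\mathbb R^{2n}$. Put $$U_\mu=\prod_{\nu\ne\mu}(x_\mu^2-x_\nu^2),\quad X_\mu=\frac1{4x_\mu^2}\Big(\sum_{k=1}^n c_kx_\mu^{2k}+m_\mu\Big),\quad N_\mu=\sum_{k=1}^n b_kx_\mu^{2k}+a\,m_\mu,\quad \Phi=1+\sum_{\mu=1}^n\frac{N_\mu}{U_\mu},$$ let $A^{(k)}_\mu$ be the $k$-th elementary symmetric polynomial in the $x_\nu^2$ with $\nu\ne\mu$, and let $$A_{(1)}=\frac1\Phi\sum_{\mu=1}^n\frac{N_\mu}{U_\mu}\sum_{k=0}^{n-1}A^{(k)}_\mu d\psi_k,\qquad e^\mu=\sqrt{\frac{U_\mu}{X_\mu}}\,dx_\mu,\qquad e^{\hat\mu}=2x_\mu\sqrt{\frac{X_\mu}{U_\mu}}\Big(\sum_{k=0}^{n-1}A^{(k)}_\mu d\psi_k-A_{(1)}\Big).$$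 Let $\Omega$ be the set of points where all $x_\mu\neq0$, the $x_\mu^2$ are pairwise distinct, $X_\mu/U_\mu>0$ for all $\mu$, and $\Phi>0$. On $\Omega$ consider the metric (type A with $f_\mu=2x_\mu$) $$g=\sum_{\mu=1}^n\frac{U_\mu}{X_\mu}dx_\mu^2+\sum_{\mu=1}^n\frac{4x_\mu^2X_\mu}{U_\mu}\Big(\sum_{k=0}^{n-1}A^{(k)}_\mu d\psi_k-A_{(1)}\Big)^2,$$ let $(e_\mu,e_{\hat\mu})$ be the frame dual to $(e^\mu,e^{\hat\mu})$, and for $\epsilon_\mu=\pm1$ let $J_\epsilon$ be given by $J_\epsilon e_\mu=-\epsilon_\mu e_{\hat\mu}$, $J_\epsilon e_{\hat\mu}=\epsilon_\mu^{-1}e_\mu$. Assume that all $\epsilon_\mu$ are equal, and set, for real $q$, $$F=q\sum_\mu\frac{\partial_\mu\ln\Phi}{2x_\mu}e^\mu\wedge e^{\hat\mu},\qquad H=-\sum_{\mu\neq\nu}\frac{x_\nu\,\partial_\mu\ln\Phi}{x_\mu}\sqrt{\frac{X_\nu}{U_\nu}}\,e^\mu\wedge e^{\hat\mu}\wedge e^{\hat\nu},\qquad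 \phi=\ln\Phi .$$ Then on $\Omega$: 1. $\Phi=1+b_{n-1}+b_n\sum_\mu x_\mu^2+a\sum_\mu m_\mu/U_\mu$, and $(e^\mu,e^{\hat\mu})$ is an orthonormal coframe of $g$. 2. $g$ is a smooth Riemannian metric, $J_\epsilon$ is an integrable complex structure, $g$ is Hermitian for it, and $H$ is the Bismut torsion of $(g,J_\epsilon)$: the connection $\nabla^B_XY=\nabla_XY+\frac12\sum_aH(X,Y,e_a)e_a$, where $\nabla$ is the Levi-Civita connection and $(e_a)$ an orthonormal frame, satisfies $\nabla^Bg=0$ and $\nabla^BJ_\epsilon=0$. So $(g,J_\epsilon,H)$ is Kähler with torsion. 3. If $1+b_{n-1}=a\,c_{n-1}+a\,q^2$, then $(g,\phi,F,H)$ solves abelian heterotic supergravity. That is, $F=dA$ with $A=q\,A_{(1)}$, there is a smooth $2$-form $B$ on $\Omega$ with $H=dB-A\wedge dA$, and (for either orientation, with $*$ normalised by $\beta\wedge*\alpha=\langle\beta,\alpha\rangle\,\mathrm{vol}$) $$R_{ab}-\nabla_a\nabla_b\phi-F_a{}^cF_{bc}-\tfrac14H_a{}^{cd}H_{bcd}=0,\qquad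 d(e^\phi*F)=e^\phi*H\wedge F,\qquad d(e^\phi*H)=0,$$ $$(\nabla\phi)^2+2\nabla^2\phi+\tfrac12F_{ab}F^{ab}+\tfrac1{12}H_{abc}H^{abc}-R=0 .$$ 4. If $c_n=0$, then the Ricci form $\rho^B(X,Y)=\frac12\sum_{a=1}^{2n}g\big(R^B(X,Y)e_a,J_\epsilon e_a\big)$ of the Bismut connection, where $R^B$ is its curvature, vanishes; that is, $(g,J_\epsilon)$ is Calabi–Yau with torsion. -/

import Mathlib

open scoped ContDiff

/-! ### Differential forms on coordinate domains

Points of a coordinate domain are functions `ι → ℝ`; a `k`-form is a function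
`(ι → ℝ) → DForm ι k`, and its exterior derivative is Mathlib's `extDeriv`. -/

noncomputable section

/-- Alternating `k`-linear forms on the coordinate tangent space. -/
abbrev DForm (ι : Type*) [Fintype ι] (k : ℕ) : Type _ := (ι → ℝ) [⋀^Fin k]→L[ℝ] ℝ

/-- The coordinate vector `∂_i`. -/
def cvec {ι : Type*} [DecidableEq ι] (i : ι) : ι → ℝ := Pi.single i 1

theorem alternatingMap_continuous {ι : Type*} [Fintype ι] {k : ℕ}
    (f : (ι → ℝ) [⋀^Fin k]→ₗ[ℝ] ℝ) : Continuous f := by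
  classical
  have h : ∀ v : Fin k → ι → ℝ,
      f v = ∑ I : Fin k → ι, (∏ s, v s (I s)) * f (fun s => cvec (I s)) := by
    intro v
    have hv : v = fun s => ∑ i : ι, v s i • cvec i := by
      funext s
      simpa [cvec] using pi_eq_sum_univ' (v s)
    conv_lhs => rw [hv]
    change f.toMultilinearMap _ = _
    rw [MultilinearMap.map_sum]
    refine Finset.sum_congr rfl fun I _ => ?_
    rw [MultilinearMap.map_smul_univ]
    rfl
  have h' : (f : (Fin k → ι → ℝ) → ℝ) = fun v =>
      ∑ I : Fin k → ι, (∏ s, v s (I s)) * f (fun s => cvec (I s)) := funext h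
  rw [h']
  fun_prop

/-- In finite dimension every alternating map is continuous. -/
def toDForm {ι : Type*} [Fintype ι] {k : ℕ} (f : (ι → ℝ) [⋀^Fin k]→ₗ[ℝ] ℝ) : DForm ι k :=
  { f with cont := alternatingMap_continuous f }

/-- The `1`-form with components `c`, that is `∑ i, c i dx^i`. -/
def oneForm {ι : Type*} [Fintype ι] (c : ι → ℝ) : DForm ι 1 :=
  ContinuousAlternatingMap.ofSubsingleton ℝ (ι → ℝ) ℝ (0 : Fin 1)
    (∑ i, c i • ContinuousLinearMap.proj (R := ℝ) (φ := fun _ : ι => ℝ) i)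

/-- The exterior product, normalised so that
`(α ∧ β)(u, v) = α u * β v - α v * β u` for `1`-forms. -/
def wedge {ι : Type*} [Fintype ι] {k l : ℕ} (α : DForm ι k) (β : DForm ι l) : DForm ι (k + l) :=
  toDForm (((LinearMap.mul' ℝ ℝ).compAlternatingMap
    (α.toAlternatingMap.domCoprod β.toAlternatingMap)).domDomCongr finSumFinEquiv)

/-- `w ↦ f (u, w)`. -/
def fixLeft {V : Type*} [AddCommGroup V] [Module ℝ V] {k m : ℕ}
    (f : V [⋀^Fin k ⊕ Fin m]→ₗ[ℝ] ℝ) (u : Fin k → V) : V [⋀^Fin m]→ₗ[ℝ] ℝ where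
  toFun w := f (Sum.elim u w)
  map_update_add' w i x y := by
    rw [← Sum.update_elim_inr, ← Sum.update_elim_inr, ← Sum.update_elim_inr]
    convert f.map_update_add (Sum.elim u w) (Sum.inr i) x y
  map_update_smul' w i c x := by
    rw [← Sum.update_elim_inr, ← Sum.update_elim_inr]
    convert f.map_update_smul (Sum.elim u w) (Sum.inr i) c x
  map_eq_zero_of_eq' w i j hw hij :=
    f.map_eq_zero_of_eq (Sum.elim u w) (i := Sum.inr i) (j := Sum.inr j) hw
      (fun h => hij (Sum.inr_injective h))

/-- The volume form `√(det g) dx^{o 0} ∧ dx^{o 1} ∧ ⋯` of the metric with components `g`;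
the enumeration `o` of the coordinates is the orientation. -/
def volForm {ι : Type*} [Fintype ι] [DecidableEq ι] {D : ℕ} (o : Fin D ≃ ι)
    (g : Matrix ι ι ℝ) : (ι → ℝ) [⋀^Fin D]→ₗ[ℝ] ℝ :=
  Real.sqrt g.det • (Matrix.detRowAlternating (n := ι) (R := ℝ)).domDomCongr o.symm

/-- The Hodge star of a `k`-form, normalised by `β ∧ ⋆α = ⟨β, α⟩ vol`; in components
`(⋆α)_{j₁…j_m} = (1/k!) α^{i₁…i_k} vol_{i₁…i_k j₁…j_m}`. -/
def hodgeStar {ι : Type*} [Fintype ι] [DecidableEq ι] {D k m : ℕ} (o : Fin D ≃ ι)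
    (h : k + m = D) (g : Matrix ι ι ℝ) (α : DForm ι k) : DForm ι m :=
  toDForm ((1 / (k.factorial : ℝ)) • ∑ I : Fin k → ι, ∑ J : Fin k → ι,
    ((∏ s, g⁻¹ (I s) (J s)) * α (fun s => cvec (J s))) •
      fixLeft ((volForm o g).domDomCongr ((finCongr h.symm).trans finSumFinEquiv.symm))
        (fun s => cvec (I s)))

/-! ### Riemannian geometry in coordinates -/

/-- The partial derivative `∂_i f`. -/
def pd {ι : Type*} [Fintype ι] [DecidableEq ι] (i : ι) (f : (ι → ℝ) → ℝ) (p : ι → ℝ) : ℝ :=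
  fderiv ℝ f p (cvec i)

/-- Christoffel symbols `Γ^k_{ij}` of the Levi-Civita connection, `∇_{∂_i} ∂_j = Γ^k_{ij} ∂_k`;
the arguments are in the order `k i j`. -/
def christoffel {ι : Type*} [Fintype ι] [DecidableEq ι] (g : (ι → ℝ) → Matrix ι ι ℝ)
    (p : ι → ℝ) (k i j : ι) : ℝ :=
  (1 / 2) * ∑ l, (g p)⁻¹ k l *
    (pd i (fun p => g p j l) p + pd j (fun p => g p i l) p - pd l (fun p => g p i j) p)

/-- The curvature components `R^l_{kij}`, with `R(∂_i, ∂_j) ∂_k = R^l_{kij} ∂_l`, of the connection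
with coefficients `Γ`; the arguments are in the order `l k i j`. -/
def curvature {ι : Type*} [Fintype ι] [DecidableEq ι] (Γ : (ι → ℝ) → ι → ι → ι → ℝ)
    (p : ι → ℝ) (l k i j : ι) : ℝ :=
  pd i (fun p => Γ p l j k) p - pd j (fun p => Γ p l i k) p +
    ∑ s, (Γ p l i s * Γ p s j k - Γ p l j s * Γ p s i k)

/-- The Ricci tensor of the Levi-Civita connection. -/
def ricci {ι : Type*} [Fintype ι] [DecidableEq ι] (g : (ι → ℝ) → Matrix ι ι ℝ)
    (p : ι → ℝ) (i j : ι) : ℝ :=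
  ∑ s, curvature (christoffel g) p s j s i

/-- The Hessian `∇_i ∇_j φ`. -/
def hessian {ι : Type*} [Fintype ι] [DecidableEq ι] (g : (ι → ℝ) → Matrix ι ι ℝ)
    (φ : (ι → ℝ) → ℝ) (p : ι → ℝ) (i j : ι) : ℝ :=
  pd i (pd j φ) p - ∑ k, christoffel g p k i j * pd k φ p

/-- The trace `g^{ij} T_{ij}`. -/
def gtrace {ι : Type*} [Fintype ι] [DecidableEq ι] (g : Matrix ι ι ℝ) (T : ι → ι → ℝ) : ℝ :=
  ∑ i, ∑ j, g⁻¹ i j * T i j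

/-- `F_a{}^c F_{bc}` for a `2`-form. -/
def sqTwo {ι : Type*} [Fintype ι] [DecidableEq ι] (g : Matrix ι ι ℝ) (F : DForm ι 2)
    (a b : ι) : ℝ :=
  gtrace g fun c d => F ![cvec a, cvec c] * F ![cvec b, cvec d]

/-- `H_a{}^{cd} H_{bcd}` for a `3`-form. -/
def sqThree {ι : Type*} [Fintype ι] [DecidableEq ι] (g : Matrix ι ι ℝ) (H : DForm ι 3)
    (a b : ι) : ℝ :=
  gtrace g fun c c' => gtrace g fun d d' =>
    H ![cvec a, cvec c, cvec d] * H ![cvec b, cvec c', cvec d']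

/-- Smoothness of a field of matrices, entry by entry. -/
def SmoothMatrixOn {ι : Type*} [Fintype ι] (T : (ι → ℝ) → Matrix ι ι ℝ) (Ω : Set (ι → ℝ)) : Prop :=
  ∀ i j, ContDiffOn ℝ ∞ (fun p => T p i j) Ω

/-- The components `g` define a smooth Riemannian metric on the open set `Ω`. -/
structure IsRiemannianMetricOn {ι : Type*} [Fintype ι] (g : (ι → ℝ) → Matrix ι ι ℝ)
    (Ω : Set (ι → ℝ)) : Prop where
  isOpen : IsOpen Ω
  smooth : SmoothMatrixOn g Ω
  posDef : ∀ p ∈ Ω, (g p).PosDef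

/-! ### Abelian heterotic supergravity -/

/-- The metric `g`, the scalar `φ`, the `U(1)` potential `A` and the `2`-form potential `B` are
smooth on the open set `Ω` of a `D`-dimensional coordinate space, have field strengths
`F = dA` and `H = dB - A ∧ dA`, and satisfy the field equations of abelian heterotic
supergravity on `Ω`. -/
structure IsAbelianHeteroticSolution {ι : Type*} [Fintype ι] [DecidableEq ι] {D : ℕ}
    (o : Fin D ≃ ι) (Ω : Set (ι → ℝ)) (g : (ι → ℝ) → Matrix ι ι ℝ) (φ : (ι → ℝ) → ℝ)
    (A : (ι → ℝ) → DForm ι 1) (B : (ι → ℝ) → DForm ι 2)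
    (F : (ι → ℝ) → DForm ι 2) (H : (ι → ℝ) → DForm ι 3) : Prop where
  three_le : 3 ≤ D
  metric : IsRiemannianMetricOn g Ω
  smooth_φ : ContDiffOn ℝ ∞ φ Ω
  smooth_A : ContDiffOn ℝ ∞ A Ω
  smooth_B : ContDiffOn ℝ ∞ B Ω
  smooth_F : ContDiffOn ℝ ∞ F Ω
  smooth_H : ContDiffOn ℝ ∞ H Ω
  strength_F : ∀ p ∈ Ω, F p = extDeriv A p
  strength_H : ∀ p ∈ Ω, H p = extDeriv B p - wedge (A p) (extDeriv A p)
  /-- `R_{ab} - ∇_a ∇_b φ - F_a{}^c F_{bc} - (1/4) H_a{}^{cd} H_{bcd} = 0` -/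
  einstein : ∀ p ∈ Ω, ∀ a b : ι,
    ricci g p a b - hessian g φ p a b - sqTwo (g p) (F p) a b
      - (1 / 4) * sqThree (g p) (H p) a b = 0
  /-- `d(e^φ ⋆F) = e^φ ⋆H ∧ F` -/
  maxwell : ∀ (m : ℕ) (hm : 3 + m = D), ∀ p ∈ Ω,
    extDeriv (fun p => Real.exp (φ p) •
        hodgeStar (m := m + 1) o ((by omega : 2 + (m + 1) = 3 + m).trans hm) (g p) (F p)) p
      = Real.exp (φ p) • wedge (hodgeStar o hm (g p) (H p)) (F p)
  /-- `d(e^φ ⋆H) = 0` -/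
  threeForm : ∀ (m : ℕ) (hm : 3 + m = D), ∀ p ∈ Ω,
    extDeriv (fun p => Real.exp (φ p) • hodgeStar o hm (g p) (H p)) p = 0
  /-- `(∇φ)² + 2 ∇²φ + (1/2) F_{ab} F^{ab} + (1/12) H_{abc} H^{abc} - R = 0` -/
  dilaton : ∀ p ∈ Ω,
    gtrace (g p) (fun a b => pd a φ p * pd b φ p) + 2 * gtrace (g p) (hessian g φ p)
      + (1 / 2) * gtrace (g p) (sqTwo (g p) (F p))
      + (1 / 12) * gtrace (g p) (sqThree (g p) (H p))
      - gtrace (g p) (ricci g p) = 0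

/-! ### Hermitian geometry with torsion

An endomorphism field is given by its components, `(J p) i j = J^i_j`, so that
`J ∂_j = J^i_j ∂_i`. -/

/-- The Nijenhuis tensor `[JX, JY] - [X, Y] - J[X, JY] - J[JX, Y]`. -/
def nijenhuis {ι : Type*} [Fintype ι] (J : (ι → ℝ) → Matrix ι ι ℝ)
    (X Y : (ι → ℝ) → (ι → ℝ)) (p : ι → ℝ) : ι → ℝ :=
  VectorField.lieBracket ℝ (fun p => (J p).mulVec (X p)) (fun p => (J p).mulVec (Y p)) p
    - VectorField.lieBracket ℝ X Y p
    - (J p).mulVec (VectorField.lieBracket ℝ X (fun p => (J p).mulVec (Y p)) p)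
    - (J p).mulVec (VectorField.lieBracket ℝ (fun p => (J p).mulVec (X p)) Y p)

/-- `J` is an integrable complex structure on `Ω`. -/
structure IsComplexStructureOn {ι : Type*} [Fintype ι] [DecidableEq ι]
    (J : (ι → ℝ) → Matrix ι ι ℝ) (Ω : Set (ι → ℝ)) : Prop where
  smooth : SmoothMatrixOn J Ω
  sq : ∀ p ∈ Ω, J p * J p = -1
  integrable : ∀ X Y : (ι → ℝ) → (ι → ℝ), ContDiffOn ℝ ∞ X Ω → ContDiffOn ℝ ∞ Y Ω →
    ∀ p ∈ Ω, nijenhuis J X Y p = 0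

/-- Coefficients of the connection `∇^T_X Y = ∇_X Y + (1/2) ∑_a T(X, Y, e_a) e_a`,
where `∇` is the Levi-Civita connection and `e_a` is an orthonormal frame. -/
def torsionConnection {ι : Type*} [Fintype ι] [DecidableEq ι] (g : (ι → ℝ) → Matrix ι ι ℝ)
    (T : (ι → ℝ) → DForm ι 3) (p : ι → ℝ) (k i j : ι) : ℝ :=
  christoffel g p k i j + (1 / 2) * ∑ l, (g p)⁻¹ k l * T p ![cvec i, cvec j, cvec l]

/-- `(g, J)` with the `3`-form `T` is Kähler with torsion on `Ω`: `J` is a complex structure, `g` is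
Hermitian, and the connection with skew torsion `T` preserves `g` and `J`. So this
connection is the Bismut connection of `(g, J)` and `T` is the Bismut torsion. -/
structure IsKahlerWithTorsion {ι : Type*} [Fintype ι] [DecidableEq ι]
    (Ω : Set (ι → ℝ)) (g J : (ι → ℝ) → Matrix ι ι ℝ) (T : (ι → ℝ) → DForm ι 3) : Prop where
  metric : IsRiemannianMetricOn g Ω
  complex : IsComplexStructureOn J Ω
  hermitian : ∀ p ∈ Ω, (J p).transpose * g p * J p = g p
  smooth_torsion : ContDiffOn ℝ ∞ T Ω
  parallel_g : ∀ p ∈ Ω, ∀ i j k : ι,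
    pd i (fun p => g p j k) p - ∑ s, torsionConnection g T p s i j * g p s k
      - ∑ s, torsionConnection g T p s i k * g p j s = 0
  parallel_J : ∀ p ∈ Ω, ∀ i j k : ι,
    pd i (fun p => J p k j) p + ∑ s, torsionConnection g T p k i s * J p s j
      - ∑ s, torsionConnection g T p s i j * J p k s = 0

/-- The Ricci form `ρ(∂_i, ∂_j) = (1/2) ∑_a g(R(∂_i, ∂_j) e_a, J e_a)` of the connection with
torsion `T`, the sum over an orthonormal frame being written through `∑_a e_a ⊗ e_a = g⁻¹`. -/
def ricciForm {ι : Type*} [Fintype ι] [DecidableEq ι] (g J : (ι → ℝ) → Matrix ι ι ℝ)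
    (T : (ι → ℝ) → DForm ι 3) (p : ι → ℝ) (i j : ι) : ℝ :=
  (1 / 2) * gtrace (g p) fun k s =>
    ∑ l, ∑ t, curvature (torsionConnection g T) p l k i j * g p l t * J p t s

/-- Calabi–Yau with torsion: Kähler with torsion, with vanishing Ricci form of the Bismut
connection. -/
def IsCalabiYauWithTorsion {ι : Type*} [Fintype ι] [DecidableEq ι]
    (Ω : Set (ι → ℝ)) (g J : (ι → ℝ) → Matrix ι ι ℝ) (T : (ι → ℝ) → DForm ι 3) : Prop :=
  IsKahlerWithTorsion Ω g J T ∧ ∀ p ∈ Ω, ∀ i j, ricciForm g J T p i j = 0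

/-! ### Type A metrics in even dimension

Coordinates are indexed by `Fin n ⊕ Fin n`: `Sum.inl μ` stands for `x_μ` and `Sum.inr k`
for `ψ_k`. -/

/-- The coordinate index set in dimension `2n`. -/
abbrev Idx (n : ℕ) : Type := Fin n ⊕ Fin n

/-- The coordinate `x_μ`. -/
def xc {n : ℕ} (p : Idx n → ℝ) (μ : Fin n) : ℝ := p (Sum.inl μ)

/-- `U_μ = ∏_{ν ≠ μ} (x_μ² - x_ν²)`. -/
def Ufun {n : ℕ} (p : Idx n → ℝ) (μ : Fin n) : ℝ :=
  ∏ ν ∈ Finset.univ.erase μ, (xc p μ ^ 2 - xc p ν ^ 2)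

/-- `A_μ^{(k)}`: the `k`-th elementary symmetric polynomial in the `x_ν²`, `ν ≠ μ`. -/
def Asym {n : ℕ} (p : Idx n → ℝ) (μ : Fin n) (k : ℕ) : ℝ :=
  ∑ s ∈ (Finset.univ.erase μ).powersetCard k, ∏ ν ∈ s, xc p ν ^ 2

/-- The one-variable functions `f_μ`, `X_μ`, `N_μ` that determine a type A metric. -/
structure TypeA (n : ℕ) where
  f : Fin n → ℝ → ℝ
  X : Fin n → ℝ → ℝ
  N : Fin n → ℝ → ℝ

namespace TypeA

variable {n : ℕ} (S : TypeA n)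

/-- `Q_μ = X_μ / U_μ`. -/
def Q (p : Idx n → ℝ) (μ : Fin n) : ℝ := S.X μ (xc p μ) / Ufun p μ

/-- `Φ = 1 + ∑_μ N_μ / U_μ`. -/
def Phi (p : Idx n → ℝ) : ℝ := 1 + ∑ μ, S.N μ (xc p μ) / Ufun p μ

/-- Components of the `1`-form `∑_k A_μ^{(k)} dψ_k`. -/
def sigma (p : Idx n → ℝ) (μ : Fin n) : Idx n → ℝ :=
  Sum.elim (fun _ => 0) (fun k => Asym p μ k)

/-- Components of the `1`-form `A_{(1)} = Φ⁻¹ ∑_μ (N_μ / U_μ) ∑_k A_μ^{(k)} dψ_k`. -/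
def A1 (p : Idx n → ℝ) : Idx n → ℝ :=
  (S.Phi p)⁻¹ • ∑ μ, (S.N μ (xc p μ) / Ufun p μ) • sigma p μ

/-- The components of the type A metric
`∑_μ (U_μ / X_μ) dx_μ² + ∑_μ (f_μ² X_μ / U_μ) (∑_k A_μ^{(k)} dψ_k - A_{(1)})²`. -/
def metric (p : Idx n → ℝ) : Matrix (Idx n) (Idx n) ℝ := fun i j =>
  ∑ μ, (Ufun p μ / S.X μ (xc p μ)) * (cvec (Sum.inl μ) i * cvec (Sum.inl μ) j) +
  ∑ μ, (S.f μ (xc p μ) ^ 2 * S.X μ (xc p μ) / Ufun p μ) *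
    ((sigma p μ - S.A1 p) i * (sigma p μ - S.A1 p) j)

/-- The canonical coframe: row `Sum.inl μ` holds the components of `e^μ = dx_μ / √Q_μ`, and
row `Sum.inr μ` those of `e^μ̂ = f_μ √Q_μ (∑_k A_μ^{(k)} dψ_k - A_{(1)})`. -/
def coframe (p : Idx n → ℝ) : Matrix (Idx n) (Idx n) ℝ := fun a =>
  Sum.elim
    (fun μ => (1 / Real.sqrt (S.Q p μ)) • cvec (Sum.inl μ))
    (fun μ => (S.f μ (xc p μ) * Real.sqrt (S.Q p μ)) • (sigma p μ - S.A1 p)) a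

/-- The `1`-form `e^μ`. -/
def e (p : Idx n → ℝ) (μ : Fin n) : DForm (Idx n) 1 := oneForm (S.coframe p (Sum.inl μ))

/-- The `1`-form `e^μ̂`. -/
def ehat (p : Idx n → ℝ) (μ : Fin n) : DForm (Idx n) 1 := oneForm (S.coframe p (Sum.inr μ))

/-- The dual frame: column `a` holds the components of the vector field `e_a`. -/
def frame (p : Idx n → ℝ) : Matrix (Idx n) (Idx n) ℝ := (S.coframe p)⁻¹

/-- The matrix of `J_ε` in the canonical frame: `J_ε e_μ = - ε_μ e_μ̂` and
`J_ε e_μ̂ = ε_μ⁻¹ e_μ`. -/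
def Jframe (ε : Fin n → ℝ) : Matrix (Idx n) (Idx n) ℝ :=
  Matrix.fromBlocks 0 (Matrix.diagonal fun μ => (ε μ)⁻¹) (Matrix.diagonal fun μ => -ε μ) 0

/-- The coordinate components of the almost complex structure `J_ε`. -/
def J (ε : Fin n → ℝ) (p : Idx n → ℝ) : Matrix (Idx n) (Idx n) ℝ :=
  S.frame p * Jframe ε * S.coframe p

/-- `∂_μ ln Φ`. -/
def dlnPhi (p : Idx n → ℝ) (μ : Fin n) : ℝ := pd (Sum.inl μ) (fun p => Real.log (S.Phi p)) p

/-- The domain: `x_μ ≠ 0`, the `x_μ²` are pairwise distinct, `Q_μ > 0` and `Φ > 0`. -/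
def domain : Set (Idx n → ℝ) :=
  {p | (∀ μ, xc p μ ≠ 0) ∧ (∀ μ ν, μ ≠ ν → xc p μ ^ 2 ≠ xc p ν ^ 2) ∧
    (∀ μ, 0 < S.Q p μ) ∧ 0 < S.Phi p}

end TypeA

/-! ### The family with `f_μ = 2 x_μ` -/

/-- `f_μ = 2 x_μ`, `X_μ = (∑_{k=1}^n c_k x_μ^{2k} + m_μ) / (4 x_μ²)` and
`N_μ = ∑_{k=1}^n b_k x_μ^{2k} + a m_μ`. -/
def ktData (n : ℕ) (a : ℝ) (b c : ℕ → ℝ) (m : Fin n → ℝ) : TypeA n where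
  f _ x := 2 * x
  X μ x := (1 / (4 * x ^ 2)) * (∑ k ∈ Finset.Icc 1 n, c k * x ^ (2 * k) + m μ)
  N μ x := ∑ k ∈ Finset.Icc 1 n, b k * x ^ (2 * k) + a * m μ

/-- `F = q ∑_μ (∂_μ ln Φ / (2 x_μ)) e^μ ∧ e^μ̂`. -/
def ktF {n : ℕ} (q : ℝ) (S : TypeA n) (p : Idx n → ℝ) : DForm (Idx n) 2 :=
  q • ∑ μ, (S.dlnPhi p μ / (2 * xc p μ)) • wedge (S.e p μ) (S.ehat p μ)

/-- `H = - ∑_{μ ≠ ν} (x_ν ∂_μ ln Φ / x_μ) √(X_ν / U_ν) e^μ ∧ e^μ̂ ∧ e^ν̂`. -/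
def ktH {n : ℕ} (S : TypeA n) (p : Idx n → ℝ) : DForm (Idx n) 3 :=
  -∑ μ, ∑ ν ∈ Finset.univ.erase μ,
    ((xc p ν * S.dlnPhi p μ / xc p μ) * Real.sqrt (S.Q p ν)) •
      wedge (wedge (S.e p μ) (S.ehat p μ)) (S.ehat p ν)

/-- `φ = ln Φ`. -/
def ktphi {n : ℕ} (S : TypeA n) (p : Idx n → ℝ) : ℝ := Real.log (S.Phi p)

end

noncomputable section

/-! ### Matrices over a ring with derivations: connections and moving frames -/

section FrameCalculus

set_option linter.unusedSectionVars false
set_option linter.unusedSimpArgs false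

open Matrix

variable {R : Type*} [CommRing R] [Algebra ℝ R]

/-! Write P_μ = 4x_μ²X_μ and σ_μk = A^{(k)}_μ, and use the frame D_k = Σ_μ (P_μ/(2x_μU_μ)) σ_μk ∂_μ
together with ∂ψ_k. In it the metric is block diagonal. The base block is h_kl = Σ_μ (P_μ/U_μ) σ_μk
σ_μl, and the fibre block G is the same h evaluated on the forms dψ_k − δ_k0 A_(1), because σ_μ0 =
1. The coframe dual to the D_k has entries depending on one x_μ each, so it is closed and the D_k
commute. Moreover h_kl = D_k e_{l+1} for the elementary symmetric polynomials e_l of the x_ν², so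
D_i h_jk is totally symmetric: h is a Hessian metric. Partial fractions show that tr(h⁻¹D_k h) is a
constant ell_k, that Φ = a h_00 + κ with κ = 1 + b_{n−1} − a c_{n−1}, and that ΦA_k = a h_0k + χ_k
with constants χ_k; here b_n = a c_n is needed.

Everything else follows from this structure, called `BoostData`. Let e be a/Φ times the projection
to direction 0, and let L be the matrix of the shifted forms. Then ∂L = −e(∂h)L and ∂e = −e(∂h)e, so
every derivative is a noncommutative word in h, h⁻¹, e, ∂h and ∂∂h, conjugated by L. Two identities
carry the field equations. The first is h^{ij}∂_i∂_j h = h^{ij}(∂_i h)h⁻¹(∂_j h) (`laplace_h`), a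
consequence of total symmetry and of the constant trace. The second is q²e² = e − ehe (`sub_e_h_e`),
a form of the condition κ = a q². The fibre part of the Einstein equation, the dilaton equation and
the equations of F and H reduce to contractions of the first identity; the base part of the Einstein
equation is a trace identity. Since det L = 1/Φ, the dilaton φ = ln Φ compensates the change of
volume, and e^φ√det g has constant logarithmic derivatives along the frame.

The complex structure exchanges D_k and ∂ψ_k through L. It is parallel for the connection with
torsion because ∂G − H = Lᵀ(∂h − 2he∂h)L has ∂h only at its right end, where total symmetry applies.
It is integrable because it is constant in the closed coframe made of L⁻¹ applied to the coframe of
the D_k, and of the dψ_k. The trace of J against the connection matrix along ∂ψ_k is the constant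
ell_k when ell_0 = n c_n vanishes, which makes the Ricci form vanish. Finally H = −dA_(1) ∧ τ with
aτ = κA_(1) − χ, so for κ = a q² the form a⁻¹A_(1) ∧ χ is a potential B.

The algebra is done in the ring `BasicRing` of smooth functions on Ω independent of ψ, with partial
derivatives as derivations; `Rep` links ring elements with the coordinate tensors. The equations
with a Hodge star become divergences through Cramer's rule (`sum_mul_detAlt_update`). -/

theorem Matrix.map_derivation_mul {l m n : Type*} [Fintype m] (d : Derivation ℝ R R)
    (M : Matrix l m R) (N : Matrix m n R) :
    (M * N).map d = M.map d * N + M * N.map d := by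
  ext i j
  simp only [map_apply, mul_apply, Matrix.add_apply, map_sum, Derivation.leibniz, smul_eq_mul,
    Finset.sum_add_distrib]
  rw [add_comm]
  congr 1
  exact Finset.sum_congr rfl fun _ _ => mul_comm _ _

theorem Matrix.map_derivation_add {m n : Type*} (d : Derivation ℝ R R) (M N : Matrix m n R) :
    (M + N).map d = M.map d + N.map d := by
  ext i j; simp

theorem Matrix.map_derivation_sub {m n : Type*} (d : Derivation ℝ R R) (M N : Matrix m n R) :
    (M - N).map d = M.map d - N.map d := by
  ext i j; simp

theorem Matrix.map_derivation_neg {m n : Type*} (d : Derivation ℝ R R) (M : Matrix m n R) :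
    (-M).map d = -M.map d := by
  ext i j; simp

theorem Matrix.map_derivation_smul {m n : Type*} (d : Derivation ℝ R R) (r : R)
    (M : Matrix m n R) : (r • M).map d = d r • M + r • M.map d := by
  ext i j; simp; ring

theorem Matrix.map_derivation_real_smul {m n : Type*} (d : Derivation ℝ R R) (r : ℝ)
    (M : Matrix m n R) : (r • M).map d = r • M.map d := by
  ext i j; simp

theorem Matrix.map_derivation_sum {m n κ : Type*} (d : Derivation ℝ R R) (s : Finset κ)
    (M : κ → Matrix m n R) : (∑ x ∈ s, M x).map d = ∑ x ∈ s, (M x).map d := by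
  ext i j; simp [Matrix.sum_apply]

theorem Matrix.map_derivation_one {n : Type*} [DecidableEq n] (d : Derivation ℝ R R) :
    (1 : Matrix n n R).map d = 0 := by
  ext i j
  by_cases h : i = j <;> simp [h, Matrix.one_apply]

/-- The derivative of an inverse matrix. -/
theorem Matrix.map_derivation_inv {n : Type*} [Fintype n] [DecidableEq n] (d : Derivation ℝ R R)
    {M N : Matrix n n R} (h : N * M = 1) : N.map d = -(N * M.map d * N) := by
  have h' : M * N = 1 := mul_eq_one_comm.mp h
  have e : N.map d * M + N * M.map d = 0 := by
    rw [← map_derivation_mul, h, map_derivation_one]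
  calc N.map d = N.map d * M * N := by rw [Matrix.mul_assoc, h', Matrix.mul_one]
    _ = (N.map d * M + N * M.map d) * N - N * M.map d * N := by rw [Matrix.add_mul]; abel
    _ = _ := by rw [e]; simp

variable {ι : Type*} [Fintype ι] [DecidableEq ι]

/-- The derivation along the `a`-th vector field of the frame `T`. -/
def frameDer (D : ι → Derivation ℝ R R) (T : Matrix ι ι R) (a : ι) : Derivation ℝ R R :=
  ∑ i, T i a • D i

theorem frameDer_apply (D : ι → Derivation ℝ R R) (T : Matrix ι ι R) (a : ι) (f : R) :
    frameDer D T a f = ∑ i, T i a * D i f := by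
  simp only [frameDer]
  rw [← Derivation.coeFnAddMonoidHom_apply, map_sum, Finset.sum_apply]
  rfl

theorem frameDer_inv (D : ι → Derivation ℝ R R) {T E : Matrix ι ι R} (h : T * E = 1) (i : ι)
    (f : R) : D i f = ∑ a, E a i * frameDer D T a f := by
  simp only [frameDer_apply, Finset.mul_sum]
  rw [Finset.sum_comm]
  have : ∀ j, ∑ a, E a i * (T j a * D j f) = (T * E) j i * D j f := fun j => by
    rw [mul_apply, Finset.sum_mul]
    exact Finset.sum_congr rfl fun _ _ => by ring
  simp [this, h, Matrix.one_apply]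

theorem map_frameDer_inv {m n : Type*} (D : ι → Derivation ℝ R R) {T E : Matrix ι ι R}
    (h : T * E = 1) (i : ι) (M : Matrix m n R) :
    M.map (D i) = ∑ a, E a i • M.map (frameDer D T a) := by
  ext x y
  simp [Matrix.sum_apply, frameDer_inv D h i]

/-- If the coframe is closed, the derivations along the frame commute. -/
theorem frameDer_comm (D : ι → Derivation ℝ R R) {T E : Matrix ι ι R} (h : T * E = 1)
    (hD : ∀ i j f, D i (D j f) = D j (D i f))
    (hE : ∀ i j a, D i (E a j) = D j (E a i)) (a b : ι) (f : R) :
    frameDer D T a (frameDer D T b f) = frameDer D T b (frameDer D T a f) := by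
  -- The derivative of T = E⁻¹ is −T(dE)T.
  have hT : ∀ a b j, frameDer D T a (T j b)
      = - ∑ c, ∑ k, ∑ i, T j c * (T i a * T k b * D i (E c k)) := by
    intro a b j
    have := congrFun (congrFun (Matrix.map_derivation_inv (frameDer D T a) h) j) b
    rw [map_apply] at this
    rw [this, Matrix.neg_apply, Matrix.mul_assoc, mul_apply]
    congr 1
    refine Finset.sum_congr rfl fun c _ => ?_
    rw [mul_apply, Finset.mul_sum]
    refine Finset.sum_congr rfl fun k _ => ?_
    rw [map_apply, frameDer_apply, Finset.sum_mul, Finset.mul_sum]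
    exact Finset.sum_congr rfl fun i _ => by ring
  -- Closedness of E makes this symmetric in a and b, so the first-order part of the commutator
  -- vanishes.
  have hT' : ∀ j, frameDer D T a (T j b) = frameDer D T b (T j a) := by
    intro j
    rw [hT, hT]
    congr 1
    refine Finset.sum_congr rfl fun c _ => ?_
    rw [Finset.sum_comm]
    exact Finset.sum_congr rfl fun k _ => Finset.sum_congr rfl fun i _ => by rw [hE]; ring
  have key : ∀ a b, frameDer D T a (frameDer D T b f)
      = ∑ j, frameDer D T a (T j b) * D j f + ∑ j, ∑ i, T j b * T i a * D i (D j f) := by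
    intro a b
    rw [frameDer_apply D T b f, map_sum, ← Finset.sum_add_distrib]
    refine Finset.sum_congr rfl fun j _ => ?_
    rw [Derivation.leibniz, smul_eq_mul, smul_eq_mul, frameDer_apply D T a (D j f),
      Finset.mul_sum, add_comm, mul_comm]
    congr 1
    exact Finset.sum_congr rfl fun i _ => by ring
  rw [key a b, key b a]
  congr 1
  · exact Finset.sum_congr rfl fun j _ => by rw [hT']
  · rw [Finset.sum_comm]
    exact Finset.sum_congr rfl fun i _ => Finset.sum_congr rfl fun j _ => by rw [hD]; ring

/-- The coordinate form index, frame matrix version of connection matrices given in a frame. -/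
def pullConn (E : Matrix ι ι R) (Γ' : ι → Matrix ι ι R) (i : ι) : Matrix ι ι R :=
  ∑ a, E a i • Γ' a

/-- Coordinate connection matrices `(Γ_i)^k_j` of the connection with frame matrices `Γ'`. -/
def coordConn (D : ι → Derivation ℝ R R) (T E : Matrix ι ι R) (Γ' : ι → Matrix ι ι R) (i : ι) :
    Matrix ι ι R :=
  T * pullConn E Γ' i * E + T * E.map (D i)

/-- The curvature matrices of the connection with matrices `Γ`. -/
def curvMat (D : ι → Derivation ℝ R R) (Γ : ι → Matrix ι ι R) (i j : ι) : Matrix ι ι R :=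
  (Γ j).map (D i) - (Γ i).map (D j) + (Γ i * Γ j - Γ j * Γ i)

/-- The first summand of `coordConn` is tensorial and inherits the symmetry of `Γ'`; the
inhomogeneous term T ∂_i E is symmetric because the coframe is closed. -/
theorem coordConn_symm (D : ι → Derivation ℝ R R) {T E : Matrix ι ι R}
    (hE : ∀ i j a, D i (E a j) = D j (E a i)) {Γ' : ι → Matrix ι ι R}
    (hΓ : ∀ a b c, Γ' a c b = Γ' b c a) (i j k : ι) :
    coordConn D T E Γ' i k j = coordConn D T E Γ' j k i := by
  have h1 : ∀ i j, (T * pullConn E Γ' i * E) k j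
      = ∑ b, ∑ a, ∑ c, T k c * E a i * E b j * Γ' a c b := by
    intro i j
    simp only [pullConn, mul_apply, Matrix.sum_apply, Matrix.smul_apply, smul_eq_mul, Finset.mul_sum,
      Finset.sum_mul]
    exact Finset.sum_congr rfl fun _ _ => Finset.sum_congr rfl fun _ _ =>
      Finset.sum_congr rfl fun _ _ => by ring
  simp only [coordConn, Matrix.add_apply]
  congr 1
  · rw [h1, h1]
    rw [Finset.sum_comm]
    exact Finset.sum_congr rfl fun a _ => Finset.sum_congr rfl fun b _ =>
      Finset.sum_congr rfl fun c _ => by rw [hΓ]; ring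
  · simp only [mul_apply, map_apply, hE i j]

/-- The inhomogeneous term of `coordConn` accounts for the derivatives of the outer factors of `Eᵀ *
G * E`, so compatibility can be checked in the frame. -/
theorem coordConn_metric (D : ι → Derivation ℝ R R) {T E : Matrix ι ι R} (hET : E * T = 1)
    {Γ' : ι → Matrix ι ι R} {G g : Matrix ι ι R} (hg : g = Eᵀ * G * E)
    (hG : ∀ a, G.map (frameDer D T a) = (Γ' a)ᵀ * G + G * Γ' a) (i : ι) :
    g.map (D i) = (coordConn D T E Γ' i)ᵀ * g + g * coordConn D T E Γ' i := by
  have hTE : T * E = 1 := mul_eq_one_comm.mp hET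
  have hG' : G.map (D i) = (pullConn E Γ' i)ᵀ * G + G * pullConn E Γ' i := by
    rw [map_frameDer_inv D hTE i G]
    simp only [hG, pullConn, Matrix.transpose_sum, Matrix.transpose_smul, Matrix.sum_mul,
      Matrix.mul_sum, smul_add, Matrix.smul_mul, Matrix.mul_smul, Finset.sum_add_distrib]
  have h1 : E * coordConn D T E Γ' i = pullConn E Γ' i * E + E.map (D i) := by
    simp only [coordConn, Matrix.mul_add, ← Matrix.mul_assoc, hET, Matrix.one_mul]
  have h2 : (coordConn D T E Γ' i)ᵀ * Eᵀ = Eᵀ * (pullConn E Γ' i)ᵀ + (E.map (D i))ᵀ := by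
    rw [← Matrix.transpose_mul, h1, Matrix.transpose_add, Matrix.transpose_mul]
  calc g.map (D i) = (E.map (D i))ᵀ * G * E
        + Eᵀ * ((pullConn E Γ' i)ᵀ * G + G * pullConn E Γ' i) * E + Eᵀ * G * E.map (D i) := by
        rw [hg, Matrix.map_derivation_mul, Matrix.map_derivation_mul, hG', Matrix.transpose_map]
        noncomm_ring
    _ = (coordConn D T E Γ' i)ᵀ * Eᵀ * (G * E) + Eᵀ * G * (E * coordConn D T E Γ' i) := by
        rw [h1, h2]; noncomm_ring
    _ = _ := by rw [hg]; noncomm_ring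

/-- Curvature is covariant under the change of frame, and the frame fields commute because the
coframe is closed, so no term with structure functions appears. -/
theorem coordConn_curv (D : ι → Derivation ℝ R R) {T E : Matrix ι ι R} (hET : E * T = 1)
    (hD : ∀ i j f, D i (D j f) = D j (D i f))
    (hE : ∀ i j a, D i (E a j) = D j (E a i)) (Γ' : ι → Matrix ι ι R) (i j : ι) :
    curvMat D (coordConn D T E Γ') i j =
      ∑ a, ∑ b, (E a i * E b j) • (T * curvMat (frameDer D T) Γ' a b * E) := by
  have hTE : T * E = 1 := mul_eq_one_comm.mp hET
  -- The change of frame by E conjugates the curvature.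
  have h1 : curvMat D (coordConn D T E Γ') i j = T * curvMat D (pullConn E Γ') i j * E := by
    have hT : ∀ k, T.map (D k) = -(T * E.map (D k) * T) := fun k =>
      Matrix.map_derivation_inv (D k) hTE
    have hDD : (E.map (D j)).map (D i) = (E.map (D i)).map (D j) := by
      ext x y; simp [hD i j]
    have e1 : ∀ X : Matrix ι ι R, E * (T * X) = X := fun X => by
      rw [← Matrix.mul_assoc, hET, Matrix.one_mul]
    simp only [curvMat, coordConn, Matrix.map_derivation_add, Matrix.map_derivation_mul, hT, hDD]
    simp only [Matrix.mul_add, Matrix.add_mul, Matrix.mul_sub, Matrix.sub_mul, Matrix.mul_assoc,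
      Matrix.neg_mul, Matrix.mul_neg, e1]
    abel
  -- Pulled back to coordinates, the terms ∂_i E_bj Γ'_b cancel under antisymmetrisation by
  -- closedness.
  have h2 : curvMat D (pullConn E Γ') i j =
      ∑ a, ∑ b, (E a i * E b j) • curvMat (frameDer D T) Γ' a b := by
    have hd : ∀ i j, (pullConn E Γ' j).map (D i) = ∑ b, D i (E b j) • Γ' b
        + ∑ a, ∑ b, (E a i * E b j) • (Γ' b).map (frameDer D T a) := by
      intro i j
      simp only [pullConn, Matrix.map_derivation_sum, Matrix.map_derivation_smul,
        Finset.sum_add_distrib]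
      congr 1
      rw [Finset.sum_comm]
      refine Finset.sum_congr rfl fun b _ => ?_
      rw [map_frameDer_inv D hTE i, Finset.smul_sum]
      exact Finset.sum_congr rfl fun a _ => by rw [smul_smul, mul_comm]
    have hm : ∀ i j, pullConn E Γ' i * pullConn E Γ' j
        = ∑ a, ∑ b, (E a i * E b j) • (Γ' a * Γ' b) := by
      intro i j
      simp only [pullConn, Matrix.sum_mul, Matrix.mul_sum, Matrix.smul_mul, Matrix.mul_smul]
      rw [Finset.sum_comm]
      simp only [Finset.smul_sum, smul_smul]
      exact Finset.sum_congr rfl fun _ _ => Finset.sum_congr rfl fun _ _ => by rw [mul_comm]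
    have hsw : ∀ X : ι → ι → Matrix ι ι R, ∑ a, ∑ b, (E a j * E b i) • X a b
        = ∑ a, ∑ b, (E a i * E b j) • X b a := fun X => by
      rw [Finset.sum_comm]
      exact Finset.sum_congr rfl fun _ _ => Finset.sum_congr rfl fun _ _ => by rw [mul_comm]
    simp only [curvMat, hd, hm, smul_add, smul_sub, Finset.sum_add_distrib,
      Finset.sum_sub_distrib, hE j i, hsw]
    abel
  rw [h1, h2]
  simp only [Matrix.mul_sum, Matrix.sum_mul, Matrix.smul_mul, Matrix.mul_smul]

theorem coordConn_parallel (D : ι → Derivation ℝ R R) {T E : Matrix ι ι R} (hET : E * T = 1)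
    {Γ' : ι → Matrix ι ι R} {J' J : Matrix ι ι R} (hJ : J = T * J' * E)
    (hJ' : ∀ a, J'.map (frameDer D T a) + Γ' a * J' - J' * Γ' a = 0) (i : ι) :
    J.map (D i) + coordConn D T E Γ' i * J - J * coordConn D T E Γ' i = 0 := by
  have hTE : T * E = 1 := mul_eq_one_comm.mp hET
  have hT : T.map (D i) = -(T * E.map (D i) * T) := Matrix.map_derivation_inv (D i) hTE
  have e1 : ∀ X : Matrix ι ι R, E * (T * X) = X := fun X => by
    rw [← Matrix.mul_assoc, hET, Matrix.one_mul]
  have h : J'.map (D i) = J' * pullConn E Γ' i - pullConn E Γ' i * J' := by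
    rw [map_frameDer_inv D hTE i J']
    simp only [pullConn, Matrix.sum_mul, Matrix.mul_sum, Matrix.smul_mul, Matrix.mul_smul,
      ← Finset.sum_sub_distrib, ← smul_sub]
    refine Finset.sum_congr rfl fun a _ => ?_
    congr 1
    have := hJ' a
    rw [sub_eq_zero] at this
    rw [← this]; abel
  rw [hJ]
  simp only [coordConn, Matrix.map_derivation_mul, hT, h]
  simp only [Matrix.mul_add, Matrix.add_mul, Matrix.mul_sub, Matrix.sub_mul, Matrix.mul_assoc,
      Matrix.neg_mul, Matrix.mul_neg, e1]
  abel

/-- The Ricci contraction of curvature matrices. -/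
def ricMat (Ω : ι → ι → Matrix ι ι R) : Matrix ι ι R := fun i j => ∑ s, Ω s i s j

theorem coordConn_ric (D : ι → Derivation ℝ R R) {T E : Matrix ι ι R} (hET : E * T = 1)
    (hD : ∀ i j f, D i (D j f) = D j (D i f))
    (hE : ∀ i j a, D i (E a j) = D j (E a i)) (Γ' : ι → Matrix ι ι R) :
    ricMat (curvMat D (coordConn D T E Γ'))
      = Eᵀ * ricMat (curvMat (frameDer D T) Γ') * E := by
  ext i j
  have key : ∀ a b (M : Matrix ι ι R), ∑ s, (E a s * E b i) * (T * M * E) s j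
      = E b i * (M * E) a j := by
    intro a b M
    have : (M * E) a j = (E * (T * M * E)) a j := by
      rw [Matrix.mul_assoc T, ← Matrix.mul_assoc E, hET, Matrix.one_mul]
    rw [this, mul_apply (M := E), Finset.mul_sum]
    exact Finset.sum_congr rfl fun _ _ => by ring
  calc ricMat (curvMat D (coordConn D T E Γ')) i j
      = ∑ a, ∑ b, ∑ s, (E a s * E b i) * (T * curvMat (frameDer D T) Γ' a b * E) s j := by
        simp only [ricMat, coordConn_curv D hET hD hE Γ', Matrix.sum_apply, Matrix.smul_apply,
          smul_eq_mul]
        rw [Finset.sum_comm]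
        exact Finset.sum_congr rfl fun _ _ => Finset.sum_comm
    _ = ∑ a, ∑ b, E b i * (curvMat (frameDer D T) Γ' a b * E) a j := by simp only [key]
    _ = _ := by
        simp only [ricMat, mul_apply, transpose_apply, Finset.sum_mul, Finset.mul_sum]
        rw [Finset.sum_comm]
        rw [Finset.sum_comm (γ := ι) (s := Finset.univ (α := ι))
          (f := fun x i_1 => ∑ s, E i_1 i * _ * E x j)]
        refine Finset.sum_congr rfl fun b _ => ?_
        rw [Finset.sum_comm]
        exact Finset.sum_congr rfl fun _ _ => Finset.sum_congr rfl fun _ _ => by ring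

/-- Second covariant derivatives of a function. -/
def hessMat (D : ι → Derivation ℝ R R) (Γ : ι → Matrix ι ι R) (f : R) : Matrix ι ι R :=
  fun i j => D i (D j f) - ∑ k, Γ i k j * D k f

/-- The terms ∂_i E_cj e_c(f) occur both in ∂_i∂_j f and in the connection term, and cancel. -/
theorem coordConn_hess (D : ι → Derivation ℝ R R) {T E : Matrix ι ι R} (hET : E * T = 1)
    (Γ' : ι → Matrix ι ι R) (f : R) :
    hessMat D (coordConn D T E Γ') f = Eᵀ * hessMat (frameDer D T) Γ' f * E := by
  have hTE : T * E = 1 := mul_eq_one_comm.mp hET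
  ext i j
  have h1 : E * coordConn D T E Γ' i = pullConn E Γ' i * E + E.map (D i) := by
    simp only [coordConn, Matrix.mul_add, ← Matrix.mul_assoc, hET, Matrix.one_mul]
  have h2 : ∑ k, coordConn D T E Γ' i k j * D k f
      = ∑ c, (∑ b, ∑ a, E a i * E b j * Γ' a c b + D i (E c j)) * frameDer D T c f := by
    have : ∀ c, ∑ b, ∑ a, E a i * E b j * Γ' a c b + D i (E c j)
        = (E * coordConn D T E Γ' i) c j := by
      intro c
      rw [h1]
      simp only [Matrix.add_apply, mul_apply, pullConn, Matrix.sum_apply, Matrix.smul_apply, smul_eq_mul,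
        map_apply, Finset.sum_mul]
      congr 1
      rw [Finset.sum_comm]
      exact Finset.sum_congr rfl fun _ _ => Finset.sum_congr rfl fun _ _ => by ring
    simp only [this, mul_apply (M := E), Finset.sum_mul]
    rw [Finset.sum_comm]
    refine Finset.sum_congr rfl fun k _ => ?_
    rw [frameDer_inv D hTE k f, Finset.mul_sum]
    exact Finset.sum_congr rfl fun _ _ => by ring
  have h3 : D i (D j f) = ∑ c, D i (E c j) * frameDer D T c f
      + ∑ b, ∑ a, E a i * E b j * frameDer D T a (frameDer D T b f) := by
    rw [frameDer_inv D hTE j f, map_sum, ← Finset.sum_add_distrib]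
    refine Finset.sum_congr rfl fun c _ => ?_
    rw [Derivation.leibniz, frameDer_inv D hTE i (frameDer D T c f), smul_eq_mul, smul_eq_mul,
      Finset.mul_sum, add_comm]
    congr 1
    · ring
    · exact Finset.sum_congr rfl fun _ _ => by ring
  have h4 : (Eᵀ * hessMat (frameDer D T) Γ' f * E) i j
      = ∑ b, ∑ a, E a i * E b j * frameDer D T a (frameDer D T b f)
        - ∑ c, ∑ b, ∑ a, E a i * E b j * Γ' a c b * frameDer D T c f := by
    simp only [mul_apply, transpose_apply, hessMat, Finset.sum_mul, mul_sub, sub_mul,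
      Finset.sum_sub_distrib]
    congr 1
    · exact Finset.sum_congr rfl fun _ _ => Finset.sum_congr rfl fun _ _ => by ring
    · rw [Finset.sum_comm (s := Finset.univ (α := ι)) (t := Finset.univ (α := ι))
        (f := fun c b => ∑ a, E a i * E b j * Γ' a c b * frameDer D T c f)]
      refine Finset.sum_congr rfl fun b _ => ?_
      rw [Finset.sum_comm]
      simp only [Finset.mul_sum, Finset.sum_mul]
      exact Finset.sum_congr rfl fun _ _ => Finset.sum_congr rfl fun _ _ => by ring
  rw [h4, hessMat, h2, h3]
  simp only [add_mul, Finset.sum_add_distrib, Finset.sum_mul]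
  ring

/-- The trace of a bilinear form. -/
theorem trace_frame {T E ginv Ginv S S' : Matrix ι ι R} (hET : E * T = 1)
    (hG : ginv = T * Ginv * Tᵀ) (hS : S = Eᵀ * S' * E) :
    (ginv * Sᵀ).trace = (Ginv * S'ᵀ).trace := by
  have hTE' : Tᵀ * Eᵀ = 1 := by rw [← Matrix.transpose_mul, hET, Matrix.transpose_one]
  rw [hG, hS]
  simp only [Matrix.transpose_mul, Matrix.transpose_transpose]
  calc _ = (T * (Ginv * (Tᵀ * Eᵀ) * S'ᵀ * E)).trace := by congr 1; noncomm_ring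
    _ = (Ginv * (Tᵀ * Eᵀ) * S'ᵀ * (E * T)).trace := by
      rw [Matrix.trace_mul_comm]; congr 1; noncomm_ring
    _ = _ := by rw [hTE', hET, Matrix.mul_one, Matrix.mul_one]

end FrameCalculus

end

/-! ### Hessian metrics with a shifted fibre metric -/

noncomputable section

section HessianGeometry

open Matrix

/-- A Hessian metric `h` with constant logarithmic volume gradient `ℓ`, in a frame of commuting
derivations `d`, with a function `Φ` and a covector `A` built from the `z`-th row of `h`. -/
structure BoostData (κ R : Type*) [Fintype κ] [DecidableEq κ] [CommRing R] [Algebra ℝ R] where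
  d : κ → Derivation ℝ R R
  comm : ∀ i j f, d i (d j f) = d j (d i f)
  h : Matrix κ κ R
  hi : Matrix κ κ R
  hi_mul : hi * h = 1
  symm : hᵀ = h
  total : ∀ i j k, d i (h j k) = d j (h i k)
  ell : κ → ℝ
  trace_log : ∀ k, (hi * h.map (d k)).trace = algebraMap ℝ R (ell k)
  z : κ
  a : ℝ
  c : ℝ
  chi : κ → ℝ
  chi_z : chi z = c - 1
  Phi : R
  Phii : R
  Phi_mul : Phi * Phii = 1
  Phi_eq : Phi = algebraMap ℝ R a * h z z + algebraMap ℝ R c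
  A : κ → R
  A_eq : ∀ k, Phi * A k = algebraMap ℝ R a * h z k + algebraMap ℝ R (chi k)
  phi : R
  d_phi : ∀ k, d k phi = Phii * d k Phi

namespace BoostData

variable {κ R : Type*} [Fintype κ] [DecidableEq κ] [CommRing R] [Algebra ℝ R]
  (S : BoostData κ R)

/-- `∂_j h`. -/
def p (j : κ) : Matrix κ κ R := S.h.map (S.d j)

/-- `∂_i ∂_j h`. -/
def p2 (i j : κ) : Matrix κ κ R := (S.p j).map (S.d i)

/-- `a / Φ` times the projection to the distinguished direction. -/
def e : Matrix κ κ R := (algebraMap ℝ R S.a * S.Phii) • Matrix.single S.z S.z 1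

/-- The matrix with row `z` equal to `A`. -/
def N : Matrix κ κ R := fun i j => if i = S.z then S.A j else 0

/-- Coefficient matrix of the forms dψ_k − δ_kz A; the fibre metric is h evaluated on them. -/
def L : Matrix κ κ R := 1 - S.N

def Li : Matrix κ κ R := 1 + S.Phi • S.N

/-- The fibre metric. -/
def G : Matrix κ κ R := S.Lᵀ * S.h * S.L

def Gi : Matrix κ κ R := S.Li * S.hi * S.Liᵀ

/-- The torsion components `H(D_j, ∂ψ_k, ∂ψ_l)`. -/
def H (j : κ) : Matrix κ κ R := S.Lᵀ * (S.h * S.e * S.p j - S.p j * S.e * S.h) * S.L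

theorem mul_hi : S.h * S.hi = 1 := mul_eq_one_comm.mp S.hi_mul

theorem hi_symm : S.hiᵀ = S.hi := by
  have h1 : S.hiᵀ * S.h = 1 := by
    have := congrArg Matrix.transpose S.mul_hi
    rwa [Matrix.transpose_mul, S.symm, Matrix.transpose_one] at this
  calc S.hiᵀ = S.hiᵀ * (S.h * S.hi) := by rw [S.mul_hi, Matrix.mul_one]
    _ = S.hi := by rw [← Matrix.mul_assoc, h1, Matrix.one_mul]

theorem p_symm (j : κ) : (S.p j)ᵀ = S.p j := by
  rw [p, ← Matrix.transpose_map, S.symm]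

theorem p_total (i j k : κ) : S.p i j k = S.p j i k := S.total i j k

theorem p_apply_symm (i j k : κ) : S.p i j k = S.p i k j := by
  conv_lhs => rw [← S.p_symm, Matrix.transpose_apply]

/-- The normalisation `chi_z` gives Φ A_z = a h_zz + c − 1 = Φ − 1. -/
theorem A_z : S.A S.z = 1 - S.Phii := by
  have h1 := S.A_eq S.z
  have h2 := S.Phi_mul
  have h3 : S.Phi * S.A S.z = S.Phi - 1 := by
    rw [h1, S.chi_z]; conv_rhs => rw [S.Phi_eq]
    simp; ring
  linear_combination S.Phii * h3 - (S.A S.z - 1) * h2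

theorem e_symm : S.eᵀ = S.e := by
  rw [e, Matrix.transpose_smul, Matrix.transpose_single]

/-- `E M E = M_zz E`. -/
theorem single_mul_single (M : Matrix κ κ R) :
    Matrix.single S.z S.z (1 : R) * M * Matrix.single S.z S.z 1
      = M S.z S.z • Matrix.single S.z S.z 1 := by
  ext i j
  simp [Matrix.single_mul_mul_single, Matrix.single_apply]

theorem N_mul_N : S.N * S.N = S.A S.z • S.N := by
  ext i j
  simp only [N, mul_apply, Matrix.smul_apply, smul_eq_mul, ite_mul, zero_mul, mul_ite, mul_zero]
  by_cases h : i = S.z <;> simp [h]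

/-- Only row z of N is non-zero, so N² = A_z N, and A_z = 1 − 1/Φ makes 1 + ΦN the inverse of 1 − N.
-/
theorem L_mul_Li : S.L * S.Li = 1 := by
  have h : (1 - S.N) * (1 + S.Phi • S.N) = 1 + (S.Phi - 1 - S.Phi * S.A S.z) • S.N := by
    rw [Matrix.mul_add, Matrix.sub_mul, Matrix.sub_mul, Matrix.mul_smul, Matrix.mul_smul, N_mul_N]
    simp only [Matrix.one_mul, Matrix.mul_one, smul_smul, sub_smul, one_smul]
    abel
  rw [L, Li, h, S.A_z]
  have : S.Phi - 1 - S.Phi * (1 - S.Phii) = 0 := by linear_combination S.Phi_mul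
  rw [this, zero_smul, add_zero]

theorem Li_mul_L : S.Li * S.L = 1 := mul_eq_one_comm.mp S.L_mul_Li

theorem LiT_mul_LT : S.Liᵀ * S.Lᵀ = 1 := by
  rw [← Matrix.transpose_mul, L_mul_Li, Matrix.transpose_one]

theorem Gi_mul_G : S.Gi * S.G = 1 := by
  calc S.Gi * S.G = S.Li * (S.hi * (S.Liᵀ * S.Lᵀ) * S.h) * S.L := by
        simp only [Gi, G, Matrix.mul_assoc]
    _ = 1 := by rw [LiT_mul_LT, Matrix.mul_one, S.hi_mul, Matrix.mul_one, Li_mul_L]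

theorem G_symm : S.Gᵀ = S.G := by
  simp only [G, Matrix.transpose_mul, Matrix.transpose_transpose, S.symm, Matrix.mul_assoc]

theorem Gi_symm : S.Giᵀ = S.Gi := by
  simp only [Gi, Matrix.transpose_mul, Matrix.transpose_transpose, S.hi_symm, Matrix.mul_assoc]

theorem d_Phi (j : κ) : S.d j S.Phi = algebraMap ℝ R S.a * S.p j S.z S.z := by
  rw [S.Phi_eq]; simp [p, Derivation.leibniz]

theorem d_Phii (j : κ) : S.d j S.Phii = -(S.Phii * S.Phii * S.d j S.Phi) := by
  have h := congrArg (S.d j) S.Phi_mul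
  simp only [Derivation.leibniz, smul_eq_mul, Derivation.map_one_eq_zero] at h
  linear_combination S.Phii * h - S.d j S.Phii * S.Phi_mul

theorem d_A (j k : κ) : S.d j (S.A k) = algebraMap ℝ R S.a * S.Phii *
    (S.p j S.z k - S.p j S.z S.z * S.A k) := by
  have h := congrArg (S.d j) (S.A_eq k)
  simp only [Derivation.leibniz, smul_eq_mul, map_add, Derivation.map_algebraMap, mul_zero,
    add_zero, S.d_Phi] at h
  change _ = algebraMap ℝ R S.a * S.p j S.z k at h
  linear_combination S.Phii * h - S.d j (S.A k) * S.Phi_mul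

/-- Differentiating Φ A_k = a h_zk + χ_k gives ∂_j A_k = (a/Φ)(∂_j h_zk − A_k ∂_j h_zz), which is
row z of e p_j L. With this the derivatives of `L`, `Li`, `e`, `h` and `hi` are all words in these
matrices and in `p`. -/
theorem d_N (j : κ) : S.N.map (S.d j) = S.e * S.p j * S.L := by
  ext i k
  have h1 : (S.e * S.p j * S.L) i k = if i = S.z then algebraMap ℝ R S.a * S.Phii *
    (S.p j S.z k - S.p j S.z S.z * S.A k) else 0 := by
    rw [L, Matrix.mul_sub, Matrix.mul_one, Matrix.sub_apply]
    have h2 : ∀ k, (S.e * S.p j) i k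
        = if i = S.z then algebraMap ℝ R S.a * S.Phii * S.p j S.z k else 0 := by
      intro k
      by_cases h : i = S.z
      · subst h; simp [e]
      · simp [e, h, Matrix.single_mul_apply_of_ne]
    rw [h2, mul_apply]
    simp only [h2, N, ite_mul, zero_mul, mul_ite, mul_zero]
    by_cases h : i = S.z <;> simp [h]
    ring
  rw [h1, map_apply, N]
  by_cases h : i = S.z <;> simp [h, S.d_A]

theorem d_L (j : κ) : S.L.map (S.d j) = -(S.e * S.p j * S.L) := by
  rw [L, Matrix.map_derivation_sub, Matrix.map_derivation_one, zero_sub, S.d_N]; rfl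

theorem d_Li (j : κ) : S.Li.map (S.d j) = S.Li * S.e * S.p j := by
  rw [Matrix.map_derivation_inv (S.d j) S.Li_mul_L, d_L]
  calc _ = S.Li * S.e * S.p j * (S.L * S.Li) := by noncomm_ring
    _ = _ := by rw [L_mul_Li, Matrix.mul_one]

theorem d_LT (j : κ) : (S.Lᵀ).map (S.d j) = -(S.Lᵀ * S.p j * S.e) := by
  rw [Matrix.transpose_map, d_L, Matrix.transpose_neg, Matrix.transpose_mul,
    Matrix.transpose_mul, S.p_symm, S.e_symm, Matrix.mul_assoc]

theorem d_LiT (j : κ) : (S.Liᵀ).map (S.d j) = S.p j * S.e * S.Liᵀ := by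
  rw [Matrix.transpose_map, d_Li, Matrix.transpose_mul,
    Matrix.transpose_mul, S.p_symm, S.e_symm, Matrix.mul_assoc]

theorem d_h (j : κ) : S.h.map (S.d j) = S.p j := rfl

theorem d_p (i j : κ) : (S.p j).map (S.d i) = S.p2 i j := rfl

theorem d_hi (j : κ) : S.hi.map (S.d j) = -(S.hi * S.p j * S.hi) :=
  Matrix.map_derivation_inv (S.d j) S.hi_mul

theorem e_mul_e (M : Matrix κ κ R) :
    S.e * M * S.e = (algebraMap ℝ R S.a * S.Phii * M S.z S.z) • S.e := by
  simp only [e, Matrix.smul_mul, Matrix.mul_smul, single_mul_single, smul_smul]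
  congr 1; ring

/-- Since ∂_jΦ = a (p_j)_zz, the factor that appears on differentiating 1/Φ is the one produced by
`e_mul_e`. -/
theorem d_e (j : κ) : S.e.map (S.d j) = -(S.e * S.p j * S.e) := by
  rw [e_mul_e]
  rw [e, Matrix.map_derivation_smul]
  have : (Matrix.single S.z S.z (1 : R)).map (S.d j) = 0 := by
    ext x y
    simp only [map_apply, Matrix.single_apply, Matrix.zero_apply]
    split <;> simp
  rw [this, smul_zero, add_zero, smul_smul, ← neg_smul]
  congr 1
  simp only [Derivation.leibniz, Derivation.map_algebraMap, smul_eq_mul, S.d_Phii, S.d_Phi]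
  ring

/-- `Lᵀ`-conjugate of `∂_j G`. -/
def M (j : κ) : Matrix κ κ R := S.p j - S.h * S.e * S.p j - S.p j * S.e * S.h

theorem d_G (j : κ) : S.G.map (S.d j) = S.Lᵀ * S.M j * S.L := by
  rw [G, Matrix.map_derivation_mul, Matrix.map_derivation_mul, d_L, d_LT, d_h, M]
  noncomm_ring

/-- `∂_i ∂_j G`. -/
theorem d_d_G (i j : κ) : (S.G.map (S.d j)).map (S.d i) =
    S.Lᵀ * (S.p2 i j - S.h * S.e * S.p2 i j - S.p2 i j * S.e * S.h
      + S.h * S.e * S.p i * S.e * S.p j + S.p j * S.e * S.p i * S.e * S.h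
      - S.p i * S.e * S.p j - S.p j * S.e * S.p i
      - S.p i * S.e * S.M j - S.M j * S.e * S.p i) * S.L := by
  rw [d_G, M]
  simp only [Matrix.map_derivation_mul, Matrix.map_derivation_sub, d_L, d_LT, d_h, d_e, d_p]
  noncomm_ring

/-- Contraction with the inverse Hessian metric. -/
def contr {M : Type*} [AddCommMonoid M] [Module R M] (T : κ → κ → M) : M :=
  ∑ i, ∑ j, S.hi i j • T i j

theorem contr_add {M : Type*} [AddCommMonoid M] [Module R M] (T U : κ → κ → M) :
    S.contr (fun i j => T i j + U i j) = S.contr T + S.contr U := by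
  simp [contr, Finset.sum_add_distrib]

theorem contr_sub {M : Type*} [AddCommGroup M] [Module R M] (T U : κ → κ → M) :
    S.contr (fun i j => T i j - U i j) = S.contr T - S.contr U := by
  simp [contr, Finset.sum_sub_distrib, smul_sub]

theorem contr_swap {M : Type*} [AddCommMonoid M] [Module R M] (T : κ → κ → M) :
    S.contr (fun i j => T j i) = S.contr T := by
  rw [contr, contr, Finset.sum_comm]
  refine Finset.sum_congr rfl fun i _ => Finset.sum_congr rfl fun j _ => ?_
  rw [show S.hi i j = S.hi j i by conv_lhs => rw [← S.hi_symm, Matrix.transpose_apply]]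

theorem contr_sandwich (X Y : Matrix κ κ R) (T : κ → κ → Matrix κ κ R) :
    S.contr (fun i j => X * T i j * Y) = X * S.contr T * Y := by
  simp [contr, Matrix.mul_sum, Matrix.sum_mul]

/-- A contraction vanishes if twice the symmetrised tensor does. -/
theorem contr_eq_zero_of_symm {M : Type*} [AddCommGroup M] [Module R M] (T : κ → κ → M)
    (hT : S.contr (fun i j => T i j + T j i) = 0) : S.contr T = 0 := by
  rw [S.contr_add, S.contr_swap T, ← two_smul R] at hT
  have h2 : (algebraMap ℝ R (1 / 2)) * 2 = 1 := by
    rw [← map_ofNat (algebraMap ℝ R) 2, ← map_mul]; norm_num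
  calc S.contr T = (algebraMap ℝ R (1 / 2) * 2) • S.contr T := by rw [h2, one_smul]
    _ = 0 := by rw [mul_smul, hT, smul_zero]

/-- Both sides are Σ h^{mn} p_{ikm} p_{jln} by total symmetry. -/
theorem p_mul_hi_mul_p (i j k l : κ) :
    (S.p i * S.hi * S.p j) k l = (S.p k * S.hi * S.p l) i j := by
  simp only [mul_apply, Finset.sum_mul]
  refine Finset.sum_congr rfl fun m _ => Finset.sum_congr rfl fun n _ => ?_
  rw [S.p_total i k n, S.p_apply_symm j m l, S.p_total j l m, S.p_apply_symm l j m]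

theorem trace_hi_mul (T : Matrix κ κ R) : (S.hi * T).trace = S.contr fun i j => T j i := by
  simp only [contr, Matrix.trace, diag_apply, mul_apply, smul_eq_mul]

/-- The constant tr(h⁻¹ ∂_j h) is differentiated. -/
theorem trace_p2 (i j : κ) : (S.hi * S.p2 i j).trace = (S.hi * S.p i * S.hi * S.p j).trace := by
  have h := congrArg (S.d i) (S.trace_log j)
  rw [Derivation.map_algebraMap] at h
  have h' : S.d i (S.hi * S.p j).trace = ((S.hi * S.p j).map (S.d i)).trace := by
    simp [Matrix.trace]
  have h2 : ((S.hi * S.p j).map (S.d i)).trace = 0 := by rw [← h']; exact h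
  rw [Matrix.map_derivation_mul, S.d_hi, S.d_p, Matrix.trace_add, Matrix.neg_mul,
    Matrix.trace_neg] at h2
  linear_combination h2

/-- Since the derivations commute and ∂h is totally symmetric, ∂_i∂_j h_xy is symmetric in all four
indices. Contracting the derivative indices is therefore the same as tracing ∂_x∂_y h. -/
theorem contr_p2_apply (x y : κ) :
    S.contr S.p2 x y = (S.hi * S.p x * S.hi * S.p y).trace := by
  rw [← S.trace_p2]
  simp only [contr, Matrix.sum_apply, Matrix.smul_apply, smul_eq_mul, Matrix.trace, diag_apply,
    mul_apply]
  refine Finset.sum_congr rfl fun i _ => Finset.sum_congr rfl fun j _ => ?_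
  congr 1
  have e1 : S.p2 i j x y = S.d i (S.d x (S.h j y)) := by rw [← S.total]; rfl
  have e2 : S.p2 x y j i = S.d x (S.d i (S.h j y)) := by
    rw [S.total i j y]
    change S.d x (S.p y j i) = S.d x (S.p j i y)
    rw [S.p_total y j i, S.p_apply_symm j y i]
  rw [e1, e2, S.comm]

/-- `Δh = ∂h h⁻¹ ∂h`. -/
theorem laplace_h : S.contr S.p2 = S.contr fun i j => S.p i * S.hi * S.p j := by
  ext x y
  -- `p_mul_hi_mul_p` moves the contraction from the matrix indices to the derivative indices.
  rw [contr_p2_apply, Matrix.mul_assoc S.hi, Matrix.mul_assoc S.hi, trace_hi_mul]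
  refine (S.contr_swap fun i j => (S.p x * S.hi * S.p y) i j).trans ?_
  simp only [contr, Matrix.sum_apply, Matrix.smul_apply, smul_eq_mul, S.p_mul_hi_mul_p x y]

theorem contr_p2_sub : S.contr (fun i j => S.p2 i j - S.p i * S.hi * S.p j) = 0 := by
  rw [contr_sub, S.laplace_h, sub_self]

end BoostData

end HessianGeometry

end

/-! ### The field equations as identities between words in h, e and ∂h -/

noncomputable section

section BoostedFieldEquations

open Matrix

namespace BoostData

variable {κ R : Type*} [Fintype κ] [DecidableEq κ] [CommRing R] [Algebra ℝ R]
  (S : BoostData κ R)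

theorem hi_h (X : Matrix κ κ R) : S.hi * (S.h * X) = X := by
  rw [← Matrix.mul_assoc, S.hi_mul, Matrix.one_mul]

theorem h_hi (X : Matrix κ κ R) : S.h * (S.hi * X) = X := by
  rw [← Matrix.mul_assoc, S.mul_hi, Matrix.one_mul]

theorem L_Li (X : Matrix κ κ R) : S.L * (S.Li * X) = X := by
  rw [← Matrix.mul_assoc, S.L_mul_Li, Matrix.one_mul]

theorem LiT_LT (X : Matrix κ κ R) : S.Liᵀ * (S.Lᵀ * X) = X := by
  rw [← Matrix.mul_assoc, S.LiT_mul_LT, Matrix.one_mul]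

/-- The matrix `q² ∂_i A ⊗ ∂_j A`. -/
def FF (q : ℝ) (i j : κ) : Matrix κ κ R :=
  algebraMap ℝ R (q ^ 2) • ((S.N.map (S.d i))ᵀ * S.N.map (S.d j))

/-- The condition c = a q² enters the Einstein and dilaton equations here. As e² = (a/Φ)e and ehe =
(a h_zz/Φ)e, the identity amounts to Φ = a h_zz + a q². -/
theorem sub_e_h_e {q : ℝ} (hq : S.c = S.a * q ^ 2) :
    algebraMap ℝ R (q ^ 2) • (S.e * S.e) = S.e - S.e * S.h * S.e := by
  have h1 : S.e * S.e = (algebraMap ℝ R S.a * S.Phii) • S.e := by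
    have := S.e_mul_e 1
    simpa using this
  rw [h1, e_mul_e, smul_smul]
  conv_rhs => rw [← one_smul R S.e, smul_smul, mul_one]
  rw [← sub_smul]
  congr 1
  have h2 := S.Phi_mul
  rw [S.Phi_eq, hq] at h2
  rw [map_mul] at h2
  linear_combination h2

theorem FF_eq {q : ℝ} (hq : S.c = S.a * q ^ 2) (i j : κ) :
    S.FF q i j = S.Lᵀ * (S.p i * (S.e - S.e * S.h * S.e) * S.p j) * S.L := by
  rw [FF, d_N, d_N, ← S.sub_e_h_e hq]
  simp only [Matrix.transpose_mul, S.e_symm, S.p_symm, Matrix.mul_smul, Matrix.smul_mul,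
    Matrix.mul_assoc]

/-- `Lᵀ`-conjugate of `H_j`. -/
def K (j : κ) : Matrix κ κ R := S.h * S.e * S.p j - S.p j * S.e * S.h

theorem H_eq (j : κ) : S.H j = S.Lᵀ * S.K j * S.L := rfl

theorem H_transpose (j : κ) : (S.H j)ᵀ = -S.H j := by
  simp only [H_eq, K, Matrix.transpose_mul, Matrix.transpose_sub, Matrix.transpose_transpose,
    S.symm, S.e_symm, S.p_symm]
  noncomm_ring

/-- `Gi` is h⁻¹ conjugated by the inverse of L, so conjugation by L passes through products and
turns `Gi` into `hi`. -/
theorem conj_Gi (X Y : Matrix κ κ R) :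
    (S.Lᵀ * X * S.L) * S.Gi * (S.Lᵀ * Y * S.L) = S.Lᵀ * (X * S.hi * Y) * S.L := by
  simp only [Gi, Matrix.mul_assoc, L_Li, LiT_LT]

theorem Gi_conj (X : Matrix κ κ R) : S.Gi * (S.Lᵀ * X * S.L) = S.Li * (S.hi * X) * S.L := by
  simp only [Gi, Matrix.mul_assoc, LiT_LT]

theorem trace_conj (X : Matrix κ κ R) : (S.Li * X * S.L).trace = X.trace := by
  rw [Matrix.trace_mul_comm, ← Matrix.mul_assoc, L_mul_Li, Matrix.one_mul]

theorem trace_Gi_conj (X : Matrix κ κ R) :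
    (S.Gi * (S.Lᵀ * X * S.L)).trace = (S.hi * X).trace := by
  rw [Gi_conj, trace_conj]

theorem trace_Gi_conj_conj (X Y : Matrix κ κ R) :
    (S.Gi * (S.Lᵀ * X * S.L) * S.Gi * (S.Lᵀ * Y * S.L)).trace = (S.hi * X * S.hi * Y).trace := by
  rw [Matrix.mul_assoc, Matrix.mul_assoc, ← Matrix.mul_assoc _ S.Gi, conj_Gi, trace_Gi_conj]
  simp only [Matrix.mul_assoc]

/-- The field equation along the fibres. -/
theorem fibre_equation {q : ℝ} (hq : S.c = S.a * q ^ 2) :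
    S.contr (fun i j => -(S.G.map (S.d j)).map (S.d i)
      + S.G.map (S.d i) * S.Gi * S.G.map (S.d j) - (2 : R) • S.FF q i j
      - S.H i * S.Gi * (S.H j)ᵀ) = 0 := by
  -- As h⁻¹ is symmetric, only the part symmetric in i and j matters; words such as h e p_i e p_j
  -- cancel only after symmetrisation.
  apply S.contr_eq_zero_of_symm
  have key : ∀ i j, (-(S.G.map (S.d j)).map (S.d i)
      + S.G.map (S.d i) * S.Gi * S.G.map (S.d j) - (2 : R) • S.FF q i j
      - S.H i * S.Gi * (S.H j)ᵀ) + (-(S.G.map (S.d i)).map (S.d j)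
      + S.G.map (S.d j) * S.Gi * S.G.map (S.d i) - (2 : R) • S.FF q j i
      - S.H j * S.Gi * (S.H i)ᵀ)
      = S.Lᵀ * ((S.p i * S.hi * S.p j - S.p2 i j) - S.h * S.e * (S.p i * S.hi * S.p j - S.p2 i j)
        - (S.p i * S.hi * S.p j - S.p2 i j) * S.e * S.h) * S.L
      + S.Lᵀ * ((S.p j * S.hi * S.p i - S.p2 j i) - S.h * S.e * (S.p j * S.hi * S.p i - S.p2 j i)
        - (S.p j * S.hi * S.p i - S.p2 j i) * S.e * S.h) * S.L := by
    intro i j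
    rw [d_d_G, d_d_G, d_G, d_G, H_transpose, H_transpose, Matrix.mul_neg, Matrix.mul_neg,
      S.FF_eq hq, S.FF_eq hq, H_eq, H_eq, conj_Gi, conj_Gi, conj_Gi, conj_Gi, M, M, K, K,
      two_smul, two_smul]
    have hL : ∀ X Y Z W : Matrix κ κ R, -(S.Lᵀ * X * S.L) + S.Lᵀ * Y * S.L
        - (S.Lᵀ * Z * S.L + S.Lᵀ * Z * S.L) - -(S.Lᵀ * W * S.L)
        = S.Lᵀ * (-X + Y - (Z + Z) + W) * S.L := fun X Y Z W => by noncomm_ring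
    have hA : ∀ X Y : Matrix κ κ R, S.Lᵀ * X * S.L + S.Lᵀ * Y * S.L = S.Lᵀ * (X + Y) * S.L :=
      fun X Y => by noncomm_ring
    rw [hL, hL, hA, hA]
    congr 2
    simp only [Matrix.mul_sub, Matrix.sub_mul, Matrix.mul_assoc, hi_h, h_hi]
    abel
  simp only [key]
  rw [S.contr_add, S.contr_swap fun i j => S.Lᵀ * ((S.p i * S.hi * S.p j - S.p2 i j)
    - S.h * S.e * (S.p i * S.hi * S.p j - S.p2 i j)
        - (S.p i * S.hi * S.p j - S.p2 i j) * S.e * S.h) * S.L, contr_sandwich]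
  -- Every surviving term contains this contraction, which vanishes by `laplace_h`.
  have h0 : S.contr (fun i j => S.p i * S.hi * S.p j - S.p2 i j) = 0 := by
    rw [contr_sub, S.laplace_h, sub_self]
  have h1 : S.contr (fun i j => (S.p i * S.hi * S.p j - S.p2 i j)
    - S.h * S.e * (S.p i * S.hi * S.p j - S.p2 i j)
        - (S.p i * S.hi * S.p j - S.p2 i j) * S.e * S.h) = 0 := by
    have h2 : S.contr (fun i j => S.h * S.e * (S.p i * S.hi * S.p j - S.p2 i j)) = 0 := by
      have := S.contr_sandwich (S.h * S.e) 1 (fun i j => S.p i * S.hi * S.p j - S.p2 i j)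
      simpa only [Matrix.mul_one, h0, Matrix.mul_zero] using this
    have h3 : S.contr (fun i j => (S.p i * S.hi * S.p j - S.p2 i j) * S.e * S.h) = 0 := by
      have := S.contr_sandwich 1 (S.e * S.h) (fun i j => S.p i * S.hi * S.p j - S.p2 i j)
      simpa only [Matrix.one_mul, h0, Matrix.mul_zero, Matrix.zero_mul, ← Matrix.mul_assoc]
        using this
    rw [contr_sub, contr_sub, h0, h2, h3]; simp
  rw [h1]; simp

/-- Transposition under the trace reverses the word, which exchanges i and j. -/
theorem trace_e_p_hi_p (i j : κ) (X : Matrix κ κ R) (hX : Xᵀ = X) :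
    (X * (S.p i * (S.hi * S.p j))).trace = (X * (S.p j * (S.hi * S.p i))).trace := by
  rw [← Matrix.trace_transpose]
  simp only [Matrix.transpose_mul, S.p_symm, S.hi_symm, hX]
  rw [Matrix.trace_mul_comm]
  simp only [Matrix.mul_assoc]

/-- The traces of words that occur in the field equations. -/
theorem trace_FF {q : ℝ} (hq : S.c = S.a * q ^ 2) (i j : κ) :
    (S.Gi * S.FF q i j).trace = (S.e * (S.p i * (S.hi * S.p j))).trace
      - (S.e * S.h * S.e * (S.p i * (S.hi * S.p j))).trace := by
  rw [S.FF_eq hq, trace_Gi_conj]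
  rw [S.trace_e_p_hi_p i j S.e S.e_symm, S.trace_e_p_hi_p i j (S.e * S.h * S.e)
    (by simp [Matrix.transpose_mul, S.e_symm, S.symm, Matrix.mul_assoc]), ← Matrix.trace_sub,
    ← Matrix.sub_mul, Matrix.trace_mul_comm S.hi, Matrix.mul_assoc (S.p i),
    Matrix.mul_assoc (S.p i), Matrix.trace_mul_comm (S.p i)]
  simp only [Matrix.mul_assoc]

/-- Cyclicity and transposition reduce all traces to the four words tr(h⁻¹p h⁻¹p), tr(e p h⁻¹p),
tr(ehe p h⁻¹p) and tr(e p e p). Once their coefficients are known here, in `trace_FF` and in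
`trace_GG`, the base equation is linear algebra. -/
theorem trace_HH (i j : κ) : (S.Gi * S.H i * S.Gi * (S.H j)ᵀ).trace
    = 2 * (S.e * S.h * S.e * (S.p i * (S.hi * S.p j))).trace
      - 2 * (S.e * (S.p i * (S.e * S.p j))).trace := by
  have hs : (S.e * S.h * S.e)ᵀ = S.e * S.h * S.e := by
    simp [Matrix.transpose_mul, S.e_symm, S.symm, Matrix.mul_assoc]
  have w1 : (S.e * (S.p i * (S.hi * (S.p j * (S.e * S.h))))).trace
      = (S.e * S.h * S.e * (S.p i * (S.hi * S.p j))).trace := by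
    rw [show S.e * (S.p i * (S.hi * (S.p j * (S.e * S.h))))
      = (S.e * (S.p i * (S.hi * S.p j))) * (S.e * S.h) by simp only [Matrix.mul_assoc],
      Matrix.trace_mul_comm]
    simp only [Matrix.mul_assoc]
  have w2 : (S.hi * (S.p i * (S.e * (S.h * (S.e * S.p j))))).trace
      = (S.e * S.h * S.e * (S.p i * (S.hi * S.p j))).trace := by
    rw [S.trace_e_p_hi_p i j _ hs]
    rw [show S.hi * (S.p i * (S.e * (S.h * (S.e * S.p j))))
      = (S.hi * S.p i) * (S.e * (S.h * (S.e * S.p j))) by simp only [Matrix.mul_assoc],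
      Matrix.trace_mul_comm]
    simp only [Matrix.mul_assoc]
  have w3 : (S.hi * (S.p i * (S.e * (S.p j * (S.e * S.h))))).trace
      = (S.e * (S.p i * (S.e * S.p j))).trace := by
    rw [show S.hi * (S.p i * (S.e * (S.p j * (S.e * S.h))))
      = (S.hi * (S.p i * (S.e * S.p j))) * (S.e * S.h) by simp only [Matrix.mul_assoc],
      Matrix.trace_mul_comm]
    simp only [Matrix.mul_assoc, h_hi]
  rw [H_transpose, Matrix.mul_neg, Matrix.trace_neg, H_eq, H_eq, trace_Gi_conj_conj, K, K]
  simp only [Matrix.mul_sub, Matrix.sub_mul, Matrix.mul_assoc, hi_h, h_hi, Matrix.trace_sub]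
  simp only [w1, w2, w3, Matrix.mul_assoc]
  ring

theorem trace_GG (i j : κ) : (S.Gi * S.G.map (S.d i) * S.Gi * S.G.map (S.d j)).trace
    = (S.hi * S.p i * S.hi * S.p j).trace - 4 * (S.e * (S.p i * (S.hi * S.p j))).trace
      + 2 * (S.e * S.h * S.e * (S.p i * (S.hi * S.p j))).trace
      + 2 * (S.e * (S.p i * (S.e * S.p j))).trace := by
  have hs : (S.e * S.h * S.e)ᵀ = S.e * S.h * S.e := by
    simp [Matrix.transpose_mul, S.e_symm, S.symm, Matrix.mul_assoc]
  have w1 : (S.e * (S.p i * (S.hi * (S.p j * (S.e * S.h))))).trace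
      = (S.e * S.h * S.e * (S.p i * (S.hi * S.p j))).trace := by
    rw [show S.e * (S.p i * (S.hi * (S.p j * (S.e * S.h))))
      = (S.e * (S.p i * (S.hi * S.p j))) * (S.e * S.h) by simp only [Matrix.mul_assoc],
      Matrix.trace_mul_comm]
    simp only [Matrix.mul_assoc]
  have w2 : (S.hi * (S.p i * (S.e * (S.h * (S.e * S.p j))))).trace
      = (S.e * S.h * S.e * (S.p i * (S.hi * S.p j))).trace := by
    rw [S.trace_e_p_hi_p i j _ hs]
    rw [show S.hi * (S.p i * (S.e * (S.h * (S.e * S.p j))))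
      = (S.hi * S.p i) * (S.e * (S.h * (S.e * S.p j))) by simp only [Matrix.mul_assoc],
      Matrix.trace_mul_comm]
    simp only [Matrix.mul_assoc]
  have w3 : (S.hi * (S.p i * (S.e * (S.p j * (S.e * S.h))))).trace
      = (S.e * (S.p i * (S.e * S.p j))).trace := by
    rw [show S.hi * (S.p i * (S.e * (S.p j * (S.e * S.h))))
      = (S.hi * (S.p i * (S.e * S.p j))) * (S.e * S.h) by simp only [Matrix.mul_assoc],
      Matrix.trace_mul_comm]
    simp only [Matrix.mul_assoc, h_hi]
  have w4 : (S.hi * (S.p i * (S.e * S.p j))).trace = (S.e * (S.p i * (S.hi * S.p j))).trace := by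
    rw [S.trace_e_p_hi_p i j _ S.e_symm,
      show S.hi * (S.p i * (S.e * S.p j)) = (S.hi * S.p i) * (S.e * S.p j) by
        simp only [Matrix.mul_assoc], Matrix.trace_mul_comm]
    simp only [Matrix.mul_assoc]
  have w5 : (S.hi * (S.p i * (S.hi * (S.p j * (S.e * S.h))))).trace
      = (S.e * (S.p i * (S.hi * S.p j))).trace := by
    rw [show S.hi * (S.p i * (S.hi * (S.p j * (S.e * S.h))))
      = (S.hi * (S.p i * (S.hi * S.p j))) * (S.e * S.h) by simp only [Matrix.mul_assoc],
      Matrix.trace_mul_comm]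
    simp only [Matrix.mul_assoc, h_hi]
  rw [d_G, d_G, trace_Gi_conj_conj, M, M]
  simp only [Matrix.mul_sub, Matrix.sub_mul, Matrix.mul_assoc, hi_h, h_hi, Matrix.trace_sub]
  simp only [w1, w2, w3, w4, w5, Matrix.mul_assoc]
  ring

/-- The field equation along the base. -/
theorem base_equation {q : ℝ} (hq : S.c = S.a * q ^ 2) (i j : κ) :
    (S.hi * S.p i * S.hi * S.p j).trace = (S.Gi * S.G.map (S.d i) * S.Gi * S.G.map (S.d j)).trace
      + 4 * (S.Gi * S.FF q i j).trace + (S.Gi * S.H i * S.Gi * (S.H j)ᵀ).trace := by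
  rw [S.trace_FF hq, trace_HH, trace_GG]; ring

theorem d_phi_eq (j : κ) : S.d j S.phi = (S.e * S.p j).trace := by
  rw [S.d_phi, S.d_Phi, e, Matrix.smul_mul, Matrix.trace_smul, smul_eq_mul]
  have : (Matrix.single S.z S.z 1 * S.p j).trace = S.p j S.z S.z := by
    simp [Matrix.trace_single_mul]
  rw [this]; ring

theorem d_d_phi (i j : κ) : S.d i (S.d j S.phi)
    = (S.e * S.p2 i j).trace - (S.e * (S.p i * (S.e * S.p j))).trace := by
  have h : S.d i (S.d j S.phi) = ((S.e * S.p j).map (S.d i)).trace := by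
    rw [d_phi_eq]; simp [Matrix.trace]
  rw [h, Matrix.map_derivation_mul, d_e, d_p, Matrix.trace_add, Matrix.neg_mul, Matrix.trace_neg]
  simp only [Matrix.mul_assoc]
  ring

/-- Since det L = 1 − A_z = 1/Φ, log det G = log det h − 2 log Φ. -/
theorem trace_Gi_d_G (j : κ) : (S.Gi * S.G.map (S.d j)).trace
    = algebraMap ℝ R (S.ell j) - 2 * S.d j S.phi := by
  have w : (S.hi * (S.p j * (S.e * S.h))).trace = (S.e * S.p j).trace := by
    rw [← Matrix.mul_assoc, Matrix.trace_mul_comm]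
    simp only [Matrix.mul_assoc, h_hi]
  rw [d_G, trace_Gi_conj, M, ← S.trace_log, d_phi_eq]
  simp only [Matrix.mul_sub, Matrix.trace_sub, Matrix.mul_assoc, hi_h, w, d_h]
  ring

/-- The contracted dilaton equation. -/
theorem dilaton_equation {q : ℝ} (hq : S.c = S.a * q ^ 2) :
    S.contr (fun i j => 2 * S.d i (S.d j S.phi) - 2 * (S.Gi * S.FF q i j).trace
      - (S.Gi * S.H i * S.Gi * (S.H j)ᵀ).trace) = 0 := by
  -- The words ehe p h⁻¹p and e p e p cancel, and what remains is e paired with the defect in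
  -- `laplace_h`.
  have h : ∀ i j, 2 * S.d i (S.d j S.phi) - 2 * (S.Gi * S.FF q i j).trace
      - (S.Gi * S.H i * S.Gi * (S.H j)ᵀ).trace
      = 2 * ((S.e * S.p2 i j).trace - (S.e * (S.p i * S.hi * S.p j)).trace) := by
    intro i j
    rw [S.trace_FF hq, trace_HH, d_d_phi]
    simp only [Matrix.mul_assoc]
    ring
  have h1 : ∀ T : κ → κ → Matrix κ κ R,
      S.contr (fun i j => (S.e * T i j).trace) = (S.e * S.contr T).trace := by
    intro T
    simp only [contr, Matrix.mul_sum, Matrix.trace_sum, Matrix.mul_smul, Matrix.trace_smul]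
  simp only [h]
  have h2 := h1 S.p2
  have h3 := h1 fun i j => S.p i * S.hi * S.p j
  rw [S.laplace_h, ← h3] at h2
  simp only [contr, smul_eq_mul] at h2 ⊢
  simp only [mul_left_comm _ (2 : R), ← Finset.mul_sum, mul_sub, Finset.sum_sub_distrib, h2]
  ring

/-- The Maxwell equation. -/
theorem maxwell_equation :
    S.contr (fun i j => (S.Gi * (S.N.map (S.d j))ᵀ).map (S.d i)
      - S.Gi * S.H i * S.Gi * (S.N.map (S.d j))ᵀ) = 0 := by
  apply S.contr_eq_zero_of_symm
  -- Raising the fibre index cancels the factor Lᵀ of the field strength.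
  have h1 : ∀ j, S.Gi * (S.N.map (S.d j))ᵀ = S.Li * S.hi * S.p j * S.e := by
    intro j
    rw [d_N, Gi]
    simp only [Matrix.transpose_mul, S.p_symm, S.e_symm, Matrix.mul_assoc, LiT_LT]
  have h2 : ∀ i j, S.Gi * S.H i * S.Gi * (S.N.map (S.d j))ᵀ
      = S.Li * (S.e * S.p i - S.hi * S.p i * S.e * S.h) * (S.hi * S.p j * S.e) := by
    intro i j
    rw [Matrix.mul_assoc _ S.Gi, h1, H_eq, Gi_conj, K]
    simp only [Matrix.mul_sub, Matrix.sub_mul, Matrix.mul_assoc, hi_h, h_hi, L_Li]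
  have key : ∀ i j, ((S.Gi * (S.N.map (S.d j))ᵀ).map (S.d i)
      - S.Gi * S.H i * S.Gi * (S.N.map (S.d j))ᵀ) + ((S.Gi * (S.N.map (S.d i))ᵀ).map (S.d j)
      - S.Gi * S.H j * S.Gi * (S.N.map (S.d i))ᵀ)
      = S.Li * S.hi * (S.p2 i j - S.p i * S.hi * S.p j) * S.e
        + S.Li * S.hi * (S.p2 j i - S.p j * S.hi * S.p i) * S.e := by
    intro i j
    rw [h2, h2, h1, h1]
    simp only [Matrix.map_derivation_mul, d_Li, d_hi, d_p, d_e]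
    simp only [Matrix.mul_sub, Matrix.sub_mul, Matrix.mul_add, Matrix.add_mul, Matrix.mul_neg,
      Matrix.neg_mul, Matrix.mul_assoc, hi_h, h_hi]
    abel
  simp only [key]
  rw [S.contr_add, S.contr_swap fun i j => S.Li * S.hi * (S.p2 i j - S.p i * S.hi * S.p j) * S.e,
    contr_sandwich]
  have h0 := S.contr_p2_sub
  rw [h0]; simp

/-- The equation of the three-form. -/
theorem threeForm_equation : S.contr (fun i j => (S.Gi * S.H j * S.Gi).map (S.d i)) = 0 := by
  apply S.contr_eq_zero_of_symm
  -- Raising both indices absorbs the factor h of `K` on either side.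
  have h1 : ∀ j, S.Gi * S.H j * S.Gi = S.Li * (S.e * S.p j * S.hi - S.hi * S.p j * S.e) * S.Liᵀ := by
    intro j
    rw [H_eq, Gi_conj, Gi, K]
    simp only [Matrix.mul_sub, Matrix.sub_mul, Matrix.mul_assoc, hi_h, h_hi, L_Li]
  have key : ∀ i j, (S.Gi * S.H j * S.Gi).map (S.d i) + (S.Gi * S.H i * S.Gi).map (S.d j)
      = (S.Li * S.e * (S.p2 i j - S.p i * S.hi * S.p j) * (S.hi * S.Liᵀ)
          - S.Li * S.hi * (S.p2 i j - S.p i * S.hi * S.p j) * (S.e * S.Liᵀ))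
        + (S.Li * S.e * (S.p2 j i - S.p j * S.hi * S.p i) * (S.hi * S.Liᵀ)
          - S.Li * S.hi * (S.p2 j i - S.p j * S.hi * S.p i) * (S.e * S.Liᵀ)) := by
    intro i j
    rw [h1, h1]
    simp only [Matrix.map_derivation_mul, Matrix.map_derivation_sub, d_Li, d_LiT, d_hi, d_p, d_e]
    simp only [Matrix.mul_sub, Matrix.sub_mul, Matrix.mul_add, Matrix.add_mul, Matrix.mul_neg,
      Matrix.neg_mul, Matrix.mul_assoc, hi_h, h_hi]
    abel
  simp only [key]
  rw [S.contr_add, S.contr_swap fun i j =>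
    (S.Li * S.e * (S.p2 i j - S.p i * S.hi * S.p j) * (S.hi * S.Liᵀ)
          - S.Li * S.hi * (S.p2 i j - S.p i * S.hi * S.p j) * (S.e * S.Liᵀ))]
  have h0 := S.contr_p2_sub
  have h2 : S.contr (fun i j => (S.Li * S.e * (S.p2 i j - S.p i * S.hi * S.p j) * (S.hi * S.Liᵀ)
          - S.Li * S.hi * (S.p2 i j - S.p i * S.hi * S.p j) * (S.e * S.Liᵀ))) = 0 := by
    have e1 := S.contr_sandwich (S.Li * S.e) (S.hi * S.Liᵀ)
      fun i j => S.p2 i j - S.p i * S.hi * S.p j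
    have e2 := S.contr_sandwich (S.Li * S.hi) (S.e * S.Liᵀ)
      fun i j => S.p2 i j - S.p i * S.hi * S.p j
    rw [h0] at e1 e2
    rw [contr_sub, e1, e2]; simp
  rw [h2]; simp

end BoostData

end BoostedFieldEquations

end

/-! ### Connections and Ricci curvature in the frame -/

noncomputable section

section BoostedConnection

open Matrix

/-- The element `1/2` of a real algebra. -/
def half (R : Type*) [CommRing R] [Algebra ℝ R] : R := algebraMap ℝ R (1 / 2)

theorem two_mul_half (R : Type*) [CommRing R] [Algebra ℝ R] : 2 * half R = 1 := by
  rw [half, ← map_ofNat (algebraMap ℝ R) 2, ← map_mul]; norm_num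

theorem Derivation.map_half {R : Type*} [CommRing R] [Algebra ℝ R] (d : Derivation ℝ R R) :
    d (half R) = 0 := Derivation.map_algebraMap d _

theorem map_half_smul {R : Type*} [CommRing R] [Algebra ℝ R] {m n : Type*} (d : Derivation ℝ R R)
    (M : Matrix m n R) : (half R • M).map d = half R • M.map d := by
  rw [Matrix.map_derivation_smul, Derivation.map_half, zero_smul, zero_add]

namespace BoostData

variable {κ R : Type*} [Fintype κ] [DecidableEq κ] [CommRing R] [Algebra ℝ R]
  (S : BoostData κ R)

/-- The derivations along the full frame: nothing depends on the fibre coordinates. -/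
def fder : κ ⊕ κ → Derivation ℝ R R := Sum.elim S.d fun _ => 0

@[simp] theorem fder_inl (j : κ) : S.fder (Sum.inl j) = S.d j := rfl

@[simp] theorem fder_inr (j : κ) : S.fder (Sum.inr j) = 0 := rfl

/-- The metric in the frame. -/
def Gm : Matrix (κ ⊕ κ) (κ ⊕ κ) R := fromBlocks S.h 0 0 S.G

def Gmi : Matrix (κ ⊕ κ) (κ ⊕ κ) R := fromBlocks S.hi 0 0 S.Gi

/-- `∂_j G`. -/
def dG (j : κ) : Matrix κ κ R := S.G.map (S.d j)

/-- `∂_j G - H_j`. -/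
def Y (j : κ) : Matrix κ κ R := S.dG j - S.H j

/-- Part of the derivative along ∂ψ_k from fibre vectors to base vectors; `connDown` goes from base
to fibre. For W = ∂G they are the second fundamental form of the fibres and, up to sign, its
adjoint. -/
def connUp (W : κ → Matrix κ κ R) (k : κ) : Matrix κ κ R :=
  fun i l => -(half R * ∑ j, S.hi i j * W j k l)

def connDown (W : κ → Matrix κ κ R) (k : κ) : Matrix κ κ R :=
  fun m j => half R * (S.Gi * (W j)ᵀ) m k

/-- Connection matrices in the frame; `W = ∂G` gives the Levi-Civita connection and
`W = ∂G - H` the connection with torsion. -/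
def conn (W : κ → Matrix κ κ R) : κ ⊕ κ → Matrix (κ ⊕ κ) (κ ⊕ κ) R :=
  Sum.elim (fun j => fromBlocks (half R • (S.hi * S.p j)) 0 0 (half R • (S.Gi * W j)))
    fun k => fromBlocks 0 (S.connUp W k) (S.connDown W k) 0

theorem dG_symm (j : κ) : (S.dG j)ᵀ = S.dG j := by
  rw [dG, ← Matrix.transpose_map, G_symm]

theorem dG_apply_symm (j k l : κ) : S.dG j k l = S.dG j l k := by
  conv_lhs => rw [← dG_symm, Matrix.transpose_apply]

theorem Gmi_mul_Gm : S.Gmi * S.Gm = 1 := by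
  rw [Gmi, Gm, fromBlocks_multiply]
  simp [S.hi_mul, S.Gi_mul_G]

theorem Gm_symm : S.Gmᵀ = S.Gm := by
  rw [Gm, fromBlocks_transpose]; simp [S.symm, S.G_symm]

theorem Gmi_symm : S.Gmiᵀ = S.Gmi := by
  rw [Gmi, fromBlocks_transpose]; simp [S.hi_symm, S.Gi_symm]

theorem mul_Gi : S.G * S.Gi = 1 := mul_eq_one_comm.mp S.Gi_mul_G

/-- The frame fields commute, so this is vanishing of the torsion. In the base block it is total
symmetry that makes ½h⁻¹∂_a h symmetric in its lower indices. -/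
theorem conn_symm (a b c : κ ⊕ κ) : S.conn S.dG a c b = S.conn S.dG b c a := by
  rcases a with a | a <;> rcases b with b | b <;> rcases c with c | c <;>
    simp [conn, connUp, connDown]
  · simp only [mul_apply]
    congr 1
    refine Finset.sum_congr rfl fun m _ => ?_
    rw [S.p_apply_symm a m b, S.p_total a b m, S.p_apply_symm b m a]
  · rw [dG_symm]
  · rw [dG_symm]
  · simp only [S.dG_apply_symm _ a b]

theorem conn_metric (a : κ ⊕ κ) :
    S.Gm.map (S.fder a) = (S.conn S.dG a)ᵀ * S.Gm + S.Gm * S.conn S.dG a := by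
  have hh : ∀ X : Matrix κ κ R, half R • X + half R • X = X := fun X => by
    rw [← add_smul, ← two_mul, two_mul_half, one_smul]
  rcases a with j | k
  · simp only [Gm, conn, Sum.elim_inl, fromBlocks_transpose, fromBlocks_multiply, fromBlocks_map,
      fromBlocks_add, fder_inl]
    simp only [Matrix.transpose_smul, Matrix.transpose_mul, S.p_symm, S.hi_symm, dG_symm,
      Gi_symm, Matrix.smul_mul, Matrix.mul_smul, Matrix.mul_assoc, S.hi_mul, S.Gi_mul_G,
      Matrix.mul_one, Matrix.transpose_zero, Matrix.zero_mul, Matrix.mul_zero, add_zero, zero_add]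
    rw [← Matrix.mul_assoc S.h, S.mul_hi, ← Matrix.mul_assoc S.G, S.mul_Gi]
    simp only [Matrix.one_mul, hh, d_h]
    congr 1 <;> ext <;> simp
  · have h1 : (S.connDown S.dG k)ᵀ * S.G = half R • (Matrix.of fun j l => S.dG j k l) := by
      ext j l
      have : ((S.connDown S.dG k)ᵀ * S.G) j l = half R * ((S.dG j) * (S.Gi * S.G)) k l := by
        rw [← Matrix.mul_assoc, mul_apply, mul_apply (M := S.dG j * S.Gi), Finset.mul_sum]
        refine Finset.sum_congr rfl fun m _ => ?_
        have e : (S.Gi * (S.dG j)ᵀ) m k = (S.dG j * S.Gi) k m := by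
          conv_rhs => rw [← S.Gi_symm, ← Matrix.transpose_transpose (S.dG j),
            ← Matrix.transpose_mul, Matrix.transpose_apply]
        rw [Matrix.transpose_apply, connDown, e]; ring
      rw [this, S.Gi_mul_G, Matrix.mul_one]; rfl
    have h2 : S.h * S.connUp S.dG k = -(half R • (Matrix.of fun j l => S.dG j k l)) := by
      ext j l
      have : (S.h * S.connUp S.dG k) j l
          = -(half R * ((S.h * S.hi) * (Matrix.of fun j l => S.dG j k l)) j l) := by
        rw [Matrix.mul_assoc, mul_apply, mul_apply, Finset.mul_sum, ← Finset.sum_neg_distrib]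
        refine Finset.sum_congr rfl fun m _ => ?_
        rw [connUp, mul_apply]; simp only [Matrix.of_apply]; ring
      rw [this, S.mul_hi, Matrix.one_mul]; rfl
    have h3 : (S.connUp S.dG k)ᵀ * S.h = (S.h * S.connUp S.dG k)ᵀ := by
      rw [Matrix.transpose_mul, S.symm]
    have h4 : S.G * S.connDown S.dG k = ((S.connDown S.dG k)ᵀ * S.G)ᵀ := by
      rw [Matrix.transpose_mul, S.G_symm, Matrix.transpose_transpose]
    simp only [Gm, conn, Sum.elim_inr, fromBlocks_transpose, fromBlocks_multiply, fromBlocks_map,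
      fromBlocks_add, fder_inr]
    rw [h4, h3, h1, h2]
    ext (i | i) (j | j) <;> simp

/-! Ricci curvature -/

/-- Total symmetry moves the summed index out of the derivative: h^{kl}p_{klm} is the trace of
h⁻¹∂_m h, the constant ell_m. -/
theorem sum_hi_p_mul (X : Matrix κ κ R) (j : κ) :
    ∑ k, (S.hi * S.p k * X) k j = ∑ m, algebraMap ℝ R (S.ell m) * X m j := by
  simp only [mul_apply (N := X)]
  rw [Finset.sum_comm]
  refine Finset.sum_congr rfl fun m _ => ?_
  rw [← Finset.sum_mul, ← S.trace_log, Matrix.trace]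
  congr 1
  refine Finset.sum_congr rfl fun k _ => ?_
  simp only [diag_apply, mul_apply]
  refine Finset.sum_congr rfl fun l _ => ?_
  change _ = S.hi k l * S.p m l k
  rw [S.p_apply_symm k l m, S.p_total k m l, S.p_apply_symm m k l]

theorem sum_hi_p2 (i j : κ) : ∑ k, (S.hi * S.p2 k i) k j
    = (S.hi * S.p i * S.hi * S.p j).trace := by
  rw [← contr_p2_apply]
  simp only [contr, Matrix.sum_apply, Matrix.smul_apply, smul_eq_mul, mul_apply]
  refine Finset.sum_congr rfl fun k _ => Finset.sum_congr rfl fun l _ => ?_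
  congr 1
  change S.d k (S.p i l j) = S.d k (S.p l i j)
  rw [S.p_total]

theorem sum_mul_p (X : Matrix κ κ R) (j : κ) : ∑ k, (X * S.p k) k j = (X * S.p j).trace := by
  simp only [Matrix.trace, diag_apply, mul_apply]
  refine Finset.sum_congr rfl fun k _ => Finset.sum_congr rfl fun l _ => ?_
  rw [S.p_apply_symm k l j, S.p_total k j l, S.p_apply_symm j k l]

theorem sum_connDown_mul (X : Matrix κ κ R) (j : κ) : ∑ k, (S.connDown S.dG k * X) k j
    = half R * ∑ m, (algebraMap ℝ R (S.ell m) - 2 * S.d m S.phi) * X m j := by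
  simp only [mul_apply (N := X)]
  rw [Finset.sum_comm, Finset.mul_sum]
  refine Finset.sum_congr rfl fun m _ => ?_
  rw [← Finset.sum_mul, ← S.trace_Gi_d_G, ← mul_assoc]
  congr 1
  simp only [connDown, ← Finset.mul_sum]
  congr 1
  rw [dG_symm]; rfl

theorem sum_mul_connDown (X : Matrix κ κ R) (j : κ) : ∑ k, (X * S.connDown S.dG k) k j
    = half R * (X * S.Gi * S.dG j).trace := by
  simp only [Matrix.trace, diag_apply, Finset.mul_sum, Matrix.mul_assoc X]
  refine Finset.sum_congr rfl fun k _ => ?_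
  rw [mul_apply, mul_apply (M := X), Finset.mul_sum]
  refine Finset.sum_congr rfl fun l _ => ?_
  rw [connDown, dG_symm]; ring

/-- First-order terms come from the traces ½ ell of the base block and ½ ell − ∂φ of the fibre
block. The terms in ell cancel between base and fibre, those in φ make up the Hessian of φ, and only
the quadratic terms remain. -/
theorem ricci_base (i j : κ) :
    ricMat (curvMat S.fder (S.conn S.dG)) (Sum.inl i) (Sum.inl j)
      - hessMat S.fder (S.conn S.dG) S.phi (Sum.inl i) (Sum.inl j)
    = half R * half R * ((S.hi * S.p i * S.hi * S.p j).trace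
        - (S.Gi * S.dG i * S.Gi * S.dG j).trace) := by
  have c1 : ∀ k, curvMat S.fder (S.conn S.dG) (Sum.inl k) (Sum.inl i) (Sum.inl k) (Sum.inl j)
      = half R * (S.hi * S.p2 k i) k j - half R * (S.hi * S.p k * (S.hi * S.p i)) k j
        - half R * S.d i ((S.hi * S.p k) k j)
        + half R * half R * ((S.hi * S.p k * (S.hi * S.p i)) k j
          - (S.hi * S.p i * S.hi * S.p k) k j) := by
    intro k
    simp only [curvMat, conn, Sum.elim_inl, fromBlocks_map, fder_inl, fromBlocks_multiply,
      Matrix.add_apply, Matrix.sub_apply, fromBlocks_apply₁₁, map_half_smul,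
      Matrix.map_derivation_mul, d_hi, d_p, Matrix.mul_zero, add_zero, Matrix.smul_apply,
      smul_eq_mul, Matrix.smul_mul, Matrix.mul_smul, Matrix.neg_apply, Matrix.neg_mul]
    have : S.d i ((S.hi * S.p k) k j) = ((S.hi * S.p k).map (S.d i)) k j := rfl
    rw [this]
    simp only [Matrix.map_derivation_mul, d_hi, d_p, Matrix.add_apply, Matrix.neg_apply,
      Matrix.neg_mul, Matrix.mul_assoc]
    ring
  have c2 : ∀ k, curvMat S.fder (S.conn S.dG) (Sum.inr k) (Sum.inl i) (Sum.inr k) (Sum.inl j)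
      = -S.d i ((S.connDown S.dG k * (1 : Matrix κ κ R)) k j) + half R * (S.connDown S.dG k * (S.hi * S.p i)) k j
        - half R * (S.Gi * S.dG i * S.connDown S.dG k) k j := by
    intro k
    simp only [curvMat, conn, Sum.elim_inl, Sum.elim_inr, fromBlocks_map, fder_inl, fder_inr,
      fromBlocks_multiply, Matrix.mul_one,
      Matrix.add_apply, Matrix.sub_apply, fromBlocks_apply₂₁, Matrix.mul_zero, add_zero,
      Matrix.smul_apply, smul_eq_mul, Matrix.smul_mul, Matrix.mul_smul, Matrix.zero_mul, zero_add,
      map_apply, Matrix.zero_apply, map_zero]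
    ring
  have hz : S.d i (S.hi * S.p j).trace = 0 := by
    have := congrArg (S.d i) (S.trace_log j)
    rwa [Derivation.map_algebraMap] at this
  -- The trace of the fibre block is ½ ell_j − ∂_jφ, whose derivative involves only φ.
  have hz2 : S.d i (∑ k, (S.connDown S.dG k * (1 : Matrix κ κ R)) k j) = -S.d i (S.d j S.phi) := by
    rw [sum_connDown_mul]
    have : ∑ m, (algebraMap ℝ R (S.ell m) - 2 * S.d m S.phi) * (1 : Matrix κ κ R) m j
        = algebraMap ℝ R (S.ell j) - 2 * S.d j S.phi := by simp [Matrix.one_apply]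
    rw [this, Derivation.leibniz, Derivation.map_half, smul_zero, add_zero, map_sub,
      Derivation.map_algebraMap, zero_sub, Derivation.leibniz, smul_eq_mul]
    have h2 : S.d i 2 = 0 := by
      rw [← map_ofNat (algebraMap ℝ R) 2]; exact Derivation.map_algebraMap _ _
    rw [h2, smul_zero, add_zero, smul_eq_mul]
    linear_combination -S.d i (S.d j S.phi) * two_mul_half R
  have hh : hessMat S.fder (S.conn S.dG) S.phi (Sum.inl i) (Sum.inl j)
      = S.d i (S.d j S.phi) - half R * ∑ m, S.d m S.phi * (S.hi * S.p i) m j := by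
    simp only [hessMat, Fintype.sum_sum_type, conn, Sum.elim_inl, fromBlocks_apply₁₁,
      fromBlocks_apply₂₁, fder_inl, fder_inr, Matrix.smul_apply, smul_eq_mul, Matrix.zero_apply,
      zero_mul, Finset.sum_const_zero, add_zero, Finset.mul_sum]
    congr 1
    exact Finset.sum_congr rfl fun m _ => by ring
  have hr : ricMat (curvMat S.fder (S.conn S.dG)) (Sum.inl i) (Sum.inl j)
      = ∑ k, curvMat S.fder (S.conn S.dG) (Sum.inl k) (Sum.inl i) (Sum.inl k) (Sum.inl j)
        + ∑ k, curvMat S.fder (S.conn S.dG) (Sum.inr k) (Sum.inl i) (Sum.inr k) (Sum.inl j) := by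
    simp only [ricMat, Fintype.sum_sum_type]
  rw [hr, hh]
  simp only [c1, c2, Finset.sum_add_distrib, Finset.sum_sub_distrib, Finset.sum_neg_distrib,
    ← Finset.mul_sum, ← map_sum, sum_hi_p2, sum_hi_p_mul, sum_mul_p, hz2]
  rw [hz, sum_connDown_mul, sum_mul_connDown]
  simp only [sub_mul, Finset.sum_sub_distrib, mul_assoc (2 : R), ← Finset.mul_sum]
  linear_combination (half R * (S.hi * (S.p i) * S.hi * S.p j).trace
    - half R * ∑ m, algebraMap ℝ R (S.ell m) * (S.hi * S.p i) m j
    + half R * ∑ m, S.d m S.phi * (S.hi * S.p i) m j) * (-two_mul_half R)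

theorem sum_connUp (k : κ) (W : κ → Matrix κ κ R) (v : κ → R) (j : κ) :
    ∑ m, v m * S.connUp W k m j = -(half R * ∑ m, v m * ∑ l, S.hi m l * W l k j) := by
  simp only [connUp, Finset.mul_sum, ← Finset.sum_neg_distrib]
  exact Finset.sum_congr rfl fun _ _ => Finset.sum_congr rfl fun _ _ => by ring

/-- The cancellation is the same as in `ricci_base`: the terms in ell drop out and those in ∂φ are
the Hessian of φ. -/
theorem ricci_fibre (i j : κ) :
    ricMat (curvMat S.fder (S.conn S.dG)) (Sum.inr i) (Sum.inr j)
      - hessMat S.fder (S.conn S.dG) S.phi (Sum.inr i) (Sum.inr j)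
    = half R * S.contr (fun k l => -(S.G.map (S.d l)).map (S.d k)
        + S.dG k * S.Gi * S.dG l) i j := by
  have c1 : ∀ k, curvMat S.fder (S.conn S.dG) (Sum.inl k) (Sum.inr i) (Sum.inl k) (Sum.inr j)
      = S.d k (S.connUp S.dG i k j) + half R * (S.hi * S.p k * S.connUp S.dG i) k j
        - half R * (S.connUp S.dG i * (S.Gi * S.dG k)) k j := by
    intro k
    simp only [curvMat, conn, Sum.elim_inl, Sum.elim_inr, fromBlocks_map, fder_inl, fder_inr,
      fromBlocks_multiply, Matrix.add_apply, Matrix.sub_apply, fromBlocks_apply₁₂,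
      Matrix.mul_zero, add_zero, Matrix.smul_apply, smul_eq_mul, Matrix.smul_mul,
      Matrix.mul_smul, Matrix.zero_mul, zero_add, map_apply, Matrix.zero_apply, map_zero]
    ring
  have c2 : ∀ k, curvMat S.fder (S.conn S.dG) (Sum.inr k) (Sum.inr i) (Sum.inr k) (Sum.inr j)
      = (S.connDown S.dG k * S.connUp S.dG i) k j
        - (S.connDown S.dG i * S.connUp S.dG k) k j := by
    intro k
    simp only [curvMat, conn, Sum.elim_inr, fromBlocks_map, fder_inr,
      fromBlocks_multiply, Matrix.add_apply, Matrix.sub_apply, fromBlocks_apply₂₂,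
      Matrix.mul_zero, add_zero, Matrix.zero_mul, map_apply, Matrix.zero_apply, map_zero,
      Derivation.coe_zero, Pi.zero_apply]
    ring
  have hr : ricMat (curvMat S.fder (S.conn S.dG)) (Sum.inr i) (Sum.inr j)
      = ∑ k, curvMat S.fder (S.conn S.dG) (Sum.inl k) (Sum.inr i) (Sum.inl k) (Sum.inr j)
        + ∑ k, curvMat S.fder (S.conn S.dG) (Sum.inr k) (Sum.inr i) (Sum.inr k) (Sum.inr j) := by
    simp only [ricMat, Fintype.sum_sum_type]
  have hh : hessMat S.fder (S.conn S.dG) S.phi (Sum.inr i) (Sum.inr j)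
      = -∑ m, S.d m S.phi * S.connUp S.dG i m j := by
    simp only [hessMat, Fintype.sum_sum_type, conn, Sum.elim_inr, fromBlocks_apply₁₂,
      fromBlocks_apply₂₂, fder_inl, fder_inr, Derivation.coe_zero, Pi.zero_apply, mul_zero,
      Finset.sum_const_zero, add_zero, zero_sub]
    congr 1
    exact Finset.sum_congr rfl fun m _ => by ring
  have b1 : ∑ k, S.d k (S.connUp S.dG i k j)
      = half R * ∑ m, algebraMap ℝ R (S.ell m) * ∑ l, S.hi m l * S.dG l i j
        - half R * S.contr (fun k l => (S.G.map (S.d l)).map (S.d k)) i j := by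
    have e : ∀ k, S.d k (S.connUp S.dG i k j)
        = half R * (S.hi * S.p k * (S.hi * Matrix.of fun l j => S.dG l i j)) k j
          - half R * ∑ l, S.hi k l * ((S.G.map (S.d l)).map (S.d k)) i j := by
      intro k
      have hd : ∀ l, S.d k (S.hi k l) = -(S.hi * S.p k * S.hi) k l := fun l => by
        have := congrFun (congrFun (S.d_hi k) k) l
        rwa [map_apply, Matrix.neg_apply] at this
      have e2 : (S.hi * S.p k * (S.hi * Matrix.of fun l j => S.dG l i j)) k j
          = ∑ l, (S.hi * S.p k * S.hi) k l * S.dG l i j := by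
        rw [← Matrix.mul_assoc, mul_apply]; rfl
      rw [e2, connUp]
      simp only [map_neg, Derivation.leibniz, Derivation.map_half, smul_eq_mul, map_sum, hd,
        mul_zero, add_zero, Finset.mul_sum, ← Finset.sum_neg_distrib, ← Finset.sum_sub_distrib]
      refine Finset.sum_congr rfl fun l _ => ?_
      have : S.d k (S.dG l i j) = ((S.G.map (S.d l)).map (S.d k)) i j := rfl
      rw [this]; ring
    simp only [e, Finset.sum_sub_distrib, ← Finset.mul_sum, sum_hi_p_mul]
    congr 1
    simp only [contr, Matrix.sum_apply, Matrix.smul_apply, smul_eq_mul]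
  have b3 : ∑ k, (S.connUp S.dG i * (S.Gi * S.dG k)) k j
      = -(half R * S.contr (fun k l => S.dG k * S.Gi * S.dG l) i j) := by
    rw [← S.contr_swap fun k l => S.dG k * S.Gi * S.dG l]
    simp only [contr, Matrix.sum_apply, Matrix.smul_apply, smul_eq_mul, Finset.mul_sum,
      ← Finset.sum_neg_distrib]
    refine Finset.sum_congr rfl fun k _ => ?_
    simp only [Matrix.mul_assoc, mul_apply (M := S.dG _), mul_apply (M := S.connUp S.dG i)]
    simp only [connUp, Finset.mul_sum, Finset.sum_mul, ← Finset.sum_neg_distrib, neg_mul]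
    rw [Finset.sum_comm]
    exact Finset.sum_congr rfl fun _ _ => Finset.sum_congr rfl fun _ _ => by ring
  have b5 : ∑ k, (S.connDown S.dG i * S.connUp S.dG k) k j
      = -(half R * half R * S.contr (fun k l => S.dG k * S.Gi * S.dG l) i j) := by
    simp only [contr, Matrix.sum_apply, Matrix.smul_apply, smul_eq_mul, Finset.mul_sum,
      ← Finset.sum_neg_distrib]
    have e : ∀ k m, (S.Gi * S.dG m) k i = (S.dG m * S.Gi) i k := fun k m => by
      conv_rhs => rw [← S.Gi_symm, ← S.dG_symm, ← Matrix.transpose_mul, Matrix.transpose_apply]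
    have e3 : ∀ m l, (S.dG m * S.Gi * S.dG l) i j
        = ∑ k, (S.dG m * S.Gi) i k * S.dG l k j := fun _ _ => mul_apply
    simp only [e3, mul_apply (M := S.connDown S.dG i), connDown, dG_symm, e]
    simp only [connUp, Finset.mul_sum, Finset.sum_mul, ← Finset.sum_neg_distrib, mul_neg]
    rw [Finset.sum_comm]
    refine Finset.sum_congr rfl fun m _ => ?_
    rw [Finset.sum_comm]
    exact Finset.sum_congr rfl fun _ _ => Finset.sum_congr rfl fun _ _ => by ring
  have hC : S.contr (fun k l => -(S.G.map (S.d l)).map (S.d k) + S.dG k * S.Gi * S.dG l) i j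
      = -S.contr (fun k l => (S.G.map (S.d l)).map (S.d k)) i j
        + S.contr (fun k l => S.dG k * S.Gi * S.dG l) i j := by
    rw [contr_add, Matrix.add_apply]
    congr 1
    rw [← Matrix.neg_apply]
    congr 2
    simp [contr]
  rw [hr, hh, hC]
  simp only [c1, c2, Finset.sum_add_distrib, Finset.sum_sub_distrib, ← Finset.mul_sum, b1,
    sum_hi_p_mul, b3, b5, sum_connDown_mul]
  simp only [sub_mul, Finset.sum_sub_distrib, mul_assoc (2 : R), ← Finset.mul_sum, sum_connUp]
  linear_combination (half R * ∑ m, S.d m S.phi * ∑ l, S.hi m l * S.dG l i j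
    + half R * S.contr (fun k l => S.dG k * S.Gi * S.dG l) i j
    - half R * ∑ m, algebraMap ℝ R (S.ell m) * ∑ l, S.hi m l * S.dG l i j) * two_mul_half R

/-- Nothing depends on ψ, and the matrices along the base are block diagonal while those along the
fibres are block antidiagonal; the mixed components vanish by this parity. -/
theorem ricci_mixed (i j : κ) :
    ricMat (curvMat S.fder (S.conn S.dG)) (Sum.inl i) (Sum.inr j) = 0
    ∧ ricMat (curvMat S.fder (S.conn S.dG)) (Sum.inr i) (Sum.inl j) = 0
    ∧ hessMat S.fder (S.conn S.dG) S.phi (Sum.inl i) (Sum.inr j) = 0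
    ∧ hessMat S.fder (S.conn S.dG) S.phi (Sum.inr i) (Sum.inl j) = 0 := by
  refine ⟨?_, ?_, ?_, ?_⟩ <;>
    simp [ricMat, hessMat, curvMat, conn, fromBlocks_map, fromBlocks_multiply,
      Fintype.sum_sum_type]

end BoostData

end BoostedConnection

end

/-! ### Einstein and dilaton equations and the complex structure in the frame -/

noncomputable section

section BoostedGeometry

open Matrix

theorem Matrix.trace_fromBlocks {m n R : Type*} [Fintype m] [Fintype n] [CommRing R]
    (A : Matrix m m R) (B : Matrix m n R) (C : Matrix n m R) (D : Matrix n n R) :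
    (fromBlocks A B C D).trace = A.trace + D.trace := by
  simp [Matrix.trace, Fintype.sum_sum_type]

namespace BoostData

variable {κ R : Type*} [Fintype κ] [DecidableEq κ] [CommRing R] [Algebra ℝ R]
  (S : BoostData κ R)

/-- The components `q ∂_k A_l`. -/
def X (q : ℝ) : Matrix κ κ R := fun k l => algebraMap ℝ R q * S.d k (S.A l)

/-- The two-form `q dA` in the frame. -/
def Fm (q : ℝ) : Matrix (κ ⊕ κ) (κ ⊕ κ) R := fromBlocks 0 (S.X q) (-(S.X q)ᵀ) 0

/-- The components `H(∂ψ_k, D_i, ∂ψ_m)`. -/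
def Z (k : κ) : Matrix κ κ R := fun i m => -S.H i k m

/-- The three-form `H` in the frame. -/
def Hm : κ ⊕ κ → Matrix (κ ⊕ κ) (κ ⊕ κ) R :=
  Sum.elim (fun j => fromBlocks 0 0 0 (S.H j)) fun k => fromBlocks 0 (S.Z k) (-(S.Z k)ᵀ) 0

/-- `H_a{}^{cd} H_{bcd}` in the frame. -/
def HH : Matrix (κ ⊕ κ) (κ ⊕ κ) R :=
  fun a b => (S.Gmi * S.Hm a * S.Gmi * (S.Hm b)ᵀ).trace

theorem FF_apply (q : ℝ) (i j k l : κ) : S.FF q i j k l = S.X q i k * S.X q j l := by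
  simp only [FF, X, Matrix.smul_apply, mul_apply, transpose_apply, map_apply, N, smul_eq_mul,
    Finset.mul_sum]
  rw [Finset.sum_eq_single S.z]
  · simp only [if_pos, map_pow]; ring
  · intro b _ hb; simp [hb]
  · simp

theorem Fm_sq (q : ℝ) : S.Fm q * S.Gmi * (S.Fm q)ᵀ
    = fromBlocks (Matrix.of fun i j => (S.Gi * S.FF q i j).trace) 0 0 (S.contr (S.FF q)) := by
  rw [Fm, Gmi, fromBlocks_transpose, fromBlocks_multiply, fromBlocks_multiply]
  simp only [Matrix.transpose_neg, Matrix.transpose_transpose, Matrix.zero_mul, Matrix.mul_zero,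
    zero_add, add_zero, Matrix.neg_mul, Matrix.mul_neg, neg_neg, Matrix.transpose_zero, neg_zero]
  congr 1
  · ext i j
    simp only [Matrix.of_apply, Matrix.trace, diag_apply, mul_apply, transpose_apply, FF_apply, Finset.sum_mul]
    exact Finset.sum_congr rfl fun k _ => Finset.sum_congr rfl fun l _ => by
      rw [show S.Gi k l = S.Gi l k by conv_lhs => rw [← S.Gi_symm, transpose_apply]]; ring
  · ext k l
    simp only [contr, Matrix.sum_apply, Matrix.smul_apply, smul_eq_mul, mul_apply,
      transpose_apply, FF_apply, Finset.sum_mul]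
    rw [Finset.sum_comm]
    exact Finset.sum_congr rfl fun k _ => Finset.sum_congr rfl fun l _ => by ring

/-- A non-zero component of H has exactly one base index. If the free index is a fibre index, the
base index can stand in either contracted slot, whence the factor 2. -/
theorem HH_eq : S.HH = fromBlocks (Matrix.of fun i j => (S.Gi * S.H i * S.Gi * (S.H j)ᵀ).trace) 0 0
    ((2 : R) • S.contr fun i j => S.H i * S.Gi * (S.H j)ᵀ) := by
  have e : ∀ k l, (S.hi * S.Z k * S.Gi * (S.Z l)ᵀ).trace
      = S.contr (fun i j => S.H i * S.Gi * (S.H j)ᵀ) k l := by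
    intro k l
    rw [Matrix.mul_assoc, Matrix.mul_assoc, trace_hi_mul,
      S.contr_swap fun i j => (S.Z k * (S.Gi * (S.Z l)ᵀ)) i j]
    simp only [contr, Matrix.sum_apply, Matrix.smul_apply, smul_eq_mul]
    refine Finset.sum_congr rfl fun i _ => Finset.sum_congr rfl fun j _ => ?_
    congr 1
    simp only [Matrix.mul_assoc, mul_apply (M := S.Z k), mul_apply (M := S.H i)]
    refine Finset.sum_congr rfl fun m _ => ?_
    simp only [mul_apply, transpose_apply, Z, mul_neg, neg_mul, Finset.sum_neg_distrib, neg_neg]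
  ext (i | i) (j | j)
  · simp [HH, Hm, Gmi, fromBlocks_multiply, fromBlocks_transpose, Matrix.trace_fromBlocks]
  · simp [HH, Hm, Gmi, fromBlocks_multiply, fromBlocks_transpose, Matrix.trace_fromBlocks]
  · simp [HH, Hm, Gmi, fromBlocks_multiply, fromBlocks_transpose, Matrix.trace_fromBlocks]
  · have h2 : (S.Gi * (S.Z i)ᵀ * S.hi * S.Z j).trace = (S.hi * S.Z i * S.Gi * (S.Z j)ᵀ).trace := by
      rw [← Matrix.trace_transpose]
      simp only [Matrix.transpose_mul, Matrix.transpose_transpose, S.hi_symm, S.Gi_symm]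
      rw [Matrix.trace_mul_comm]
      simp only [Matrix.mul_assoc]
    simp only [HH, Hm, Gmi, Sum.elim_inr, fromBlocks_multiply, fromBlocks_transpose,
      Matrix.trace_fromBlocks, Matrix.zero_mul, Matrix.mul_zero, add_zero, zero_add,
      Matrix.transpose_neg, Matrix.transpose_transpose, Matrix.neg_mul, Matrix.mul_neg, neg_neg,
      Matrix.transpose_zero, neg_zero, fromBlocks_apply₂₂, Matrix.smul_apply, smul_eq_mul, ← e]
    rw [h2]; ring

/-- The Einstein equation in the frame. -/
theorem einstein_frame {q : ℝ} (hq : S.c = S.a * q ^ 2) :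
    ricMat (curvMat S.fder (S.conn S.dG)) - hessMat S.fder (S.conn S.dG) S.phi
      - S.Fm q * S.Gmi * (S.Fm q)ᵀ - (half R * half R) • S.HH = 0 := by
  have hh := two_mul_half R
  rw [Fm_sq, HH_eq]
  ext (i | i) (j | j)
  · have h1 := S.ricci_base i j
    have h2 := S.base_equation hq i j
    simp only [Matrix.sub_apply, Matrix.smul_apply, smul_eq_mul, fromBlocks_apply₁₁,
      Matrix.zero_apply, Matrix.of_apply] at h1 ⊢
    rw [h1]
    change _ = (S.Gi * S.dG i * S.Gi * S.dG j).trace + _ + _ at h2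
    rw [h2]
    linear_combination (2 * half R + 1) * (S.Gi * S.FF q i j).trace * hh
  · obtain ⟨h1, -, h2, -⟩ := S.ricci_mixed i j
    simp [Matrix.sub_apply, h1, h2]
  · obtain ⟨-, h1, -, h2⟩ := S.ricci_mixed i j
    simp [Matrix.sub_apply, h1, h2]
  · have h1 := S.ricci_fibre i j
    have h2 := congrFun (congrFun (S.fibre_equation hq) i) j
    rw [S.contr_sub, S.contr_sub] at h2
    have h3 : S.contr (fun i j => (2 : R) • S.FF q i j) = (2 : R) • S.contr (S.FF q) := by
      simp only [contr, Finset.smul_sum, smul_comm (2 : R)]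
    rw [h3] at h2
    simp only [Matrix.sub_apply, Matrix.smul_apply, smul_eq_mul, fromBlocks_apply₂₂,
      Matrix.zero_apply] at h1 h2 ⊢
    rw [h1]
    change S.contr (fun k l => -(S.G.map (S.d l)).map (S.d k)
        + S.dG k * S.Gi * S.dG l) i j - _ - _ = 0 at h2
    linear_combination half R * h2 + (S.contr (S.FF q) i j
      - half R * S.contr (fun i j => S.H i * S.Gi * (S.H j)ᵀ) i j) * hh

theorem contr_p (m : κ) : S.contr (fun i j => (S.hi * S.p i) m j)
    = ∑ l, S.hi m l * algebraMap ℝ R (S.ell l) := by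
  simp only [contr, ← S.trace_log, Matrix.trace, diag_apply, mul_apply, smul_eq_mul,
    Finset.mul_sum]
  rw [Finset.sum_congr rfl fun i _ => Finset.sum_comm, Finset.sum_comm]
  refine Finset.sum_congr rfl fun l _ => Finset.sum_congr rfl fun i _ =>
    Finset.sum_congr rfl fun j _ => ?_
  change _ = S.hi m l * (S.hi i j * S.p l j i)
  rw [S.p_total i l j, S.p_apply_symm l i j]; ring

theorem trace_Gmi_mul (P Q : Matrix κ κ R) (U V : Matrix κ κ R) :
    (S.Gmi * (fromBlocks P U V Q)ᵀ).trace = (S.hi * Pᵀ).trace + (S.Gi * Qᵀ).trace := by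
  simp [Gmi, fromBlocks_transpose, fromBlocks_multiply, Matrix.trace_fromBlocks]

/-- The connection terms contribute −½ ell from the base and ½ ell − ∂φ from the fibres, paired with
the gradient of φ; the terms in ell cancel. -/
theorem trace_hess : (S.Gmi * (hessMat S.fder (S.conn S.dG) S.phi)ᵀ).trace
    = S.contr fun i j => S.d i (S.d j S.phi) - S.d i S.phi * S.d j S.phi := by
  have hb : ∀ i j, hessMat S.fder (S.conn S.dG) S.phi (Sum.inl i) (Sum.inl j)
      = S.d i (S.d j S.phi) - half R * ∑ m, S.d m S.phi * (S.hi * S.p i) m j := by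
    intro i j
    simp only [hessMat, Fintype.sum_sum_type, conn, Sum.elim_inl, fromBlocks_apply₁₁,
      fromBlocks_apply₂₁, fder_inl, fder_inr, Matrix.smul_apply, smul_eq_mul, Matrix.zero_apply,
      zero_mul, Finset.sum_const_zero, add_zero, Finset.mul_sum]
    congr 1
    exact Finset.sum_congr rfl fun m _ => by ring
  have hf : ∀ i j, hessMat S.fder (S.conn S.dG) S.phi (Sum.inr i) (Sum.inr j)
      = half R * ∑ m, S.d m S.phi * ∑ l, S.hi m l * S.dG l i j := by
    intro i j
    rw [← neg_inj, ← sum_connUp]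
    simp only [hessMat, Fintype.sum_sum_type, conn, Sum.elim_inr, fromBlocks_apply₁₂,
      fromBlocks_apply₂₂, fder_inl, fder_inr, Derivation.coe_zero, Pi.zero_apply, mul_zero,
      Finset.sum_const_zero, add_zero, zero_sub, neg_neg]
    exact Finset.sum_congr rfl fun m _ => by ring
  have hblock : hessMat S.fder (S.conn S.dG) S.phi = fromBlocks
      (Matrix.of fun i j => S.d i (S.d j S.phi) - half R * ∑ m, S.d m S.phi * (S.hi * S.p i) m j)
      0 0 (Matrix.of fun i j => half R * ∑ m, S.d m S.phi * ∑ l, S.hi m l * S.dG l i j) := by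
    ext (i | i) (j | j)
    · rw [hb]; rfl
    · exact (S.ricci_mixed i j).2.2.1
    · exact (S.ricci_mixed i j).2.2.2
    · rw [hf]; rfl
  rw [hblock, trace_Gmi_mul, trace_hi_mul]
  have h1 : (S.contr fun i j => ((Matrix.of fun i j => S.d i (S.d j S.phi)
      - half R * ∑ m, S.d m S.phi * (S.hi * S.p i) m j)ᵀ) j i)
      = S.contr (fun i j => S.d i (S.d j S.phi))
        - half R * ∑ m, S.d m S.phi * ∑ l, S.hi m l * algebraMap ℝ R (S.ell l) := by
    simp only [transpose_apply, Matrix.of_apply]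
    rw [contr_sub]
    congr 1
    simp only [← contr_p, contr, smul_eq_mul, Finset.mul_sum]
    rw [Finset.sum_congr rfl fun i _ => Finset.sum_comm, Finset.sum_comm]
    exact Finset.sum_congr rfl fun _ _ => Finset.sum_congr rfl fun _ _ =>
      Finset.sum_congr rfl fun _ _ => by ring
  have h2 : (S.Gi * (Matrix.of fun i j => half R * ∑ m, S.d m S.phi * ∑ l, S.hi m l * S.dG l i j)ᵀ).trace
      = half R * ∑ m, S.d m S.phi * ∑ l, S.hi m l * (S.Gi * S.dG l).trace := by
    have e : (Matrix.of fun i j => half R * ∑ m, S.d m S.phi * ∑ l, S.hi m l * S.dG l i j)ᵀ = half R • ∑ m, S.d m S.phi • ∑ l, S.hi m l • S.dG l := by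
      ext i j
      simp only [transpose_apply, Matrix.of_apply, Matrix.smul_apply, Matrix.sum_apply, smul_eq_mul,
        S.dG_apply_symm _ j i]
    rw [e]
    simp only [Matrix.mul_smul, Matrix.mul_sum, Matrix.trace_smul, Matrix.trace_sum, smul_eq_mul]
  rw [h1, h2, contr_sub]
  have h3 : S.contr (fun i j => S.d i S.phi * S.d j S.phi)
      = ∑ m, S.d m S.phi * ∑ l, S.hi m l * S.d l S.phi := by
    simp only [contr, smul_eq_mul, Finset.mul_sum]
    exact Finset.sum_congr rfl fun _ _ => Finset.sum_congr rfl fun _ _ => by ring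
  have h4 : ∀ l, (S.Gi * S.dG l).trace = algebraMap ℝ R (S.ell l) - 2 * S.d l S.phi :=
    S.trace_Gi_d_G
  simp only [h3, h4, mul_sub, Finset.sum_sub_distrib, mul_left_comm _ (2 : R), ← Finset.mul_sum]
  linear_combination -(∑ m, S.d m S.phi * ∑ l, S.hi m l * S.d l S.phi) * two_mul_half R

/-- The dilaton equation in the frame. -/
theorem dilaton_frame {q : ℝ} (hq : S.c = S.a * q ^ 2) :
    (S.Gmi * (Matrix.of fun a b => S.fder a S.phi * S.fder b S.phi)ᵀ).trace
      + 2 * (S.Gmi * (hessMat S.fder (S.conn S.dG) S.phi)ᵀ).trace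
      + algebraMap ℝ R (1 / 2) * (S.Gmi * (S.Fm q * S.Gmi * (S.Fm q)ᵀ)ᵀ).trace
      + algebraMap ℝ R (1 / 12) * (S.Gmi * S.HHᵀ).trace
      - (S.Gmi * (ricMat (curvMat S.fder (S.conn S.dG)))ᵀ).trace = 0 := by
  have hE := S.einstein_frame hq
  -- The traced Einstein equation eliminates R. The full contractions of F and H are 2 and 3 times
  -- the base contractions, and the remainder is half of `dilaton_equation`.
  have hric : ricMat (curvMat S.fder (S.conn S.dG)) = hessMat S.fder (S.conn S.dG) S.phi
      + S.Fm q * S.Gmi * (S.Fm q)ᵀ + (half R * half R) • S.HH := by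
    rw [sub_sub, sub_sub, sub_eq_zero] at hE
    rw [hE, add_assoc]
  have ho : (Matrix.of fun a b => S.fder a S.phi * S.fder b S.phi)
      = fromBlocks (Matrix.of fun i j => S.d i S.phi * S.d j S.phi) 0 0 0 := by
    ext (i | i) (j | j) <;> simp
  rw [hric]
  simp only [Matrix.transpose_add, Matrix.transpose_smul, Matrix.mul_add, Matrix.mul_smul,
    Matrix.trace_add, Matrix.trace_smul, smul_eq_mul]
  have hF : (S.Gmi * (S.Fm q * S.Gmi * (S.Fm q)ᵀ)ᵀ).trace
      = 2 * S.contr fun i j => (S.Gi * S.FF q i j).trace := by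
    have e : (S.Gi * (S.contr (S.FF q))ᵀ).trace = S.contr fun i j => (S.Gi * S.FF q i j).trace := by
      rw [← S.contr_swap]
      simp only [contr, Matrix.transpose_sum, Matrix.transpose_smul, Matrix.mul_sum,
        Matrix.mul_smul, Matrix.trace_sum, Matrix.trace_smul]
      refine Finset.sum_congr rfl fun i _ => Finset.sum_congr rfl fun j _ => ?_
      congr 3
      ext k l
      rw [transpose_apply, FF_apply, FF_apply, mul_comm]
    rw [Fm_sq, trace_Gmi_mul, trace_hi_mul, e]
    simp only [transpose_apply, Matrix.of_apply]
    ring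
  have hH : (S.Gmi * S.HHᵀ).trace
      = 3 * S.contr fun i j => (S.Gi * S.H i * S.Gi * (S.H j)ᵀ).trace := by
    have e : (S.Gi * (S.contr fun i j => S.H i * S.Gi * (S.H j)ᵀ)ᵀ).trace
        = S.contr fun i j => (S.Gi * S.H i * S.Gi * (S.H j)ᵀ).trace := by
      rw [← S.contr_swap fun i j => (S.Gi * S.H i * S.Gi * (S.H j)ᵀ).trace]
      simp only [contr, Matrix.transpose_sum, Matrix.transpose_smul, Matrix.mul_sum,
        Matrix.mul_smul, Matrix.trace_sum, Matrix.trace_smul]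
      refine Finset.sum_congr rfl fun i _ => Finset.sum_congr rfl fun j _ => ?_
      simp only [Matrix.transpose_mul, Matrix.transpose_transpose, S.Gi_symm, Matrix.mul_assoc]
    rw [HH_eq, trace_Gmi_mul, trace_hi_mul, Matrix.transpose_smul, Matrix.mul_smul,
      Matrix.trace_smul, e]
    simp only [transpose_apply, smul_eq_mul, Matrix.of_apply]
    ring
  have hP : (S.Gmi * (Matrix.of fun a b => S.fder a S.phi * S.fder b S.phi)ᵀ).trace
      = S.contr fun i j => S.d i S.phi * S.d j S.phi := by
    rw [ho, trace_Gmi_mul, trace_hi_mul]; simp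
  have hD := S.dilaton_equation hq
  rw [contr_sub, contr_sub] at hD
  have m2 : ∀ T : κ → κ → R, S.contr (fun i j => 2 * T i j) = 2 * S.contr T := fun T => by
    simp only [contr, smul_eq_mul, mul_left_comm _ (2 : R), ← Finset.mul_sum]
  rw [m2, m2] at hD
  rw [hF, hH, hP, S.trace_hess, contr_sub]
  have c12 : 12 * algebraMap ℝ R (1 / 12) = 1 := by
    rw [← map_ofNat (algebraMap ℝ R) 12, ← map_mul]; norm_num
  have hh := two_mul_half R
  change 2 * algebraMap ℝ R (1 / 2) = 1 at hh
  have c12' : 6 * algebraMap ℝ R (1 / 12) = algebraMap ℝ R (1 / 2) := by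
    rw [← map_ofNat (algebraMap ℝ R) 6, ← map_mul]; norm_num
  have c4 : half R * half R = 3 * algebraMap ℝ R (1 / 12) := by
    rw [half, ← map_ofNat (algebraMap ℝ R) 3, ← map_mul, ← map_mul]; norm_num
  rw [c4]
  linear_combination algebraMap ℝ R (1 / 2) * hD
    + (S.contr (fun i j => (S.Gi * S.FF q i j).trace) * 2
      - S.contr fun i j => S.d i (S.d j S.phi)) * hh
    - S.contr (fun i j => (S.Gi * S.H i * S.Gi * (S.H j)ᵀ).trace) * c12'

/-! The complex structure -/

/-- The complex structure in the frame, up to sign. -/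
def Jm : Matrix (κ ⊕ κ) (κ ⊕ κ) R := fromBlocks 0 S.L (-S.Li) 0

/-- H vanishes on two base vectors, so adding half of it leaves the base block unchanged and
replaces ∂G by ∂G − H in the others. -/
theorem conn_Y (a : κ ⊕ κ) :
    S.conn S.Y a = S.conn S.dG a + half R • (S.Gmi * (S.Hm a)ᵀ) := by
  rcases a with j | k
  · simp only [conn, Sum.elim_inl, Hm, Gmi, fromBlocks_transpose, fromBlocks_multiply,
      fromBlocks_smul, fromBlocks_add, Y, H_transpose, Matrix.mul_sub, Matrix.mul_neg, smul_sub,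
      smul_neg, Matrix.transpose_zero, Matrix.mul_zero, Matrix.zero_mul, add_zero, zero_add,
      smul_zero, sub_eq_add_neg, Matrix.mul_add, smul_add, neg_zero]
  · simp only [conn, Sum.elim_inr, Hm, Gmi, fromBlocks_transpose, fromBlocks_multiply,
      fromBlocks_smul, fromBlocks_add, Matrix.transpose_zero, Matrix.mul_zero, Matrix.zero_mul,
      add_zero, zero_add, smul_zero, Matrix.transpose_neg, Matrix.transpose_transpose]
    congr 1
    · ext i l
      simp only [connUp, Y, Matrix.add_apply, Matrix.smul_apply, smul_eq_mul, mul_apply,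
        Matrix.neg_apply, Matrix.sub_apply, Z, mul_sub, Finset.sum_sub_distrib, neg_neg]
      ring
    · ext m j
      simp only [connDown, Y, Matrix.add_apply, Matrix.smul_apply, smul_eq_mul, mul_apply,
        Matrix.sub_apply, Z, mul_sub, Finset.sum_sub_distrib, transpose_apply, mul_neg,
        Finset.sum_neg_distrib]
      ring

/-- In ∂G − H the words p_j e h cancel. Now p_j stands only at the right end, where total symmetry
can exchange j with the column index. -/
theorem Y_eq (j : κ) : S.Y j = S.Lᵀ * (S.p j - S.h * S.e * S.p j - S.h * S.e * S.p j) * S.L := by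
  rw [Y, dG, d_G, H_eq, M, K]; noncomm_ring

theorem e_apply (i j : κ) :
    S.e i j = if i = S.z ∧ j = S.z then algebraMap ℝ R S.a * S.Phii else 0 := by
  simp only [e, Matrix.smul_apply, Matrix.single_apply, smul_eq_mul]
  by_cases h : i = S.z ∧ j = S.z
  · simp [h]
  · rw [if_neg h, if_neg (fun h' => h ⟨h'.1.symm, h'.2.symm⟩), mul_zero]

theorem Y_mul_Li (j : κ) :
    S.Y j * S.Li = S.Lᵀ * (S.p j - S.h * S.e * S.p j - S.h * S.e * S.p j) := by
  rw [Y_eq, Matrix.mul_assoc, L_mul_Li, Matrix.mul_one]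

theorem Y_mul_Li_symm (j k i : κ) : (S.Y j * S.Li) k i = (S.Y i * S.Li) k j := by
  rw [Y_mul_Li, Y_mul_Li, mul_apply, mul_apply]
  refine Finset.sum_congr rfl fun b _ => ?_
  have h1 : ∀ i j b, (S.h * S.e * S.p j) b i = (S.h * S.e * S.p i) b j := by
    intro i j b
    rw [mul_apply, mul_apply]
    refine Finset.sum_congr rfl fun m _ => ?_
    rw [S.p_total j m i, S.p_apply_symm m j i, S.p_total m i j]
  congr 1
  simp only [Matrix.sub_apply, h1 i j]
  rw [S.p_total j b i, S.p_apply_symm b j i, S.p_total b i j]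

/-- Parallelism of J along the fibres: raising with `Gi` leaves the transpose of Y_j L⁻¹, and
`Y_mul_Li_symm` identifies the two sides. -/
theorem L_mul_connDown (k : κ) : S.L * S.connDown S.Y k = -(S.connUp S.Y k * S.Li) := by
  ext n j
  have h1 : (S.connUp S.Y k * S.Li) n j = -(half R * ∑ i, S.hi n i * (S.Y i * S.Li) k j) := by
    simp only [mul_apply, connUp, Finset.mul_sum, Finset.sum_mul, ← Finset.sum_neg_distrib,
      neg_mul]
    rw [Finset.sum_comm]
    exact Finset.sum_congr rfl fun _ _ => Finset.sum_congr rfl fun _ _ => by ring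
  have h2 : (S.L * S.connDown S.Y k) n j = half R * (S.L * S.Gi * (S.Y j)ᵀ) n k := by
    rw [Matrix.mul_assoc, mul_apply, mul_apply, Finset.mul_sum]
    exact Finset.sum_congr rfl fun _ _ => by rw [connDown]; ring
  have h3 : S.L * S.Gi * (S.Y j)ᵀ = S.hi * (S.Y j * S.Li)ᵀ := by
    rw [Gi, Matrix.transpose_mul]
    simp only [Matrix.mul_assoc, L_Li]
  rw [Matrix.neg_apply, h1, h2, h3, neg_neg, mul_apply]
  congr 1
  exact Finset.sum_congr rfl fun i _ => by rw [transpose_apply, S.Y_mul_Li_symm]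

/-- Along the base, ∂L = −e p L compensates the difference between ½h⁻¹p and the fibre block, where
G⁻¹Y = L⁻¹(h⁻¹p − 2e p)L. Along the fibres it is `L_mul_connDown`. -/
theorem Jm_parallel (a : κ ⊕ κ) :
    S.Jm.map (S.fder a) + S.conn S.Y a * S.Jm - S.Jm * S.conn S.Y a = 0 := by
  rcases a with j | k
  · have hGY : S.Gi * S.Y j = S.Li * (S.hi * S.p j - S.e * S.p j - S.e * S.p j) * S.L := by
      rw [Y_eq, Gi_conj]
      simp only [Matrix.mul_sub, Matrix.sub_mul, Matrix.mul_assoc, hi_h]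
    have hhalf : ∀ X : Matrix κ κ R, half R • X + half R • X = X := fun X => by
      rw [← add_smul, ← two_mul, two_mul_half, one_smul]
    simp only [Jm, conn, Sum.elim_inl, fromBlocks_map, fromBlocks_multiply, fromBlocks_add,
      fder_inl, hGY, Matrix.map_derivation_neg, sub_eq_add_neg, fromBlocks_neg]
    simp only [Matrix.zero_mul, Matrix.mul_zero, add_zero, zero_add, d_L, d_Li]
    have h1 : -(S.e * S.p j * S.L) + half R • (S.hi * S.p j) * S.L
        + -(S.L * half R • (S.Li * (S.hi * S.p j + -(S.e * S.p j) + -(S.e * S.p j)) * S.L)) = 0 := by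
      simp only [Matrix.mul_smul, Matrix.smul_mul, Matrix.mul_assoc, L_Li]
      simp only [Matrix.mul_add, Matrix.add_mul, Matrix.mul_neg, Matrix.neg_mul, smul_add,
        smul_neg, Matrix.mul_assoc]
      have := hhalf (S.e * (S.p j * S.L))
      generalize half R • (S.e * (S.p j * S.L)) = x at *
      rw [← this]; abel
    have h2 : -(S.Li * S.e * S.p j)
        + half R • (S.Li * (S.hi * S.p j + -(S.e * S.p j) + -(S.e * S.p j)) * S.L) * -S.Li
        + -(-S.Li * half R • (S.hi * S.p j)) = 0 := by
      simp only [Matrix.mul_smul, Matrix.smul_mul, Matrix.mul_assoc, Matrix.mul_neg,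
        Matrix.neg_mul, L_mul_Li, Matrix.mul_one]
      simp only [Matrix.mul_add, Matrix.mul_neg, smul_add, smul_neg]
      have := hhalf (S.Li * (S.e * S.p j))
      generalize half R • (S.Li * (S.e * S.p j)) = x at *
      rw [← this]; abel
    have h3 : S.L * (half R • (S.hi * S.p j)) = S.L * (half R • (S.hi * S.p j)) := rfl
    ext (x | x) (y | y)
    · simp
    · simpa using congrFun (congrFun h1 x) y
    · simpa using congrFun (congrFun h2 x) y
    · simp
  · have h1 := S.L_mul_connDown k
    have h2 : S.connDown S.Y k * S.L = -(S.Li * S.connUp S.Y k) := by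
      calc S.connDown S.Y k * S.L = S.Li * (S.L * S.connDown S.Y k) * S.L := by
            rw [← Matrix.mul_assoc, Li_mul_L, Matrix.one_mul]
        _ = _ := by
            rw [h1]
            simp only [Matrix.mul_neg, Matrix.neg_mul, Matrix.mul_assoc, Li_mul_L, Matrix.mul_one]
    simp only [Jm, conn, Sum.elim_inr, fromBlocks_map, fromBlocks_multiply, fromBlocks_add,
      fder_inr, sub_eq_add_neg, fromBlocks_neg]
    simp only [Matrix.zero_mul, Matrix.mul_zero, add_zero, zero_add, h1, h2]
    ext (x | x) (y | y) <;> simp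

/-- The trace is the contraction h^{ij}(Y_j L⁻¹)_{ki}. Its main term is ell_k; the word h e p and
the rank-one part of L contribute multiples of ell_z, which is zero. -/
theorem trace_Jm_conn (hl : S.ell S.z = 0) (k : κ) :
    (S.Jm * S.conn S.Y (Sum.inr k)).trace = algebraMap ℝ R (S.ell k) := by
  have h1 : (S.Jm * S.conn S.Y (Sum.inr k)).trace = -2 * (S.connUp S.Y k * S.Li).trace := by
    simp only [Jm, conn, Sum.elim_inr, fromBlocks_multiply, Matrix.trace_fromBlocks, Matrix.zero_mul,
      Matrix.mul_zero, add_zero, zero_add, L_mul_connDown, Matrix.trace_neg, Matrix.neg_mul]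
    rw [Matrix.trace_mul_comm S.Li]; ring
  have h2 : (S.connUp S.Y k * S.Li).trace
      = -(half R * S.contr fun i j => (S.Y j * S.Li) k i) := by
    simp only [Matrix.trace, diag_apply, mul_apply, connUp, contr, smul_eq_mul, Finset.mul_sum,
      Finset.sum_mul, ← Finset.sum_neg_distrib, neg_mul]
    refine Finset.sum_congr rfl fun i _ => ?_
    rw [Finset.sum_comm]
    exact Finset.sum_congr rfl fun _ _ => Finset.sum_congr rfl fun _ _ => by ring
  have h3 : (S.contr fun i j => (S.Y j * S.Li) k i) = algebraMap ℝ R (S.ell k) := by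
    have e0 : ∀ b, (S.contr fun i j => S.p j b i) = algebraMap ℝ R (S.ell b) := by
      intro b
      rw [← S.trace_log]
      change _ = (S.hi * S.p b).trace
      rw [trace_hi_mul]
      simp only [S.p_total b]
    have e1 : ∀ b, (S.contr fun i j => (S.h * S.e * S.p j) b i) = 0 := by
      intro b
      have : (S.contr fun i j => (S.h * S.e * S.p j) b i)
          = ∑ m, (S.h * S.e) b m * algebraMap ℝ R (S.ell m) := by
        simp only [← e0, contr, mul_apply (N := S.p _), smul_eq_mul, Finset.mul_sum]
        rw [Finset.sum_congr rfl fun i _ => Finset.sum_comm, Finset.sum_comm]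
        exact Finset.sum_congr rfl fun _ _ => Finset.sum_congr rfl fun _ _ =>
          Finset.sum_congr rfl fun _ _ => by ring
      rw [this]
      refine Finset.sum_eq_zero fun m _ => ?_
      by_cases h : m = S.z
      · rw [h, hl, map_zero, mul_zero]
      · rw [mul_apply, Finset.sum_eq_zero, zero_mul]
        intro l _
        rw [e_apply, if_neg (fun h' => h h'.2), mul_zero]
    have e2 : (S.contr fun i j => (S.Y j * S.Li) k i)
        = ∑ b, S.L b k * ((S.contr fun i j => S.p j b i)
          - (S.contr fun i j => (S.h * S.e * S.p j) b i)
          - (S.contr fun i j => (S.h * S.e * S.p j) b i)) := by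
      simp only [← contr_sub, Y_mul_Li, mul_apply (M := S.Lᵀ), transpose_apply]
      simp only [contr, smul_eq_mul, Finset.mul_sum, Matrix.sub_apply]
      rw [Finset.sum_congr rfl fun i _ => Finset.sum_comm, Finset.sum_comm]
      exact Finset.sum_congr rfl fun _ _ => Finset.sum_congr rfl fun _ _ =>
        Finset.sum_congr rfl fun _ _ => by ring
    rw [e2]
    simp only [e0, e1, sub_zero, L, Matrix.sub_apply, sub_mul, Finset.sum_sub_distrib,
      Matrix.one_apply, N, ite_mul, one_mul, zero_mul, Finset.sum_ite_eq', Finset.mem_univ,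
      if_true, hl, map_zero, mul_zero]
  rw [h1, h2, h3]
  linear_combination algebraMap ℝ R (S.ell k) * two_mul_half R

/-- The Ricci form vanishes if `ell` vanishes in the distinguished direction. -/
theorem trace_Jm_curv (hl : S.ell S.z = 0) (a b : κ ⊕ κ) :
    (S.Jm * curvMat S.fder (S.conn S.Y) a b).trace = 0 := by
  have hc : ∀ k, S.conn S.Y (Sum.inr k) * S.Jm = S.Jm * S.conn S.Y (Sum.inr k) := by
    intro k
    have := S.Jm_parallel (Sum.inr k)
    rw [fder_inr] at this
    have h0 : S.Jm.map (0 : Derivation ℝ R R) = 0 := by ext; simp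
    rw [h0, zero_add, sub_eq_zero] at this
    exact this
  -- The trace of J against the matrix along ∂ψ_k is constant. As J is parallel, ∂J is a commutator
  -- with the connection, and the vanishing derivative of the trace becomes the trace of J against
  -- the mixed curvature.
  have hmix : ∀ i k, (S.Jm * curvMat S.fder (S.conn S.Y) (Sum.inl i) (Sum.inr k)).trace = 0 := by
    intro i k
    have e1 : S.d i (S.Jm * S.conn S.Y (Sum.inr k)).trace = 0 := by
      rw [S.trace_Jm_conn hl, Derivation.map_algebraMap]
    have e2 : S.d i (S.Jm * S.conn S.Y (Sum.inr k)).trace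
        = ((S.Jm * S.conn S.Y (Sum.inr k)).map (S.d i)).trace := by
      simp only [Matrix.trace, map_sum, diag_apply, map_apply]
    have e3 := S.Jm_parallel (Sum.inl i)
    rw [fder_inl, sub_eq_zero, ← eq_sub_iff_add_eq] at e3
    have h0 : (S.conn S.Y (Sum.inl i)).map (0 : Derivation ℝ R R) = 0 := by ext; simp
    rw [e2, Matrix.map_derivation_mul, e3, Matrix.trace_add, Matrix.sub_mul,
      Matrix.trace_sub] at e1
    rw [curvMat, fder_inl, fder_inr, h0, sub_zero, Matrix.mul_add, Matrix.mul_sub,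
      Matrix.trace_add, Matrix.trace_sub]
    have e4 : (S.conn S.Y (Sum.inl i) * S.Jm * S.conn S.Y (Sum.inr k)).trace
        = (S.Jm * (S.conn S.Y (Sum.inr k) * S.conn S.Y (Sum.inl i))).trace := by
      rw [Matrix.mul_assoc, Matrix.trace_mul_comm, Matrix.mul_assoc]
    rw [e4, Matrix.mul_assoc] at e1
    linear_combination e1
  rcases a with i | k <;> rcases b with j | l
  -- On two base directions the curvature is block diagonal and J is block antidiagonal.
  · simp [curvMat, Jm, conn, fromBlocks_map, fromBlocks_multiply, Matrix.trace_fromBlocks,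
      sub_eq_add_neg, fromBlocks_neg, fromBlocks_add]
  · exact hmix i l
  · have : curvMat S.fder (S.conn S.Y) (Sum.inr k) (Sum.inl j)
        = -curvMat S.fder (S.conn S.Y) (Sum.inl j) (Sum.inr k) := by
      simp only [curvMat]; abel
    rw [this, Matrix.mul_neg, Matrix.trace_neg, hmix, neg_zero]
  -- On two fibre directions the curvature is a commutator of matrices commuting with J, and
  -- cyclicity of the trace gives zero.
  · have h0 : ∀ X : Matrix (κ ⊕ κ) (κ ⊕ κ) R, X.map (0 : Derivation ℝ R R) = 0 := fun X => by
      ext; simp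
    rw [curvMat, fder_inr, fder_inr, h0, h0, sub_zero, zero_add, Matrix.mul_sub,
      Matrix.trace_sub, ← Matrix.mul_assoc, ← hc, Matrix.mul_assoc, Matrix.trace_mul_comm,
      Matrix.mul_assoc, sub_self]

end BoostData

end BoostedGeometry

end

noncomputable section

/-! ### The ring of smooth functions on an open set that are constant in some directions -/

section SmoothRing

variable {ι : Type*} [Fintype ι] [DecidableEq ι]

theorem pd_congr {Ω : Set (ι → ℝ)} (hΩ : IsOpen Ω) {f f' : (ι → ℝ) → ℝ}
    (h : ∀ p ∈ Ω, f p = f' p) (i : ι) {p : ι → ℝ} (hp : p ∈ Ω) : pd i f p = pd i f' p := by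
  have : f =ᶠ[nhds p] f' := Filter.eventually_of_mem (hΩ.mem_nhds hp) h
  rw [pd, pd, this.fderiv_eq]

theorem ContDiffOn.differentiableAt_of_isOpen {E F : Type*} [NormedAddCommGroup E]
    [NormedSpace ℝ E] [NormedAddCommGroup F] [NormedSpace ℝ F] {Ω : Set E} (hΩ : IsOpen Ω)
    {f : E → F} (h : ContDiffOn ℝ ∞ f Ω) {p : E} (hp : p ∈ Ω) : DifferentiableAt ℝ f p :=
  (h.contDiffAt (hΩ.mem_nhds hp)).differentiableAt (by simp)

theorem ContDiffOn.pd {Ω : Set (ι → ℝ)} (hΩ : IsOpen Ω) {f : (ι → ℝ) → ℝ}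
    (h : ContDiffOn ℝ ∞ f Ω) (i : ι) : ContDiffOn ℝ ∞ (pd i f) Ω := by
  have := h.fderiv_of_isOpen hΩ (m := ∞) (by simp)
  exact this.clm_apply contDiffOn_const

theorem pd_comm {Ω : Set (ι → ℝ)} (hΩ : IsOpen Ω) {f : (ι → ℝ) → ℝ}
    (h : ContDiffOn ℝ ∞ f Ω) (i j : ι) {p : ι → ℝ} (hp : p ∈ Ω) :
    pd i (pd j f) p = pd j (pd i f) p := by
  have hc : ContDiffAt ℝ ∞ f p := h.contDiffAt (hΩ.mem_nhds hp)
  have hs := hc.isSymmSndFDerivAt (by simpa using WithTop.coe_le_coe.2 (le_top : (2 : ℕ∞) ≤ ⊤))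
  have hd : DifferentiableAt ℝ (fderiv ℝ f) p :=
    ContDiffOn.differentiableAt_of_isOpen hΩ (h.fderiv_of_isOpen hΩ (m := ∞) (by simp)) hp
  have e : ∀ i j, pd i (pd j f) p = fderiv ℝ (fderiv ℝ f) p (cvec i) (cvec j) := by
    intro i j
    have : pd j f = fun q => fderiv ℝ f q (cvec j) := rfl
    rw [this, pd, fderiv_clm_apply hd (differentiableAt_const _)]
    simp
  rw [e, e, hs]

/-- Smooth functions on `Ω` that are constant in the directions `s`. -/
def IsBasic (Ω : Set (ι → ℝ)) (s : Set ι) (f : (ι → ℝ) → ℝ) : Prop :=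
  ContDiffOn ℝ ∞ f Ω ∧ ∀ i ∈ s, ∀ p ∈ Ω, pd i f p = 0

theorem pd_add' {f f' : (ι → ℝ) → ℝ} {p : ι → ℝ} (hf : DifferentiableAt ℝ f p)
    (hf' : DifferentiableAt ℝ f' p) (i : ι) :
    pd i (fun p => f p + f' p) p = pd i f p + pd i f' p := by
  simp only [pd]
  rw [fderiv_fun_add hf hf']; rfl

theorem pd_mul' {f f' : (ι → ℝ) → ℝ} {p : ι → ℝ} (hf : DifferentiableAt ℝ f p)
    (hf' : DifferentiableAt ℝ f' p) (i : ι) :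
    pd i (fun p => f p * f' p) p = f p * pd i f' p + f' p * pd i f p := by
  simp only [pd]
  rw [fderiv_fun_mul hf hf']; rfl

theorem pd_const' (c : ℝ) (i : ι) (p : ι → ℝ) : pd i (fun _ => c) p = 0 := by
  simp [pd]

/-- The open set together with the directions in which all functions are constant. -/
structure BasicDomain (ι : Type*) [Fintype ι] where
  carrier : Set (ι → ℝ)
  isOpen : IsOpen carrier
  dirs : Set ι

variable (W : BasicDomain ι)

/-- The algebra of restrictions of basic functions. -/
def basicAlgebra : Subalgebra ℝ (W.carrier → ℝ) where
  -- Elements are functions on the subtype, so equality in the ring is equality on the open set and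
  -- the values of an extension outside it are forgotten.
  carrier := {r | ∃ f, IsBasic W.carrier W.dirs f ∧ ∀ p : W.carrier, r p = f p}
  mul_mem' := by
    rintro r r' ⟨f, hf, h⟩ ⟨f', hf', h'⟩
    refine ⟨fun p => f p * f' p, ⟨hf.1.mul hf'.1, fun i hi p hp => ?_⟩, fun p => ?_⟩
    · rw [pd_mul' (hf.1.differentiableAt_of_isOpen W.isOpen hp)
        (hf'.1.differentiableAt_of_isOpen W.isOpen hp), hf.2 i hi p hp, hf'.2 i hi p hp]
      ring
    · rw [Pi.mul_apply, h, h']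
  add_mem' := by
    rintro r r' ⟨f, hf, h⟩ ⟨f', hf', h'⟩
    refine ⟨fun p => f p + f' p, ⟨hf.1.add hf'.1, fun i hi p hp => ?_⟩, fun p => ?_⟩
    · rw [pd_add' (hf.1.differentiableAt_of_isOpen W.isOpen hp)
        (hf'.1.differentiableAt_of_isOpen W.isOpen hp), hf.2 i hi p hp, hf'.2 i hi p hp]
      ring
    · rw [Pi.add_apply, h, h']
  algebraMap_mem' c := ⟨fun _ => c, ⟨contDiffOn_const, fun i _ p _ => pd_const' c i p⟩,
    fun _ => rfl⟩

/-- The ring of basic functions. -/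
abbrev BasicRing : Type _ := basicAlgebra W

namespace BasicRing

variable {W}

/-- A basic function on the whole space that restricts to the given one. -/
def lift (r : BasicRing W) : (ι → ℝ) → ℝ := r.2.choose

theorem lift_basic (r : BasicRing W) : IsBasic W.carrier W.dirs r.lift := r.2.choose_spec.1

theorem lift_eq (r : BasicRing W) (p : W.carrier) : r.1 p = r.lift p := r.2.choose_spec.2 p

/-- Evaluation at a point. -/
def ev (p : W.carrier) : BasicRing W →ₐ[ℝ] ℝ :=
  (Pi.evalAlgHom ℝ (fun _ => ℝ) p).comp (basicAlgebra W).val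

theorem ev_eq_lift (p : W.carrier) (r : BasicRing W) : ev p r = r.lift p := lift_eq r p

theorem ext_ev {r r' : BasicRing W} (h : ∀ p, ev p r = ev p r') : r = r' :=
  Subtype.ext (funext h)

theorem ev_algebraMap (p : W.carrier) (c : ℝ) : ev p (algebraMap ℝ (BasicRing W) c) = c :=
  (ev p).commutes c

/-- A function represents `r` if it restricts to `r`. -/
def Rep (f : (ι → ℝ) → ℝ) (r : BasicRing W) : Prop := ∀ p : W.carrier, f p = ev p r

theorem rep_lift (r : BasicRing W) : Rep r.lift r := fun p => (ev_eq_lift p r).symm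

/-- The element of the ring given by a basic function. -/
def mk (f : (ι → ℝ) → ℝ) (hf : IsBasic W.carrier W.dirs f) : BasicRing W :=
  ⟨fun p => f p, f, hf, fun _ => rfl⟩

theorem rep_mk (f : (ι → ℝ) → ℝ) (hf : IsBasic W.carrier W.dirs f) : Rep f (mk f hf) :=
  fun _ => rfl

theorem ev_mk (f : (ι → ℝ) → ℝ) (hf : IsBasic W.carrier W.dirs f) (p : W.carrier) :
    ev p (mk f hf) = f p := rfl

theorem pd_lift_basic (r : BasicRing W) (i : ι) : IsBasic W.carrier W.dirs (pd i r.lift) := by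
  refine ⟨r.lift_basic.1.pd W.isOpen i, fun j hj p hp => ?_⟩
  rw [pd_comm W.isOpen r.lift_basic.1 j i hp,
    pd_congr W.isOpen (f' := fun _ => 0) (fun q hq => r.lift_basic.2 j hj q hq) i hp, pd_const']

theorem Rep.pd_eq {f : (ι → ℝ) → ℝ} {r : BasicRing W} (h : Rep f r) (i : ι) (p : W.carrier) :
    pd i f p = pd i r.lift p :=
  pd_congr W.isOpen (fun q hq => (h ⟨q, hq⟩).trans (ev_eq_lift ⟨q, hq⟩ r)) i p.2

theorem differentiableAt_lift (r : BasicRing W) (p : W.carrier) :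
    DifferentiableAt ℝ r.lift p :=
  r.lift_basic.1.differentiableAt_of_isOpen W.isOpen p.2

/-- The partial derivatives as derivations. -/
def D (i : ι) : Derivation ℝ (BasicRing W) (BasicRing W) :=
  Derivation.mk'
    { toFun := fun r => mk (_root_.pd i r.lift) (r.pd_lift_basic i)
      map_add' := fun r r' => ext_ev fun p => by
        have h : Rep (fun p => r.lift p + r'.lift p) (r + r') := fun p => by
          rw [map_add, ev_eq_lift, ev_eq_lift]
        rw [map_add, ev_mk, ev_mk, ev_mk, ← h.pd_eq i p,
          pd_add' (differentiableAt_lift r p) (differentiableAt_lift r' p)]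
      map_smul' := fun c r => ext_ev fun p => by
        have h : Rep (fun p => c * r.lift p) (c • r) := fun p => by
          rw [map_smul, ev_eq_lift, smul_eq_mul]
        rw [map_smul, ev_mk, ev_mk, ← h.pd_eq i p,
          pd_mul' (differentiableAt_const c) (differentiableAt_lift r p), pd_const']
        simp }
    fun r r' => ext_ev fun p => by
      have h : Rep (fun p => r.lift p * r'.lift p) (r * r') := fun p => by
        rw [map_mul, ev_eq_lift, ev_eq_lift]
      simp only [LinearMap.coe_mk, AddHom.coe_mk, map_add, smul_eq_mul, map_mul, ev_mk]
      rw [← h.pd_eq i p, pd_mul' (differentiableAt_lift r p) (differentiableAt_lift r' p),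
        ev_eq_lift, ev_eq_lift]

theorem ev_D (i : ι) (r : BasicRing W) (p : W.carrier) : ev p (D i r) = pd i r.lift p := rfl

theorem Rep.pd {f : (ι → ℝ) → ℝ} {r : BasicRing W} (h : Rep f r) (i : ι) :
    Rep (_root_.pd i f) (D i r) := fun p => h.pd_eq i p

theorem D_comm (i j : ι) (r : BasicRing W) : D i (D j r) = D j (D i r) := ext_ev fun p => by
  rw [← ((rep_lift r).pd j).pd i p, ← ((rep_lift r).pd i).pd j p,
    pd_comm W.isOpen r.lift_basic.1 i j p.2]

theorem D_dirs {i : ι} (hi : i ∈ W.dirs) : (D i : Derivation ℝ (BasicRing W) (BasicRing W)) = 0 :=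
  Derivation.ext fun r => ext_ev fun p => by
    rw [ev_D, r.lift_basic.2 i hi p p.2]; simp

theorem Rep.contDiffOn {f : (ι → ℝ) → ℝ} {r : BasicRing W} (h : Rep f r) :
    ContDiffOn ℝ ∞ f W.carrier :=
  r.lift_basic.1.congr fun p hp => (h ⟨p, hp⟩).trans (ev_eq_lift ⟨p, hp⟩ r)

/-- The matrix of basic functions represented by a matrix of functions. -/
theorem map_ev_mul {l m n : Type*} [Fintype m] (p : W.carrier) (M : Matrix l m (BasicRing W))
    (N : Matrix m n (BasicRing W)) : (M * N).map (ev p) = M.map (ev p) * N.map (ev p) :=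
  Matrix.map_mul

theorem isBasic_of_inv {f : (ι → ℝ) → ℝ} (hf : IsBasic W.carrier W.dirs f)
    (h0 : ∀ p ∈ W.carrier, f p ≠ 0) : IsBasic W.carrier W.dirs fun p => (f p)⁻¹ := by
  refine ⟨hf.1.inv h0, fun i hi p hp => ?_⟩
  have hd := hf.1.differentiableAt_of_isOpen W.isOpen hp
  have h1 : pd i (fun p => f p * (f p)⁻¹) p = 0 := by
    rw [pd_congr W.isOpen (f' := fun _ => 1) (fun q hq => mul_inv_cancel₀ (h0 q hq)) i hp,
      pd_const']
  rw [pd_mul' (f' := fun p => (f p)⁻¹) hd (hd.inv (h0 p hp)), hf.2 i hi p hp, mul_zero, add_zero] at h1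
  exact (mul_eq_zero.mp h1).resolve_left (h0 p hp)

end BasicRing

end SmoothRing

end

noncomputable section

/-! ### Coordinate tensor calculus over the ring of basic functions -/

section TensorBridge

open Matrix BasicRing

/-- A torsion-free connection preserving the metric is the Levi-Civita connection. -/
theorem levi_civita_unique {ι R : Type*} [Fintype ι] [DecidableEq ι] [CommRing R] [Algebra ℝ R]
    (D : ι → Derivation ℝ R R) {g gi : Matrix ι ι R} (hgi : gi * g = 1) (hg : gᵀ = g)
    {Γ : ι → Matrix ι ι R} (hs : ∀ i j k, Γ i k j = Γ j k i)
    (hm : ∀ i, g.map (D i) = (Γ i)ᵀ * g + g * Γ i) (k i j : ι) :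
    half R * ∑ l, gi k l * (D i (g j l) + D j (g i l) - D l (g i j)) = Γ i k j := by
  have e : ∀ i j l, D i (g j l) = (g * Γ i) l j + (g * Γ i) j l := by
    intro i j l
    have h := congrFun (congrFun (hm i) j) l
    have h2 : (Γ i)ᵀ * g = (g * Γ i)ᵀ := by rw [Matrix.transpose_mul, hg]
    rwa [h2, map_apply] at h
  have sy : ∀ i j l, (g * Γ i) l j = (g * Γ j) l i := fun i j l => by
    simp only [mul_apply, hs i j]
  -- Koszul's formula: expanded through Γ, four of the six terms cancel by symmetry.
  have h3 : ∀ l, D i (g j l) + D j (g i l) - D l (g i j) = 2 * (g * Γ i) l j := by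
    intro l
    rw [e, e, e, sy j i l, sy l j i, sy l i j, sy j l i]; ring
  simp only [h3]
  have h4 : ∑ l, gi k l * (2 * (g * Γ i) l j) = 2 * (gi * (g * Γ i)) k j := by
    rw [mul_apply, Finset.mul_sum]
    exact Finset.sum_congr rfl fun _ _ => by ring
  rw [h4, ← Matrix.mul_assoc, hgi, Matrix.one_mul]
  linear_combination Γ i k j * two_mul_half R

theorem gtrace_eq_trace {ι : Type*} [Fintype ι] [DecidableEq ι] (g : Matrix ι ι ℝ)
    (T : ι → ι → ℝ) : gtrace g T = (g⁻¹ * (Matrix.of T)ᵀ).trace := by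
  simp only [gtrace, Matrix.trace, diag_apply, mul_apply, transpose_apply, Matrix.of_apply]

/-- The components of a two-form. -/
def formMat {ι : Type*} [Fintype ι] [DecidableEq ι] (F : DForm ι 2) : Matrix ι ι ℝ :=
  fun i j => F ![cvec i, cvec j]

theorem sqTwo_eq {ι : Type*} [Fintype ι] [DecidableEq ι] (g : Matrix ι ι ℝ) (F : DForm ι 2) :
    (fun a b => sqTwo g F a b) = formMat F * g⁻¹ * (formMat F)ᵀ := by
  ext a b
  simp only [sqTwo, gtrace, mul_apply, formMat, transpose_apply, Finset.sum_mul]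
  rw [Finset.sum_comm]
  exact Finset.sum_congr rfl fun _ _ => Finset.sum_congr rfl fun _ _ => by ring

/-- The components of a three-form. -/
def formMat₃ {ι : Type*} [Fintype ι] [DecidableEq ι] (H : DForm ι 3) (a : ι) : Matrix ι ι ℝ :=
  fun i j => H ![cvec a, cvec i, cvec j]

theorem sqThree_eq {ι : Type*} [Fintype ι] [DecidableEq ι] {g : Matrix ι ι ℝ}
    (hg : (g⁻¹)ᵀ = g⁻¹) (H : DForm ι 3) (a b : ι) :
    sqThree g H a b = (g⁻¹ * formMat₃ H a * g⁻¹ * (formMat₃ H b)ᵀ).trace := by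
  have h1 : ∀ c c', gtrace g (fun d d' => H ![cvec a, cvec c, cvec d] * H ![cvec b, cvec c', cvec d'])
      = (formMat₃ H a * g⁻¹ * (formMat₃ H b)ᵀ) c c' := by
    intro c c'
    simp only [gtrace, mul_apply, formMat₃, transpose_apply, Finset.sum_mul]
    rw [Finset.sum_comm]
    exact Finset.sum_congr rfl fun _ _ => Finset.sum_congr rfl fun _ _ => by ring
  rw [sqThree]
  simp only [h1]
  rw [gtrace_eq_trace, ← Matrix.trace_transpose, Matrix.transpose_mul, hg,
    Matrix.transpose_transpose, Matrix.trace_mul_comm]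
  congr 1
  simp only [Matrix.mul_assoc]
  rfl

variable {ι : Type*} [Fintype ι] [DecidableEq ι] {W : BasicDomain ι}

/-- The metric is represented by an invertible symmetric matrix of basic functions. -/
structure MetricRep (g : (ι → ℝ) → Matrix ι ι ℝ) (G Gi : Matrix ι ι (BasicRing W)) : Prop where
  rep : ∀ p : W.carrier, g p = G.map (ev p)
  inv_mul : Gi * G = 1
  symm : Gᵀ = G

theorem rep_curvature {Γf : (ι → ℝ) → ι → ι → ι → ℝ} {Γ : ι → Matrix ι ι (BasicRing W)}
    (h : ∀ k i j, Rep (fun p => Γf p k i j) (Γ i k j)) (l k i j : ι) :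
    Rep (fun p => curvature Γf p l k i j) (curvMat (D (W := W)) Γ i j l k) := by
  intro p
  simp only [curvature, curvMat, Matrix.add_apply, Matrix.sub_apply, map_apply, mul_apply,
    map_add, map_sub, map_sum, map_mul]
  rw [(h l j k).pd i p, (h l i k).pd j p]
  simp only [h _ _ _ p, Finset.sum_sub_distrib]

namespace MetricRep

variable {g : (ι → ℝ) → Matrix ι ι ℝ} {G Gi : Matrix ι ι (BasicRing W)}

theorem apply (h : MetricRep g G Gi) (i j : ι) : Rep (fun p => g p i j) (G i j) := fun p => by
  simp only [h.rep p, map_apply]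

theorem inv (h : MetricRep g G Gi) (p : W.carrier) : (g p)⁻¹ = Gi.map (ev p) := by
  refine Matrix.inv_eq_left_inv ?_
  rw [h.rep p, ← map_ev_mul, h.inv_mul]
  ext i j
  by_cases hij : i = j <;> simp [hij, Matrix.one_apply]

theorem inv_symm (h : MetricRep g G Gi) : Giᵀ = Gi := by
  have h1 : Giᵀ * G = 1 := by
    have := congrArg Matrix.transpose (mul_eq_one_comm.mp h.inv_mul)
    rwa [Matrix.transpose_mul, h.symm, Matrix.transpose_one] at this
  calc Giᵀ = Giᵀ * (G * Gi) := by rw [mul_eq_one_comm.mp h.inv_mul, Matrix.mul_one]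
    _ = Gi := by rw [← Matrix.mul_assoc, h1, Matrix.one_mul]

/-- The matrices `Γ` are torsion free and preserve the metric. -/
structure LeviCivita (G : Matrix ι ι (BasicRing W)) (Γ : ι → Matrix ι ι (BasicRing W)) :
    Prop where
  symm : ∀ i j k, Γ i k j = Γ j k i
  metric : ∀ i, G.map (D i) = (Γ i)ᵀ * G + G * Γ i

variable {Γ : ι → Matrix ι ι (BasicRing W)}

/-- Instead of computing Christoffel symbols, any torsion-free metric connection over the ring is
shown to represent them, by `levi_civita_unique`. -/
theorem rep_christoffel (h : MetricRep g G Gi) (hΓ : LeviCivita G Γ) (k i j : ι) :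
    Rep (fun p => christoffel g p k i j) (Γ i k j) := by
  intro p
  rw [← levi_civita_unique (D (W := W)) h.inv_mul h.symm hΓ.symm hΓ.metric k i j]
  simp only [christoffel, h.inv p, (h.apply _ _).pd _ p, map_mul, map_sum, map_add, map_sub, half,
    ev_algebraMap, map_apply]

theorem rep_torsionConnection (h : MetricRep g G Gi) (hΓ : LeviCivita G Γ)
    {T : (ι → ℝ) → DForm ι 3} {Hc : ι → Matrix ι ι (BasicRing W)}
    (hT : ∀ p : W.carrier, ∀ i, formMat₃ (T p) i = (Hc i).map (ev p)) (k i j : ι) :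
    Rep (fun p => torsionConnection g T p k i j)
      ((Γ i + half (BasicRing W) • (Gi * (Hc i)ᵀ)) k j) := by
  intro p
  have e : ∀ i j l, T p ![cvec i, cvec j, cvec l] = ev p (Hc i j l) := fun i j l =>
    congrFun (congrFun (hT p i) j) l
  simp only [torsionConnection, h.rep_christoffel hΓ k i j p, e, h.inv p, Matrix.add_apply,
    Matrix.smul_apply, smul_eq_mul, mul_apply, transpose_apply, map_add, map_mul, map_sum, half,
    ev_algebraMap, map_apply]

theorem rep_ricci (h : MetricRep g G Gi) (hΓ : LeviCivita G Γ) (i j : ι) :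
    Rep (fun p => ricci g p i j) (ricMat (curvMat (D (W := W)) Γ) i j) := by
  intro p
  simp only [ricci, ricMat, map_sum]
  exact Finset.sum_congr rfl fun s _ => rep_curvature (h.rep_christoffel hΓ) s j s i p

theorem rep_hessian (h : MetricRep g G Gi) (hΓ : LeviCivita G Γ) {φ : (ι → ℝ) → ℝ}
    {f : BasicRing W} (hφ : Rep φ f) (i j : ι) :
    Rep (fun p => hessian g φ p i j) (hessMat (D (W := W)) Γ f i j) := by
  intro p
  simp only [hessian, hessMat, map_sub, map_sum, map_mul, (hφ.pd j).pd i p, hφ.pd _ p,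
    h.rep_christoffel hΓ _ _ _ p]

theorem rep_gtrace (h : MetricRep g G Gi) {S : (ι → ℝ) → ι → ι → ℝ}
    {M : Matrix ι ι (BasicRing W)} (hS : ∀ i j, Rep (fun p => S p i j) (M i j)) :
    Rep (fun p => gtrace (g p) (S p)) (Gi * Mᵀ).trace := by
  intro p
  simp only [gtrace, h.inv p, Matrix.trace, diag_apply, mul_apply, transpose_apply, map_sum,
    map_mul, map_apply, hS _ _ p]

theorem rep_sqTwo (h : MetricRep g G Gi) {F : (ι → ℝ) → DForm ι 2}
    {Fc : Matrix ι ι (BasicRing W)} (hF : ∀ p : W.carrier, formMat (F p) = Fc.map (ev p))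
    (i j : ι) : Rep (fun p => sqTwo (g p) (F p) i j) ((Fc * Gi * Fcᵀ) i j) := by
  intro p
  have := congrFun (congrFun (sqTwo_eq (g p) (F p)) i) j
  dsimp only at this ⊢
  rw [this, hF p, h.inv p, ← Matrix.transpose_map, ← map_ev_mul, ← map_ev_mul]
  rfl

theorem rep_sqThree (h : MetricRep g G Gi) {T : (ι → ℝ) → DForm ι 3}
    {Hc : ι → Matrix ι ι (BasicRing W)}
    (hT : ∀ p : W.carrier, ∀ i, formMat₃ (T p) i = (Hc i).map (ev p)) (i j : ι) :
    Rep (fun p => sqThree (g p) (T p) i j) (Gi * Hc i * Gi * (Hc j)ᵀ).trace := by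
  intro p
  dsimp only
  rw [sqThree_eq, hT, hT, h.inv p, ← Matrix.transpose_map, ← map_ev_mul, ← map_ev_mul,
    ← map_ev_mul, Matrix.trace, Matrix.trace, map_sum]
  · rfl
  · rw [h.inv p, ← Matrix.transpose_map, h.inv_symm]

/-- Compatibility and J² = −1 give JᵀG = −GJ, hence G⁻¹JᵀG = −J, and the sum over an orthonormal
frame becomes minus the trace of J times the curvature. -/
theorem rep_ricciForm (h : MetricRep g G Gi) (hΓ : LeviCivita G Γ)
    {T : (ι → ℝ) → DForm ι 3} {Hc : ι → Matrix ι ι (BasicRing W)}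
    (hT : ∀ p : W.carrier, ∀ i, formMat₃ (T p) i = (Hc i).map (ev p))
    {J : (ι → ℝ) → Matrix ι ι ℝ} {Jc : Matrix ι ι (BasicRing W)}
    (hJ : ∀ p : W.carrier, J p = Jc.map (ev p)) (hherm : Jcᵀ * G * Jc = G) (hsq : Jc * Jc = -1)
    (i j : ι) : Rep (fun p => ricciForm g J T p i j) (-(half (BasicRing W) *
      (Jc * curvMat (D (W := W)) (fun i => Γ i + half (BasicRing W) • (Gi * (Hc i)ᵀ)) i j).trace)) := by
  have hGJ : Gi * Jcᵀ * G = -Jc := by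
    have h1 : Jcᵀ * G = -(G * Jc) := by
      calc Jcᵀ * G = -(Jcᵀ * G * (Jc * Jc)) := by rw [hsq]; simp
        _ = -(G * Jc) := by rw [← Matrix.mul_assoc, hherm]
    rw [Matrix.mul_assoc, h1, Matrix.mul_neg, ← Matrix.mul_assoc, h.inv_mul, Matrix.one_mul]
  set Ω := curvMat (D (W := W)) (fun i => Γ i + half (BasicRing W) • (Gi * (Hc i)ᵀ)) i j with hΩ
  have h2 : (Jc * Ω).trace = -(Gi * (Ωᵀ * G * Jc)ᵀ).trace := by
    rw [← Matrix.trace_neg]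
    congr 1
    rw [Matrix.transpose_mul, Matrix.transpose_mul, Matrix.transpose_transpose, h.symm,
      ← Matrix.mul_assoc, ← Matrix.mul_assoc, hGJ, Matrix.neg_mul, neg_neg]
  intro p
  have h3 : Rep (fun p => gtrace (g p) fun k s =>
    ∑ l, ∑ t, curvature (torsionConnection g T) p l k i j * g p l t * J p t s)
      (Gi * (Ωᵀ * G * Jc)ᵀ).trace := by
    refine h.rep_gtrace fun k s p => ?_
    have e : ∀ t s, J p t s = ev p (Jc t s) := fun t s => congrFun (congrFun (hJ p) t) s
    simp only [Matrix.mul_apply (N := Jc), Matrix.mul_apply (M := Ωᵀ), transpose_apply, map_sum,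
      map_mul, e, Finset.sum_mul,
      rep_curvature (h.rep_torsionConnection hΓ hT) _ _ _ _ p, ← hΩ, h.apply _ _ p]
    rw [Finset.sum_comm]
  simp only [ricciForm, h3 p, h2, map_neg, map_mul, half, ev_algebraMap]
  ring

end MetricRep

end TensorBridge

end

noncomputable section

/-! ### The Hodge star and exterior derivatives -/

section HodgeCalculus

open Matrix

variable {ι : Type*} [Fintype ι] [DecidableEq ι]

/-- The determinant as an alternating map of vectors enumerated by `σ`. -/
def detAlt {X : Type*} (σ : ι ≃ X) : (ι → ℝ) [⋀^X]→ₗ[ℝ] ℝ :=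
  (Matrix.detRowAlternating (n := ι) (R := ℝ)).domDomCongr σ

theorem detAlt_apply {X : Type*} (σ : ι ≃ X) (u : X → ι → ℝ) :
    detAlt σ u = Matrix.det (Matrix.of fun i => u (σ i)) := rfl

/-- Cramer's rule in the form `∑ₛ ξ(uₛ) det(u with uₛ replaced by x) = ξ(x) det u`. -/
theorem sum_mul_detAlt_update {X : Type*} [Fintype X] [DecidableEq X] (σ : ι ≃ X)
    (ξ : (ι → ℝ) →ₗ[ℝ] ℝ) (u : X → ι → ℝ) (x : ι → ℝ) :
    ∑ s, ξ (u s) * detAlt σ (Function.update u s x) = ξ x * detAlt σ u := by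
  have hx : ∀ y : ι → ℝ, ξ y = ∑ i, y i * ξ (cvec i) := by
    intro y
    conv_lhs => rw [pi_eq_sum_univ' y, map_sum]
    exact Finset.sum_congr rfl fun i _ => by rw [map_smul, smul_eq_mul]; rfl
  set A : Matrix ι ι ℝ := Matrix.of fun i => u (σ i) with hA
  -- Replacing one row by x gives a component of a Cramer vector; `mulVec_cramer` paired with ξ is
  -- then the claim.
  have h1 : ∀ s, detAlt σ (Function.update u (σ s) x) = Matrix.cramer Aᵀ x s := by
    intro s
    rw [Matrix.cramer_transpose_apply, detAlt_apply]
    congr 1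
    ext i j
    by_cases h : i = s
    · subst h; simp
    · simp [Matrix.updateRow_apply, h, hA, Function.update_of_ne]
  have h2 : ∀ i, ∑ s, u (σ s) i * Matrix.cramer Aᵀ x s = A.det * x i := by
    intro i
    have := congrFun (Matrix.mulVec_cramer Aᵀ x) i
    simpa [Matrix.mulVec, dotProduct, hA, Matrix.det_transpose] using this
  rw [← Equiv.sum_comp σ]
  simp only [h1, hx (u _), Finset.sum_mul]
  rw [Finset.sum_comm, hx x, Finset.sum_mul]
  refine Finset.sum_congr rfl fun i _ => ?_
  rw [detAlt_apply, ← hA]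
  have := h2 i
  calc _ = (∑ s, u (σ s) i * Matrix.cramer Aᵀ x s) * ξ (cvec i) := by
        rw [Finset.sum_mul]; exact Finset.sum_congr rfl fun _ _ => by ring
    _ = _ := by rw [this]; ring

variable {D k m : ℕ}

/-- Positions of the arguments of the volume form split after the first `k`. -/
def splitEquiv (o : Fin D ≃ ι) (h : k + m = D) : ι ≃ Fin k ⊕ Fin m :=
  (o.symm.trans (finCongr h.symm)).trans finSumFinEquiv.symm

/-- `det (u, w)`. -/
def detSplit (o : Fin D ≃ ι) (h : k + m = D) (u : Fin k → ι → ℝ) (w : Fin m → ι → ℝ) : ℝ :=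
  detAlt (splitEquiv o h) (Sum.elim u w)

/-- The constant form `det (∂_{I 0}, ∂_{I 1}, …, ⋅)`. -/
def starBasis (o : Fin D ≃ ι) (h : k + m = D) (I : Fin k → ι) : DForm ι m :=
  toDForm (fixLeft (detAlt (splitEquiv o h)) fun s => cvec (I s))

theorem starBasis_apply (o : Fin D ≃ ι) (h : k + m = D) (I : Fin k → ι) (w : Fin m → ι → ℝ) :
    starBasis o h I w = detSplit o h (fun s => cvec (I s)) w := rfl

theorem alternatingMap_sum_apply {V X κ : Type*} [AddCommGroup V] [Module ℝ V] (s : Finset κ)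
    (f : κ → V [⋀^X]→ₗ[ℝ] ℝ) (v : X → V) : (∑ i ∈ s, f i) v = ∑ i ∈ s, f i v := by
  classical
  induction s using Finset.induction_on with
  | empty => simp
  | insert a s ha ih => rw [Finset.sum_insert ha, Finset.sum_insert ha, AlternatingMap.add_apply, ih]

/-- The coefficients of the Hodge star. -/
def starCoeff (g : Matrix ι ι ℝ) (α : DForm ι k) (I : Fin k → ι) : ℝ :=
  Real.sqrt g.det * ((1 / (k.factorial : ℝ)) *
    ∑ J : Fin k → ι, (∏ s, g⁻¹ (I s) (J s)) * α fun s => cvec (J s))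

theorem hodgeStar_eq (o : Fin D ≃ ι) (h : k + m = D) (g : Matrix ι ι ℝ) (α : DForm ι k) :
    hodgeStar o h g α = ∑ I : Fin k → ι, starCoeff g α I • starBasis o h I := by
  ext w
  have e : ∀ u : Fin k → ι → ℝ, fixLeft ((volForm o g).domDomCongr
      ((finCongr h.symm).trans finSumFinEquiv.symm)) u w = Real.sqrt g.det * detSplit o h u w :=
    fun u => rfl
  have e1 : hodgeStar o h g α w = (1 / (k.factorial : ℝ)) * ∑ I : Fin k → ι, ∑ J : Fin k → ι,
      ((∏ s, g⁻¹ (I s) (J s)) * α (fun s => cvec (J s))) *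
        (Real.sqrt g.det * detSplit o h (fun s => cvec (I s)) w) := by
    simp only [← e]
    change (((1 / (k.factorial : ℝ)) • ∑ I : Fin k → ι, ∑ J : Fin k → ι,
      ((∏ s, g⁻¹ (I s) (J s)) * α (fun s => cvec (J s))) •
      fixLeft ((volForm o g).domDomCongr ((finCongr h.symm).trans finSumFinEquiv.symm))
        (fun s => cvec (I s)) : (ι → ℝ) [⋀^Fin m]→ₗ[ℝ] ℝ)) w = _
    simp only [AlternatingMap.smul_apply, alternatingMap_sum_apply, smul_eq_mul]
  rw [e1]
  simp only [ContinuousAlternatingMap.sum_apply, ContinuousAlternatingMap.smul_apply,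
    starBasis_apply, starCoeff, smul_eq_mul, Finset.mul_sum, Finset.sum_mul]
  exact Finset.sum_congr rfl fun _ _ => Finset.sum_congr rfl fun _ _ => by ring

/-- Moving the first argument into slot j of the tail costs (−1)^j, against the sign (−1)^(j+1) of
the exterior derivative. -/
theorem neg_one_pow_map_removeNth_succ {V : Type*} [AddCommGroup V] [Module ℝ V]
    (f : V [⋀^Fin m]→ₗ[ℝ] ℝ) (v : Fin (m + 1) → V) (j : Fin m) :
    (-1) ^ (j.succ : ℕ) * f (j.succ.removeNth v)
      = -f (Function.update (Fin.tail v) j (v 0)) := by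
  obtain _ | m := m
  · exact j.elim0
  have h1 : Function.update (Fin.tail v) j (v 0) = j.insertNth (v 0) (j.removeNth (Fin.tail v)) := by
    rw [Fin.insertNth_removeNth]
  have h2 : j.succ.removeNth v = Matrix.vecCons (v 0) (j.removeNth (Fin.tail v)) := by
    ext i : 1
    refine Fin.cases ?_ (fun i => ?_) i
    · simp [Fin.removeNth]
    · simp [Fin.removeNth, Fin.tail]
  rw [h1, h2, ← AlternatingMap.neg_one_pow_smul_map_insertNth f j, Fin.val_succ, pow_succ, zsmul_eq_mul]
  push_cast
  have : ((-1 : ℝ) ^ (j : ℕ)) * (-1) ^ (j : ℕ) = 1 := by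
    rw [← mul_pow]; simp
  linear_combination -f (j.insertNth (v 0) (j.removeNth (Fin.tail v))) * this

/-- The exterior derivative of a combination of the forms `det (∂_{I 0}, …, ⋅)` is a divergence. -/
theorem extDeriv_sum_starBasis (o : Fin D ≃ ι) (h : k + m = D)
    {w : (Fin k → ι) → (ι → ℝ) → ℝ} {p : ι → ℝ} (hw : ∀ I, DifferentiableAt ℝ (w I) p)
    (v : Fin (m + 1) → ι → ℝ) :
    extDeriv (fun p => ∑ I, w I p • starBasis o h I) p v
      = ∑ I, ∑ s, pd (I s) (w I) p *
        detSplit o h (Function.update (fun s => cvec (I s)) s (v 0)) (Fin.tail v) := by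
  have hd : DifferentiableAt ℝ (fun p => ∑ I, w I p • starBasis o h I) p := by
    refine DifferentiableAt.fun_sum fun I _ => ?_
    exact (hw I).smul (differentiableAt_const _)
  rw [extDeriv_apply hd]
  have h1 : ∀ j : Fin (m + 1), fderiv ℝ (fun p => (∑ I, w I p • starBasis o h I) (j.removeNth v)) p
      (v j) = ∑ I, fderiv ℝ (w I) p (v j) * starBasis o h I (j.removeNth v) := by
    intro j
    simp only [ContinuousAlternatingMap.sum_apply, ContinuousAlternatingMap.smul_apply, smul_eq_mul]
    rw [fderiv_fun_sum (u := Finset.univ) (A := fun I p => w I p * starBasis o h I (j.removeNth v))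
      fun I _ => (hw I).mul_const _]
    rw [_root_.sum_apply]
    refine Finset.sum_congr rfl fun I _ => ?_
    rw [fderiv_mul_const (hw I)]
    simp [mul_comm]
  simp only [h1, zsmul_eq_mul, Int.cast_pow, Int.cast_neg, Int.cast_one, Finset.mul_sum]
  refine Finset.sum_comm.trans ?_
  refine Finset.sum_congr rfl fun I _ => ?_
  set ξ : (ι → ℝ) →ₗ[ℝ] ℝ := (fderiv ℝ (w I) p).toLinearMap
  -- Cramer's rule with x = v 0: the sum over the slots of the tail of v cancels against the
  -- alternating sum in d, and the sum over the slots of I is left as the divergence.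
  have hc := sum_mul_detAlt_update (splitEquiv o h) ξ
    (Sum.elim (fun s => cvec (I s)) (Fin.tail v)) (v 0)
  rw [Fintype.sum_sum_type] at hc
  simp only [Sum.elim_inl, Sum.elim_inr, Sum.update_elim_inl, Sum.update_elim_inr] at hc
  have h2 : ∀ j : Fin m, (-1) ^ (j.succ : ℕ) *
      (fderiv ℝ (w I) p (v j.succ) * starBasis o h I (j.succ.removeNth v))
      = -(ξ (Fin.tail v j) * detAlt (splitEquiv o h)
        (Sum.elim (fun s => cvec (I s)) (Function.update (Fin.tail v) j (v 0)))) := by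
    intro j
    have := neg_one_pow_map_removeNth_succ
      (fixLeft (detAlt (splitEquiv o h)) fun s => cvec (I s)) v j
    change (-1) ^ (j.succ : ℕ) * starBasis o h I (j.succ.removeNth v) = -detAlt (splitEquiv o h)
        (Sum.elim (fun s => cvec (I s)) (Function.update (Fin.tail v) j (v 0))) at this
    change (-1) ^ (j.succ : ℕ) * (ξ (Fin.tail v j) * starBasis o h I (j.succ.removeNth v)) = _
    linear_combination ξ (Fin.tail v j) * this
  rw [Fin.sum_univ_succ]
  simp only [h2, Finset.sum_neg_distrib]
  have h3 : (-1) ^ ((0 : Fin (m + 1)) : ℕ) * (fderiv ℝ (w I) p (v 0) *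
      starBasis o h I (Fin.removeNth 0 v)) = ξ (v 0) * detAlt (splitEquiv o h)
        (Sum.elim (fun s => cvec (I s)) (Fin.tail v)) := by
    simp only [Fin.val_zero, pow_zero, one_mul]
    rfl
  rw [h3, ← hc]
  simp only [add_neg_cancel_right]
  rfl

end HodgeCalculus

end

/-! ### Products of a two-form with contractions of the volume form -/

noncomputable section

section WedgeCalculus

open Matrix

variable {ι : Type*} [Fintype ι] [DecidableEq ι]

/-- The antisymmetrization of a function of several vectors. -/
def altSum {X V : Type*} [Fintype X] [DecidableEq X] (f : (X → V) → ℝ) (v : X → V) : ℝ :=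
  ∑ σ : Equiv.Perm X, ((Equiv.Perm.sign σ : ℤ) : ℝ) * f (v ∘ σ)

theorem altSum_comp {X V : Type*} [Fintype X] [DecidableEq X] (f : (X → V) → ℝ) (v : X → V)
    (τ : Equiv.Perm X) :
    altSum (fun w => f (w ∘ τ)) v = ((Equiv.Perm.sign τ : ℤ) : ℝ) * altSum f v := by
  rw [altSum, altSum, ← Equiv.sum_comp (Equiv.mulRight τ)
    (fun σ => ((Equiv.Perm.sign σ : ℤ) : ℝ) * f (v ∘ σ)), Finset.mul_sum]
  refine Finset.sum_congr rfl fun σ _ => ?_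
  simp only [Equiv.coe_mulRight, Equiv.Perm.sign_mul, Units.val_mul, Int.cast_mul]
  have h : ((Equiv.Perm.sign τ : ℤ) : ℝ) * ((Equiv.Perm.sign τ : ℤ) : ℝ) = 1 := by
    rcases Int.units_eq_one_or (Equiv.Perm.sign τ) with h | h <;> simp [h]
  have e : (v ∘ σ) ∘ τ = v ∘ (σ * τ : Equiv.Perm X) := rfl
  rw [e]
  linear_combination -((Equiv.Perm.sign σ : ℤ) : ℝ) * f (v ∘ (σ * τ : Equiv.Perm X)) * h

theorem altSum_swap {X V : Type*} [Fintype X] [DecidableEq X] (f : (X → V) → ℝ) (v : X → V)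
    {a b : X} (hab : a ≠ b) : altSum (fun w => f (w ∘ Equiv.swap a b)) v = -altSum f v := by
  rw [altSum_comp, Equiv.Perm.sign_swap hab]; simp

theorem altSum_add {X V : Type*} [Fintype X] [DecidableEq X] (f f' : (X → V) → ℝ) (v : X → V) :
    altSum (fun w => f w + f' w) v = altSum f v + altSum f' v := by
  simp [altSum, mul_add, Finset.sum_add_distrib]

theorem altSum_sum {X V κ : Type*} [Fintype X] [DecidableEq X] (s : Finset κ)
    (f : κ → (X → V) → ℝ) (v : X → V) :
    altSum (fun w => ∑ i ∈ s, f i w) v = ∑ i ∈ s, altSum (f i) v := by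
  simp only [altSum, Finset.mul_sum]
  exact Finset.sum_comm

theorem altSum_const_mul {X V : Type*} [Fintype X] [DecidableEq X] (c : ℝ) (f : (X → V) → ℝ)
    (v : X → V) : altSum (fun w => c * f w) v = c * altSum f v := by
  simp only [altSum, Finset.mul_sum]
  exact Finset.sum_congr rfl fun _ _ => by ring

/-- The product is a sum over shuffles, and the sum over all permutations counts every shuffle m! k!
times. -/
theorem wedge_eq_altSum {m k : ℕ} (α : DForm ι m) (β : DForm ι k) (v : Fin (m + k) → ι → ℝ) :
    (m.factorial * k.factorial : ℝ) * wedge α β v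
      = altSum (fun w : Fin m ⊕ Fin k → ι → ℝ => α (fun i => w (Sum.inl i))
        * β fun i => w (Sum.inr i)) (v ∘ finSumFinEquiv) := by
  have h := MultilinearMap.domCoprod_alternization_eq α.toAlternatingMap β.toAlternatingMap
  have h2 := congrArg (fun f : (ι → ℝ) [⋀^Fin m ⊕ Fin k]→ₗ[ℝ] (TensorProduct ℝ ℝ ℝ) =>
    LinearMap.mul' ℝ ℝ (f (v ∘ finSumFinEquiv))) h
  simp only [Fintype.card_fin] at h2
  have h3 : wedge α β v = LinearMap.mul' ℝ ℝ
    (α.toAlternatingMap.domCoprod β.toAlternatingMap (v ∘ finSumFinEquiv)) := rfl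
  rw [AlternatingMap.smul_apply, map_nsmul, ← h3, nsmul_eq_mul, Nat.cast_mul] at h2
  rw [← h2, MultilinearMap.alternatization_apply, map_sum, altSum]
  refine Finset.sum_congr rfl fun σ _ => ?_
  rw [Units.smul_def, map_zsmul, zsmul_eq_mul]
  rfl

variable {D k m : ℕ}

/-- The products of a two-form with the forms `det (u, ⋅)`. -/
theorem altSum_detSplit (o : Fin D ≃ ι) (h : k + m = D) (u : Fin k → ι → ℝ) (F : DForm ι 2)
    (v : Fin m ⊕ Fin 2 → ι → ℝ) :
    (m + 1 : ℝ) * (m + 2) * altSum (fun w => detSplit o h u (fun i => w (Sum.inl i))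
        * F fun i => w (Sum.inr i)) v
      = (m + 2).factorial * ∑ s, ∑ r ∈ Finset.univ.erase s, F ![u s, u r] *
        detSplit o h (Function.update (Function.update u s (v (Sum.inr 0))) r (v (Sum.inr 1)))
          (fun i => v (Sum.inl i)) := by
  have hF : ∀ w : Fin m ⊕ Fin 2 → ι → ℝ, (fun i => w (Sum.inr i))
      = ![w (Sum.inr 0), w (Sum.inr 1)] := fun w => by
    ext i : 1; fin_cases i <;> rfl
  let ξ₁ : (ι → ℝ) → (ι → ℝ) →ₗ[ℝ] ℝ := fun y =>
    { toFun := fun x => F ![x, y]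
      map_add' := fun a b => F.toAlternatingMap.map_vecCons_add (![y]) a b
      map_smul' := fun c a => F.toAlternatingMap.map_vecCons_smul (![y]) c a }
  have hanti : ∀ x y, F ![x, y] = -F ![y, x] := by
    intro x y
    have := F.toAlternatingMap.map_swap ![y, x] (i := 0) (j := 1) (by simp)
    have e : ![y, x] ∘ Equiv.swap (0 : Fin 2) 1 = ![x, y] := by
      ext i : 1; fin_cases i <;> rfl
    rw [e] at this
    exact this
  -- Cramer's rule, with the slots of the determinant separated into fixed vectors u and arguments
  -- w.
  have cr : ∀ (ξ : (ι → ℝ) →ₗ[ℝ] ℝ) (u : Fin k → ι → ℝ) (w : Fin m → ι → ℝ) (x : ι → ℝ),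
      ξ x * detSplit o h u w = ∑ s, ξ (u s) * detSplit o h (Function.update u s x) w
        + ∑ t, ξ (w t) * detSplit o h u (Function.update w t x) := by
    intro ξ u w x
    have hc := sum_mul_detAlt_update (splitEquiv o h) ξ (Sum.elim u w) x
    rw [Fintype.sum_sum_type] at hc
    simp only [Sum.elim_inl, Sum.elim_inr, Sum.update_elim_inl, Sum.update_elim_inr] at hc
    exact hc.symm
  set f := fun w : Fin m ⊕ Fin 2 → ι → ℝ => detSplit o h u (fun i => w (Sum.inl i))
        * F fun i => w (Sum.inr i) with hf
  set f₁ := fun (s : Fin k) (w : Fin m ⊕ Fin 2 → ι → ℝ) => F ![u s, w (Sum.inr 1)] *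
    detSplit o h (Function.update u s (w (Sum.inr 0))) (fun i => w (Sum.inl i)) with hf₁
  -- Cramer's rule for ξ = F(·, w₁) and x = w₀. Each of the m slots of w gives f with two arguments
  -- exchanged, hence −altSum f, and these m terms moved to the left make the factor m + 1.
  have step1 : (m + 1 : ℝ) * altSum f v = ∑ s, altSum (f₁ s) v := by
    have e : f = fun w => ∑ s, f₁ s w
        + ∑ t, f (w ∘ Equiv.swap (Sum.inl t) (Sum.inr 0)) := by
      funext w
      have := cr (ξ₁ (w (Sum.inr 1))) u (fun i => w (Sum.inl i)) (w (Sum.inr 0))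
      change F ![w (Sum.inr 0), w (Sum.inr 1)] * _ = _ at this
      simp only [hf, hF w]
      rw [mul_comm, this]
      congr 1
      refine Finset.sum_congr rfl fun t _ => ?_
      have e1 : (fun i => (w ∘ Equiv.swap (Sum.inl t) (Sum.inr 0)) (Sum.inr i))
          = ![w (Sum.inl t), w (Sum.inr 1)] := by
        ext i : 1
        fin_cases i
        · simp
        · simp [Equiv.swap_apply_of_ne_of_ne]
      have e2 : (fun i => (w ∘ Equiv.swap (Sum.inl t) (Sum.inr (0 : Fin 2))) (Sum.inl i))
          = Function.update (fun i => w (Sum.inl i)) t (w (Sum.inr 0)) := by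
        ext i : 1
        by_cases hi : i = t
        · subst hi; simp
        · simp [Function.update_of_ne hi, Equiv.swap_apply_of_ne_of_ne, hi]
      rw [e1, e2, mul_comm]
      rfl
    have e' : altSum f v = ∑ s, altSum (f₁ s) v - m * altSum f v := by
      conv_lhs => rw [e]
      rw [altSum_add, altSum_sum, altSum_sum]
      simp only [altSum_swap f v Sum.inl_ne_inr]
      simp [sub_eq_add_neg]
    linear_combination e'
  -- Cramer's rule again, with F(·, u s). The slot s, now occupied by w₀, returns the negative of
  -- the term itself, and the m slots of w return m more negatives: the factor is m + 2.
  have step2 : ∀ s, (m + 2 : ℝ) * altSum (f₁ s) v = (m + 2).factorial *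
      ∑ r ∈ Finset.univ.erase s, F ![u s, u r] *
        detSplit o h (Function.update (Function.update u s (v (Sum.inr 0))) r (v (Sum.inr 1)))
          (fun i => v (Sum.inl i)) := by
    intro s
    set f₂ := fun (r : Fin k) (w : Fin m ⊕ Fin 2 → ι → ℝ) =>
        detSplit o h (Function.update (Function.update u s (w (Sum.inr 0))) r (w (Sum.inr 1)))
          (fun i => w (Sum.inl i)) with hf₂
    have e : f₁ s = fun w => f₁ s (w ∘ Equiv.swap (Sum.inr 0) (Sum.inr 1))
        + ∑ r ∈ Finset.univ.erase s, F ![u s, u r] * f₂ r w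
        + ∑ t, f₁ s (w ∘ Equiv.swap (Sum.inl t) (Sum.inr 1)) := by
      funext w
      have := cr (ξ₁ (u s)) (Function.update u s (w (Sum.inr 0))) (fun i => w (Sum.inl i))
        (w (Sum.inr 1))
      change F ![w (Sum.inr 1), u s] * _ = _ at this
      rw [← Finset.add_sum_erase _ _ (Finset.mem_univ s)] at this
      simp only [hf₁]
      rw [hanti, neg_mul, this, neg_add, neg_add]
      congr 1
      · congr 1
        · change -(F ![Function.update u s _ s, u s] * _) = _
          rw [Function.update_self, Function.update_idem, hanti, neg_mul, neg_neg]
          simp [Equiv.swap_apply_of_ne_of_ne]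
        · rw [← Finset.sum_neg_distrib]
          refine Finset.sum_congr rfl fun r hr => ?_
          change -(F ![Function.update u s _ r, u s] * _) = _
          rw [Function.update_of_ne (Finset.ne_of_mem_erase hr), hanti, neg_mul, neg_neg]
      · rw [← Finset.sum_neg_distrib]
        refine Finset.sum_congr rfl fun t _ => ?_
        have e2 : (fun i => (w ∘ Equiv.swap (Sum.inl t) (Sum.inr (1 : Fin 2))) (Sum.inl i))
            = Function.update (fun i => w (Sum.inl i)) t (w (Sum.inr 1)) := by
          ext i : 1
          by_cases hi : i = t
          · subst hi; simp
          · simp [Function.update_of_ne hi, Equiv.swap_apply_of_ne_of_ne, hi]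
        rw [e2]
        change -(F ![w (Sum.inl t), u s] * _) = _
        rw [hanti, neg_mul, neg_neg]
        simp [Equiv.swap_apply_of_ne_of_ne]
    -- `f₂ r` is already alternating, so antisymmetrisation multiplies it by the number of
    -- permutations.
    have hf₂' : ∀ r ∈ Finset.univ.erase s, altSum (f₂ r) v = (m + 2).factorial * f₂ r v := by
      intro r hr
      have hrs := Finset.ne_of_mem_erase hr
      have : ∀ σ : Equiv.Perm (Fin m ⊕ Fin 2), f₂ r (v ∘ σ)
          = ((Equiv.Perm.sign σ : ℤ) : ℝ) * f₂ r v := by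
        intro σ
        -- The slots of the determinant that receive the arguments. A permutation of the arguments
        -- extends along `q` to one of all slots, with the same sign.
        let q : Fin m ⊕ Fin 2 → Fin k ⊕ Fin m :=
          Sum.elim Sum.inr ![Sum.inl s, Sum.inl r]
        have hq : Function.Injective q := by
          rintro (i | i) (j | j) hij
          · exact congrArg _ (Sum.inr_injective hij)
          · fin_cases j <;> simp [q] at hij
          · fin_cases i <;> simp [q] at hij
          · fin_cases i <;> fin_cases j <;> simp [q, hrs, Ne.symm hrs] at hij ⊢
        have hvec : ∀ w : Fin m ⊕ Fin 2 → ι → ℝ, f₂ r w = detAlt (splitEquiv o h)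
            (fun x => if hx : ∃ y, q y = x then w hx.choose else Sum.elim u 0 x) := by
          intro w
          simp only [hf₂, detSplit]
          congr 1
          have hqi : ∀ y, (if hx : ∃ y', q y' = q y then w hx.choose else Sum.elim u 0 (q y))
              = w y := by
            intro y
            have hx : ∃ y', q y' = q y := ⟨y, rfl⟩
            rw [dif_pos hx, hq hx.choose_spec]
          funext x
          rcases x with x | x
          · by_cases h1 : x = r
            · subst h1
              have := hqi (Sum.inr 1)
              simpa [q] using this.symm
            · by_cases h2 : x = s
              · subst h2
                have := hqi (Sum.inr 0)
                rw [Sum.elim_inl, Function.update_of_ne h1, Function.update_self]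
                simpa [q] using this.symm
              · have hx : ¬ ∃ y, q y = Sum.inl x := by
                  rintro ⟨y | y, hy⟩
                  · simp [q] at hy
                  · fin_cases y
                    · exact h2 (by simpa [q] using hy.symm)
                    · exact h1 (by simpa [q] using hy.symm)
                rw [dif_neg hx, Sum.elim_inl, Function.update_of_ne h1, Function.update_of_ne h2]
                rfl
          · exact (hqi (Sum.inl x)).symm
        rw [hvec, hvec]
        let σ' : Equiv.Perm (Fin k ⊕ Fin m) := σ.viaFintypeEmbedding ⟨q, hq⟩
        have hs : Equiv.Perm.sign σ' = Equiv.Perm.sign σ :=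
          Equiv.Perm.viaFintypeEmbedding_sign _ _
        have hcomp : (fun x => if hx : ∃ y, q y = x then (v ∘ σ) hx.choose else Sum.elim u 0 x)
            = (fun x => if hx : ∃ y, q y = x then v hx.choose else Sum.elim u 0 x) ∘ σ' := by
          funext x
          by_cases hx : ∃ y, q y = x
          · obtain ⟨y, rfl⟩ := hx
            have h1 : σ' (q y) = q (σ y) := σ.viaFintypeEmbedding_apply_image ⟨q, hq⟩ y
            have hx1 : ∃ y', q y' = q y := ⟨y, rfl⟩
            have hx2 : ∃ y', q y' = q (σ y) := ⟨σ y, rfl⟩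
            simp only [Function.comp_apply, h1]
            rw [dif_pos hx1, dif_pos hx2, hq hx1.choose_spec, hq hx2.choose_spec]
          · have h1 : σ' x = x := σ.viaFintypeEmbedding_apply_notMem_range ⟨q, hq⟩
              (fun ⟨y, hy⟩ => hx ⟨y, hy⟩)
            simp only [Function.comp_apply, h1]
            rw [dif_neg hx, dif_neg hx]
        rw [hcomp, AlternatingMap.map_perm, hs, Units.smul_def, zsmul_eq_mul]
      have hsq : ∀ σ : Equiv.Perm (Fin m ⊕ Fin 2),
          ((Equiv.Perm.sign σ : ℤ) : ℝ) * (((Equiv.Perm.sign σ : ℤ) : ℝ) * f₂ r v) = f₂ r v := by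
        intro σ
        rcases Int.units_eq_one_or (Equiv.Perm.sign σ) with h | h <;> simp [h]
      simp only [altSum, this, hsq]
      simp [Fintype.card_perm]
    have e' : altSum (f₁ s) v = -altSum (f₁ s) v
        + ∑ r ∈ Finset.univ.erase s, F ![u s, u r] * ((m + 2).factorial * f₂ r v)
        - m * altSum (f₁ s) v := by
      conv_lhs => rw [e]
      rw [altSum_add, altSum_add, altSum_sum, altSum_sum, altSum_swap (f₁ s) v (by simp)]
      simp only [altSum_swap (f₁ s) v Sum.inl_ne_inr, altSum_const_mul]
      rw [Finset.sum_congr rfl fun r hr => by rw [hf₂' r hr]]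
      simp [sub_eq_add_neg]
    rw [Finset.mul_sum]
    have e'' : ∑ r ∈ Finset.univ.erase s, F ![u s, u r] * ((m + 2).factorial * f₂ r v)
        = ∑ r ∈ Finset.univ.erase s, ((m + 2).factorial : ℝ) * (F ![u s, u r] * f₂ r v) :=
      Finset.sum_congr rfl fun _ _ => by ring
    rw [← e'']
    linear_combination e'
  rw [mul_right_comm, step1, Finset.sum_mul, Finset.mul_sum]
  refine Finset.sum_congr rfl fun s _ => ?_
  rw [← step2 s]; ring

end WedgeCalculus

end

/-! ### Equations with a Hodge star as divergences -/

noncomputable section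

section HodgeEquations

open Matrix

variable {ι : Type*} [Fintype ι] [DecidableEq ι]

/-- The position of an argument of `detSplit`. -/
def splitPos {D k m : ℕ} (h : k + m = D) (x : Fin k ⊕ Fin m) : Fin D := finCongr h (finSumFinEquiv x)

theorem splitPos_inl {D k m : ℕ} (h : k + m = D) (x : Fin k) :
    (splitPos h (Sum.inl x) : ℕ) = x := by simp [splitPos]

theorem splitPos_inr {D k m : ℕ} (h : k + m = D) (x : Fin m) :
    (splitPos h (Sum.inr x) : ℕ) = k + x := by simp [splitPos]

/-- Determinants whose arguments are split in different ways are compared as one list of D vectors,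
so only the sign of a permutation of positions matters. -/
theorem detSplit_perm {D k m k' m' : ℕ} (o : Fin D ≃ ι) (h : k + m = D) (h' : k' + m' = D)
    {u : Fin k → ι → ℝ} {w : Fin m → ι → ℝ} {u' : Fin k' → ι → ℝ} {w' : Fin m' → ι → ℝ}
    (π : Equiv.Perm (Fin D)) (q : Fin k ⊕ Fin m → Fin k' ⊕ Fin m')
    (hv : ∀ x, Sum.elim u w x = Sum.elim u' w' (q x))
    (hq : ∀ x, π (splitPos h x) = splitPos h' (q x)) :
    detSplit o h u w = ((Equiv.Perm.sign π : ℤ) : ℝ) * detSplit o h' u' w' := by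
  have key : ∀ (k m : ℕ) (h : k + m = D) (u : Fin k → ι → ℝ) (w : Fin m → ι → ℝ),
      detSplit o h u w = detAlt o.symm fun j => Sum.elim u w
        (finSumFinEquiv.symm (finCongr h.symm j)) := fun k m h u w => rfl
  rw [key k m h u w, key k' m' h' u' w', ← zsmul_eq_mul, ← Units.smul_def, ← AlternatingMap.map_perm]
  congr 1
  funext j
  obtain ⟨x, rfl⟩ : ∃ x, splitPos h x = j :=
    ⟨finSumFinEquiv.symm (finCongr h.symm j), by simp [splitPos]⟩
  simp only [Function.comp_apply, hq]
  have e : ∀ (k m : ℕ) (h : k + m = D) (x : Fin k ⊕ Fin m),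
      finSumFinEquiv.symm (finCongr h.symm (splitPos h x)) = x := fun k m h x => by
    simp [splitPos]
  rw [e, e, hv]

theorem detSplit_two {m : ℕ} {D : ℕ} (o : Fin D ≃ ι) (h1 : 1 + (m + 1) = D) (h2 : 2 + m = D)
    (e : ι → ℝ) (v : Fin (m + 1) → ι → ℝ) :
    detSplit o h2 ![v 0, e] (Fin.tail v) = -detSplit o h1 ![e] v := by
  have := detSplit_perm o h2 h1 (u := ![v 0, e]) (w := Fin.tail v) (u' := ![e]) (w' := v)
    (Equiv.swap ⟨0, by omega⟩ ⟨1, by omega⟩)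
    (Sum.elim ![Sum.inr 0, Sum.inl 0] fun t => Sum.inr t.succ) ?_ ?_
  · rw [this, Equiv.Perm.sign_swap (by simp)]; simp
  · rintro (x | x)
    · fin_cases x <;> rfl
    · rfl
  · rintro (x | x)
    · fin_cases x
      · have : splitPos h2 (Sum.inl 0) = ⟨0, by omega⟩ := Fin.ext (by simp [splitPos_inl])
        refine (congrArg _ this).trans (Fin.ext ?_)
        rw [Equiv.swap_apply_left]
        simp [splitPos_inr]
      · have : splitPos h2 (Sum.inl 1) = ⟨1, by omega⟩ := Fin.ext (by simp [splitPos_inl])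
        refine (congrArg _ this).trans (Fin.ext ?_)
        rw [Equiv.swap_apply_right]
        simp [splitPos_inl]
    · rw [Equiv.swap_apply_of_ne_of_ne]
      · refine Fin.ext ?_
        simp only [Sum.elim_inr, splitPos_inr, Fin.val_succ]
        omega
      · exact fun h => by have := congrArg Fin.val h; rw [splitPos_inr] at this; simp at this
      · exact fun h => by
          have := congrArg Fin.val h; rw [splitPos_inr] at this; simp at this; omega

/-- Moving the last of three vectors to the front is a three-cycle, hence even. -/
theorem detSplit_three {m : ℕ} {D : ℕ} (o : Fin D ≃ ι) (h1 : 1 + (m + 2) = D) (h3 : 3 + m = D)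
    (x y e : ι → ℝ) (w : Fin m → ι → ℝ) :
    detSplit o h3 ![x, y, e] w = detSplit o h1 ![e] (Fin.cons x (Fin.cons y w : Fin (m + 1) → ι → ℝ)) := by
  have p0 : (0 : ℕ) < D := by omega
  have p1 : (1 : ℕ) < D := by omega
  have p2 : (2 : ℕ) < D := by omega
  have := detSplit_perm o h3 h1 (u := ![x, y, e]) (w := w) (u' := ![e])
    (w' := Fin.cons x (Fin.cons y w : Fin (m + 1) → ι → ℝ))
    (Equiv.swap ⟨0, p0⟩ ⟨1, p1⟩ * Equiv.swap ⟨1, p1⟩ ⟨2, p2⟩)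
    (Sum.elim ![Sum.inr 0, Sum.inr 1, Sum.inl 0] fun t => Sum.inr t.succ.succ) ?_ ?_
  · rw [this, Equiv.Perm.sign_mul, Equiv.Perm.sign_swap (by simp), Equiv.Perm.sign_swap (by simp)]
    simp
  · rintro (x | x)
    · fin_cases x <;> rfl
    · rfl
  · rintro (x | x)
    · fin_cases x
      · have : splitPos h3 (Sum.inl 0) = ⟨0, p0⟩ := Fin.ext (by simp [splitPos_inl])
        refine (congrArg _ this).trans (Fin.ext ?_)
        have e0 : Equiv.swap (⟨1, p1⟩ : Fin D) ⟨2, p2⟩ ⟨0, p0⟩ = ⟨0, p0⟩ :=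
          Equiv.swap_apply_of_ne_of_ne (by simp) (by simp)
        rw [Equiv.Perm.mul_apply, e0, Equiv.swap_apply_left]
        simp [splitPos_inr]
      · have : splitPos h3 (Sum.inl 1) = ⟨1, p1⟩ := Fin.ext (by simp [splitPos_inl])
        refine (congrArg _ this).trans (Fin.ext ?_)
        rw [Equiv.Perm.mul_apply, Equiv.swap_apply_left,
          Equiv.swap_apply_of_ne_of_ne (by simp) (by simp)]
        simp [splitPos_inr]
      · have : splitPos h3 (Sum.inl 2) = ⟨2, p2⟩ := Fin.ext (by simp [splitPos_inl])
        refine (congrArg _ this).trans (Fin.ext ?_)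
        rw [Equiv.Perm.mul_apply, Equiv.swap_apply_right, Equiv.swap_apply_right]
        simp [splitPos_inl]
    · have hne : ∀ (i : ℕ) (hi : i < D), i < 3 → splitPos h3 (Sum.inr x) ≠ ⟨i, hi⟩ := by
        intro i hi h3' h
        have := congrArg Fin.val h; rw [splitPos_inr] at this; simp at this; omega
      rw [Equiv.Perm.mul_apply, Equiv.swap_apply_of_ne_of_ne (hne _ _ (by omega)) (hne _ _ (by omega)),
        Equiv.swap_apply_of_ne_of_ne (hne _ _ (by omega)) (hne _ _ (by omega))]
      refine Fin.ext ?_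
      simp only [Sum.elim_inr, splitPos_inr, Fin.val_succ]
      omega

/-- Moving the last two arguments to the front is the square of a cyclic rotation, hence even for
every m. -/
theorem detSplit_one_rotate {m : ℕ} {D : ℕ} (o : Fin D ≃ ι) (h1 : 1 + (m + 2) = D)
    (e : ι → ℝ) (v : Fin (m + 2) → ι → ℝ) :
    detSplit o h1 ![e] (Fin.cons (v (Fin.natAdd m 0)) (Fin.cons (v (Fin.natAdd m 1))
      (fun i => v (Fin.castAdd 2 i)) : Fin (m + 1) → ι → ℝ)) = detSplit o h1 ![e] v := by
  set ρ : Equiv.Perm (Fin (m + 2)) := (finRotate (m + 2))⁻¹ * (finRotate (m + 2))⁻¹ with hρ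
  have hv : (Fin.cons (v (Fin.natAdd m 0)) (Fin.cons (v (Fin.natAdd m 1))
      (fun i => v (Fin.castAdd 2 i)) : Fin (m + 1) → ι → ℝ)) = v ∘ ρ := by
    have h : ∀ i j, finRotate (m + 2) (finRotate (m + 2) j) = i → ρ i = j := by
      intro i j hij
      rw [hρ, Equiv.Perm.mul_apply, ← hij]
      exact (congrArg _ (Equiv.symm_apply_apply _ _)).trans (Equiv.symm_apply_apply _ _)
    have r : ∀ (j : Fin (m + 2)) (h : (j : ℕ) < m + 1), finRotate (m + 2) j = ⟨j + 1, by omega⟩ :=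
      fun j h => by rw [finRotate_of_lt h]
    have rl : finRotate (m + 2) (Fin.natAdd m 1) = 0 := by
      have : (Fin.natAdd m 1 : Fin (m + 2)) = Fin.last (m + 1) := Fin.ext (by simp)
      rw [this, finRotate_last]
    have r0 : finRotate (m + 2) 0 = 1 := by rw [r 0 (by simp)]; rfl
    have rm : finRotate (m + 2) (Fin.natAdd m 0) = Fin.natAdd m 1 := by
      rw [r _ (by simp)]; exact Fin.ext (by simp)
    funext i
    refine Fin.cases ?_ (fun i => Fin.cases ?_ (fun i => ?_) i) i
    · rw [Function.comp_apply, h 0 (Fin.natAdd m 0) (by rw [rm, rl])]; rfl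
    · rw [Function.comp_apply, h _ (Fin.natAdd m 1) (by rw [rl, r0]; rfl)]; rfl
    · rw [Function.comp_apply, h _ (Fin.castAdd 2 i) ?_]
      · rfl
      · have hr : finRotate (m + 2) (Fin.castAdd 2 i) = ⟨i + 1, by omega⟩ :=
          r _ (by simp)
        rw [hr]
        refine (r _ ?_).trans ?_
        · simp
        · exact Fin.ext (by simp)
  have e1 : ∀ v, detSplit o h1 ![e] v = fixLeft (detAlt (splitEquiv o h1)) ![e] v := fun _ => rfl
  rw [hv, e1, e1, AlternatingMap.map_perm]
  have : Equiv.Perm.sign ρ = 1 := by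
    rw [hρ, Equiv.Perm.sign_mul]
    rcases Int.units_eq_one_or (Equiv.Perm.sign (finRotate (m + 2))⁻¹) with h | h <;> simp [h]
  rw [this, one_smul]

theorem sum_fin_two {M : Type*} [AddCommMonoid M] (f : (Fin 2 → ι) → M) :
    ∑ I, f I = ∑ a, ∑ b, f ![a, b] := by
  rw [← Equiv.sum_comp (finTwoArrowEquiv ι).symm, Fintype.sum_prod_type]
  rfl

theorem sum_fin_three {M : Type*} [AddCommMonoid M] (f : (Fin 3 → ι) → M) :
    ∑ I, f I = ∑ a, ∑ b, ∑ c, f ![a, b, c] := by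
  rw [← Equiv.sum_comp (Fin.consEquiv fun _ => ι), Fintype.sum_prod_type]
  refine Finset.sum_congr rfl fun a _ => ?_
  rw [sum_fin_two fun I => f (Fin.consEquiv (fun _ => ι) (a, I))]
  rfl

theorem starCoeff_perm {k : ℕ} (g : Matrix ι ι ℝ) (α : DForm ι k) (I : Fin k → ι)
    (τ : Equiv.Perm (Fin k)) :
    starCoeff g α (I ∘ τ) = ((Equiv.Perm.sign τ : ℤ) : ℝ) * starCoeff g α I := by
  simp only [starCoeff]
  rw [← Equiv.sum_comp (Equiv.arrowCongr τ.symm (Equiv.refl ι))]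
  have h : ∀ J : Fin k → ι, (∏ s, g⁻¹ ((I ∘ τ) s) (Equiv.arrowCongr τ.symm (Equiv.refl ι) J s)) *
      α (fun s => cvec (Equiv.arrowCongr τ.symm (Equiv.refl ι) J s))
      = ((Equiv.Perm.sign τ : ℤ) : ℝ) * ((∏ s, g⁻¹ (I s) (J s)) * α fun s => cvec (J s)) := by
    intro J
    have h1 : ∏ s, g⁻¹ ((I ∘ τ) s) (Equiv.arrowCongr τ.symm (Equiv.refl ι) J s)
        = ∏ s, g⁻¹ (I s) (J s) := by
      rw [← Equiv.prod_comp τ fun s => g⁻¹ (I s) (J s)]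
      rfl
    have h2 := α.toAlternatingMap.map_perm (fun s => cvec (J s)) τ
    rw [Units.smul_def, zsmul_eq_mul] at h2
    rw [h1]
    change _ * α.toAlternatingMap ((fun s => cvec (J s)) ∘ τ) = _
    rw [h2]
    change _ * (_ * α _) = _
    ring
  simp only [h, ← Finset.mul_sum]
  ring

/-- A three-form is coclosed with weight if the weighted divergence of its components vanishes. -/
theorem extDeriv_sum_starBasis_three {D m : ℕ} (o : Fin D ≃ ι) (h : 3 + m = D)
    {w : (Fin 3 → ι) → (ι → ℝ) → ℝ} {p : ι → ℝ} (hw : ∀ I, DifferentiableAt ℝ (w I) p)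
    (h1 : ∀ a b c, w ![b, a, c] = -w ![a, b, c]) (h2 : ∀ a b c, w ![a, c, b] = -w ![a, b, c])
    (hdiv : ∀ b c, ∑ a, pd a (w ![a, b, c]) p = 0) :
    extDeriv (fun p => ∑ I, w I p • starBasis o h I) p = 0 := by
  have pdn : ∀ (f : (ι → ℝ) → ℝ) i, pd i (-f) p = -pd i f p := fun f i => by
    simp [pd, fderiv_neg]
  ext v
  rw [extDeriv_sum_starBasis o h hw, sum_fin_three]
  -- Antisymmetry carries the vanishing divergence from the first slot to the other two.
  have hdiv1 : ∀ a c, ∑ b, pd b (w ![a, b, c]) p = 0 := by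
    intro a c
    have := hdiv a c
    simp only [h1 a _ c, pdn, Finset.sum_neg_distrib, neg_eq_zero] at this
    exact this
  have hdiv2 : ∀ a b, ∑ c, pd c (w ![a, b, c]) p = 0 := by
    intro a b
    have := hdiv1 a b
    simp only [h2 a b _, pdn, Finset.sum_neg_distrib, neg_eq_zero] at this
    exact this
  have u : ∀ a b c : ι, (fun s => cvec (![a, b, c] s) : Fin 3 → ι → ℝ) = ![cvec a, cvec b, cvec c] :=
    fun a b c => by ext s : 1; fin_cases s <;> rfl
  have u0 : ∀ (a b c x : ι → ℝ), Function.update ![a, b, c] 0 x = ![x, b, c] := fun a b c x => by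
    ext s : 1; fin_cases s <;> simp
  have u1 : ∀ (a b c x : ι → ℝ), Function.update ![a, b, c] 1 x = ![a, x, c] := fun a b c x => by
    ext s : 1; fin_cases s <;> simp
  have u2 : ∀ (a b c x : ι → ℝ), Function.update ![a, b, c] 2 x = ![a, b, x] := fun a b c x => by
    ext s : 1; fin_cases s <;> simp
  simp only [Fin.sum_univ_three, u, u0, u1, u2, Finset.sum_add_distrib]
  have e0 : ∑ a, ∑ b, ∑ c, pd (![a, b, c] 0) (w ![a, b, c]) p *
      detSplit o h ![v 0, cvec b, cvec c] (Fin.tail v) = 0 := by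
    rw [Finset.sum_comm]
    refine Finset.sum_eq_zero fun b _ => ?_
    rw [Finset.sum_comm]
    refine Finset.sum_eq_zero fun c _ => ?_
    rw [← Finset.sum_mul]
    exact mul_eq_zero_of_left (hdiv b c) _
  have e1 : ∑ a, ∑ b, ∑ c, pd (![a, b, c] 1) (w ![a, b, c]) p *
      detSplit o h ![cvec a, v 0, cvec c] (Fin.tail v) = 0 := by
    refine Finset.sum_eq_zero fun a _ => ?_
    rw [Finset.sum_comm]
    refine Finset.sum_eq_zero fun c _ => ?_
    rw [← Finset.sum_mul]
    exact mul_eq_zero_of_left (hdiv1 a c) _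
  have e2 : ∑ a, ∑ b, ∑ c, pd (![a, b, c] 2) (w ![a, b, c]) p *
      detSplit o h ![cvec a, cvec b, v 0] (Fin.tail v) = 0 := by
    refine Finset.sum_eq_zero fun a _ => Finset.sum_eq_zero fun b _ => ?_
    rw [← Finset.sum_mul]
    exact mul_eq_zero_of_left (hdiv2 a b) _
  rw [e0, e1, e2]; simp

/-- The factor 2 is the 2! of the two-form; the factorials of m cancel between `wedge_eq_altSum` and
`altSum_detSplit`. -/
theorem wedge_sum_starBasis {D m k : ℕ} (o : Fin D ≃ ι) (h : k + m = D) (w : (Fin k → ι) → ℝ)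
    (F : DForm ι 2) (v : Fin (m + 2) → ι → ℝ) :
    2 * wedge (∑ I, w I • starBasis o h I) F v = ∑ I, w I * ∑ s, ∑ r ∈ Finset.univ.erase s,
      F ![cvec (I s), cvec (I r)] * detSplit o h (Function.update (Function.update
        (fun s => cvec (I s)) s (v (Fin.natAdd m 0))) r (v (Fin.natAdd m 1)))
          (fun i => v (Fin.castAdd 2 i)) := by
  have h1 := wedge_eq_altSum (∑ I, w I • starBasis o h I) F v
  have h2 : altSum (fun x : Fin m ⊕ Fin 2 → ι → ℝ => (∑ I, w I • starBasis o h I)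
      (fun i => x (Sum.inl i)) * F fun i => x (Sum.inr i)) (v ∘ finSumFinEquiv)
      = ∑ I, w I * altSum (fun x : Fin m ⊕ Fin 2 → ι → ℝ => detSplit o h (fun s => cvec (I s))
        (fun i => x (Sum.inl i)) * F fun i => x (Sum.inr i)) (v ∘ finSumFinEquiv) := by
    simp only [← altSum_const_mul, ← altSum_sum]
    congr 1
    funext x
    simp only [ContinuousAlternatingMap.sum_apply, ContinuousAlternatingMap.smul_apply,
      smul_eq_mul, starBasis_apply, Finset.sum_mul, mul_assoc]
  rw [h2] at h1
  have hm : ((m + 1 : ℝ) * (m + 2)) ≠ 0 := by positivity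
  have hf : (m.factorial : ℝ) ≠ 0 := by positivity
  have hfac : ((m + 2).factorial : ℝ) = (m + 2) * ((m + 1) * m.factorial) := by
    rw [Nat.factorial_succ, Nat.factorial_succ]; push_cast; ring
  have h3 := fun I : Fin k → ι => altSum_detSplit o h (fun s => cvec (I s)) F (v ∘ finSumFinEquiv)
  refine mul_left_cancel₀ (mul_ne_zero hm hf) ?_
  have h4 : (m + 1 : ℝ) * (m + 2) * m.factorial * (2 * wedge (∑ I, w I • starBasis o h I) F v)
      = ∑ I, w I * ((m + 1 : ℝ) * (m + 2) * altSum (fun x : Fin m ⊕ Fin 2 → ι → ℝ =>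
        detSplit o h (fun s => cvec (I s)) (fun i => x (Sum.inl i)) * F fun i => x (Sum.inr i))
          (v ∘ finSumFinEquiv)) := by
    have : ∀ I : Fin k → ι, ∀ y : ℝ, w I * ((m + 1 : ℝ) * (m + 2) * y)
        = (m + 1 : ℝ) * (m + 2) * (w I * y) := fun _ _ => by ring
    simp only [this, ← Finset.mul_sum, ← h1]
    rw [Nat.factorial_two]; push_cast; ring
  rw [h4, Finset.mul_sum]
  refine Finset.sum_congr rfl fun I _ => ?_
  rw [h3, hfac]
  have e : ∀ i, (v ∘ finSumFinEquiv) (Sum.inl i) = v (Fin.castAdd 2 i) := fun i => by simp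
  have e' : ∀ i, (v ∘ finSumFinEquiv) (Sum.inr i) = v (Fin.natAdd m i) := fun i => by simp
  simp only [e, e']
  ring

/-- The coordinate form of `d(ρ ⋆F) = ρ ⋆H ∧ F`. -/
theorem extDeriv_sum_starBasis_two {D m : ℕ} (o : Fin D ≃ ι) (h2 : 2 + (m + 1) = D)
    (h3 : 3 + m = D) {w : (Fin 2 → ι) → (ι → ℝ) → ℝ} {p : ι → ℝ}
    (hw : ∀ I, DifferentiableAt ℝ (w I) p) (hs : ∀ a b, w ![b, a] = -w ![a, b])
    {w' : (Fin 3 → ι) → ℝ}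
    (h1' : ∀ a b c, w' ![b, a, c] = -w' ![a, b, c]) (h2' : ∀ a b c, w' ![a, c, b] = -w' ![a, b, c])
    (F : DForm ι 2)
    (heq : ∀ c, 2 * ∑ a, pd a (w ![a, c]) p
      = -(3 * ∑ a, ∑ b, w' ![a, b, c] * F ![cvec a, cvec b])) :
    extDeriv (fun p => ∑ I, w I p • starBasis o h2 I) p
      = wedge (∑ I, w' I • starBasis o h3 I) F := by
  have pdn : ∀ (f : (ι → ℝ) → ℝ) i, pd i (-f) p = -pd i f p := fun f i => by
    simp [pd, fderiv_neg]
  have hD1 : 1 + (m + 2) = D := by omega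
  ext v
  have hF : ∀ a b : ι → ℝ, F ![b, a] = -F ![a, b] := by
    intro x y
    have := F.toAlternatingMap.map_swap ![x, y] (i := 0) (j := 1) (by simp)
    have e : ![x, y] ∘ Equiv.swap (0 : Fin 2) 1 = ![y, x] := by
      ext i : 1; fin_cases i <;> rfl
    rw [e] at this
    exact this
  -- By antisymmetry both slots contribute equally; the minus sign is that of `detSplit_two`.
  have L : extDeriv (fun p => ∑ I, w I p • starBasis o h2 I) p v
      = -∑ c, (2 * ∑ a, pd a (w ![a, c]) p) * detSplit o hD1 ![cvec c] v := by
    rw [extDeriv_sum_starBasis o h2 hw, sum_fin_two]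
    have u : ∀ a b : ι, (fun s => cvec (![a, b] s) : Fin 2 → ι → ℝ) = ![cvec a, cvec b] :=
      fun a b => by ext s : 1; fin_cases s <;> rfl
    have u0 : ∀ (a b x : ι → ℝ), Function.update ![a, b] 0 x = ![x, b] := fun a b x => by
      ext s : 1; fin_cases s <;> simp
    have u1 : ∀ (a b x : ι → ℝ), Function.update ![a, b] 1 x = ![a, x] := fun a b x => by
      ext s : 1; fin_cases s <;> simp
    simp only [Fin.sum_univ_two, u, u0, u1, Finset.sum_add_distrib]
    have sw : ∀ x y : ι → ℝ, ∀ z, detSplit o h2 ![y, x] z = -detSplit o h2 ![x, y] z := by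
      intro x y z
      have := (detAlt (splitEquiv o h2)).map_swap (Sum.elim ![x, y] z)
        (i := Sum.inl 0) (j := Sum.inl 1) (by simp)
      have e : Sum.elim ![x, y] z ∘ Equiv.swap (Sum.inl (0 : Fin 2)) (Sum.inl 1)
          = Sum.elim ![y, x] z := by
        ext i : 1
        rcases i with i | i
        · fin_cases i <;> simp
        · simp [Equiv.swap_apply_of_ne_of_ne]
      rw [e] at this
      exact this
    have e1 : ∑ a, ∑ b, pd (![a, b] 1) (w ![a, b]) p * detSplit o h2 ![cvec a, v 0] (Fin.tail v)
        = ∑ a, ∑ b, pd (![a, b] 0) (w ![a, b]) p * detSplit o h2 ![v 0, cvec b] (Fin.tail v) := by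
      rw [Finset.sum_comm]
      refine Finset.sum_congr rfl fun a _ => Finset.sum_congr rfl fun b _ => ?_
      change pd a (w ![b, a]) p * _ = pd a (w ![a, b]) p * _
      rw [hs a b, pdn, sw (v 0)]; ring
    rw [e1, ← two_mul, Finset.sum_comm, Finset.mul_sum, ← Finset.sum_neg_distrib]
    refine Finset.sum_congr rfl fun c _ => ?_
    rw [← Finset.sum_mul, detSplit_two o hD1 h2]
    change 2 * ((∑ a, pd a (w ![a, c]) p) * _) = _
    ring
  -- Of the six ordered pairs of slots two leave a given slot free, and by antisymmetry the three
  -- choices of the free slot agree: together the factor 6.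
  have Rr : 2 * wedge (∑ I, w' I • starBasis o h3 I) F v
      = ∑ c, (6 * ∑ a, ∑ b, w' ![a, b, c] * F ![cvec a, cvec b])
        * detSplit o hD1 ![cvec c] v := by
    rw [wedge_sum_starBasis, sum_fin_three]
    set x := v (Fin.natAdd m (0 : Fin 2))
    set y := v (Fin.natAdd m (1 : Fin 2))
    set z : Fin m → ι → ℝ := fun i => v (Fin.castAdd 2 i)
    have hdet : ∀ c, detSplit o hD1 ![cvec c] v = detSplit o h3 ![x, y, cvec c] z := by
      intro c
      rw [detSplit_three o hD1 h3, detSplit_one_rotate]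
    have u : ∀ a b c : ι, (fun s => cvec (![a, b, c] s) : Fin 3 → ι → ℝ)
        = ![cvec a, cvec b, cvec c] :=
      fun a b c => by ext s : 1; fin_cases s <;> rfl
    have u0 : ∀ (a b c x : ι → ℝ), Function.update ![a, b, c] 0 x = ![x, b, c] := fun a b c x => by
      ext s : 1; fin_cases s <;> simp
    have u1 : ∀ (a b c x : ι → ℝ), Function.update ![a, b, c] 1 x = ![a, x, c] := fun a b c x => by
      ext s : 1; fin_cases s <;> simp
    have u2 : ∀ (a b c x : ι → ℝ), Function.update ![a, b, c] 2 x = ![a, b, x] := fun a b c x => by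
      ext s : 1; fin_cases s <;> simp
    have sw01 : ∀ a b c : ι → ℝ, detSplit o h3 ![b, a, c] z = -detSplit o h3 ![a, b, c] z := by
      intro a b c
      have := (detAlt (splitEquiv o h3)).map_swap (Sum.elim ![a, b, c] z)
        (i := Sum.inl 0) (j := Sum.inl 1) (by simp)
      have e : Sum.elim ![a, b, c] z ∘ Equiv.swap (Sum.inl (0 : Fin 3)) (Sum.inl 1)
          = Sum.elim ![b, a, c] z := by
        ext i : 1
        rcases i with i | i
        · fin_cases i <;> simp [Equiv.swap_apply_of_ne_of_ne]
        · simp [Equiv.swap_apply_of_ne_of_ne]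
      rw [e] at this
      exact this
    have sw12 : ∀ a b c : ι → ℝ, detSplit o h3 ![a, c, b] z = -detSplit o h3 ![a, b, c] z := by
      intro a b c
      have := (detAlt (splitEquiv o h3)).map_swap (Sum.elim ![a, b, c] z)
        (i := Sum.inl 1) (j := Sum.inl 2) (by simp)
      have e : Sum.elim ![a, b, c] z ∘ Equiv.swap (Sum.inl (1 : Fin 3)) (Sum.inl 2)
          = Sum.elim ![a, c, b] z := by
        ext i : 1
        rcases i with i | i
        · fin_cases i <;> simp [Equiv.swap_apply_of_ne_of_ne]
        · simp [Equiv.swap_apply_of_ne_of_ne]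
      rw [e] at this
      exact this
    have er : ∀ f : Fin 3 → Fin 3 → ℝ, ∑ s, ∑ r ∈ Finset.univ.erase s, f s r
        = f 0 1 + f 0 2 + f 1 0 + f 1 2 + f 2 0 + f 2 1 := by
      intro f
      have e0 : (Finset.univ.erase 0 : Finset (Fin 3)) = {1, 2} := by decide
      have e1 : (Finset.univ.erase 1 : Finset (Fin 3)) = {0, 2} := by decide
      have e2 : (Finset.univ.erase 2 : Finset (Fin 3)) = {0, 1} := by decide
      rw [Fin.sum_univ_three, e0, e1, e2, Finset.sum_pair (by decide), Finset.sum_pair (by decide),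
        Finset.sum_pair (by decide)]
      ring
    set T := ∑ a, ∑ b, ∑ c, w' ![a, b, c] * (F ![cvec a, cvec b]
      * detSplit o h3 ![x, y, cvec c] z) with hT
    have i1 : ∀ a b c : ι, w' ![a, b, c] * ∑ s, ∑ r ∈ Finset.univ.erase s,
        F ![cvec (![a, b, c] s), cvec (![a, b, c] r)] * detSplit o h3 (Function.update
          (Function.update ![cvec a, cvec b, cvec c] s x) r y) z
        = 2 * (w' ![a, b, c] * (F ![cvec a, cvec b] * detSplit o h3 ![x, y, cvec c] z))
          + 2 * (w' ![a, c, b] * (F ![cvec a, cvec c] * detSplit o h3 ![x, y, cvec b] z))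
          + 2 * (w' ![b, c, a] * (F ![cvec b, cvec c] * detSplit o h3 ![x, y, cvec a] z)) := by
      intro a b c
      rw [er]
      simp only [Matrix.cons_val_zero, Matrix.cons_val_one, Matrix.cons_val_two, Matrix.cons_val,
        Matrix.head_cons, Matrix.tail_cons, u0, u1, u2]
      rw [sw01 x y, sw12 x y (cvec b), sw12 y x (cvec b), sw01 x y (cvec b), sw01 x (cvec a) y,
        sw12 x y (cvec a), sw01 y (cvec a) x, sw12 y x (cvec a), sw01 x y (cvec a),
        hF (cvec a) (cvec b), hF (cvec a) (cvec c), hF (cvec b) (cvec c)]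
      have w1 := h2' a b c
      have w2 := h2' b a c
      have w3 := h1' a b c
      rw [w1, w2, w3]
      ring
    simp only [u, i1, Finset.sum_add_distrib, ← Finset.mul_sum]
    have t1 : ∑ a, ∑ b, ∑ c, w' ![a, c, b] * (F ![cvec a, cvec c]
        * detSplit o h3 ![x, y, cvec b] z) = T :=
      Finset.sum_congr rfl fun a _ => Finset.sum_comm
    have t2 : ∑ a, ∑ b, ∑ c, w' ![b, c, a] * (F ![cvec b, cvec c]
        * detSplit o h3 ![x, y, cvec a] z) = T := by
      rw [Finset.sum_comm]
      exact Finset.sum_congr rfl fun a _ => Finset.sum_comm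
    rw [t1, t2, ← hT]
    have t3 : T = ∑ c, (∑ a, ∑ b, w' ![a, b, c] * F ![cvec a, cvec b])
        * detSplit o hD1 ![cvec c] v := by
      rw [hT, Finset.sum_congr rfl fun a _ => Finset.sum_comm, Finset.sum_comm]
      refine Finset.sum_congr rfl fun c _ => ?_
      simp only [hdet, Finset.sum_mul, mul_assoc]
    have t4 : ∑ c, 6 * (∑ a, ∑ b, w' ![a, b, c] * F ![cvec a, cvec b])
        * detSplit o hD1 ![cvec c] v = 6 * T := by
      rw [t3, Finset.mul_sum]
      exact Finset.sum_congr rfl fun _ _ => by ring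
    rw [t4]; ring
  have hc : ∀ c, 6 * ∑ a, ∑ b, w' ![a, b, c] * F ![cvec a, cvec b]
      = -2 * (2 * ∑ a, pd a (w ![a, c]) p) := fun c => by rw [heq c]; ring
  simp only [hc] at Rr
  rw [L]
  have : ∑ c, -2 * (2 * ∑ a, pd a (w ![a, c]) p) * detSplit o hD1 ![cvec c] v
      = 2 * -∑ c, (2 * ∑ a, pd a (w ![a, c]) p) * detSplit o hD1 ![cvec c] v := by
    rw [mul_neg, Finset.mul_sum, ← Finset.sum_neg_distrib]
    exact Finset.sum_congr rfl fun _ _ => by ring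
  rw [this] at Rr
  exact (mul_left_cancel₀ two_ne_zero Rr).symm

end HodgeEquations

end

/-! ### Jacobi's formula and weighted divergences in a frame -/

noncomputable section

section WeightedDivergence

open Matrix

variable {R : Type*} [CommRing R] [Algebra ℝ R] {ι : Type*} [Fintype ι] [DecidableEq ι]

theorem Derivation.leibniz_finset_prod {κ : Type*} [DecidableEq κ] (d : Derivation ℝ R R)
    (s : Finset κ) (f : κ → R) :
    d (∏ i ∈ s, f i) = ∑ i ∈ s, d (f i) * ∏ j ∈ s.erase i, f j := by
  induction s using Finset.induction_on with
  | empty => simp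
  | insert a s ha ih =>
    rw [Finset.prod_insert ha, Derivation.leibniz, ih, Finset.sum_insert ha,
      Finset.erase_insert ha, smul_eq_mul, smul_eq_mul, Finset.mul_sum, add_comm, mul_comm (∏ _ ∈ _, _)]
    congr 1
    refine Finset.sum_congr rfl fun i hi => ?_
    have hai : a ≠ i := fun h => ha (h ▸ hi)
    rw [Finset.erase_insert_of_ne hai, Finset.prod_insert (fun h => ha (Finset.mem_of_mem_erase h))]
    ring

/-- Jacobi's formula. -/
theorem Derivation.map_det (d : Derivation ℝ R R) (M : Matrix ι ι R) :
    d M.det = (M.adjugate * M.map d).trace := by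
  have h1 : ∀ i, (M.adjugate * M.map d) i i = (M.updateCol i fun k => d (M k i)).det := by
    intro i
    rw [← Matrix.cramer_apply, Matrix.cramer_eq_adjugate_mulVec]
    rfl
  simp only [Matrix.trace, diag_apply, h1, Matrix.det_apply]
  rw [map_sum, Finset.sum_comm]
  refine Finset.sum_congr rfl fun σ _ => ?_
  rw [← Finset.smul_sum]
  have h2 : ∀ x : R, d (Equiv.Perm.sign σ • x) = Equiv.Perm.sign σ • d x := fun x => by
    rw [Units.smul_def, Units.smul_def, map_zsmul]
  rw [h2, Derivation.leibniz_finset_prod]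
  congr 1
  refine Finset.sum_congr rfl fun i _ => ?_
  rw [← Finset.mul_prod_erase _ _ (Finset.mem_univ i), Matrix.updateCol_self]
  congr 1
  refine Finset.prod_congr rfl fun j hj => ?_
  rw [Matrix.updateCol_ne (Finset.ne_of_mem_erase hj)]

theorem Derivation.map_det_of_inv (d : Derivation ℝ R R) {M N : Matrix ι ι R} (h : N * M = 1) :
    d M.det = M.det * (N * M.map d).trace := by
  have : M.adjugate = M.det • N := by
    calc M.adjugate = M.adjugate * (M * N) := by rw [mul_eq_one_comm.mp h, Matrix.mul_one]
      _ = M.det • N := by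
        rw [← Matrix.mul_assoc, Matrix.adjugate_mul, Matrix.smul_mul, Matrix.one_mul]
  rw [Derivation.map_det, this, Matrix.smul_mul, Matrix.trace_smul, smul_eq_mul]

/-- The logarithmic derivative of the density `e^φ √(det g)`. -/
def logDensity (D : ι → Derivation ℝ R R) (g gi : Matrix ι ι R) (f : R) (i : ι) : R :=
  half R * (gi * g.map (D i)).trace + D i f

variable (D : ι → Derivation ℝ R R) {T E : Matrix ι ι R}

/-- Differentiating T = E⁻¹ brings in ∂E, and closedness exchanges the summed derivative index with
the one contracted with the frame vector. -/
theorem sum_D_frame (hET : E * T = 1) (hE : ∀ i j a, D i (E a j) = D j (E a i)) (b : ι) :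
    ∑ i, D i (T i b) = -(T * E.map (frameDer D T b)).trace := by
  have hTE := mul_eq_one_comm.mp hET
  have h1 : ∀ i, D i (T i b) = -∑ c, T i c * ∑ j, T j b * D j (E c i) := by
    intro i
    have := congrFun (congrFun (Matrix.map_derivation_inv (D i) hTE) i) b
    rw [map_apply, Matrix.neg_apply, Matrix.mul_assoc, mul_apply] at this
    rw [this]
    congr 1
    refine Finset.sum_congr rfl fun c _ => ?_
    rw [mul_apply]
    congr 1
    exact Finset.sum_congr rfl fun j _ => by rw [map_apply, hE i j]; ring
  simp only [h1, Finset.sum_neg_distrib, Matrix.trace, diag_apply, mul_apply, map_apply,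
    frameDer_apply]

/-- The weighted divergence in a frame. -/
theorem weighted_divergence (hET : E * T = 1) (hE : ∀ i j a, D i (E a j) = D j (E a i))
    {g gi G Gi : Matrix ι ι R} (hg : g = Eᵀ * G * E) (hgi : gi = T * Gi * Tᵀ)
    (hGi : Gi * G = 1) (hG : Gᵀ = G) (f : R) {δ : ι → R}
    (hδ : ∀ b, half R * (Gi * G.map (frameDer D T b)).trace + frameDer D T b f = δ b) (y : ι → R) :
    ∑ i, (D i (∑ b, T i b * y b) + logDensity D g gi f i * ∑ b, T i b * y b)
      = ∑ b, (frameDer D T b (y b) + δ b * y b) := by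
  have hTE := mul_eq_one_comm.mp hET
  have hGi' : G * Gi = 1 := mul_eq_one_comm.mp hGi
  have hGiT : Giᵀ = Gi := by
    have h1 : Giᵀ * G = 1 := by
      have := congrArg Matrix.transpose hGi'
      rwa [Matrix.transpose_mul, hG, Matrix.transpose_one] at this
    calc Giᵀ = Giᵀ * (G * Gi) := by rw [hGi', Matrix.mul_one]
      _ = Gi := by rw [← Matrix.mul_assoc, h1, Matrix.one_mul]
  have hTE' : Tᵀ * Eᵀ = 1 := by rw [← Matrix.transpose_mul, hET, Matrix.transpose_one]
  -- The derivative of log det g = log det G + 2 log det E.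
  have tr1 : ∀ d : Derivation ℝ R R, (gi * g.map d).trace
      = (Gi * G.map d).trace + 2 * (T * E.map d).trace := by
    intro d
    have e1 : (T * Gi * Tᵀ * ((E.map d)ᵀ * G * E)).trace = (T * E.map d).trace := by
      calc (T * Gi * Tᵀ * ((E.map d)ᵀ * G * E)).trace
          = (T * (Gi * Tᵀ * (E.map d)ᵀ * G * E)).trace := by congr 1; noncomm_ring
        _ = (Gi * Tᵀ * (E.map d)ᵀ * G * (E * T)).trace := by
            rw [Matrix.trace_mul_comm]; congr 1; noncomm_ring
        _ = (Gi * (Tᵀ * (E.map d)ᵀ * G)).trace := by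
            rw [hET, Matrix.mul_one]; congr 1; noncomm_ring
        _ = (Tᵀ * (E.map d)ᵀ * (G * Gi)).trace := by
            rw [Matrix.trace_mul_comm]; congr 1; noncomm_ring
        _ = _ := by
            rw [hGi', Matrix.mul_one, ← Matrix.transpose_mul, Matrix.trace_transpose,
              Matrix.trace_mul_comm]
    have e2 : (T * Gi * Tᵀ * (Eᵀ * G.map d * E)).trace = (Gi * G.map d).trace := by
      calc (T * Gi * Tᵀ * (Eᵀ * G.map d * E)).trace
          = (T * (Gi * (Tᵀ * Eᵀ) * G.map d * E)).trace := by congr 1; noncomm_ring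
        _ = (Gi * (Tᵀ * Eᵀ) * G.map d * (E * T)).trace := by
            rw [Matrix.trace_mul_comm]; congr 1; noncomm_ring
        _ = _ := by rw [hTE', hET, Matrix.mul_one, Matrix.mul_one]
    have e3 : (T * Gi * Tᵀ * (Eᵀ * G * E.map d)).trace = (T * E.map d).trace := by
      calc (T * Gi * Tᵀ * (Eᵀ * G * E.map d)).trace
          = (T * (Gi * (Tᵀ * Eᵀ) * G) * E.map d).trace := by congr 1; noncomm_ring
        _ = _ := by rw [hTE', Matrix.mul_one, hGi, Matrix.mul_one]
    rw [hg, hgi, Matrix.map_derivation_mul, Matrix.map_derivation_mul, Matrix.transpose_map,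
      Matrix.add_mul, Matrix.mul_add, Matrix.mul_add, Matrix.trace_add, Matrix.trace_add,
      e1, e2, e3]
    ring
  -- The volume factor of E in the density cancels the divergence of the frame fields from
  -- `sum_D_frame`.
  have fr : ∀ b, ∑ i, T i b * logDensity D g gi f i
      = δ b + (T * E.map (frameDer D T b)).trace := by
    intro b
    have h1 : ∑ i, T i b * logDensity D g gi f i
        = half R * (gi * g.map (frameDer D T b)).trace + frameDer D T b f := by
      simp only [logDensity, mul_add, Finset.sum_add_distrib, frameDer_apply]
      congr 1
      have : (gi * g.map (frameDer D T b)).trace = ∑ i, T i b * (gi * g.map (D i)).trace := by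
        simp only [Matrix.trace, diag_apply, mul_apply, map_apply, frameDer_apply, Finset.mul_sum]
        rw [Finset.sum_congr rfl fun x _ => Finset.sum_comm, Finset.sum_comm]
        exact Finset.sum_congr rfl fun _ _ => Finset.sum_congr rfl fun _ _ =>
          Finset.sum_congr rfl fun _ _ => by ring
      rw [this, Finset.mul_sum]
      exact Finset.sum_congr rfl fun _ _ => by ring
    rw [h1, tr1, ← hδ]
    linear_combination (T * E.map (frameDer D T b)).trace * two_mul_half R
  have e1 : ∀ i, D i (∑ b, T i b * y b) + logDensity D g gi f i * ∑ b, T i b * y b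
      = ∑ b, (T i b * D i (y b) + D i (T i b) * y b + T i b * logDensity D g gi f i * y b) := by
    intro i
    rw [map_sum, Finset.mul_sum, ← Finset.sum_add_distrib]
    refine Finset.sum_congr rfl fun b _ => ?_
    rw [Derivation.leibniz, smul_eq_mul, smul_eq_mul]; ring
  simp only [e1]
  rw [Finset.sum_comm]
  refine Finset.sum_congr rfl fun b _ => ?_
  rw [Finset.sum_add_distrib, Finset.sum_add_distrib, ← Finset.sum_mul, ← Finset.sum_mul, fr,
    sum_D_frame D hET hE, ← frameDer_apply]
  ring

/-- Fully raised components of a three-form. -/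
def raise₃ (gi : Matrix ι ι R) (H : ι → Matrix ι ι R) (a : ι) : Matrix ι ι R :=
  ∑ a', gi a a' • (gi * H a' * giᵀ)

theorem raise₃_frame (hET : E * T = 1) {gi Gi : Matrix ι ι R} (hgi : gi = T * Gi * Tᵀ)
    (hGiT : Giᵀ = Gi) {H H' : ι → Matrix ι ι R} (hH : ∀ i, H i = ∑ a, E a i • (Eᵀ * H' a * E))
    (a : ι) : raise₃ gi H a = ∑ e, T a e • ∑ d, Gi e d • (T * (Gi * H' d * Gi) * Tᵀ) := by
  have hTE' : Tᵀ * Eᵀ = 1 := by rw [← Matrix.transpose_mul, hET, Matrix.transpose_one]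
  have h1 : ∀ d, gi * (Eᵀ * H' d * E) * giᵀ = T * (Gi * H' d * Gi) * Tᵀ := by
    intro d
    rw [hgi]
    simp only [Matrix.transpose_mul, Matrix.transpose_transpose, hGiT]
    calc _ = T * Gi * (Tᵀ * Eᵀ) * H' d * (E * T) * Gi * Tᵀ := by noncomm_ring
      _ = _ := by rw [hTE', hET]; noncomm_ring
  have h2 : ∀ d, ∑ a', gi a a' * E d a' = ∑ e, T a e * Gi e d := by
    intro d
    calc ∑ a', gi a a' * E d a' = (gi * Eᵀ) a d := by simp [mul_apply]
      _ = (T * Gi) a d := by rw [hgi, Matrix.mul_assoc, hTE', Matrix.mul_one]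
      _ = _ := mul_apply
  simp only [raise₃, hH, Matrix.mul_sum, Matrix.sum_mul, Matrix.mul_smul, Matrix.smul_mul, h1,
    Finset.smul_sum, smul_smul]
  rw [Finset.sum_comm]
  conv_rhs => rw [Finset.sum_comm]
  refine Finset.sum_congr rfl fun d _ => ?_
  rw [← Finset.sum_smul, ← Finset.sum_smul, h2]

end WeightedDivergence

/-! ### Divergence form of the equations of F and H -/

section BoostDivergence

open Matrix

namespace BoostData

variable {κ R : Type*} [Fintype κ] [DecidableEq κ] [CommRing R] [Algebra ℝ R]
  (S : BoostData κ R)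

/-- The frame `(D_j, ∂_{ψ_k})`. -/
def blockFrame (T₁ : Matrix κ κ R) : Matrix (κ ⊕ κ) (κ ⊕ κ) R := fromBlocks T₁ 0 0 1

/-- The derivations along the frame. -/
def weight : κ ⊕ κ → R := Sum.elim (fun j => algebraMap ℝ R (S.ell j)) 0

/-- The base contributes ½ ell and the fibres ½ ell − ∂φ; the factor e^φ restores ∂φ, so the
logarithmic derivatives of the density are constant. -/
theorem half_trace_log (b : κ ⊕ κ) :
    half R * (S.Gmi * S.Gm.map (S.fder b)).trace + S.fder b S.phi = S.weight b := by
  rcases b with j | k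
  · have h1 : (S.Gmi * S.Gm.map (S.fder (Sum.inl j))).trace
        = algebraMap ℝ R (S.ell j) + (algebraMap ℝ R (S.ell j) - 2 * S.d j S.phi) := by
      rw [← S.trace_Gi_d_G, ← S.trace_log]
      simp only [Gmi, Gm, fromBlocks_map, fromBlocks_multiply, Matrix.trace_fromBlocks, fder_inl,
        Matrix.zero_mul, add_zero, zero_add]
    rw [h1, weight, fder_inl, Sum.elim_inl]
    linear_combination (algebraMap ℝ R (S.ell j) - S.d j S.phi) * two_mul_half R
  · have h0 : S.Gm.map (0 : Derivation ℝ R R) = 0 := by ext; simp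
    rw [weight, fder_inr, h0]; simp

/-- The weighted divergence of vectors whose components are contracted with `hi`. -/
theorem sum_weighted_hi (y : κ → R) :
    ∑ i, (S.d i (∑ j, S.hi i j * y j) + algebraMap ℝ R (S.ell i) * ∑ j, S.hi i j * y j)
      = S.contr fun i j => S.d i (y j) := by
  have h1 : ∀ i, S.d i (∑ j, S.hi i j * y j)
      = ∑ j, S.hi i j * S.d i (y j) - ∑ j, (S.hi * S.p i * S.hi) i j * y j := by
    intro i
    rw [map_sum, ← Finset.sum_sub_distrib]
    refine Finset.sum_congr rfl fun j _ => ?_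
    have := congrFun (congrFun (S.d_hi i) i) j
    rw [map_apply, Matrix.neg_apply] at this
    rw [Derivation.leibniz, this, smul_eq_mul, smul_eq_mul]; ring
  -- The derivative of h⁻¹ is traced to ell by total symmetry and cancels the weight.
  have h2 : ∑ i, ∑ j, (S.hi * S.p i * S.hi) i j * y j
      = ∑ i, algebraMap ℝ R (S.ell i) * ∑ j, S.hi i j * y j := by
    rw [Finset.sum_comm]
    simp only [← Finset.sum_mul, S.sum_hi_p_mul, Finset.mul_sum]
    rw [Finset.sum_comm]
    simp only [Finset.sum_mul, mul_assoc]
  simp only [h1, Finset.sum_add_distrib, Finset.sum_sub_distrib, h2, contr, smul_eq_mul]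
  ring

/-- The frame components of the raised two-form. -/
theorem Gmi_Fm_Gmi (q : ℝ) : S.Gmi * S.Fm q * S.Gmi
    = fromBlocks 0 (S.hi * S.X q * S.Gi) (-(S.Gi * (S.X q)ᵀ * S.hi)) 0 := by
  rw [Gmi, Fm, fromBlocks_multiply, fromBlocks_multiply]
  simp

theorem Gmi_Hm_inl (j : κ) : S.Gmi * S.Hm (Sum.inl j) * S.Gmi
    = fromBlocks 0 0 0 (S.Gi * S.H j * S.Gi) := by
  rw [Gmi, Hm, Sum.elim_inl, fromBlocks_multiply, fromBlocks_multiply]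
  simp

theorem Gmi_Hm_inr (k : κ) : S.Gmi * S.Hm (Sum.inr k) * S.Gmi
    = fromBlocks 0 (S.hi * S.Z k * S.Gi) (-(S.Gi * (S.Z k)ᵀ * S.hi)) 0 := by
  rw [Gmi, Hm, Sum.elim_inr, fromBlocks_multiply, fromBlocks_multiply]
  simp

/-- Only row z of `N` is non-zero, so column z of `maxwell_equation` carries all its content. -/
theorem maxwell_frame (q : ℝ) (k : κ) :
    S.contr (fun i j => S.d i ((S.X q * S.Gi) j k))
      = -∑ l, S.Gi k l * (S.hi * S.Z l * S.Gi * (S.X q)ᵀ).trace := by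
  have h0 := congrFun (congrFun S.maxwell_equation k) S.z
  rw [contr_sub, Matrix.sub_apply, Matrix.zero_apply, sub_eq_zero] at h0
  have hN : ∀ j (l : κ), algebraMap ℝ R q * (S.N.map (S.d j)) S.z l = S.X q j l := by
    intro j l; simp [X, N]
  have hM : ∀ (M : Matrix κ κ R) j, algebraMap ℝ R q * (M * (S.N.map (S.d j))ᵀ) k S.z
      = (M * (S.X q)ᵀ) k j := by
    intro M j
    rw [mul_apply, mul_apply, Finset.mul_sum]
    exact Finset.sum_congr rfl fun l _ => by
      rw [transpose_apply, transpose_apply, ← hN]; ring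
  have h1 : ∀ T : κ → κ → Matrix κ κ R, algebraMap ℝ R q * S.contr T k S.z
      = S.contr fun i j => algebraMap ℝ R q * T i j k S.z := by
    intro T
    simp only [contr, Matrix.sum_apply, Matrix.smul_apply, smul_eq_mul, Finset.mul_sum]
    exact Finset.sum_congr rfl fun _ _ => Finset.sum_congr rfl fun _ _ => by ring
  have h2 := congrArg (fun x => algebraMap ℝ R q * x) h0
  simp only [h1, hM] at h2
  have h3 : ∀ i j, algebraMap ℝ R q * (S.Gi * (S.N.map (S.d j))ᵀ).map (S.d i) k S.z
      = S.d i ((S.X q * S.Gi) j k) := by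
    intro i j
    rw [map_apply]
    have e : (S.X q * S.Gi) j k = (S.Gi * (S.X q)ᵀ) k j := by
      conv_lhs => rw [← S.Gi_symm, ← Matrix.transpose_transpose (S.X q), ← Matrix.transpose_mul,
        Matrix.transpose_apply]
    rw [e, ← hM, Derivation.leibniz, Derivation.map_algebraMap, smul_zero, add_zero, smul_eq_mul]
  simp only [h3] at h2
  rw [h2]
  have h4 : ∀ l, (S.hi * S.Z l * S.Gi * (S.X q)ᵀ).trace
      = -S.contr fun i j => (S.H i * S.Gi * (S.X q)ᵀ) l j := by
    intro l
    rw [Matrix.mul_assoc, Matrix.mul_assoc, trace_hi_mul,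
      S.contr_swap fun i j => (S.Z l * (S.Gi * (S.X q)ᵀ)) i j]
    simp only [contr, smul_eq_mul, ← Finset.sum_neg_distrib]
    refine Finset.sum_congr rfl fun i _ => Finset.sum_congr rfl fun j _ => ?_
    rw [← mul_neg]
    congr 1
    simp only [Matrix.mul_assoc, mul_apply (M := S.Z l), mul_apply (M := S.H i), Z, neg_mul,
      Finset.sum_neg_distrib]
  simp only [h4, mul_neg, Finset.sum_neg_distrib, neg_neg, contr, smul_eq_mul, Finset.mul_sum]
  symm
  rw [Finset.sum_comm]
  refine Finset.sum_congr rfl fun i _ => ?_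
  rw [Finset.sum_comm]
  refine Finset.sum_congr rfl fun j _ => ?_
  have e : S.Gi * S.H i * S.Gi * (S.X q)ᵀ = S.Gi * (S.H i * S.Gi * (S.X q)ᵀ) := by
    simp only [Matrix.mul_assoc]
  rw [e, mul_apply (M := S.Gi), Finset.mul_sum]
  exact Finset.sum_congr rfl fun l _ => by ring

variable (D : κ ⊕ κ → Derivation ℝ R R) {T₁ E₁ : Matrix κ κ R}

/-- The coframe dual to `blockFrame`. -/
theorem blockFrame_inv (h : E₁ * T₁ = 1) : blockFrame E₁ * blockFrame T₁ = 1 := by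
  rw [blockFrame, blockFrame, fromBlocks_multiply]
  simp [h]

theorem blockFrame_inr (T₁ : Matrix κ κ R) (a : κ ⊕ κ) (k : κ) :
    blockFrame T₁ a (Sum.inr k) = if a = Sum.inr k then 1 else 0 := by
  rcases a with a | a <;> simp [blockFrame, Matrix.one_apply]

/-- The divergence form of the Maxwell equation. -/
theorem maxwell_divergence (h : E₁ * T₁ = 1) (hD : frameDer D (blockFrame T₁) = S.fder)
    (hE : ∀ i j a, D i (blockFrame E₁ a j) = D j (blockFrame E₁ a i))
    {g gi : Matrix (κ ⊕ κ) (κ ⊕ κ) R} (hg : g = (blockFrame E₁)ᵀ * S.Gm * blockFrame E₁)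
    (hgi : gi = blockFrame T₁ * S.Gmi * (blockFrame T₁)ᵀ) (q : ℝ)
    {Fc : Matrix (κ ⊕ κ) (κ ⊕ κ) R} {Hc : κ ⊕ κ → Matrix (κ ⊕ κ) (κ ⊕ κ) R}
    (hF : Fc = (blockFrame E₁)ᵀ * S.Fm q * blockFrame E₁)
    (hH : ∀ i, Hc i = ∑ a, blockFrame E₁ a i • ((blockFrame E₁)ᵀ * S.Hm a * blockFrame E₁))
    (c : κ ⊕ κ) :
    ∑ a, (D a ((gi * Fc * giᵀ) a c) + logDensity D g gi S.phi a * (gi * Fc * giᵀ) a c)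
      = -(half R * (raise₃ gi Hc c * Fcᵀ).trace) := by
  have hET := blockFrame_inv h
  have hTE' : (blockFrame T₁)ᵀ * (blockFrame E₁)ᵀ = 1 := by
    rw [← Matrix.transpose_mul, hET, Matrix.transpose_one]
  have hup : gi * Fc * giᵀ = blockFrame T₁ * (S.Gmi * S.Fm q * S.Gmi) * (blockFrame T₁)ᵀ := by
    rw [hgi, hF]
    simp only [Matrix.transpose_mul, Matrix.transpose_transpose, S.Gmi_symm]
    calc _ = blockFrame T₁ * S.Gmi * ((blockFrame T₁)ᵀ * (blockFrame E₁)ᵀ) * S.Fm q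
          * (blockFrame E₁ * blockFrame T₁) * S.Gmi * (blockFrame T₁)ᵀ := by noncomm_ring
      _ = _ := by rw [hTE', hET]; noncomm_ring
  have hup' : ∀ a, (gi * Fc * giᵀ) a c = ∑ b, blockFrame T₁ a b *
      (S.Gmi * S.Fm q * S.Gmi * (blockFrame T₁)ᵀ) b c := by
    intro a; rw [hup, Matrix.mul_assoc, mul_apply]
  simp only [hup']
  rw [weighted_divergence D hET hE hg hgi S.Gmi_mul_Gm S.Gm_symm S.phi (δ := S.weight)
    (fun b => by rw [hD]; exact S.half_trace_log b)]
  rw [raise₃_frame hET hgi S.Gmi_symm hH]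
  -- Derivative and weight both vanish along the fibres; the base components fall under
  -- `sum_weighted_hi`.
  have hL : ∑ b, (frameDer D (blockFrame T₁) b ((S.Gmi * S.Fm q * S.Gmi * (blockFrame T₁)ᵀ) b c)
      + S.weight b * (S.Gmi * S.Fm q * S.Gmi * (blockFrame T₁)ᵀ) b c)
      = ∑ k, blockFrame T₁ c (Sum.inr k) * S.contr fun i j => S.d i ((S.X q * S.Gi) j k) := by
    have h1 : ∀ i, (S.Gmi * S.Fm q * S.Gmi * (blockFrame T₁)ᵀ) (Sum.inl i) c
        = ∑ k, blockFrame T₁ c (Sum.inr k) * ∑ j, S.hi i j * (S.X q * S.Gi) j k := by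
      intro i
      rw [Gmi_Fm_Gmi, mul_apply, Fintype.sum_sum_type]
      simp only [fromBlocks_apply₁₁, fromBlocks_apply₁₂, Matrix.zero_apply, zero_mul,
        Finset.sum_const_zero, zero_add, transpose_apply]
      refine Finset.sum_congr rfl fun k _ => ?_
      rw [Matrix.mul_assoc, mul_apply, mul_comm]
    have h0' : ∀ i k, S.d i (blockFrame T₁ c (Sum.inr k)) = 0 := fun i k => by
      rw [blockFrame_inr]; split_ifs <;> simp
    rw [hD, Fintype.sum_sum_type]
    simp only [fder_inl, fder_inr, weight, Sum.elim_inl, Sum.elim_inr, Derivation.coe_zero,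
      Pi.zero_apply, zero_mul, add_zero, Finset.sum_const_zero, h1, ← S.sum_weighted_hi]
    have h5 : ∀ i, S.d i (∑ k, blockFrame T₁ c (Sum.inr k) * ∑ j, S.hi i j * (S.X q * S.Gi) j k)
        = ∑ k, blockFrame T₁ c (Sum.inr k) * S.d i (∑ j, S.hi i j * (S.X q * S.Gi) j k) := by
      intro i
      rw [map_sum]
      refine Finset.sum_congr rfl fun k _ => ?_
      rw [Derivation.leibniz, h0', smul_zero, add_zero, smul_eq_mul]
    simp only [h5]
    generalize hy : (fun i k => ∑ j, S.hi i j * (S.X q * S.Gi) j k) = y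
    have hy' : ∀ i k, ∑ j, S.hi i j * (S.X q * S.Gi) j k = y i k := fun i k => by rw [← hy]
    simp only [hy', Finset.mul_sum, ← Finset.sum_add_distrib]
    rw [Finset.sum_comm]
    exact Finset.sum_congr rfl fun _ _ => Finset.sum_congr rfl fun _ _ => by ring
  rw [hL]
  have htr : ∀ d, (blockFrame T₁ * (S.Gmi * S.Hm d * S.Gmi) * (blockFrame T₁)ᵀ * Fcᵀ).trace
      = (S.Gmi * S.Hm d * S.Gmi * (S.Fm q)ᵀ).trace := by
    intro d
    rw [hF]
    simp only [Matrix.transpose_mul, Matrix.transpose_transpose]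
    calc _ = (blockFrame T₁ * (S.Gmi * S.Hm d * S.Gmi * ((blockFrame T₁)ᵀ * (blockFrame E₁)ᵀ)
          * (S.Fm q)ᵀ * blockFrame E₁)).trace := by congr 1; noncomm_ring
      _ = (S.Gmi * S.Hm d * S.Gmi * ((blockFrame T₁)ᵀ * (blockFrame E₁)ᵀ)
          * (S.Fm q)ᵀ * (blockFrame E₁ * blockFrame T₁)).trace := by
        rw [Matrix.trace_mul_comm]; congr 1; noncomm_ring
      _ = _ := by rw [hTE', hET, Matrix.mul_one, Matrix.mul_one]
  have hinl : ∀ j, (S.Gmi * S.Hm (Sum.inl j) * S.Gmi * (S.Fm q)ᵀ).trace = 0 := by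
    intro j
    rw [Gmi_Hm_inl, Fm, fromBlocks_transpose, fromBlocks_multiply, Matrix.trace_fromBlocks]
    simp
  have hinr : ∀ k, (S.Gmi * S.Hm (Sum.inr k) * S.Gmi * (S.Fm q)ᵀ).trace
      = 2 * (S.hi * S.Z k * S.Gi * (S.X q)ᵀ).trace := by
    intro k
    have e : (S.Gi * (S.Z k)ᵀ * S.hi * S.X q).trace = (S.hi * S.Z k * S.Gi * (S.X q)ᵀ).trace := by
      rw [← Matrix.trace_transpose]
      simp only [Matrix.transpose_mul, Matrix.transpose_transpose, S.hi_symm, S.Gi_symm]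
      rw [Matrix.trace_mul_comm]
      simp only [Matrix.mul_assoc]
    rw [Gmi_Hm_inr, Fm, fromBlocks_transpose, fromBlocks_multiply, Matrix.trace_fromBlocks]
    simp only [Matrix.transpose_zero, Matrix.mul_zero, Matrix.zero_mul, zero_add, add_zero,
      Matrix.transpose_neg, Matrix.transpose_transpose, Matrix.neg_mul, Matrix.mul_neg, neg_neg, e]
    ring
  simp only [Matrix.sum_mul, Matrix.smul_mul, Matrix.trace_sum, Matrix.trace_smul, smul_eq_mul,
    htr]
  rw [Fintype.sum_sum_type]
  have z1 : ∀ i, ∑ d, S.Gmi (Sum.inl i) d * (S.Gmi * S.Hm d * S.Gmi * (S.Fm q)ᵀ).trace = 0 := by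
    intro i
    rw [Fintype.sum_sum_type]
    simp only [hinl, mul_zero, Finset.sum_const_zero, zero_add]
    simp [Gmi]
  have z2 : ∀ k, ∑ d, S.Gmi (Sum.inr k) d * (S.Gmi * S.Hm d * S.Gmi * (S.Fm q)ᵀ).trace
      = 2 * ∑ l, S.Gi k l * (S.hi * S.Z l * S.Gi * (S.X q)ᵀ).trace := by
    intro k
    rw [Fintype.sum_sum_type]
    simp only [hinl, mul_zero, Finset.sum_const_zero, zero_add, hinr, Finset.mul_sum]
    refine Finset.sum_congr rfl fun l _ => ?_
    simp only [Gmi, fromBlocks_apply₂₂]; ring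
  simp only [z1, z2, mul_zero, Finset.sum_const_zero, zero_add, maxwell_frame, Finset.mul_sum,
    mul_neg, Finset.sum_neg_distrib]
  congr 1
  refine Finset.sum_congr rfl fun k _ => Finset.sum_congr rfl fun l _ => ?_
  linear_combination -(blockFrame T₁ c (Sum.inr k) * (S.Gi k l
    * (S.hi * S.Z l * S.Gi * (S.X q)ᵀ).trace)) * two_mul_half R

/-- The divergence form of the equation of motion of the three-form. -/
theorem threeForm_divergence (h : E₁ * T₁ = 1) (hD : frameDer D (blockFrame T₁) = S.fder)
    (hE : ∀ i j a, D i (blockFrame E₁ a j) = D j (blockFrame E₁ a i))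
    {g gi : Matrix (κ ⊕ κ) (κ ⊕ κ) R} (hg : g = (blockFrame E₁)ᵀ * S.Gm * blockFrame E₁)
    (hgi : gi = blockFrame T₁ * S.Gmi * (blockFrame T₁)ᵀ)
    {Hc : κ ⊕ κ → Matrix (κ ⊕ κ) (κ ⊕ κ) R}
    (hH : ∀ i, Hc i = ∑ a, blockFrame E₁ a i • ((blockFrame E₁)ᵀ * S.Hm a * blockFrame E₁))
    (b c : κ ⊕ κ) :
    ∑ a, (D a (raise₃ gi Hc a b c) + logDensity D g gi S.phi a * raise₃ gi Hc a b c) = 0 := by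
  have hET := blockFrame_inv h
  have hup : ∀ a, raise₃ gi Hc a b c = ∑ e, blockFrame T₁ a e * ∑ d, S.Gmi e d *
      (blockFrame T₁ * (S.Gmi * S.Hm d * S.Gmi) * (blockFrame T₁)ᵀ) b c := by
    intro a
    rw [raise₃_frame hET hgi S.Gmi_symm hH]
    simp only [Matrix.sum_apply, Matrix.smul_apply, smul_eq_mul]
  simp only [hup]
  rw [weighted_divergence D hET hE hg hgi S.Gmi_mul_Gm S.Gm_symm S.phi (δ := S.weight)
    (fun b => by rw [hD]; exact S.half_trace_log b), hD, Fintype.sum_sum_type]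
  have h1 : ∀ j, (blockFrame T₁ * (S.Gmi * S.Hm (Sum.inl j) * S.Gmi) * (blockFrame T₁)ᵀ)
      = fromBlocks 0 0 0 (S.Gi * S.H j * S.Gi) := by
    intro j
    rw [Gmi_Hm_inl, blockFrame, fromBlocks_transpose, fromBlocks_multiply, fromBlocks_multiply]
    simp
  have h2 : ∀ i, ∑ d, S.Gmi (Sum.inl i) d *
      (blockFrame T₁ * (S.Gmi * S.Hm d * S.Gmi) * (blockFrame T₁)ᵀ) b c
      = ∑ j, S.hi i j * fromBlocks (0 : Matrix κ κ R) 0 0 (S.Gi * S.H j * S.Gi) b c := by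
    intro i
    rw [Fintype.sum_sum_type]
    simp only [h1]
    simp [Gmi]
  simp only [fder_inl, fder_inr, weight, Sum.elim_inl, Sum.elim_inr, Derivation.coe_zero,
    Pi.zero_apply, zero_mul, add_zero, Finset.sum_const_zero, h2, S.sum_weighted_hi]
  have h3 := S.threeForm_equation
  rcases b with b | b <;> rcases c with c | c
  · simp [contr]
  · simp [contr]
  · simp [contr]
  · have := congrFun (congrFun h3 b) c
    simpa [contr, Matrix.sum_apply] using this

end BoostData

end BoostDivergence

end

/-! ### From divergences over the ring to forms on the domain -/

noncomputable section

section HodgeBridge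

open Matrix BasicRing

theorem pd_comp_hasDerivAt {ι : Type*} [Fintype ι] [DecidableEq ι] {f : (ι → ℝ) → ℝ} {p : ι → ℝ}
    {F : ℝ → ℝ} {F' : ℝ} (hF : HasDerivAt F F' (f p)) (hf : DifferentiableAt ℝ f p) (i : ι) :
    pd i (fun p => F (f p)) p = F' * pd i f p := by
  have := hF.comp_hasFDerivAt p hf.hasFDerivAt
  rw [pd, HasFDerivAt.fderiv (f := fun p => F (f p)) this]
  simp [pd]

theorem wedge_smul_left {ι : Type*} [Fintype ι] [DecidableEq ι] {k l : ℕ} (r : ℝ) (α : DForm ι k)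
    (β : DForm ι l) : wedge (r • α) β = r • wedge α β := by
  ext v
  have h1 := wedge_eq_altSum (r • α) β v
  have h2 := wedge_eq_altSum α β v
  have h3 : altSum (fun x : Fin k ⊕ Fin l → ι → ℝ => (r • α) (fun i => x (Sum.inl i)) *
      β fun i => x (Sum.inr i)) (v ∘ finSumFinEquiv) = r * altSum (fun x : Fin k ⊕ Fin l → ι → ℝ =>
        α (fun i => x (Sum.inl i)) * β fun i => x (Sum.inr i)) (v ∘ finSumFinEquiv) := by
    rw [← altSum_const_mul]
    congr 1
    funext x
    rw [ContinuousAlternatingMap.smul_apply, smul_eq_mul, mul_assoc]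
  rw [h3, ← h2] at h1
  have h0 : ((k.factorial * l.factorial : ℕ) : ℝ) ≠ 0 := by positivity
  rw [ContinuousAlternatingMap.smul_apply, smul_eq_mul]
  refine mul_left_cancel₀ h0 ?_
  push_cast at h1 ⊢
  linear_combination h1

variable {ι : Type*} [Fintype ι] [DecidableEq ι] {W : BasicDomain ι}
  {g : (ι → ℝ) → Matrix ι ι ℝ} {G Gi : Matrix ι ι (BasicRing W)}

theorem MetricRep.rep_det (h : MetricRep g G Gi) : Rep (fun p => (g p).det) G.det := fun p => by
  dsimp only
  rw [h.rep p]
  exact ((ev p).map_det G).symm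

/-- The density `e^φ √(det g)` and its logarithmic derivatives. -/
theorem MetricRep.exists_density (h : MetricRep g G Gi) (hpos : ∀ p ∈ W.carrier, 0 < (g p).det)
    {φ : (ι → ℝ) → ℝ} {f : BasicRing W} (hφ : Rep φ f) :
    ∃ r : BasicRing W, Rep (fun p => Real.exp (φ p) * Real.sqrt (g p).det) r ∧
      ∀ i, D i r = r * logDensity (D (W := W)) G Gi f i := by
  have hd := h.rep_det
  -- By Jacobi's formula √det g has logarithmic derivative ½ tr(g⁻¹∂_i g).
  have key : ∀ i (p : W.carrier), pd i (fun p => Real.exp (φ p) * Real.sqrt (g p).det) p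
      = Real.exp (φ p) * Real.sqrt (g p).det * ev p (logDensity (D (W := W)) G Gi f i) := by
    intro i p
    have hφd := hφ.contDiffOn.differentiableAt_of_isOpen W.isOpen p.2
    have hdd := hd.contDiffOn.differentiableAt_of_isOpen W.isOpen p.2
    have hp := hpos p p.2
    rw [pd_mul' (f := fun p => Real.exp (φ p)) (f' := fun p => Real.sqrt (g p).det)
      hφd.exp (hdd.sqrt hp.ne'), pd_comp_hasDerivAt (Real.hasDerivAt_exp _) hφd,
      pd_comp_hasDerivAt (f := fun p => (g p).det) (Real.hasDerivAt_sqrt hp.ne') hdd,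
      hφ.pd i p, hd.pd i p, Derivation.map_det_of_inv (D i) h.inv_mul, map_mul, ← hd p, logDensity,
      map_add, map_mul, half, ev_algebraMap]
    have hs : Real.sqrt (g p).det ≠ 0 := (Real.sqrt_pos.2 hp).ne'
    have h2 : 1 / (2 * Real.sqrt (g p).det) * (g p).det = 1 / 2 * Real.sqrt (g p).det := by
      conv_lhs => rw [← Real.mul_self_sqrt hp.le, Real.sqrt_mul_self (Real.sqrt_nonneg _)]
      rw [one_div, mul_inv, mul_assoc, ← mul_assoc _ (Real.sqrt _) (Real.sqrt _),
        inv_mul_cancel₀ hs, one_mul, one_div]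
    generalize ev p (Gi * G.map (D i)).trace = x
    linear_combination Real.exp (φ p) * x * h2
  have hb : IsBasic W.carrier W.dirs fun p => Real.exp (φ p) * Real.sqrt (g p).det := by
    refine ⟨hφ.contDiffOn.exp.mul (hd.contDiffOn.sqrt fun p hp => (hpos p hp).ne'),
      fun i hi p hp => ?_⟩
    rw [key i ⟨p, hp⟩, logDensity, D_dirs hi]
    have : G.map (0 : Derivation ℝ (BasicRing W) (BasicRing W)) = 0 := by ext; simp
    rw [this]; simp
  refine ⟨BasicRing.mk _ hb, rep_mk _ hb, fun i => ext_ev fun p => ?_⟩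
  rw [← (rep_mk _ hb).pd i p, key, map_mul, ev_mk]

/-- The constant is the 1/2! of the Hodge star; with the 1/3! of `starCoeff_three` it accounts for
the factors 2 and 3 in `extDeriv_sum_starBasis_two`. -/
theorem MetricRep.starCoeff_two (h : MetricRep g G Gi) {F : (ι → ℝ) → DForm ι 2}
    {Fc : Matrix ι ι (BasicRing W)} (hF : ∀ p : W.carrier, formMat (F p) = Fc.map (ev p))
    {φ : (ι → ℝ) → ℝ} {r : BasicRing W}
    (hr : Rep (fun p => Real.exp (φ p) * Real.sqrt (g p).det) r) (a b : ι) :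
    Rep (fun p => Real.exp (φ p) * starCoeff (g p) (F p) ![a, b])
      (half (BasicRing W) * (r * (Gi * Fc * Giᵀ) a b)) := by
  intro p
  have e : ∀ i j, F p ![cvec i, cvec j] = ev p (Fc i j) := fun i j =>
    congrFun (congrFun (hF p) i) j
  have hv : ∀ J : Fin 2 → ι, (fun s => (cvec (J s) : ι → ℝ)) = ![cvec (J 0), cvec (J 1)] := by
    intro J; funext s; fin_cases s <;> rfl
  simp only [starCoeff, sum_fin_two, Fin.prod_univ_two, hv, h.inv p, map_mul, half, ev_algebraMap,
    ← hr p, mul_apply, transpose_apply, map_sum, Matrix.cons_val_zero, Matrix.cons_val_one, e,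
    map_apply, Finset.sum_mul]
  rw [Finset.sum_comm]
  simp only [Finset.mul_sum]
  refine Finset.sum_congr rfl fun _ _ => Finset.sum_congr rfl fun _ _ => ?_
  norm_num [Nat.factorial]
  ring

theorem MetricRep.starCoeff_three (h : MetricRep g G Gi) {T : (ι → ℝ) → DForm ι 3}
    {Hc : ι → Matrix ι ι (BasicRing W)}
    (hT : ∀ p : W.carrier, ∀ i, formMat₃ (T p) i = (Hc i).map (ev p))
    {φ : (ι → ℝ) → ℝ} {r : BasicRing W}
    (hr : Rep (fun p => Real.exp (φ p) * Real.sqrt (g p).det) r) (a b c : ι) :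
    Rep (fun p => Real.exp (φ p) * starCoeff (g p) (T p) ![a, b, c])
      (algebraMap ℝ (BasicRing W) (1 / 6) * (r * raise₃ Gi Hc a b c)) := by
  intro p
  have e : ∀ i j k, T p ![cvec i, cvec j, cvec k] = ev p (Hc i j k) := fun i j k =>
    congrFun (congrFun (hT p i) j) k
  have hv : ∀ J : Fin 3 → ι, (fun s => (cvec (J s) : ι → ℝ))
      = ![cvec (J 0), cvec (J 1), cvec (J 2)] := by
    intro J; funext s; fin_cases s <;> rfl
  simp only [starCoeff, sum_fin_three, Fin.prod_univ_three, hv, h.inv p, map_mul, ev_algebraMap,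
    ← hr p, raise₃, Matrix.sum_apply, Matrix.smul_apply, smul_eq_mul, mul_apply, transpose_apply,
    map_sum, Matrix.cons_val_zero, Matrix.cons_val_one, Matrix.cons_val_two, Matrix.tail_cons,
    Matrix.head_cons, e, map_apply, Finset.sum_mul, Finset.mul_sum]
  refine Finset.sum_congr rfl fun _ _ => ?_
  rw [Finset.sum_comm]
  refine Finset.sum_congr rfl fun _ _ => Finset.sum_congr rfl fun _ _ => ?_
  norm_num [Nat.factorial]
  ring

theorem starCoeff_swap_two (g : Matrix ι ι ℝ) (α : DForm ι 2) (a b : ι) :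
    starCoeff g α ![b, a] = -starCoeff g α ![a, b] := by
  have h := starCoeff_perm g α ![a, b] (Equiv.swap 0 1)
  have e : (![a, b] : Fin 2 → ι) ∘ Equiv.swap 0 1 = ![b, a] := by
    funext s; fin_cases s <;> rfl
  rw [e, Equiv.Perm.sign_swap (by decide)] at h
  rw [h]; simp

theorem starCoeff_swap_three (g : Matrix ι ι ℝ) (α : DForm ι 3) (a b c : ι) :
    starCoeff g α ![b, a, c] = -starCoeff g α ![a, b, c] ∧
      starCoeff g α ![a, c, b] = -starCoeff g α ![a, b, c] := by
  have h := starCoeff_perm g α ![a, b, c] (Equiv.swap 0 1)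
  have h' := starCoeff_perm g α ![a, b, c] (Equiv.swap 1 2)
  have e : (![a, b, c] : Fin 3 → ι) ∘ Equiv.swap 0 1 = ![b, a, c] := by
    funext s; fin_cases s <;> rfl
  have e' : (![a, b, c] : Fin 3 → ι) ∘ Equiv.swap 1 2 = ![a, c, b] := by
    funext s; fin_cases s <;> rfl
  rw [e, Equiv.Perm.sign_swap (by decide)] at h
  rw [e', Equiv.Perm.sign_swap (by decide)] at h'
  rw [h, h']; simp

theorem smul_hodgeStar {D k m : ℕ} (o : Fin D ≃ ι) (h : k + m = D) (g : Matrix ι ι ℝ)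
    (α : DForm ι k) (r : ℝ) : r • hodgeStar o h g α
      = ∑ I : Fin k → ι, (r * starCoeff g α I) • starBasis o h I := by
  rw [hodgeStar_eq, Finset.smul_sum]
  exact Finset.sum_congr rfl fun I _ => by rw [smul_smul]

theorem vecCons_eta_two (I : Fin 2 → ι) : I = ![I 0, I 1] := by
  funext s; fin_cases s <;> rfl

theorem vecCons_eta_three (I : Fin 3 → ι) : I = ![I 0, I 1, I 2] := by
  funext s; fin_cases s <;> rfl

/-- `d(e^φ ⋆H) = 0` from the vanishing of a divergence. -/
theorem MetricRep.extDeriv_star_three (h : MetricRep g G Gi)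
    (hpos : ∀ p ∈ W.carrier, 0 < (g p).det) {φ : (ι → ℝ) → ℝ} {f : BasicRing W} (hφ : Rep φ f)
    {T : (ι → ℝ) → DForm ι 3} {Hc : ι → Matrix ι ι (BasicRing W)}
    (hT : ∀ p : W.carrier, ∀ i, formMat₃ (T p) i = (Hc i).map (ev p))
    (hdiv : ∀ b c, ∑ a, (D a (raise₃ Gi Hc a b c) + logDensity (D (W := W)) G Gi f a * raise₃ Gi Hc a b c) = 0)
    {N m : ℕ} (o : Fin N ≃ ι) (hm : 3 + m = N) (p : W.carrier) :
    extDeriv (fun p => Real.exp (φ p) • hodgeStar o hm (g p) (T p)) p = 0 := by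
  obtain ⟨r, hr, hrD⟩ := h.exists_density hpos hφ
  have hw := h.starCoeff_three hT hr
  simp only [smul_hodgeStar]
  refine extDeriv_sum_starBasis_three o hm (w := fun I p => Real.exp (φ p) * starCoeff (g p) (T p) I)
    ?_ ?_ ?_ ?_
  · intro I
    rw [vecCons_eta_three I]
    exact (hw _ _ _).contDiffOn.differentiableAt_of_isOpen W.isOpen p.2
  · intro a b c; funext q
    simp only [(starCoeff_swap_three (g q) (T q) a b c).1, mul_neg, Pi.neg_apply]
  · intro a b c; funext q
    simp only [(starCoeff_swap_three (g q) (T q) a b c).2, mul_neg, Pi.neg_apply]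
  · intro b c
    have e : ∀ a, D a (algebraMap ℝ (BasicRing W) (1 / 6) * (r * raise₃ Gi Hc a b c))
        = algebraMap ℝ (BasicRing W) (1 / 6) * r * (D a (raise₃ Gi Hc a b c)
          + logDensity (D (W := W)) G Gi f a * raise₃ Gi Hc a b c) := by
      intro a
      rw [Derivation.leibniz, Derivation.map_algebraMap, Derivation.leibniz, hrD]
      simp only [smul_eq_mul]; ring
    have e2 : ∀ a, pd a (fun p => Real.exp (φ p) * starCoeff (g p) (T p) ![a, b, c]) p
        = ev p (D a (algebraMap ℝ (BasicRing W) (1 / 6) * (r * raise₃ Gi Hc a b c))) :=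
      fun a => (hw a b c).pd a p
    simp only [e2, e]
    rw [← map_sum, ← Finset.mul_sum, hdiv, mul_zero, map_zero]

/-- `d(e^φ ⋆F) = e^φ ⋆H ∧ F` from a divergence. -/
theorem MetricRep.extDeriv_star_two (h : MetricRep g G Gi)
    (hpos : ∀ p ∈ W.carrier, 0 < (g p).det) {φ : (ι → ℝ) → ℝ} {f : BasicRing W} (hφ : Rep φ f)
    {F : (ι → ℝ) → DForm ι 2} {Fc : Matrix ι ι (BasicRing W)}
    (hF : ∀ p : W.carrier, formMat (F p) = Fc.map (ev p))
    {T : (ι → ℝ) → DForm ι 3} {Hc : ι → Matrix ι ι (BasicRing W)}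
    (hT : ∀ p : W.carrier, ∀ i, formMat₃ (T p) i = (Hc i).map (ev p))
    (hdiv : ∀ c, ∑ a, (D a ((Gi * Fc * Giᵀ) a c) + logDensity (D (W := W)) G Gi f a * (Gi * Fc * Giᵀ) a c)
      = -(half (BasicRing W) * (raise₃ Gi Hc c * Fcᵀ).trace))
    {N m : ℕ} (o : Fin N ≃ ι) (hm' : 2 + (m + 1) = N) (hm : 3 + m = N) (p : W.carrier) :
    extDeriv (fun p => Real.exp (φ p) • hodgeStar o hm' (g p) (F p)) p
      = Real.exp (φ p) • wedge (hodgeStar o hm (g p) (T p)) (F p) := by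
  obtain ⟨r, hr, hrD⟩ := h.exists_density hpos hφ
  have hw := h.starCoeff_two hF hr
  have hw' := h.starCoeff_three hT hr
  rw [← wedge_smul_left]
  simp only [smul_hodgeStar]
  have s3 := fun a b c => starCoeff_swap_three (g p) (T p) a b c
  refine extDeriv_sum_starBasis_two o hm' hm
    (w := fun I p => Real.exp (φ p) * starCoeff (g p) (F p) I)
    (w' := fun I => Real.exp (φ p) * starCoeff (g p) (T p) I) ?_ ?_ ?_ ?_ _ ?_
  · intro I
    rw [vecCons_eta_two I]
    exact (hw _ _).contDiffOn.differentiableAt_of_isOpen W.isOpen p.2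
  · intro a b; funext q
    simp only [starCoeff_swap_two (g q) (F q) a b, mul_neg, Pi.neg_apply]
  · intro a b c; simp only [(s3 a b c).1, mul_neg]
  · intro a b c; simp only [(s3 a b c).2, mul_neg]
  · intro c
    have e : ∀ a, D a (half (BasicRing W) * (r * (Gi * Fc * Giᵀ) a c))
        = half (BasicRing W) * r * (D a ((Gi * Fc * Giᵀ) a c)
          + logDensity (D (W := W)) G Gi f a * (Gi * Fc * Giᵀ) a c) := by
      intro a
      rw [Derivation.leibniz, half, Derivation.map_algebraMap, Derivation.leibniz, hrD]
      simp only [smul_eq_mul]; ring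
    have e2 : ∀ a, pd a (fun p => Real.exp (φ p) * starCoeff (g p) (F p) ![a, c]) p
        = ev p (D a (half (BasicRing W) * (r * (Gi * Fc * Giᵀ) a c))) :=
      fun a => (hw a c).pd a p
    -- A cyclic permutation, which is even, brings the free index to the front.
    have e3 : ∀ a b, Real.exp (φ p) * starCoeff (g p) (T p) ![a, b, c]
        = ev p (algebraMap ℝ (BasicRing W) (1 / 6) * (r * raise₃ Gi Hc c a b)) := by
      intro a b
      rw [← hw' c a b p, ← neg_neg (starCoeff (g p) (T p) ![a, b, c]), ← (s3 a b c).2,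
        ← (s3 a c b).1]
    have e4 : ∀ a b, F p ![cvec a, cvec b] = ev p (Fc a b) := fun i j =>
      congrFun (congrFun (hF p) i) j
    simp only [e2, e, e3, e4]
    rw [← map_sum, ← Finset.mul_sum, hdiv]
    simp only [map_mul, map_neg, Matrix.trace, diag_apply, mul_apply, transpose_apply, map_sum,
      half, ev_algebraMap, Finset.mul_sum, ← Finset.sum_neg_distrib]
    exact Finset.sum_congr rfl fun _ _ => Finset.sum_congr rfl fun _ _ => by ring

end HodgeBridge

end

/-! ### Boost geometry in coordinates -/

noncomputable section

section BoostGeometry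

open Matrix BasicRing

namespace BoostData

section Algebra

variable {κ R : Type*} [Fintype κ] [DecidableEq κ] [CommRing R] [Algebra ℝ R]
  (S : BoostData κ R)

theorem Jm_sq : S.Jm * S.Jm = -1 := by
  rw [Jm, fromBlocks_multiply]
  simp only [Matrix.mul_neg, Matrix.neg_mul, Matrix.mul_zero, Matrix.zero_mul, zero_add, add_zero,
    L_mul_Li, Li_mul_L]
  rw [← fromBlocks_one, fromBlocks_neg]; simp

theorem Jm_hermitian : S.Jmᵀ * S.Gm * S.Jm = S.Gm := by
  have h1 : S.Liᵀ * S.G * S.Li = S.h := by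
    have : S.Liᵀ * S.Lᵀ = 1 := by rw [← Matrix.transpose_mul, L_mul_Li, Matrix.transpose_one]
    rw [G, ← Matrix.mul_assoc, ← Matrix.mul_assoc, this, Matrix.one_mul, Matrix.mul_assoc, L_mul_Li,
      Matrix.mul_one]
  rw [Jm, Gm, fromBlocks_transpose, fromBlocks_multiply, fromBlocks_multiply]
  have h2 : S.Lᵀ * S.h * S.L = S.G := rfl
  simp [h1, h2]

theorem trace_conj_frame {ι : Type*} [Fintype ι] [DecidableEq ι] {T E : Matrix ι ι R} (hET : E * T = 1)
    (X : Matrix ι ι R) : (T * X * E).trace = X.trace := by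
  rw [Matrix.trace_mul_comm, ← Matrix.mul_assoc, hET, Matrix.one_mul]

theorem mul_conj {ι : Type*} [Fintype ι] [DecidableEq ι] {T E : Matrix ι ι R} (hET : E * T = 1)
    (X Y : Matrix ι ι R) : T * X * E * (T * Y * E) = T * (X * Y) * E := by
  calc T * X * E * (T * Y * E) = T * X * (E * T) * Y * E := by noncomm_ring
    _ = _ := by rw [hET]; noncomm_ring

theorem inv_mul_conj {ι : Type*} [Fintype ι] [DecidableEq ι] {T E : Matrix ι ι R} (hET : E * T = 1)
    (X Y : Matrix ι ι R) : T * X * Tᵀ * (Eᵀ * Y * E) = T * (X * Y) * E := by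
  have hTE' : Tᵀ * Eᵀ = 1 := by rw [← Matrix.transpose_mul, hET, Matrix.transpose_one]
  calc T * X * Tᵀ * (Eᵀ * Y * E) = T * X * (Tᵀ * Eᵀ) * Y * E := by noncomm_ring
    _ = _ := by rw [hTE']; noncomm_ring

theorem trace_mul_curv_frame {ι : Type*} [Fintype ι] [DecidableEq ι] {D : ι → Derivation ℝ R R}
    {T E : Matrix ι ι R} (hET : E * T = 1) (hD : ∀ i j f, D i (D j f) = D j (D i f))
    (hE : ∀ i j a, D i (E a j) = D j (E a i)) {J' : Matrix ι ι R} {Γ' : ι → Matrix ι ι R}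
    (h : ∀ a b, (J' * curvMat (frameDer D T) Γ' a b).trace = 0) (i j : ι) :
    (T * J' * E * curvMat D (coordConn D T E Γ') i j).trace = 0 := by
  rw [coordConn_curv D hET hD hE]
  simp only [Matrix.mul_sum, Matrix.trace_sum, Matrix.mul_smul, Matrix.trace_smul, mul_conj hET,
    trace_conj_frame hET, h, smul_zero, Finset.sum_const_zero]

theorem Hm_transpose (a : κ ⊕ κ) : (S.Hm a)ᵀ = -S.Hm a := by
  rcases a with j | k
  · simp [Hm, fromBlocks_transpose, fromBlocks_neg, H_transpose]
  · simp [Hm, fromBlocks_transpose, fromBlocks_neg]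

end Algebra

variable {κ : Type*} [Fintype κ] [DecidableEq κ] {W : BasicDomain (κ ⊕ κ)}
  (S : BoostData κ (BasicRing W))

/-- A coordinate realisation of the frame of the boost data. -/
structure Frame (S : BoostData κ (BasicRing W)) where
  T : Matrix κ κ (BasicRing W)
  E : Matrix κ κ (BasicRing W)
  inv : E * T = 1
  der : frameDer (D (W := W)) (blockFrame T) = S.fder
  closed : ∀ i j a, D i (blockFrame E a j) = D j (blockFrame E a i)

namespace Frame

variable {S} (P : S.Frame)

def TT : Matrix (κ ⊕ κ) (κ ⊕ κ) (BasicRing W) := blockFrame P.T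

def EE : Matrix (κ ⊕ κ) (κ ⊕ κ) (BasicRing W) := blockFrame P.E

theorem ET : P.EE * P.TT = 1 := blockFrame_inv P.inv

theorem TE : P.TT * P.EE = 1 := mul_eq_one_comm.mp P.ET

/-- The coordinate components of the metric. -/
def gc : Matrix (κ ⊕ κ) (κ ⊕ κ) (BasicRing W) := P.EEᵀ * S.Gm * P.EE

def gci : Matrix (κ ⊕ κ) (κ ⊕ κ) (BasicRing W) := P.TT * S.Gmi * P.TTᵀ

def Fc (q : ℝ) : Matrix (κ ⊕ κ) (κ ⊕ κ) (BasicRing W) := P.EEᵀ * S.Fm q * P.EE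

def Hc (i : κ ⊕ κ) : Matrix (κ ⊕ κ) (κ ⊕ κ) (BasicRing W) :=
  ∑ a, P.EE a i • (P.EEᵀ * S.Hm a * P.EE)

def Jc : Matrix (κ ⊕ κ) (κ ⊕ κ) (BasicRing W) := P.TT * S.Jm * P.EE

theorem TE_transpose : P.TTᵀ * P.EEᵀ = 1 := by
  rw [← Matrix.transpose_mul, P.ET, Matrix.transpose_one]

theorem gci_mul_gc : P.gci * P.gc = 1 := by
  calc P.gci * P.gc = P.TT * S.Gmi * (P.TTᵀ * P.EEᵀ) * S.Gm * P.EE := by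
        rw [gci, gc]; noncomm_ring
    _ = P.TT * (S.Gmi * S.Gm) * P.EE := by rw [P.TE_transpose]; noncomm_ring
    _ = 1 := by rw [S.Gmi_mul_Gm, Matrix.mul_one, P.TE]

theorem gc_symm : P.gcᵀ = P.gc := by
  rw [gc, Matrix.transpose_mul, Matrix.transpose_mul, Matrix.transpose_transpose, S.Gm_symm,
    Matrix.mul_assoc]

theorem Jc_sq : P.Jc * P.Jc = -1 := by
  calc P.Jc * P.Jc = P.TT * S.Jm * (P.EE * P.TT) * S.Jm * P.EE := by rw [Jc]; noncomm_ring
    _ = P.TT * (S.Jm * S.Jm) * P.EE := by rw [P.ET]; noncomm_ring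
    _ = -1 := by rw [S.Jm_sq]; simp [P.TE]

theorem Jc_hermitian : P.Jcᵀ * P.gc * P.Jc = P.gc := by
  calc P.Jcᵀ * P.gc * P.Jc
      = P.EEᵀ * S.Jmᵀ * (P.TTᵀ * P.EEᵀ) * S.Gm * (P.EE * P.TT) * S.Jm * P.EE := by
        simp only [Jc, gc, Matrix.transpose_mul]; noncomm_ring
    _ = P.EEᵀ * (S.Jmᵀ * S.Gm * S.Jm) * P.EE := by rw [P.ET, P.TE_transpose]; noncomm_ring
    _ = P.gc := by rw [S.Jm_hermitian, gc]

/-- The Levi-Civita connection matrices. -/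
def lc (i : κ ⊕ κ) : Matrix (κ ⊕ κ) (κ ⊕ κ) (BasicRing W) :=
  coordConn (D (W := W)) P.TT P.EE (S.conn S.dG) i

theorem leviCivita : MetricRep.LeviCivita P.gc P.lc where
  symm := coordConn_symm (D (W := W)) P.closed S.conn_symm
  metric := coordConn_metric (D (W := W)) P.ET rfl fun a => by
    have := P.der
    rw [TT, this]; exact S.conn_metric a

theorem Hc_transpose (i : κ ⊕ κ) : (P.Hc i)ᵀ = -P.Hc i := by
  simp only [Hc, Matrix.transpose_sum, Matrix.transpose_smul, Matrix.transpose_mul, S.Hm_transpose,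
    Matrix.transpose_transpose, Matrix.neg_mul, Matrix.mul_neg, smul_neg, Finset.sum_neg_distrib,
    Matrix.mul_assoc]

/-- The inhomogeneous term occurs once on each side, so only the torsion part of `conn_Y` has to be
transformed, as a tensor. -/
theorem coordConn_Y (i : κ ⊕ κ) : coordConn (D (W := W)) P.TT P.EE (S.conn S.Y) i
    = P.lc i + half (BasicRing W) • (P.gci * (P.Hc i)ᵀ) := by
  have h1 : P.gci * (P.Hc i)ᵀ = ∑ a, P.EE a i • (P.TT * (S.Gmi * (S.Hm a)ᵀ) * P.EE) := by
    simp only [Hc, Matrix.transpose_sum, Matrix.transpose_smul, Matrix.transpose_mul,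
      Matrix.transpose_transpose, Matrix.mul_sum, Matrix.mul_smul]
    refine Finset.sum_congr rfl fun a _ => ?_
    congr 1
    calc P.gci * (P.EEᵀ * ((S.Hm a)ᵀ * P.EE))
        = P.TT * S.Gmi * (P.TTᵀ * P.EEᵀ) * (S.Hm a)ᵀ * P.EE := by rw [gci]; noncomm_ring
      _ = _ := by rw [P.TE_transpose]; noncomm_ring
  have h2 : pullConn P.EE (S.conn S.Y) i = pullConn P.EE (S.conn S.dG) i
      + half (BasicRing W) • ∑ a, P.EE a i • (S.Gmi * (S.Hm a)ᵀ) := by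
    simp only [pullConn, S.conn_Y, smul_add, Finset.sum_add_distrib, Finset.smul_sum]
    congr 1
    exact Finset.sum_congr rfl fun a _ => smul_comm _ _ _
  rw [h1, lc, coordConn, coordConn, h2, Matrix.mul_add, Matrix.add_mul, Matrix.mul_smul,
    Matrix.smul_mul, Matrix.mul_sum, Matrix.sum_mul]
  simp only [Matrix.mul_smul, Matrix.smul_mul]
  abel

variable {g : (κ ⊕ κ → ℝ) → Matrix (κ ⊕ κ) (κ ⊕ κ) ℝ}

theorem metricRep (hg : ∀ p : W.carrier, g p = P.gc.map (ev p)) : MetricRep g P.gc P.gci :=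
  ⟨hg, P.gci_mul_gc, P.gc_symm⟩

variable {T : (κ ⊕ κ → ℝ) → DForm (κ ⊕ κ) 3}

/-- H is skew in its last two indices, so the torsion terms cancel in the derivative of the metric.
-/
theorem parallel_g (hg : ∀ p : W.carrier, g p = P.gc.map (ev p))
    (hT : ∀ p : W.carrier, ∀ i, formMat₃ (T p) i = (P.Hc i).map (ev p)) (p : W.carrier)
    (i j k : κ ⊕ κ) :
    pd i (fun p => g p j k) p - ∑ s, torsionConnection g T p s i j * g p s k
      - ∑ s, torsionConnection g T p s i k * g p j s = 0 := by
  have hr := P.metricRep hg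
  have e := fun k i j => hr.rep_torsionConnection P.leviCivita hT k i j p
  dsimp only at e
  have key : P.gc.map (D i) - (P.lc i + half (BasicRing W) • (P.gci * (P.Hc i)ᵀ))ᵀ * P.gc
      - P.gc * (P.lc i + half (BasicRing W) • (P.gci * (P.Hc i)ᵀ)) = 0 := by
    have h1 : P.gc * P.gci = 1 := mul_eq_one_comm.mp P.gci_mul_gc
    rw [P.leviCivita.metric i, Matrix.transpose_add, Matrix.add_mul, Matrix.mul_add,
      Matrix.transpose_smul, Matrix.transpose_mul, Matrix.transpose_transpose, hr.inv_symm,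
      Matrix.smul_mul, Matrix.mul_smul, Matrix.mul_assoc (P.Hc i), P.gci_mul_gc, ← Matrix.mul_assoc,
      h1, Matrix.mul_one, Matrix.one_mul, P.Hc_transpose, smul_neg]
    abel
  have := congrArg (ev p) (congrFun (congrFun key j) k)
  simp only [Matrix.sub_apply, map_sub, map_apply, mul_apply (M := P.gc), mul_apply (N := P.gc),
    transpose_apply, map_sum, map_mul, Matrix.zero_apply, map_zero] at this
  rw [(hr.apply j k).pd i p, ← this]
  simp only [e, hr.apply _ _ p]
  congr 1
  exact Finset.sum_congr rfl fun _ _ => mul_comm _ _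

theorem parallel_J (hg : ∀ p : W.carrier, g p = P.gc.map (ev p))
    (hT : ∀ p : W.carrier, ∀ i, formMat₃ (T p) i = (P.Hc i).map (ev p))
    {J : (κ ⊕ κ → ℝ) → Matrix (κ ⊕ κ) (κ ⊕ κ) ℝ} {s : ℝ}
    (hJ : ∀ p : W.carrier, J p = (s • P.Jc).map (ev p)) (p : W.carrier) (i j k : κ ⊕ κ) :
    pd i (fun p => J p k j) p + ∑ s, torsionConnection g T p k i s * J p s j
      - ∑ s, torsionConnection g T p s i j * J p k s = 0 := by
  have hr := P.metricRep hg
  have e := fun k j => hr.rep_torsionConnection P.leviCivita hT k i j p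
  have eJ : ∀ k j, Rep (fun p => J p k j) ((s • P.Jc) k j) := fun k j p =>
    congrFun (congrFun (hJ p) k) j
  dsimp only at e
  have key := coordConn_parallel (D (W := W)) P.ET (J := P.Jc) (J' := S.Jm) (Γ' := S.conn S.Y) rfl
    (fun a => by have := P.der; rw [TT, this]; exact S.Jm_parallel a) i
  rw [P.coordConn_Y] at key
  have key' : (s • P.Jc).map (D i) + (P.lc i + half (BasicRing W) • (P.gci * (P.Hc i)ᵀ)) * (s • P.Jc)
      - (s • P.Jc) * (P.lc i + half (BasicRing W) • (P.gci * (P.Hc i)ᵀ)) = 0 := by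
    rw [Matrix.map_derivation_real_smul, Matrix.mul_smul, Matrix.smul_mul, ← smul_add, ← smul_sub,
      key, smul_zero]
  generalize P.lc i + half (BasicRing W) • (P.gci * (P.Hc i)ᵀ) = Y at e key'
  have := congrArg (ev p) (congrFun (congrFun key' k) j)
  simp only [Matrix.sub_apply, map_sub, map_apply, Matrix.add_apply, mul_apply, map_sum, map_mul,
    Matrix.zero_apply, map_zero, map_add] at this
  rw [(eJ k j).pd i p, ← this]
  simp only [e, eJ _ _ p]
  congr 1
  exact Finset.sum_congr rfl fun _ _ => mul_comm _ _

theorem ricciForm_eq_zero (hg : ∀ p : W.carrier, g p = P.gc.map (ev p))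
    (hT : ∀ p : W.carrier, ∀ i, formMat₃ (T p) i = (P.Hc i).map (ev p))
    {J : (κ ⊕ κ → ℝ) → Matrix (κ ⊕ κ) (κ ⊕ κ) ℝ} {s : ℝ} (hs : s * s = 1)
    (hJ : ∀ p : W.carrier, J p = (s • P.Jc).map (ev p)) (hl : S.ell S.z = 0) (p : W.carrier)
    (i j : κ ⊕ κ) : ricciForm g J T p i j = 0 := by
  have hr := P.metricRep hg
  have h := hr.rep_ricciForm P.leviCivita hT hJ
    (by rw [Matrix.transpose_smul, Matrix.smul_mul, Matrix.smul_mul, Matrix.mul_smul, smul_smul, hs,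
      one_smul, P.Jc_hermitian])
    (by rw [Matrix.smul_mul, Matrix.mul_smul, smul_smul, hs, one_smul, P.Jc_sq]) i j p
  dsimp only at h
  rw [h]
  have e1 : (fun i => P.lc i + half (BasicRing W) • (P.gci * (P.Hc i)ᵀ))
      = coordConn (D (W := W)) P.TT P.EE (S.conn S.Y) := funext fun i => (P.coordConn_Y i).symm
  have e2 := trace_mul_curv_frame (D := D (W := W)) P.ET D_comm P.closed (J' := S.Jm) (Γ' := S.conn S.Y)
    (by rw [TT, P.der]; exact S.trace_Jm_curv hl) i j
  rw [e1, Matrix.smul_mul, Matrix.trace_smul, Jc, e2]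
  simp

variable {φ : (κ ⊕ κ → ℝ) → ℝ} {F : (κ ⊕ κ → ℝ) → DForm (κ ⊕ κ) 2} {q : ℝ}

theorem Fc_sq : P.Fc q * P.gci * (P.Fc q)ᵀ = P.EEᵀ * (S.Fm q * S.Gmi * (S.Fm q)ᵀ) * P.EE := by
  calc P.Fc q * P.gci * (P.Fc q)ᵀ
      = P.EEᵀ * S.Fm q * (P.EE * P.TT) * S.Gmi * (P.TTᵀ * P.EEᵀ) * (S.Fm q)ᵀ * P.EE := by
        simp only [Fc, gci, Matrix.transpose_mul, Matrix.transpose_transpose]; noncomm_ring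
    _ = _ := by rw [P.ET, P.TE_transpose]; noncomm_ring

theorem Hc_sq (i j : κ ⊕ κ) : (P.gci * P.Hc i * P.gci * (P.Hc j)ᵀ).trace
    = (P.EEᵀ * S.HH * P.EE) i j := by
  have h1 : ∀ a b, (P.gci * (P.EEᵀ * S.Hm a * P.EE) * P.gci * (P.EEᵀ * S.Hm b * P.EE)ᵀ).trace
      = S.HH a b := by
    intro a b
    have e : (P.EEᵀ * S.Hm b * P.EE)ᵀ = P.EEᵀ * (S.Hm b)ᵀ * P.EE := by
      rw [Matrix.transpose_mul, Matrix.transpose_mul, Matrix.transpose_transpose, Matrix.mul_assoc]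
    rw [e, gci, inv_mul_conj P.ET, Matrix.mul_assoc (P.TT * (S.Gmi * S.Hm a) * P.EE),
      inv_mul_conj P.ET, mul_conj P.ET, trace_conj_frame P.ET, HH, ← Matrix.mul_assoc]
  simp only [Hc, Matrix.transpose_sum, Matrix.transpose_smul, Matrix.mul_sum, Matrix.sum_mul,
    Matrix.mul_smul, Matrix.smul_mul, Matrix.trace_sum, Matrix.trace_smul, h1, smul_eq_mul,
    mul_apply, transpose_apply, Finset.mul_sum]
  refine Finset.sum_congr rfl fun b _ => ?_
  rw [Finset.sum_mul]
  exact Finset.sum_congr rfl fun a _ => by ring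

theorem ric_eq : ricMat (curvMat (D (W := W)) P.lc)
    = P.EEᵀ * ricMat (curvMat S.fder (S.conn S.dG)) * P.EE := by
  have := coordConn_ric (D (W := W)) P.ET D_comm P.closed (S.conn S.dG)
  have hd := P.der
  rw [TT, hd, ← TT] at this
  exact this

theorem hess_eq (f : BasicRing W) : hessMat (D (W := W)) P.lc f
    = P.EEᵀ * hessMat S.fder (S.conn S.dG) f * P.EE := by
  have := coordConn_hess (D (W := W)) P.ET (S.conn S.dG) f
  have hd := P.der
  rw [TT, hd, ← TT] at this
  exact this

theorem einstein (hq : S.c = S.a * q ^ 2) (hg : ∀ p : W.carrier, g p = P.gc.map (ev p))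
    (hφ : Rep φ S.phi) (hF : ∀ p : W.carrier, formMat (F p) = (P.Fc q).map (ev p))
    (hT : ∀ p : W.carrier, ∀ i, formMat₃ (T p) i = (P.Hc i).map (ev p)) (p : W.carrier)
    (a b : κ ⊕ κ) :
    ricci g p a b - hessian g φ p a b - sqTwo (g p) (F p) a b
      - (1 / 4) * sqThree (g p) (T p) a b = 0 := by
  have hr := P.metricRep hg
  have h1 := hr.rep_ricci P.leviCivita a b p
  have h2 := hr.rep_hessian P.leviCivita hφ a b p
  have h3 := hr.rep_sqTwo hF a b p
  have h4 := hr.rep_sqThree hT a b p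
  dsimp only at h1 h2 h3 h4
  rw [h1, h2, h3, h4, P.Hc_sq, P.ric_eq, P.hess_eq, P.Fc_sq]
  have key : P.EEᵀ * ricMat (curvMat S.fder (S.conn S.dG)) * P.EE
      - P.EEᵀ * hessMat S.fder (S.conn S.dG) S.phi * P.EE
      - P.EEᵀ * (S.Fm q * S.Gmi * (S.Fm q)ᵀ) * P.EE
      - (half (BasicRing W) * half (BasicRing W)) • (P.EEᵀ * S.HH * P.EE) = 0 := by
    rw [← Matrix.smul_mul, ← Matrix.mul_smul, ← Matrix.sub_mul, ← Matrix.sub_mul,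
      ← Matrix.sub_mul, ← Matrix.mul_sub, ← Matrix.mul_sub, ← Matrix.mul_sub, S.einstein_frame hq]
    simp
  have := congrArg (ev p) (congrFun (congrFun key a) b)
  simp only [Matrix.sub_apply, Matrix.smul_apply, smul_eq_mul, map_sub, map_mul, half,
    ev_algebraMap, Matrix.zero_apply, map_zero] at this
  linarith

theorem dilaton (hq : S.c = S.a * q ^ 2) (hg : ∀ p : W.carrier, g p = P.gc.map (ev p))
    (hφ : Rep φ S.phi) (hF : ∀ p : W.carrier, formMat (F p) = (P.Fc q).map (ev p))
    (hT : ∀ p : W.carrier, ∀ i, formMat₃ (T p) i = (P.Hc i).map (ev p)) (p : W.carrier) :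
    gtrace (g p) (fun a b => pd a φ p * pd b φ p) + 2 * gtrace (g p) (hessian g φ p)
      + (1 / 2) * gtrace (g p) (sqTwo (g p) (F p))
      + (1 / 12) * gtrace (g p) (sqThree (g p) (T p))
      - gtrace (g p) (ricci g p) = 0 := by
  have hr := P.metricRep hg
  have hd := P.der
  have e0 : (Matrix.of fun a b => D a S.phi * D b S.phi)
      = P.EEᵀ * (Matrix.of fun a b => S.fder a S.phi * S.fder b S.phi) * P.EE := by
    refine Matrix.ext fun i j => ?_
    rw [← hd, Matrix.of_apply, frameDer_inv (D (W := W)) P.TE i, frameDer_inv (D (W := W)) P.TE j]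
    simp only [mul_apply, transpose_apply, Matrix.of_apply, TT, Finset.sum_mul, Finset.mul_sum]
    exact Finset.sum_congr rfl fun _ _ => Finset.sum_congr rfl fun _ _ => by ring
  have h0 := hr.rep_gtrace (S := fun p a b => pd a φ p * pd b φ p)
    (M := Matrix.of fun a b => D a S.phi * D b S.phi)
    (fun a b p => by rw [Matrix.of_apply, map_mul, ← hφ.pd a p, ← hφ.pd b p]) p
  have h1 := hr.rep_gtrace (S := ricci g) (fun a b => hr.rep_ricci P.leviCivita a b) p
  have h2 := hr.rep_gtrace (S := hessian g φ) (fun a b => hr.rep_hessian P.leviCivita hφ a b) p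
  have h3 := hr.rep_gtrace (S := fun p => sqTwo (g p) (F p)) (fun a b => hr.rep_sqTwo hF a b) p
  have h4 := hr.rep_gtrace (S := fun p => sqThree (g p) (T p)) (M := P.EEᵀ * S.HH * P.EE)
    (fun a b => by rw [← P.Hc_sq]; exact hr.rep_sqThree hT a b) p
  dsimp only at h0 h1 h2 h3 h4
  have tf := fun {X X' : Matrix (κ ⊕ κ) (κ ⊕ κ) (BasicRing W)} (h : X = P.EEᵀ * X' * P.EE) =>
    trace_frame (ginv := P.gci) P.ET rfl h
  rw [h0, h1, h2, h3, h4, tf e0, tf P.ric_eq, tf (P.hess_eq _), tf P.Fc_sq, tf rfl]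
  have := congrArg (ev p) (S.dilaton_frame hq)
  simpa only [map_add, map_sub, map_mul, ev_algebraMap, map_ofNat, map_zero] using this

variable {N : ℕ}

theorem threeForm (hg : ∀ p : W.carrier, g p = P.gc.map (ev p))
    (hpos : ∀ p ∈ W.carrier, 0 < (g p).det) (hφ : Rep φ S.phi)
    (hT : ∀ p : W.carrier, ∀ i, formMat₃ (T p) i = (P.Hc i).map (ev p)) (o : Fin N ≃ κ ⊕ κ) (m : ℕ)
    (hm : 3 + m = N) (p : W.carrier) :
    extDeriv (fun p => Real.exp (φ p) • hodgeStar o hm (g p) (T p)) p = 0 :=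
  (P.metricRep hg).extDeriv_star_three hpos hφ hT
    (fun b c => S.threeForm_divergence (D (W := W)) P.inv P.der P.closed rfl rfl (fun _ => rfl) b c) o hm p

theorem maxwell (hg : ∀ p : W.carrier, g p = P.gc.map (ev p))
    (hpos : ∀ p ∈ W.carrier, 0 < (g p).det) (hφ : Rep φ S.phi)
    (hF : ∀ p : W.carrier, formMat (F p) = (P.Fc q).map (ev p))
    (hT : ∀ p : W.carrier, ∀ i, formMat₃ (T p) i = (P.Hc i).map (ev p)) (o : Fin N ≃ κ ⊕ κ) (m : ℕ)
    (hm' : 2 + (m + 1) = N) (hm : 3 + m = N) (p : W.carrier) :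
    extDeriv (fun p => Real.exp (φ p) • hodgeStar o hm' (g p) (F p)) p
      = Real.exp (φ p) • wedge (hodgeStar o hm (g p) (T p)) (F p) :=
  (P.metricRep hg).extDeriv_star_two hpos hφ hF hT
    (fun c => S.maxwell_divergence (D (W := W)) P.inv P.der P.closed rfl rfl q rfl (fun _ => rfl) c) o hm' hm p

end Frame

end BoostData

end BoostGeometry

end

/-! ### Elementary symmetric polynomials -/

noncomputable section

section ElementarySymmetric

variable {R κ : Type*} [CommRing R] [DecidableEq κ]

/-- The elementary symmetric polynomial of degree `k` in the `y ν`, `ν ∈ s`. -/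
def esym (y : κ → R) (s : Finset κ) (k : ℕ) : R := ∑ t ∈ s.powersetCard k, ∏ ν ∈ t, y ν

theorem esym_zero (y : κ → R) (s : Finset κ) : esym y s 0 = 1 := by simp [esym]

theorem esym_insert (y : κ → R) {s : Finset κ} {a : κ} (ha : a ∉ s) (k : ℕ) :
    esym y (insert a s) (k + 1) = esym y s (k + 1) + y a * esym y s k := by
  have hd : Disjoint (s.powersetCard (k + 1)) ((s.powersetCard k).image (insert a)) := by
    rw [Finset.disjoint_left]
    intro t ht ht'
    obtain ⟨t', _, rfl⟩ := Finset.mem_image.mp ht'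
    exact ha ((Finset.mem_powersetCard.mp ht).1 (Finset.mem_insert_self a t'))
  rw [esym, Finset.powersetCard_succ_insert ha, Finset.sum_union hd, Finset.sum_image]
  · rw [esym, esym, Finset.mul_sum]
    congr 1
    refine Finset.sum_congr rfl fun t ht => ?_
    rw [Finset.prod_insert fun h => ha ((Finset.mem_powersetCard.mp ht).1 h)]
  · intro t ht t' ht' h
    have hn : ∀ t ∈ s.powersetCard k, a ∉ t := fun t ht h' =>
      ha ((Finset.mem_powersetCard.mp ht).1 h')
    rw [← Finset.erase_insert (hn t ht), h, Finset.erase_insert (hn t' ht')]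

theorem esym_erase (y : κ → R) {s : Finset κ} {a : κ} (ha : a ∈ s) (k : ℕ) :
    esym y s (k + 1) = esym y (s.erase a) (k + 1) + y a * esym y (s.erase a) k := by
  conv_lhs => rw [← Finset.insert_erase ha]
  exact esym_insert y (Finset.notMem_erase a s) k

theorem esym_eq_zero (y : κ → R) {s : Finset κ} {k : ℕ} (h : s.card < k) : esym y s k = 0 := by
  rw [esym, Finset.powersetCard_eq_empty.mpr h, Finset.sum_empty]

/-- Vieta's formula. -/
theorem prod_sub_eq_sum_esym (y : κ → R) (s : Finset κ) (t : R) :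
    ∏ ν ∈ s, (t - y ν) = ∑ k ∈ Finset.range (s.card + 1), (-1) ^ k * t ^ (s.card - k) * esym y s k := by
  have h1 : ∏ ν ∈ s, (t - y ν) = ∏ ν ∈ s, (-y ν + t) :=
    Finset.prod_congr rfl fun _ _ => by ring
  rw [h1, Finset.prod_add, Finset.sum_powerset]
  refine Finset.sum_congr rfl fun k _ => ?_
  rw [esym, Finset.mul_sum]
  refine Finset.sum_congr rfl fun r hr => ?_
  obtain ⟨hrs, hrk⟩ := Finset.mem_powersetCard.mp hr
  rw [Finset.prod_neg, Finset.prod_const, Finset.card_sdiff_of_subset hrs, hrk]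
  ring

variable [Algebra ℝ R]

theorem Derivation.map_esym (d : Derivation ℝ R R) (y : κ → R) (s : Finset κ) (k : ℕ) :
    d (esym y s (k + 1)) = ∑ ν ∈ s, d (y ν) * esym y (s.erase ν) k := by
  induction s using Finset.induction_on generalizing k with
  | empty => rw [esym_eq_zero y (by simp)]; simp
  | insert a s ha ih =>
    rw [esym_insert y ha, map_add, Derivation.leibniz, ih, Finset.sum_insert ha,
      Finset.erase_insert ha, smul_eq_mul, smul_eq_mul]
    have hne : ∀ ν ∈ s, a ≠ ν := fun ν hν h => ha (h ▸ hν)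
    have h1 : ∑ ν ∈ s, d (y ν) * esym y ((insert a s).erase ν) k
        = ∑ ν ∈ s, d (y ν) * esym y (s.erase ν) k + y a * d (esym y s k) := by
      rcases k with _ | k
      · simp only [esym_zero, Derivation.map_one_eq_zero, mul_zero, add_zero]
      · rw [ih, Finset.mul_sum, ← Finset.sum_add_distrib]
        refine Finset.sum_congr rfl fun ν hν => ?_
        rw [Finset.erase_insert_of_ne (hne ν hν),
          esym_insert y fun h => ha (Finset.mem_of_mem_erase h)]
        ring
    rw [h1]; ring

end ElementarySymmetric

/-! ### Separable coordinates and partial fractions -/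

section Separable

open Matrix

/-- Coordinates `x_μ` with inverses of `x_μ` and of `∏ (x_μ² - x_ν²)`, and the derivations
`∂_μ`. -/
structure SepCoords (n : ℕ) (R : Type*) [CommRing R] [Algebra ℝ R] where
  x : Fin n → R
  xi : Fin n → R
  x_mul : ∀ μ, x μ * xi μ = 1
  ui : Fin n → R
  u_mul : ∀ μ, (∏ ν ∈ Finset.univ.erase μ, (x μ ^ 2 - x ν ^ 2)) * ui μ = 1
  pd : Fin n → Derivation ℝ R R
  pd_x : ∀ μ ν, pd μ (x ν) = if μ = ν then 1 else 0

namespace SepCoords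

variable {n : ℕ} {R : Type*} [CommRing R] [Algebra ℝ R] (C : SepCoords n R)

def y (μ : Fin n) : R := C.x μ ^ 2

def u (μ : Fin n) : R := ∏ ν ∈ Finset.univ.erase μ, (C.y μ - C.y ν)

/-- The symmetric polynomials of the `y ν`, `ν ≠ μ`. -/
def sig : Matrix (Fin n) (Fin n) R := fun μ k => esym C.y (Finset.univ.erase μ) k

/-- The symmetric polynomials of all `y ν`. -/
def e (k : ℕ) : R := esym C.y Finset.univ k

theorem u_mul_ui (μ : Fin n) : C.u μ * C.ui μ = 1 := C.u_mul μ

theorem pd_y (μ ν : Fin n) : C.pd μ (C.y ν) = if μ = ν then 2 * C.x μ else 0 := by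
  rw [y, sq, Derivation.leibniz, pd_x, smul_eq_mul]
  split_ifs with h
  · subst h; ring
  · ring

/-- The inverse of the matrix `sig`. -/
def sigInv : Matrix (Fin n) (Fin n) R :=
  fun k μ => (-1) ^ (k : ℕ) * C.y μ ^ (n - 1 - k) * C.ui μ

theorem sum_sig (μ : Fin n) (t : R) :
    ∑ k : Fin n, (-1) ^ (k : ℕ) * t ^ (n - 1 - k) * C.sig μ k
      = ∏ ν ∈ Finset.univ.erase μ, (t - C.y ν) := by
  have hc : (Finset.univ.erase μ).card = n - 1 := by
    rw [Finset.card_erase_of_mem (Finset.mem_univ μ), Finset.card_fin]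
  have hn : n - 1 + 1 = n := Nat.sub_add_cancel (Nat.one_le_of_lt μ.2)
  rw [prod_sub_eq_sum_esym, hc, hn, Finset.sum_range]
  rfl

/-- Lagrange interpolation: row μ paired with signed powers of t is ∏_{ν≠μ}(t − y_ν), which at t =
y_μ is U_μ and at every other y_ν is zero. -/
theorem sig_mul_sigInv : C.sig * C.sigInv = 1 := by
  ext μ ν
  have h1 : (C.sig * C.sigInv) μ ν
      = (∑ k : Fin n, (-1) ^ (k : ℕ) * C.y ν ^ (n - 1 - k) * C.sig μ k) * C.ui ν := by
    rw [mul_apply, Finset.sum_mul]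
    exact Finset.sum_congr rfl fun k _ => by rw [sigInv]; ring
  rw [h1, sum_sig, Matrix.one_apply]
  split_ifs with h
  · subst h; exact C.u_mul_ui μ
  · rw [Finset.prod_eq_zero (Finset.mem_erase.mpr ⟨fun h' => h h'.symm, Finset.mem_univ ν⟩)
      (sub_self _), zero_mul]

theorem sigInv_mul_sig : C.sigInv * C.sig = 1 := mul_eq_one_comm.mp C.sig_mul_sigInv

/-- Row n − 1 − j of the identity σ⁻¹σ = 1. -/
theorem sum_pow_mul_sig (j : ℕ) (hj : j < n) (l : Fin n) :
    ∑ μ, C.y μ ^ j * C.ui μ * C.sig μ l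
      = if n - 1 - j = (l : ℕ) then (-1) ^ (l : ℕ) else 0 := by
  have h := congrFun (congrFun C.sigInv_mul_sig ⟨n - 1 - j, by omega⟩) l
  have e : n - 1 - (n - 1 - j) = j := by omega
  simp only [mul_apply, sigInv, e, Matrix.one_apply, Fin.ext_iff] at h
  have h2 : ∑ μ, C.y μ ^ j * C.ui μ * C.sig μ l = (-1) ^ (n - 1 - j) *
      ∑ μ, (-1) ^ (n - 1 - j) * C.y μ ^ j * C.ui μ * C.sig μ l := by
    rw [Finset.mul_sum]
    refine Finset.sum_congr rfl fun μ _ => ?_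
    have : ((-1 : R) ^ (n - 1 - j)) * (-1) ^ (n - 1 - j) = 1 := by
      rw [← mul_pow]; simp
    linear_combination (-(C.y μ ^ j * C.ui μ * C.sig μ l)) * this
  rw [h2, h]
  split_ifs with h'
  · rw [h', mul_one]
  · rw [mul_zero]

/-- Vieta's formula at the root y_μ of ∏(t − y_ν). -/
theorem y_pow (μ : Fin n) :
    C.y μ ^ n = ∑ k : Fin n, (-1) ^ (k : ℕ) * C.y μ ^ (n - 1 - k) * C.e (k + 1) := by
  have h := prod_sub_eq_sum_esym C.y Finset.univ (C.y μ)
  rw [Finset.prod_eq_zero (Finset.mem_univ μ) (sub_self _), Finset.card_fin,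
    Finset.sum_range_succ', Finset.sum_range] at h
  simp only [pow_zero, Nat.sub_zero, esym_zero, one_mul, mul_one] at h
  have h2 : ∑ k : Fin n, (-1) ^ ((k : ℕ) + 1) * C.y μ ^ (n - (k + 1)) * esym C.y Finset.univ (k + 1)
      = -∑ k : Fin n, (-1) ^ (k : ℕ) * C.y μ ^ (n - 1 - k) * C.e (k + 1) := by
    rw [← Finset.sum_neg_distrib]
    refine Finset.sum_congr rfl fun k _ => ?_
    rw [show n - ((k : ℕ) + 1) = n - 1 - k by omega, e]; ring
  rw [h2] at h
  linear_combination -h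

theorem sum_pow_n_mul_sig (l : Fin n) : ∑ μ, C.y μ ^ n * C.ui μ * C.sig μ l = C.e (l + 1) := by
  have h1 : ∀ μ, C.y μ ^ n * C.ui μ * C.sig μ l
      = ∑ k : Fin n, C.e (k + 1) * (C.sigInv k μ * C.sig μ l) := by
    intro μ
    rw [y_pow, Finset.sum_mul, Finset.sum_mul]
    exact Finset.sum_congr rfl fun k _ => by rw [sigInv]; ring
  simp only [h1]
  rw [Finset.sum_comm]
  have h2 : ∀ k, ∑ μ, C.sigInv k μ * C.sig μ l = (1 : Matrix (Fin n) (Fin n) R) k l := fun k => by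
    rw [← C.sigInv_mul_sig, mul_apply]
  simp only [← Finset.mul_sum, h2, Matrix.one_apply, mul_ite, mul_one, mul_zero]
  simp

theorem sig_zero (h : 0 < n) (μ : Fin n) : C.sig μ ⟨0, h⟩ = 1 := esym_zero _ _

theorem pd_e (μ : Fin n) (k : Fin n) : C.pd μ (C.e (k + 1)) = 2 * C.x μ * C.sig μ k := by
  rw [e, Derivation.map_esym, Finset.sum_eq_single μ]
  · rw [pd_y, if_pos rfl]; rfl
  · intro ν _ h; rw [pd_y, if_neg h.symm, zero_mul]
  · simp

theorem pd_sig_self (μ : Fin n) (k : Fin n) : C.pd μ (C.sig μ k) = 0 := by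
  rw [sig]
  rcases hk : (k : ℕ) with _ | j
  · rw [esym_zero, Derivation.map_one_eq_zero]
  · rw [Derivation.map_esym]
    refine Finset.sum_eq_zero fun ν hν => ?_
    rw [pd_y, if_neg (Finset.ne_of_mem_erase hν).symm, zero_mul]

/-- Let s_j denote the symmetric polynomials without y_μ and y_ν. For μ ≠ ν, σ_νk = s_k + y_μ
s_{k−1} and σ_μk = s_k + y_ν s_{k−1}, so their difference is (y_μ − y_ν)s_{k−1}, while ∂_μσ_νk =
2x_μ s_{k−1}. -/
theorem pd_sig (μ ν : Fin n) (k : Fin n) :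
    (C.y μ - C.y ν) * C.pd μ (C.sig ν k) = 2 * C.x μ * (C.sig ν k - C.sig μ k) := by
  by_cases h : μ = ν
  · subst h; simp
  have hμ : μ ∈ Finset.univ.erase ν := Finset.mem_erase.mpr ⟨h, Finset.mem_univ _⟩
  have hν : ν ∈ Finset.univ.erase μ := Finset.mem_erase.mpr ⟨Ne.symm h, Finset.mem_univ _⟩
  simp only [sig]
  rcases hk : (k : ℕ) with _ | j
  · simp only [esym_zero, Derivation.map_one_eq_zero]; ring
  · rw [Derivation.map_esym, Finset.sum_eq_single_of_mem μ hμ, pd_y, if_pos rfl,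
      esym_erase C.y hμ, esym_erase C.y hν, Finset.erase_right_comm]
    · ring
    · intro ρ _ hρ; rw [pd_y, if_neg hρ.symm, zero_mul]

/-- The inverse of `y_μ - y_ν`. -/
def di (μ ν : Fin n) : R := C.ui μ * ∏ ρ ∈ (Finset.univ.erase μ).erase ν, (C.y μ - C.y ρ)

theorem di_mul {μ ν : Fin n} (h : μ ≠ ν) : (C.y μ - C.y ν) * C.di μ ν = 1 := by
  have hν : ν ∈ Finset.univ.erase μ := Finset.mem_erase.mpr ⟨h.symm, Finset.mem_univ _⟩
  have h1 := C.u_mul_ui μ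
  rw [u, ← Finset.mul_prod_erase _ _ hν] at h1
  rw [di]; linear_combination h1

theorem di_symm {μ ν : Fin n} (h : μ ≠ ν) : C.di ν μ = -C.di μ ν := by
  linear_combination (-C.di μ ν) * C.di_mul h.symm - C.di ν μ * C.di_mul h

theorem pd_ui (d : Derivation ℝ R R) (μ : Fin n) :
    d (C.ui μ) = -(C.ui μ * ∑ ν ∈ Finset.univ.erase μ, (d (C.y μ) - d (C.y ν)) * C.di μ ν) := by
  have h1 : d (C.u μ * C.ui μ) = 0 := by rw [u_mul_ui, Derivation.map_one_eq_zero]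
  have h2 : C.ui μ * d (C.u μ)
      = ∑ ν ∈ Finset.univ.erase μ, (d (C.y μ) - d (C.y ν)) * C.di μ ν := by
    rw [u, Derivation.leibniz_finset_prod, Finset.mul_sum]
    exact Finset.sum_congr rfl fun ν _ => by rw [map_sub, di]; ring
  rw [Derivation.leibniz, smul_eq_mul, smul_eq_mul] at h1
  rw [← h2]
  linear_combination C.ui μ * h1 - d (C.ui μ) * C.u_mul_ui μ

theorem pd_ui_ne {μ ν : Fin n} (h : μ ≠ ν) :
    C.pd μ (C.ui ν) = -(2 * C.x μ * C.ui ν * C.di μ ν) := by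
  rw [pd_ui, Finset.sum_eq_single_of_mem μ (Finset.mem_erase.mpr ⟨h, Finset.mem_univ _⟩)]
  · rw [pd_y, pd_y, if_neg h, if_pos rfl, C.di_symm h]; ring
  · intro ρ _ hρ
    rw [pd_y, pd_y, if_neg h, if_neg hρ.symm]; ring

theorem pd_ui_self (μ : Fin n) :
    C.pd μ (C.ui μ) = -(2 * C.x μ * C.ui μ * ∑ ν ∈ Finset.univ.erase μ, C.di μ ν) := by
  rw [pd_ui, Finset.mul_sum, Finset.mul_sum]
  congr 1
  refine Finset.sum_congr rfl fun ν hν => ?_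
  rw [pd_y, pd_y, if_pos rfl, if_neg (Finset.ne_of_mem_erase hν).symm]; ring

theorem pd_sig_ne {μ ν : Fin n} (h : μ ≠ ν) (k : Fin n) :
    C.pd μ (C.sig ν k) = 2 * C.x μ * C.di μ ν * (C.sig ν k - C.sig μ k) := by
  linear_combination C.di μ ν * C.pd_sig μ ν k - C.pd μ (C.sig ν k) * C.di_mul h

/-- Functions of the single variable `x_ν`, one for each `ν`. -/
def IsSeparated (f : Fin n → R) : Prop := ∀ μ ν, μ ≠ ν → C.pd μ (f ν) = 0

theorem isSeparated_x : C.IsSeparated C.x := fun μ ν h => by rw [pd_x, if_neg h]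

theorem isSeparated_y : C.IsSeparated C.y := fun μ ν h => by rw [pd_y, if_neg h]

variable {C} in
theorem IsSeparated.of_inv {f g : Fin n → R} (hf : C.IsSeparated f) (h : ∀ ν, f ν * g ν = 1) :
    C.IsSeparated g := fun μ ν hμ => by
  have h1 : C.pd μ (f ν * g ν) = 0 := by rw [h, Derivation.map_one_eq_zero]
  rw [Derivation.leibniz, hf μ ν hμ, smul_zero, add_zero, smul_eq_mul] at h1
  linear_combination g ν * h1 - C.pd μ (g ν) * h ν

variable {C} in
-- For μ ≠ ν, differentiating 1/U_ν contributes −σ_ν and differentiating σ_ν contributes σ_ν − σ_μ,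
-- both with the factor 2x_μ f_ν/(U_ν(y_μ − y_ν)). The sum is a multiple of σ_μ.
theorem IsSeparated.pd_ui_sig {f : Fin n → R} (hf : C.IsSeparated f) (μ ν k : Fin n) :
    C.pd μ (f ν * C.ui ν * C.sig ν k) = C.pd μ (f ν * C.ui ν) * C.sig μ k := by
  by_cases h : μ = ν
  · subst h
    rw [Derivation.leibniz, pd_sig_self, smul_zero, zero_add, smul_eq_mul, mul_comm]
  · have e : C.pd μ (f ν * C.ui ν) = -(2 * C.x μ * f ν * C.ui ν * C.di μ ν) := by
      rw [Derivation.leibniz, hf μ ν h, C.pd_ui_ne h, smul_eq_mul, smul_eq_mul]; ring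
    rw [Derivation.leibniz, e, C.pd_sig_ne h, smul_eq_mul, smul_eq_mul]; ring

variable {C} in
/-- `∂_μ ∑ (f/U) σ = σ_μ ∂_μ ∑ f/U`. -/
theorem IsSeparated.pd_sum {f : Fin n → R} (hf : C.IsSeparated f) (μ k : Fin n) :
    C.pd μ (∑ ν, f ν * C.ui ν * C.sig ν k) = C.pd μ (∑ ν, f ν * C.ui ν) * C.sig μ k := by
  simp only [map_sum, hf.pd_ui_sig, Finset.sum_mul]

/-- The sum of derivatives appearing in the trace of the logarithmic derivative of the metric. -/
theorem sum_sigInv_pd {f f' : Fin n → R} (hf : C.IsSeparated f)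
    (hf' : ∀ μ, C.pd μ (f μ) = 2 * C.x μ * f' μ) (k : Fin n) :
    ∑ μ, C.xi μ * ∑ j, C.sigInv j μ * C.pd μ (∑ ν, f ν * C.ui ν * C.sig ν j * C.sig ν k)
      = 2 * ∑ μ, f' μ * C.ui μ * C.sig μ k := by
  have hs : ∀ μ ν, ∑ j, C.sigInv j μ * C.sig ν j = if ν = μ then 1 else 0 := by
    intro μ ν
    have := congrFun (congrFun C.sig_mul_sigInv ν) μ
    rw [mul_apply, Matrix.one_apply] at this
    rw [← this]
    exact Finset.sum_congr rfl fun _ _ => mul_comm _ _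
  set w : Fin n → R := fun ν => f ν * C.ui ν * C.sig ν k with hw
  -- Contraction with σ⁻¹ leaves the diagonal term and, for ν ≠ μ, the term in which ∂_μ acts on
  -- σ_ν.
  have h1 : ∀ μ ν, ∑ j, C.sigInv j μ * C.pd μ (f ν * C.ui ν * C.sig ν j * C.sig ν k)
      = if ν = μ then C.pd μ (w μ) else -(2 * C.x μ * C.di μ ν * w ν) := by
    intro μ ν
    have e : ∀ j, C.sigInv j μ * C.pd μ (f ν * C.ui ν * C.sig ν j * C.sig ν k)
        = C.pd μ (w ν) * (C.sigInv j μ * C.sig ν j) + w ν * (C.sigInv j μ * C.pd μ (C.sig ν j)) := by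
      intro j
      rw [show f ν * C.ui ν * C.sig ν j * C.sig ν k = w ν * C.sig ν j by rw [hw]; ring,
        Derivation.leibniz, smul_eq_mul, smul_eq_mul]
      ring
    simp only [e, Finset.sum_add_distrib, ← Finset.mul_sum, hs]
    by_cases h : ν = μ
    · subst h; simp [pd_sig_self]
    · have e2 : ∑ j, C.sigInv j μ * C.pd μ (C.sig ν j)
          = 2 * C.x μ * C.di μ ν * (∑ j, C.sigInv j μ * C.sig ν j
            - ∑ j, C.sigInv j μ * C.sig μ j) := by
        rw [← Finset.sum_sub_distrib, Finset.mul_sum]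
        exact Finset.sum_congr rfl fun j _ => by rw [C.pd_sig_ne (Ne.symm h)]; ring
      rw [e2, hs, hs, if_neg h, if_neg h, if_pos rfl]; ring
  have h2 : ∀ μ, ∑ j, C.sigInv j μ * C.pd μ (∑ ν, f ν * C.ui ν * C.sig ν j * C.sig ν k)
      = 2 * C.x μ * (f' μ * C.ui μ * C.sig μ k)
        - 2 * C.x μ * ∑ ν ∈ Finset.univ.erase μ, C.di μ ν * w μ
        - 2 * C.x μ * ∑ ν ∈ Finset.univ.erase μ, C.di μ ν * w ν := by
    intro μ
    simp only [map_sum, Finset.mul_sum]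
    rw [Finset.sum_comm]
    simp only [h1]
    rw [← Finset.add_sum_erase _ _ (Finset.mem_univ μ), if_pos rfl]
    have e3 : ∑ ν ∈ Finset.univ.erase μ,
        (if ν = μ then C.pd μ (w μ) else -(2 * C.x μ * C.di μ ν * w ν))
        = -∑ ν ∈ Finset.univ.erase μ, 2 * C.x μ * (C.di μ ν * w ν) := by
      rw [← Finset.sum_neg_distrib]
      refine Finset.sum_congr rfl fun ν hν => ?_
      rw [if_neg (Finset.ne_of_mem_erase hν)]; ring
    have e4 : C.pd μ (w μ) = 2 * C.x μ * (f' μ * C.ui μ * C.sig μ k)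
        - ∑ ν ∈ Finset.univ.erase μ, 2 * C.x μ * (C.di μ ν * w μ) := by
      rw [hw]
      dsimp only
      rw [hf.pd_ui_sig, Derivation.leibniz, hf', C.pd_ui_self, smul_eq_mul, smul_eq_mul]
      have : ∑ ν ∈ Finset.univ.erase μ, 2 * C.x μ * (C.di μ ν * (f μ * C.ui μ * C.sig μ k))
          = 2 * C.x μ * (∑ ν ∈ Finset.univ.erase μ, C.di μ ν) * (f μ * C.ui μ * C.sig μ k) := by
        rw [Finset.mul_sum, Finset.sum_mul]
        exact Finset.sum_congr rfl fun _ _ => by ring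
      rw [this]; ring
    rw [e3, e4, sub_eq_add_neg (_ - _)]
  -- 1/(y_μ − y_ν) is antisymmetric, so the two double sums cancel.
  have h3 : ∑ μ, ∑ ν ∈ Finset.univ.erase μ, C.di μ ν * w ν
      = -∑ μ, ∑ ν ∈ Finset.univ.erase μ, C.di μ ν * w μ := by
    rw [Finset.sum_comm' (t' := Finset.univ) (s' := fun ν => Finset.univ.erase ν)]
    · rw [← Finset.sum_neg_distrib]
      refine Finset.sum_congr rfl fun ν _ => ?_
      rw [← Finset.sum_neg_distrib]
      refine Finset.sum_congr rfl fun μ hμ => ?_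
      rw [C.di_symm (Finset.ne_of_mem_erase hμ).symm]; ring
    · intro μ ν; simp [ne_comm]
  have h4 : ∀ μ, C.xi μ * (2 * C.x μ * (f' μ * C.ui μ * C.sig μ k)
        - 2 * C.x μ * ∑ ν ∈ Finset.univ.erase μ, C.di μ ν * w μ
        - 2 * C.x μ * ∑ ν ∈ Finset.univ.erase μ, C.di μ ν * w ν)
      = 2 * (f' μ * C.ui μ * C.sig μ k - ∑ ν ∈ Finset.univ.erase μ, C.di μ ν * w μ
        - ∑ ν ∈ Finset.univ.erase μ, C.di μ ν * w ν) := fun μ => by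
    linear_combination 2 * (f' μ * C.ui μ * C.sig μ k - ∑ ν ∈ Finset.univ.erase μ, C.di μ ν * w μ
        - ∑ ν ∈ Finset.univ.erase μ, C.di μ ν * w ν) * C.x_mul μ
  simp only [h2, h4]
  rw [← Finset.mul_sum, Finset.sum_sub_distrib, Finset.sum_sub_distrib, h3]
  ring

end SepCoords

end Separable

end

/-! ### The family as boost data -/

noncomputable section

section SeparableBoost

open Matrix

/-- The ring data of the family with `f_μ = 2 x_μ`. -/
structure SepBoost (n : ℕ) (R : Type*) [CommRing R] [Algebra ℝ R] extends SepCoords n R where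
  two_le : 2 ≤ n
  pd_comm : ∀ i j f, pd i (pd j f) = pd j (pd i f)
  a : ℝ
  b : ℕ → ℝ
  c : ℕ → ℝ
  m : Fin n → ℝ
  b_top : b n = a * c n
  Pi : Fin n → R
  P_mul : ∀ μ, (∑ k ∈ Finset.Icc 1 n, algebraMap ℝ R (c k) * (x μ ^ 2) ^ k
    + algebraMap ℝ R (m μ)) * Pi μ = 1
  Phii : R
  Phi_mul_Phii : (1 + ∑ μ, (∑ k ∈ Finset.Icc 1 n, algebraMap ℝ R (b k) * (x μ ^ 2) ^ k
    + algebraMap ℝ R (a * m μ)) * ui μ) * Phii = 1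
  phi : R
  pd_phi : ∀ μ, pd μ phi = Phii * pd μ (∑ μ, (∑ k ∈ Finset.Icc 1 n, algebraMap ℝ R (b k) *
    (x μ ^ 2) ^ k + algebraMap ℝ R (a * m μ)) * ui μ)

namespace SepBoost

variable {n : ℕ} {R : Type*} [CommRing R] [Algebra ℝ R] (S : SepBoost n R)

/-- The polynomial `∑ c_k y^k` at `y_μ`. -/
def poly (c : ℕ → ℝ) (μ : Fin n) : R := ∑ k ∈ Finset.Icc 1 n, algebraMap ℝ R (c k) * S.y μ ^ k

/-- `4 x² X`. -/
def P (μ : Fin n) : R := S.poly S.c μ + algebraMap ℝ R (S.m μ)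

def Nf (μ : Fin n) : R := S.poly S.b μ + algebraMap ℝ R (S.a * S.m μ)

theorem P_mul_Pi (μ : Fin n) : S.P μ * S.Pi μ = 1 := S.P_mul μ

def Phi : R := 1 + ∑ μ, S.Nf μ * S.ui μ

theorem Phi_mul : S.Phi * S.Phii = 1 := S.Phi_mul_Phii

theorem pd_Phi (d : Derivation ℝ R R) : d S.Phi = d (∑ μ, S.Nf μ * S.ui μ) := by
  rw [Phi, map_add, Derivation.map_one_eq_zero, zero_add]

theorem pd_phi_eq (μ : Fin n) : S.pd μ S.phi = S.Phii * S.pd μ S.Phi := by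
  rw [pd_Phi]; exact S.pd_phi μ

theorem isSeparated_poly (c : ℕ → ℝ) : S.IsSeparated (S.poly c) := fun μ ν h => by
  rw [poly, map_sum]
  refine Finset.sum_eq_zero fun k _ => ?_
  rw [Derivation.leibniz, Derivation.map_algebraMap, Derivation.leibniz_pow,
    S.isSeparated_y μ ν h]
  simp

theorem isSeparated_add_const {f : Fin n → R} (hf : S.IsSeparated f) (r : Fin n → ℝ) :
    S.IsSeparated fun ν => f ν + algebraMap ℝ R (r ν) := fun μ ν h => by
  rw [map_add, hf μ ν h, Derivation.map_algebraMap, add_zero]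

theorem isSeparated_P : S.IsSeparated S.P := S.isSeparated_add_const (S.isSeparated_poly _) S.m

theorem isSeparated_N : S.IsSeparated S.Nf :=
  S.isSeparated_add_const (S.isSeparated_poly _) fun μ => S.a * S.m μ

theorem isSeparated_Pi : S.IsSeparated S.Pi := S.isSeparated_P.of_inv S.P_mul_Pi

/-- Only two powers contribute: y^(n−1−l), by `sum_pow_mul_sig`, and y^n, which gives e_{l+1}. For l
= n − 1 the first would be a constant term, which the polynomial does not have. -/
theorem sum_poly_sig (c : ℕ → ℝ) (l : Fin n) :
    ∑ μ, S.poly c μ * S.ui μ * S.sig μ l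
      = algebraMap ℝ R (if (l : ℕ) = n - 1 then 0 else (-1) ^ (l : ℕ) * c (n - 1 - l))
        + algebraMap ℝ R (c n) * S.e (l + 1) := by
  have hn := S.two_le
  have h1 : ∀ μ, S.poly c μ * S.ui μ * S.sig μ l
      = ∑ k ∈ Finset.Icc 1 n, algebraMap ℝ R (c k) * (S.y μ ^ k * S.ui μ * S.sig μ l) := by
    intro μ
    rw [poly, Finset.sum_mul, Finset.sum_mul]
    exact Finset.sum_congr rfl fun _ _ => by ring
  simp only [h1]
  rw [Finset.sum_comm]
  simp only [← Finset.mul_sum]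
  have hI : Finset.Icc 1 n = insert n (Finset.Icc 1 (n - 1)) := by
    ext k; simp only [Finset.mem_Icc, Finset.mem_insert]; omega
  rw [hI, Finset.sum_insert (by simp; omega), S.sum_pow_n_mul_sig, add_comm]
  congr 1
  have h2 : ∀ k ∈ Finset.Icc 1 (n - 1), algebraMap ℝ R (c k) * ∑ μ, S.y μ ^ k * S.ui μ * S.sig μ l
      = if k = n - 1 - l then algebraMap ℝ R ((-1) ^ (l : ℕ) * c (n - 1 - l)) else 0 := by
    intro k hk
    rw [Finset.mem_Icc] at hk
    rw [S.sum_pow_mul_sig k (by omega)]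
    have hl := l.2
    by_cases h : k = n - 1 - l
    · rw [if_pos (by omega), if_pos h, h, map_mul, map_pow, map_neg, map_one]; ring
    · rw [if_neg (by omega), if_neg h, mul_zero]
  rw [Finset.sum_congr rfl h2, Finset.sum_ite_eq' (Finset.Icc 1 (n - 1))]
  have hl := l.2
  by_cases h : (l : ℕ) = n - 1
  · rw [if_pos h, if_neg (by simp; omega), map_zero]
  · rw [if_neg h, if_pos (by simp; omega)]

/-- The index `0`. -/
def z : Fin n := ⟨0, by have := S.two_le; omega⟩

theorem sig_z (μ : Fin n) : S.sig μ S.z = 1 := S.sig_zero _ μ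

def h : Matrix (Fin n) (Fin n) R := fun k l => ∑ μ, S.P μ * S.ui μ * S.sig μ k * S.sig μ l

theorem h_eq : S.h = S.sigᵀ * Matrix.diagonal (fun μ => S.P μ * S.ui μ) * S.sig := by
  ext k l
  rw [h, mul_apply]
  exact Finset.sum_congr rfl fun μ _ => by rw [mul_diagonal, transpose_apply]; ring

def hi : Matrix (Fin n) (Fin n) R :=
  S.sigInv * Matrix.diagonal (fun μ => S.u μ * S.Pi μ) * S.sigInvᵀ

theorem hi_mul_h : S.hi * S.h = 1 := by
  have e1 : S.sigInvᵀ * S.sigᵀ = 1 := by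
    rw [← Matrix.transpose_mul, S.sig_mul_sigInv, Matrix.transpose_one]
  have e2 : Matrix.diagonal (fun μ => S.u μ * S.Pi μ) *
      Matrix.diagonal (fun μ => S.P μ * S.ui μ) = (1 : Matrix (Fin n) (Fin n) R) := by
    rw [diagonal_mul_diagonal, ← diagonal_one]
    congr 1; funext μ
    linear_combination S.P_mul_Pi μ * S.u μ * S.ui μ + S.u_mul_ui μ
  calc S.hi * S.h = S.sigInv * (Matrix.diagonal (fun μ => S.u μ * S.Pi μ) * (S.sigInvᵀ * S.sigᵀ) *
        Matrix.diagonal (fun μ => S.P μ * S.ui μ)) * S.sig := by rw [hi, h_eq]; noncomm_ring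
    _ = 1 := by rw [e1, Matrix.mul_one, e2, Matrix.mul_one, S.sigInv_mul_sig]

/-- The frame `D_k = ∑ T1 μ k ∂_μ`. -/
def T1 : Matrix (Fin n) (Fin n) R :=
  fun μ k => half R * (S.P μ * S.xi μ * S.ui μ) * S.sig μ k

/-- The entry at (k, μ) is a function of x_μ alone, which makes the rows closed forms. -/
def E1 : Matrix (Fin n) (Fin n) R :=
  fun k μ => (-1) ^ (k : ℕ) * S.y μ ^ (n - 1 - k) * (2 * S.x μ * S.Pi μ)

theorem E1_eq (k μ : Fin n) : S.E1 k μ = S.sigInv k μ * (2 * S.x μ * S.Pi μ * S.u μ) := by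
  rw [E1, SepCoords.sigInv]
  linear_combination -((-1) ^ (k : ℕ) * S.y μ ^ (n - 1 - k) * (2 * S.x μ * S.Pi μ)) * S.u_mul_ui μ

theorem E1_mul_T1 : S.E1 * S.T1 = 1 := by
  ext k l
  rw [← S.sigInv_mul_sig, mul_apply, mul_apply]
  refine Finset.sum_congr rfl fun μ _ => ?_
  rw [E1_eq, T1]
  linear_combination (S.sigInv k μ * S.sig μ l) *
    (two_mul_half R + 2 * half R * (S.x_mul μ + S.x μ * S.xi μ * S.P_mul_Pi μ
      + S.x μ * S.xi μ * (S.P μ * S.Pi μ) * S.u_mul_ui μ))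

theorem sig_mul_E1 (μ ν : Fin n) :
    (S.sig * S.E1) μ ν = if μ = ν then 2 * S.x μ * S.Pi μ * S.u μ else 0 := by
  have h := congrFun (congrFun S.sig_mul_sigInv μ) ν
  rw [mul_apply, Matrix.one_apply] at h
  simp only [mul_apply, E1_eq, ← mul_assoc, ← Finset.sum_mul, h]
  split_ifs with h'
  · rw [h']; ring
  · ring

theorem isSeparated_E1 (k : Fin n) : S.IsSeparated (S.E1 k) := by
  have h1 : S.IsSeparated fun μ => S.y μ ^ (n - 1 - k) := fun μ ν h => by
    rw [Derivation.leibniz_pow, S.isSeparated_y μ ν h]; simp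
  intro μ ν h
  have hc : S.pd μ ((-1 : R) ^ (k : ℕ)) = 0 := by
    rw [Derivation.leibniz_pow, map_neg, Derivation.map_one_eq_zero]; simp
  have h2 : S.pd μ (2 : R) = 0 := by
    have := Derivation.map_natCast (S.pd μ) 2
    exact_mod_cast this
  rw [E1, Derivation.leibniz, Derivation.leibniz, Derivation.leibniz, Derivation.leibniz,
    S.isSeparated_Pi μ ν h, S.isSeparated_x μ ν h, h1 μ ν h, hc, h2]
  simp

theorem E1_closed (i j k : Fin n) : S.pd i (S.E1 k j) = S.pd j (S.E1 k i) := by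
  by_cases h : i = j
  · rw [h]
  · rw [S.isSeparated_E1 k i j h, S.isSeparated_E1 k j i (Ne.symm h)]

def d (k : Fin n) : Derivation ℝ R R := frameDer S.pd S.T1 k

theorem d_apply (k : Fin n) (f : R) : S.d k f = ∑ μ, S.T1 μ k * S.pd μ f := frameDer_apply _ _ _ _

theorem d_comm (i j : Fin n) (f : R) : S.d i (S.d j f) = S.d j (S.d i f) :=
  frameDer_comm S.pd (mul_eq_one_comm.mp S.E1_mul_T1) S.pd_comm S.E1_closed i j f

/-- As ∂_μ e_{l+1} = 2x_μσ_μl, the e_{l+1} are potentials for the columns of h along the frame.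
Total symmetry of ∂h then follows because the `d k` commute. -/
theorem d_e (k l : Fin n) : S.d k (S.e (l + 1)) = S.h k l := by
  rw [d_apply, h]
  refine Finset.sum_congr rfl fun μ _ => ?_
  rw [SepCoords.pd_e, T1]
  linear_combination (S.P μ * S.ui μ * S.sig μ k * S.sig μ l) *
    (2 * half R * S.x_mul μ + two_mul_half R)

theorem h_symm : S.hᵀ = S.h := by
  ext k l
  rw [transpose_apply, h, h]
  exact Finset.sum_congr rfl fun _ _ => by ring

theorem h_total (i j k : Fin n) : S.d i (S.h j k) = S.d j (S.h i k) := by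
  rw [← d_e, ← d_e, d_comm]

/-- The constants in the trace of the logarithmic derivative of `h`. -/
def ell (k : Fin n) : ℝ := (-1) ^ (k : ℕ) * ((n - k : ℕ) * S.c (n - k))

/-- By total symmetry the trace is h^{ij}∂_j h_{ik}, which `sum_sigInv_pd` evaluates as Σ_μ P'_μ
σ_μk/U_μ with P' the derivative in y. Of this polynomial only the power y^(n−k−1) contributes. -/
theorem trace_log (k : Fin n) : (S.hi * S.h.map (S.d k)).trace = algebraMap ℝ R (S.ell k) := by
  have h1 : (S.hi * S.h.map (S.d k)).trace = ∑ i, ∑ j, S.hi i j * S.d j (S.h i k) := by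
    simp only [Matrix.trace, diag_apply, mul_apply, map_apply]
    refine Finset.sum_congr rfl fun i _ => Finset.sum_congr rfl fun j _ => ?_
    have : S.h k i = S.h i k := congrFun (congrFun S.h_symm i) k
    rw [S.h_total k j i, this]
  have h2 : ∀ i μ, ∑ j, S.hi i j * S.T1 μ j = half R * (S.xi μ * S.sigInv i μ) := by
    intro i μ
    have e1 : S.sigInvᵀ * S.sigᵀ = 1 := by
      rw [← Matrix.transpose_mul, S.sig_mul_sigInv, Matrix.transpose_one]
    have e2 : S.hi * S.sigᵀ = S.sigInv * Matrix.diagonal (fun μ => S.u μ * S.Pi μ) := by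
      rw [hi, Matrix.mul_assoc, e1, Matrix.mul_one]
    have e3 := congrFun (congrFun e2 i) μ
    rw [mul_diagonal, mul_apply] at e3
    have e4 : ∑ j, S.hi i j * S.T1 μ j = half R * (S.P μ * S.xi μ * S.ui μ) *
        ∑ j, S.hi i j * S.sigᵀ j μ := by
      rw [Finset.mul_sum]
      exact Finset.sum_congr rfl fun j _ => by rw [T1, transpose_apply]; ring
    rw [e4, e3]
    linear_combination (half R * S.xi μ * S.sigInv i μ) *
      (S.P_mul_Pi μ * S.u μ * S.ui μ + S.u_mul_ui μ)
  have h3 : ∀ i, ∑ j, S.hi i j * S.d j (S.h i k)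
      = ∑ μ, half R * (S.xi μ * (S.sigInv i μ * S.pd μ (S.h i k))) := by
    intro i
    simp only [d_apply, Finset.mul_sum]
    rw [Finset.sum_comm]
    refine Finset.sum_congr rfl fun μ _ => ?_
    have := congrArg (· * S.pd μ (S.h i k)) (h2 i μ)
    simp only [Finset.sum_mul] at this
    rw [show half R * (S.xi μ * (S.sigInv i μ * S.pd μ (S.h i k)))
      = half R * (S.xi μ * S.sigInv i μ) * S.pd μ (S.h i k) by ring, ← this]
    exact Finset.sum_congr rfl fun _ _ => by ring
  have h4 : ∀ μ, S.pd μ (S.P μ) = 2 * S.x μ *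
      ∑ j ∈ Finset.Icc 1 n, algebraMap ℝ R (j * S.c j) * S.y μ ^ (j - 1) := by
    intro μ
    rw [P, map_add, Derivation.map_algebraMap, add_zero, poly, map_sum, Finset.mul_sum]
    refine Finset.sum_congr rfl fun j _ => ?_
    rw [Derivation.leibniz, Derivation.map_algebraMap, Derivation.leibniz_pow,
      SepCoords.pd_y, if_pos rfl, map_mul, map_natCast]
    simp only [smul_eq_mul, nsmul_eq_mul]; ring
  have h5 := S.sum_sigInv_pd S.isSeparated_P h4 k
  rw [h1]
  simp only [h3]
  rw [Finset.sum_comm]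
  have h6 : ∑ μ, ∑ i, half R * (S.xi μ * (S.sigInv i μ * S.pd μ (S.h i k)))
      = half R * ∑ μ, S.xi μ * ∑ i, S.sigInv i μ * S.pd μ (S.h i k) := by
    simp only [Finset.mul_sum]
  rw [h6]
  have h7 : ∑ μ, S.xi μ * ∑ i, S.sigInv i μ * S.pd μ (S.h i k) = 2 * ∑ μ,
      (∑ j ∈ Finset.Icc 1 n, algebraMap ℝ R (j * S.c j) * S.y μ ^ (j - 1)) * S.ui μ * S.sig μ k := h5
  have hk := k.2
  have h8 : ∑ μ, (∑ j ∈ Finset.Icc 1 n, algebraMap ℝ R (j * S.c j) * S.y μ ^ (j - 1))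
      * S.ui μ * S.sig μ k = algebraMap ℝ R (S.ell k) := by
    simp only [Finset.sum_mul]
    rw [Finset.sum_comm, Finset.sum_eq_single_of_mem (n - (k : ℕ)) (by simp; omega)]
    · have := S.sum_pow_mul_sig (n - k - 1) (by omega) k
      rw [if_pos (by omega)] at this
      have e : algebraMap ℝ R (S.ell k)
          = (-1) ^ (k : ℕ) * algebraMap ℝ R ((n - k : ℕ) * S.c (n - k)) := by
        rw [ell, map_mul, map_pow, map_neg, map_one]
      rw [e, ← this, Finset.sum_mul]
      exact Finset.sum_congr rfl fun _ _ => by ring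
    · intro j hj hjk
      rw [Finset.mem_Icc] at hj
      have := S.sum_pow_mul_sig (j - 1) (by omega) k
      rw [if_neg (by omega)] at this
      rw [← mul_zero (algebraMap ℝ R (j * S.c j)), ← this, Finset.mul_sum]
      exact Finset.sum_congr rfl fun _ _ => by ring
  rw [h7, h8]
  linear_combination algebraMap ℝ R (S.ell k) * two_mul_half R

/-- The potential. -/
def A (k : Fin n) : R := S.Phii * ∑ μ, S.Nf μ * S.ui μ * S.sig μ k

theorem Phi_mul_A (k : Fin n) : S.Phi * S.A k = ∑ μ, S.Nf μ * S.ui μ * S.sig μ k := by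
  rw [A]; linear_combination (∑ μ, S.Nf μ * S.ui μ * S.sig μ k) * S.Phi_mul

def chi (k : Fin n) : ℝ :=
  if (k : ℕ) = n - 1 then 0 else (-1) ^ (k : ℕ) * (S.b (n - 1 - k) - S.a * S.c (n - 1 - k))

def kap : ℝ := 1 + S.b (n - 1) - S.a * S.c (n - 1)

/-- N and aP have the same leading coefficient, since b_n = a c_n, and the same constant term a m_μ;
only lower coefficients are left in the difference, and these sum to constants. -/
theorem Phi_mul_A_eq (k : Fin n) :
    S.Phi * S.A k = algebraMap ℝ R S.a * S.h S.z k + algebraMap ℝ R (S.chi k) := by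
  have h1 : S.h S.z k = ∑ μ, S.poly S.c μ * S.ui μ * S.sig μ k
      + ∑ μ, algebraMap ℝ R (S.m μ) * S.ui μ * S.sig μ k := by
    rw [h, ← Finset.sum_add_distrib]
    exact Finset.sum_congr rfl fun μ _ => by rw [sig_z, P]; ring
  have h2 : ∑ μ, S.Nf μ * S.ui μ * S.sig μ k = ∑ μ, S.poly S.b μ * S.ui μ * S.sig μ k
      + algebraMap ℝ R S.a * ∑ μ, algebraMap ℝ R (S.m μ) * S.ui μ * S.sig μ k := by
    rw [Finset.mul_sum, ← Finset.sum_add_distrib]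
    exact Finset.sum_congr rfl fun μ _ => by rw [Nf, map_mul]; ring
  rw [Phi_mul_A, h1, h2, sum_poly_sig, sum_poly_sig, S.b_top, chi]
  split_ifs <;> simp only [map_mul, map_sub, map_zero] <;> ring

theorem Phi_eq_one_add : S.Phi = 1 + S.Phi * S.A S.z := by
  rw [Phi_mul_A, Phi]
  simp only [sig_z, mul_one]

theorem chi_z : S.chi S.z = S.kap - 1 := by
  have hn := S.two_le
  rw [chi, kap, if_neg (by simp only [z]; omega)]
  simp only [z, pow_zero, one_mul, Nat.sub_zero]; ring

theorem Phi_eq : S.Phi = algebraMap ℝ R S.a * S.h S.z S.z + algebraMap ℝ R S.kap := by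
  have e : S.kap = 1 + S.chi S.z := by rw [chi_z]; ring
  rw [Phi_eq_one_add, Phi_mul_A_eq, e, map_add, map_one]; ring

/-- The boost data of the family. -/
def boost : BoostData (Fin n) R where
  d := S.d
  comm := S.d_comm
  h := S.h
  hi := S.hi
  hi_mul := S.hi_mul_h
  symm := S.h_symm
  total := S.h_total
  ell := S.ell
  trace_log := S.trace_log
  z := S.z
  a := S.a
  c := S.kap
  chi := S.chi
  chi_z := S.chi_z
  Phi := S.Phi
  Phii := S.Phii
  Phi_mul := S.Phi_mul
  Phi_eq := S.Phi_eq
  A := S.A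
  A_eq := S.Phi_mul_A_eq
  phi := S.phi
  d_phi k := by
    rw [d_apply, d_apply, Finset.mul_sum]
    exact Finset.sum_congr rfl fun μ _ => by rw [pd_phi_eq]; ring

/-- `∂_μ A = ∂_μ ln Φ (σ_μ - A)`. -/
theorem pd_A (μ k : Fin n) : S.pd μ (S.A k) = S.pd μ S.phi * (S.sig μ k - S.A k) := by
  have h1 := congrArg (S.pd μ) (S.Phi_mul_A k)
  rw [S.isSeparated_N.pd_sum, ← pd_Phi, Derivation.leibniz, smul_eq_mul, smul_eq_mul] at h1
  rw [pd_phi_eq]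
  linear_combination S.Phii * h1 - S.pd μ (S.A k) * S.Phi_mul

/-- The forms `θ_μ = σ_μ - A`. -/
def theta : Matrix (Fin n) (Fin n) R := fun μ k => S.sig μ k - S.A k

/-- Because σ_μz = 1, subtracting A from every row of σ is multiplication by L. -/
theorem theta_eq : S.theta = S.sig * S.boost.L := by
  ext μ k
  have : (S.sig * S.boost.N) μ k = S.A k := by
    rw [mul_apply, Finset.sum_eq_single S.z]
    · simp [BoostData.N, boost, sig_z]
    · intro j _ hj
      have : S.boost.N j k = 0 := if_neg hj
      rw [this, mul_zero]
    · simp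
  rw [BoostData.L, Matrix.mul_sub, Matrix.mul_one, Matrix.sub_apply, this, theta]

/-- Orthogonality of σ and E₁ collapses Σ_l ΦA_l (E₁)_lμ to the single term N_μ · 2x_μ/P_μ. -/
theorem Li_mul_E1 (k μ : Fin n) : (S.boost.Li * S.E1) k μ
    = S.E1 k μ + if k = S.z then S.Nf μ * (2 * S.x μ * S.Pi μ) else 0 := by
  have h0 : ∑ l, S.Phi * S.A l * S.E1 l μ = S.Nf μ * (2 * S.x μ * S.Pi μ) := by
    have e : ∀ l, S.Phi * S.A l * S.E1 l μ
        = ∑ ν, S.Nf ν * S.ui ν * (S.sig ν l * S.E1 l μ) := fun l => by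
      rw [Phi_mul_A, Finset.sum_mul]
      exact Finset.sum_congr rfl fun _ _ => by ring
    simp only [e]
    rw [Finset.sum_comm]
    have e2 : ∀ ν, ∑ l, S.sig ν l * S.E1 l μ = if ν = μ then 2 * S.x ν * S.Pi ν * S.u ν else 0 :=
      fun ν => by rw [← sig_mul_E1, mul_apply]
    simp only [← Finset.mul_sum, e2, mul_ite, mul_zero, Finset.sum_ite_eq', Finset.mem_univ, if_true]
    linear_combination S.Nf μ * (2 * S.x μ * S.Pi μ) * S.u_mul_ui μ
  have h1 : (S.boost.Phi • S.boost.N * S.E1) k μ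
      = if k = S.z then ∑ l, S.Phi * S.A l * S.E1 l μ else 0 := by
    rw [mul_apply]
    by_cases h : k = S.z
    · rw [if_pos h]
      refine Finset.sum_congr rfl fun l _ => ?_
      simp [BoostData.N, boost, h]
    · rw [if_neg h]
      refine Finset.sum_eq_zero fun l _ => ?_
      simp [BoostData.N, boost, h]
  rw [BoostData.Li, Matrix.add_mul, Matrix.one_mul, Matrix.add_apply, h1, h0]

/-- The rows of L⁻¹E₁ are therefore closed forms again; integrability of the complex structure rests
on this. -/
theorem isSeparated_Li_E1 (k : Fin n) : S.IsSeparated ((S.boost.Li * S.E1) k) := by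
  intro μ ν h
  have h2 : S.pd μ (2 : R) = 0 := by
    have := Derivation.map_natCast (S.pd μ) 2
    exact_mod_cast this
  rw [Li_mul_E1, map_add, S.isSeparated_E1 k μ ν h, zero_add]
  split_ifs
  · rw [Derivation.leibniz, Derivation.leibniz, Derivation.leibniz, S.isSeparated_N μ ν h,
      S.isSeparated_Pi μ ν h, S.isSeparated_x μ ν h, h2]
    simp
  · simp

end SepBoost

end SeparableBoost

end

/-! ### Realisation on the coordinate domain -/

noncomputable section

section KtGeometry

open Matrix BasicRing

/-- Differentiability is not required, since `fderiv` is 0 where it fails. -/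
theorem pd_eq_zero_of_invariant {ι : Type*} [Fintype ι] [DecidableEq ι] {f : (ι → ℝ) → ℝ}
    {p : ι → ℝ} {i : ι} (h : ∀ t : ℝ, f (p + t • cvec i) = f p) : pd i f p = 0 := by
  by_cases hd : DifferentiableAt ℝ f p
  · rw [pd, ← hd.lineDeriv_eq_fderiv, lineDeriv]
    simp only [h, deriv_const]
  · rw [pd, fderiv_zero_of_not_differentiableAt hd]; rfl

namespace BasicRing

variable {ι : Type*} [Fintype ι] [DecidableEq ι] {W : BasicDomain ι}

/-- The inverse of a nowhere vanishing function. -/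
def inv (r : BasicRing W) (h : ∀ p, ev p r ≠ 0) : BasicRing W :=
  mk (fun p => (r.lift p)⁻¹) (isBasic_of_inv r.lift_basic fun p hp => by
    rw [← ev_eq_lift ⟨p, hp⟩]; exact h _)

theorem ev_inv (r : BasicRing W) (h : ∀ p, ev p r ≠ 0) (p : W.carrier) :
    ev p (inv r h) = (ev p r)⁻¹ := by rw [inv, ev_mk, ev_eq_lift]

theorem mul_inv (r : BasicRing W) (h : ∀ p, ev p r ≠ 0) : r * inv r h = 1 := ext_ev fun p => by
  rw [map_mul, ev_inv, map_one, mul_inv_cancel₀ (h p)]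

theorem log_basic (r : BasicRing W) (h : ∀ p, ev p r ≠ 0) :
    IsBasic W.carrier W.dirs fun p => Real.log (r.lift p) := by
  have h' : ∀ p ∈ W.carrier, r.lift p ≠ 0 := fun p hp => by rw [← ev_eq_lift ⟨p, hp⟩]; exact h _
  refine ⟨r.lift_basic.1.log h', fun i hi p hp => ?_⟩
  rw [pd_comp_hasDerivAt (Real.hasDerivAt_log (h' p hp)) (differentiableAt_lift r ⟨p, hp⟩),
    r.lift_basic.2 i hi p hp, mul_zero]

/-- The logarithm of a nowhere vanishing function. -/
def log (r : BasicRing W) (h : ∀ p, ev p r ≠ 0) : BasicRing W := mk _ (log_basic r h)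

theorem ev_log (r : BasicRing W) (h : ∀ p, ev p r ≠ 0) (p : W.carrier) :
    ev p (log r h) = Real.log (ev p r) := by rw [log, ev_mk, ev_eq_lift]

theorem D_log (r : BasicRing W) (h : ∀ p, ev p r ≠ 0) (i : ι) :
    D i (log r h) = inv r h * D i r := ext_ev fun p => by
  have h' : r.lift p ≠ 0 := by rw [← ev_eq_lift p]; exact h _
  refine ((rep_mk _ (log_basic r h)).pd i p).symm.trans ?_
  rw [map_mul, ev_inv, ev_D, ev_eq_lift, pd_comp_hasDerivAt (Real.hasDerivAt_log h') (differentiableAt_lift r p)]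

end BasicRing

namespace BoostData

variable {κ R : Type*} [Fintype κ] [DecidableEq κ] [CommRing R] [Algebra ℝ R]
  (D : κ ⊕ κ → Derivation ℝ R R)

theorem frameDer_blockFrame_inl (T : Matrix κ κ R) (k : κ) :
    frameDer D (blockFrame T) (Sum.inl k) = frameDer (fun μ => D (Sum.inl μ)) T k := by
  refine Derivation.ext fun f => ?_
  rw [frameDer_apply, frameDer_apply, Fintype.sum_sum_type]
  simp [blockFrame]

theorem frameDer_blockFrame_inr (h0 : ∀ k, D (Sum.inr k) = 0) (T : Matrix κ κ R) (k : κ) :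
    frameDer D (blockFrame T) (Sum.inr k) = 0 := by
  refine Derivation.ext fun f => ?_
  rw [frameDer_apply, Fintype.sum_sum_type]
  simp [blockFrame, h0]

theorem blockFrame_closed (h0 : ∀ k, D (Sum.inr k) = 0) {E : Matrix κ κ R}
    (hE : ∀ i j k, D (Sum.inl i) (E k j) = D (Sum.inl j) (E k i)) (i j k : κ ⊕ κ) :
    D i (blockFrame E k j) = D j (blockFrame E k i) := by
  have h1 : ∀ (d : Derivation ℝ R R) (k l : κ), d ((1 : Matrix κ κ R) k l) = 0 := fun d k l => by
    rw [Matrix.one_apply]; split_ifs <;> simp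
  rcases i with i | i <;> rcases j with j | j <;> rcases k with k | k <;>
    simp [blockFrame, h0, h1, hE i j]

end BoostData

/-- The frame `(D_k, ∂ψ_k)`. -/
def SepBoost.frame {n : ℕ} {W : BasicDomain (Idx n)} (S : SepBoost n (BasicRing W))
    (hpd : S.pd = fun μ => D (Sum.inl μ)) (hdirs : ∀ k, Sum.inr k ∈ W.dirs) : S.boost.Frame where
  T := S.T1
  E := S.E1
  inv := S.E1_mul_T1
  der := by
    have hl := BoostData.frameDer_blockFrame_inl (R := BasicRing W) (κ := Fin n) D S.T1
    have hr := BoostData.frameDer_blockFrame_inr (R := BasicRing W) (κ := Fin n) D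
      (fun k => D_dirs (hdirs k)) S.T1
    have hd : S.boost.d = frameDer (R := BasicRing W) (fun μ => D (Sum.inl μ)) S.T1 := by
      rw [← hpd]; rfl
    funext i
    rcases i with k | k
    · exact (hl k).trans (congrFun hd k).symm
    · exact hr k
  closed := BoostData.blockFrame_closed (R := BasicRing W) (κ := Fin n) D
    (fun k => D_dirs (hdirs k)) (E := S.E1) fun i j k => by
      have := S.E1_closed i j k
      rwa [hpd] at this

theorem xc_contDiff {n : ℕ} (μ : Fin n) : ContDiff ℝ ∞ fun p : Idx n → ℝ => xc p μ :=
  contDiff_apply ℝ ℝ (Sum.inl μ)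

variable {n : ℕ} (a : ℝ) (b c : ℕ → ℝ) (m : Fin n → ℝ)

theorem Ufun_ne_zero {p : Idx n → ℝ} (h : ∀ μ ν, μ ≠ ν → xc p μ ^ 2 ≠ xc p ν ^ 2) (μ : Fin n) :
    Ufun p μ ≠ 0 :=
  Finset.prod_ne_zero_iff.mpr fun ν hν => sub_ne_zero.mpr (h μ ν (Finset.ne_of_mem_erase hν).symm)

/-- Continuity of Q and Φ is available where x_μ ≠ 0 and the x_μ² are distinct, so positivity is
imposed relative to that open set. -/
theorem ktData_isOpen_domain : IsOpen (ktData n a b c m).domain := by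
  have hx : ∀ μ : Fin n, Continuous fun p : Idx n → ℝ => xc p μ := fun μ => (xc_contDiff μ).continuous
  set Ω : Set (Idx n → ℝ) := {p | (∀ μ, xc p μ ≠ 0) ∧ ∀ μ ν, μ ≠ ν → xc p μ ^ 2 ≠ xc p ν ^ 2}
    with hΩ
  have hΩo : IsOpen Ω := by
    have : Ω = (⋂ μ, {p : Idx n → ℝ | xc p μ ≠ 0}) ∩
        ⋂ μ, ⋂ ν, ⋂ (_ : μ ≠ ν), {p : Idx n → ℝ | xc p μ ^ 2 ≠ xc p ν ^ 2} := by
      ext p; simp [hΩ]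
    rw [this]
    exact (isOpen_iInter_of_finite fun μ => isOpen_ne_fun (hx μ) continuous_const).inter
      (isOpen_iInter_of_finite fun μ => isOpen_iInter_of_finite fun ν =>
        isOpen_iInter_of_finite fun _ => isOpen_ne_fun ((hx μ).pow 2) ((hx ν).pow 2))
  have hU : ∀ μ : Fin n, Continuous fun p : Idx n → ℝ => Ufun p μ := fun μ =>
    continuous_finset_prod _ fun ν _ => ((hx μ).pow 2).sub ((hx ν).pow 2)
  have hQ : ∀ μ, ContinuousOn (fun p => (ktData n a b c m).Q p μ) Ω := by
    intro μ
    have h1 : ContinuousOn (fun p : Idx n → ℝ => 1 / (4 * xc p μ ^ 2)) Ω :=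
      continuousOn_const.div (continuous_const.mul ((hx μ).pow 2)).continuousOn fun p hp =>
        mul_ne_zero (by norm_num) (pow_ne_zero 2 (hp.1 μ))
    have h2 : Continuous fun p : Idx n → ℝ => ∑ k ∈ Finset.Icc 1 n, c k * xc p μ ^ (2 * k) + m μ :=
      (continuous_finset_sum _ fun k _ => continuous_const.mul ((hx μ).pow _)).add continuous_const
    exact (h1.mul h2.continuousOn).div (hU μ).continuousOn fun p hp => Ufun_ne_zero hp.2 μ
  have hP : ContinuousOn (fun p => (ktData n a b c m).Phi p) Ω := by
    refine continuousOn_const.add (continuousOn_finset_sum _ fun μ _ => ?_)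
    have h2 : Continuous fun p : Idx n → ℝ => ∑ k ∈ Finset.Icc 1 n, b k * xc p μ ^ (2 * k) + a * m μ :=
      (continuous_finset_sum _ fun k _ => continuous_const.mul ((hx μ).pow _)).add continuous_const
    exact h2.continuousOn.div (hU μ).continuousOn fun p hp => Ufun_ne_zero hp.2 μ
  have e : (ktData n a b c m).domain = (⋂ μ, (Ω ∩ (fun p => (ktData n a b c m).Q p μ) ⁻¹' Set.Ioi 0))
      ∩ (Ω ∩ (fun p => (ktData n a b c m).Phi p) ⁻¹' Set.Ioi 0) := by
    ext p
    simp only [TypeA.domain, Set.mem_setOf_eq, hΩ, Set.mem_inter_iff, Set.mem_iInter,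
      Set.mem_preimage, Set.mem_Ioi]
    constructor
    · rintro ⟨h1, h2, h3, h4⟩; exact ⟨fun μ => ⟨⟨h1, h2⟩, h3 μ⟩, ⟨h1, h2⟩, h4⟩
    · rintro ⟨h3, ⟨h1, h2⟩, h4⟩; exact ⟨h1, h2, fun μ => (h3 μ).2, h4⟩
  rw [e]
  exact (isOpen_iInter_of_finite fun μ => (hQ μ).isOpen_inter_preimage hΩo isOpen_Ioi).inter
    (hP.isOpen_inter_preimage hΩo isOpen_Ioi)

/-- The domain; functions are constant along the fibre coordinates. -/
def ktDomain : BasicDomain (Idx n) where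
  carrier := (ktData n a b c m).domain
  isOpen := ktData_isOpen_domain a b c m
  dirs := Set.range Sum.inr

namespace Kt

theorem inr_mem (k : Fin n) : Sum.inr k ∈ (ktDomain a b c m).dirs := ⟨k, rfl⟩

def x (μ : Fin n) : BasicRing (ktDomain a b c m) :=
  mk (fun p => xc p μ) ⟨(xc_contDiff μ).contDiffOn, by
    rintro _ ⟨k, rfl⟩ p _
    exact pd_eq_zero_of_invariant fun t => by simp [xc, cvec]⟩

variable {a b c m}

theorem ev_x (μ : Fin n) (p : (ktDomain a b c m).carrier) : ev p (x a b c m μ) = xc p μ := rfl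

theorem ev_u (μ : Fin n) (p : (ktDomain a b c m).carrier) :
    ev p (∏ ν ∈ Finset.univ.erase μ, (x a b c m μ ^ 2 - x a b c m ν ^ 2)) = Ufun (p : Idx n → ℝ) μ := by
  simp only [map_prod, map_sub, map_pow, ev_x, Ufun]

theorem ev_poly (r : ℕ → ℝ) (s : ℝ) (μ : Fin n) (p : (ktDomain a b c m).carrier) :
    ev p (∑ k ∈ Finset.Icc 1 n, algebraMap ℝ _ (r k) * (x a b c m μ ^ 2) ^ k + algebraMap ℝ _ s)
      = ∑ k ∈ Finset.Icc 1 n, r k * xc (p : Idx n → ℝ) μ ^ (2 * k) + s := by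
  simp only [map_add, map_sum, map_mul, map_pow, ev_x, ev_algebraMap, pow_mul]

theorem x_ne (μ : Fin n) (p : (ktDomain a b c m).carrier) : ev p (x a b c m μ) ≠ 0 := p.2.1 μ

theorem u_ne (μ : Fin n) (p : (ktDomain a b c m).carrier) :
    ev p (∏ ν ∈ Finset.univ.erase μ, (x a b c m μ ^ 2 - x a b c m ν ^ 2)) ≠ 0 := by
  rw [ev_u]; exact Ufun_ne_zero p.2.2.1 μ

theorem P_eq (μ : Fin n) (p : (ktDomain a b c m).carrier) :
    ∑ k ∈ Finset.Icc 1 n, c k * xc (p : Idx n → ℝ) μ ^ (2 * k) + m μ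
      = 4 * xc (p : Idx n → ℝ) μ ^ 2 * (ktData n a b c m).X μ (xc (p : Idx n → ℝ) μ) := by
  have h := p.2.1 μ
  have h4 : 4 * xc (p : Idx n → ℝ) μ ^ 2 ≠ 0 := mul_ne_zero (by norm_num) (pow_ne_zero 2 h)
  rw [ktData, ← mul_assoc, mul_one_div_cancel h4, one_mul]

theorem X_ne (μ : Fin n) (p : (ktDomain a b c m).carrier) :
    (ktData n a b c m).X μ (xc (p : Idx n → ℝ) μ) ≠ 0 := by
  intro h0
  have := p.2.2.2.1 μ
  rw [TypeA.Q, h0, zero_div] at this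
  exact lt_irrefl _ this

theorem P_ne (μ : Fin n) (p : (ktDomain a b c m).carrier) :
    ev p (∑ k ∈ Finset.Icc 1 n, algebraMap ℝ _ (c k) * (x a b c m μ ^ 2) ^ k
      + algebraMap ℝ _ (m μ)) ≠ 0 := by
  rw [ev_poly, P_eq]
  exact mul_ne_zero (mul_ne_zero (by norm_num) (pow_ne_zero 2 (p.2.1 μ))) (X_ne μ p)

variable (a b c m)

def ui (μ : Fin n) : BasicRing (ktDomain a b c m) := inv _ (u_ne μ)

def Phi : BasicRing (ktDomain a b c m) := 1 + ∑ μ, (∑ k ∈ Finset.Icc 1 n, algebraMap ℝ _ (b k) *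
  (x a b c m μ ^ 2) ^ k + algebraMap ℝ _ (a * m μ)) * ui a b c m μ

variable {a b c m}

theorem ev_Phi (p : (ktDomain a b c m).carrier) :
    ev p (Phi a b c m) = (ktData n a b c m).Phi p := by
  rw [Phi, map_add, map_one, map_sum, TypeA.Phi]
  congr 1
  refine Finset.sum_congr rfl fun μ _ => ?_
  rw [map_mul, ev_poly, ui, ev_inv, ev_u]
  exact (div_eq_mul_inv _ _).symm

theorem Phi_ne (p : (ktDomain a b c m).carrier) : ev p (Phi a b c m) ≠ 0 := by
  rw [ev_Phi]; exact p.2.2.2.2.ne'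

theorem D_Phi (i : Idx n) : D i (Phi a b c m) = D i (∑ μ, (∑ k ∈ Finset.Icc 1 n,
    algebraMap ℝ _ (b k) * (x a b c m μ ^ 2) ^ k + algebraMap ℝ _ (a * m μ)) * ui a b c m μ) := by
  rw [Phi, map_add, Derivation.map_one_eq_zero, zero_add]

/-- The ring data of the family. -/
def sep (hn : 2 ≤ n) (hb : b n = a * c n) : SepBoost n (BasicRing (ktDomain a b c m)) where
  x := x a b c m
  xi μ := inv _ (x_ne μ)
  x_mul μ := mul_inv _ _
  ui := ui a b c m
  u_mul μ := mul_inv _ _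
  pd μ := D (Sum.inl μ)
  pd_x μ ν := ext_ev fun p => by
    have h : pd (Sum.inl μ) (fun p : Idx n → ℝ => xc p ν) p = if μ = ν then 1 else 0 := by
      have := (ContinuousLinearMap.proj (R := ℝ) (φ := fun _ : Idx n => ℝ) (Sum.inl ν)).hasFDerivAt
        (x := (p : Idx n → ℝ))
      rw [pd, HasFDerivAt.fderiv (f := fun p : Idx n → ℝ => xc p ν) this]
      simp [cvec, Pi.single_apply, eq_comm]
    refine ((rep_mk (W := ktDomain a b c m) (fun p => xc p ν) _).pd (Sum.inl μ) p).symm.trans ?_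
    rw [h]
    split_ifs <;> simp
  two_le := hn
  pd_comm i j f := D_comm _ _ f
  a := a
  b := b
  c := c
  m := m
  b_top := hb
  Pi μ := inv _ (P_ne μ)
  P_mul μ := mul_inv _ _
  Phii := inv _ Phi_ne
  Phi_mul_Phii := mul_inv _ Phi_ne
  phi := log _ Phi_ne
  pd_phi μ := (D_log _ Phi_ne _).trans (congrArg _ (D_Phi _))

end Kt

end KtGeometry

end

/-! ### The type A metric and the complex structure in terms of the boost data -/

noncomputable section

section KtRealization

open Matrix BasicRing

namespace TypeA

variable {n : ℕ} (K : TypeA n)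

theorem metric_eq_coframe {p : Idx n → ℝ} (hp : ∀ μ, 0 < K.Q p μ) :
    K.metric p = (K.coframe p).transpose * K.coframe p := by
  have h1 : ∀ μ, Real.sqrt (K.Q p μ) * Real.sqrt (K.Q p μ) = K.Q p μ :=
    fun μ => Real.mul_self_sqrt (hp μ).le
  have h2 : ∀ μ, 1 / Real.sqrt (K.Q p μ) * (1 / Real.sqrt (K.Q p μ))
      = Ufun p μ / K.X μ (xc p μ) := fun μ => by
    rw [one_div_mul_one_div, h1, Q, one_div_div]
  ext i j
  rw [mul_apply, Fintype.sum_sum_type, metric]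
  congr 1
  · refine Finset.sum_congr rfl fun μ _ => ?_
    simp only [coframe, transpose_apply, Sum.elim_inl, Pi.smul_apply, smul_eq_mul]
    rw [← h2]; ring
  · refine Finset.sum_congr rfl fun μ _ => ?_
    simp only [coframe, transpose_apply, Sum.elim_inr, Pi.smul_apply, smul_eq_mul]
    rw [show K.f μ (xc p μ) ^ 2 * K.X μ (xc p μ) / Ufun p μ = K.f μ (xc p μ) ^ 2 *
      (Real.sqrt (K.Q p μ) * Real.sqrt (K.Q p μ)) by rw [h1, Q, mul_div_assoc]]
    ring

/-- The components of `∑_k A_μ^{(k)} dψ_k - A_{(1)}`. -/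
def th (p : Idx n → ℝ) (μ : Fin n) : Idx n → ℝ := sigma p μ - K.A1 p

theorem A1_inl (p : Idx n → ℝ) (μ : Fin n) : K.A1 p (Sum.inl μ) = 0 := by
  simp [A1, sigma, Finset.sum_apply]

theorem th_inl (p : Idx n → ℝ) (μ ν : Fin n) : K.th p μ (Sum.inl ν) = 0 := by
  simp [th, A1_inl, sigma]

theorem coframe_eq (p : Idx n → ℝ) : K.coframe p = fromBlocks
    (Matrix.diagonal fun μ => 1 / Real.sqrt (K.Q p μ)) 0 0
    (Matrix.of fun μ k => K.f μ (xc p μ) * Real.sqrt (K.Q p μ) * K.th p μ (Sum.inr k)) := by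
  ext i j
  rcases i with i | i <;> rcases j with j | j
  · by_cases h : i = j
    · subst h; simp [coframe, cvec]
    · have h' : (Sum.inl j : Idx n) ≠ Sum.inl i := fun e => h (Sum.inl_injective e).symm
      simp [coframe, cvec, h, Pi.single_eq_of_ne h']
  · simp [coframe, cvec]
  · have := K.th_inl p i j
    simp only [th, Pi.sub_apply] at this
    simp [coframe, this]
  · simp [coframe, th]

end TypeA

/-- The type A data `K` are represented by the ring data `S`. -/
structure KtReal {n : ℕ} {W : BasicDomain (Idx n)} (S : SepBoost n (BasicRing W)) (K : TypeA n) :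
    Prop where
  eq : K = ktData n S.a S.b S.c S.m
  carrier : W.carrier = K.domain
  pd : S.pd = fun μ => D (Sum.inl μ)
  dirs : ∀ k, Sum.inr k ∈ W.dirs
  ev_x : ∀ μ (p : W.carrier), ev p (S.x μ) = xc (p : Idx n → ℝ) μ
  rep_phi : Rep (ktphi K) S.phi

namespace KtReal

variable {n : ℕ} {W : BasicDomain (Idx n)} {S : SepBoost n (BasicRing W)} {K : TypeA n}
  (H : KtReal S K) (p : W.carrier)

/-- The frame of the realisation. -/
def frame : S.boost.Frame := S.frame H.pd H.dirs

include H

theorem mem : (p : Idx n → ℝ) ∈ K.domain := by rw [← H.carrier]; exact p.2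

theorem ev_y (μ : Fin n) : ev p (S.y μ) = xc (p : Idx n → ℝ) μ ^ 2 := by
  rw [SepCoords.y, map_pow, H.ev_x]

theorem ev_u (μ : Fin n) : ev p (S.u μ) = Ufun (p : Idx n → ℝ) μ := by
  simp only [SepCoords.u, map_prod, map_sub, H.ev_y, Ufun]

theorem ev_ui (μ : Fin n) : ev p (S.ui μ) = (Ufun (p : Idx n → ℝ) μ)⁻¹ := by
  rw [← H.ev_u]
  refine eq_inv_of_mul_eq_one_right ?_
  rw [← map_mul, S.u_mul_ui, map_one]

theorem ev_sig (μ k : Fin n) : ev p (S.sig μ k) = Asym (p : Idx n → ℝ) μ k := by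
  simp only [SepCoords.sig, esym, map_sum, map_prod, H.ev_y, Asym]

theorem ev_poly (r : ℕ → ℝ) (μ : Fin n) : ev p (S.poly r μ)
    = ∑ k ∈ Finset.Icc 1 n, r k * xc (p : Idx n → ℝ) μ ^ (2 * k) := by
  simp only [SepBoost.poly, map_sum, map_mul, map_pow, H.ev_y, ev_algebraMap, pow_mul]

theorem ev_P (μ : Fin n) : ev p (S.P μ)
    = 4 * xc (p : Idx n → ℝ) μ ^ 2 * K.X μ (xc (p : Idx n → ℝ) μ) := by
  have h4 : 4 * xc (p : Idx n → ℝ) μ ^ 2 ≠ 0 :=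
    mul_ne_zero (by norm_num) (pow_ne_zero 2 ((H.mem p).1 μ))
  rw [SepBoost.P, map_add, H.ev_poly, ev_algebraMap, H.eq, ktData, ← mul_assoc,
    mul_one_div_cancel h4, one_mul]

theorem ev_Pi (μ : Fin n) : ev p (S.Pi μ)
    = (4 * xc (p : Idx n → ℝ) μ ^ 2 * K.X μ (xc (p : Idx n → ℝ) μ))⁻¹ := by
  rw [← H.ev_P]
  refine eq_inv_of_mul_eq_one_right ?_
  rw [← map_mul, S.P_mul_Pi, map_one]

theorem ev_Nf (μ : Fin n) : ev p (S.Nf μ) = K.N μ (xc (p : Idx n → ℝ) μ) := by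
  rw [SepBoost.Nf, map_add, H.ev_poly, ev_algebraMap, H.eq, ktData]

theorem ev_Phi : ev p S.Phi = K.Phi p := by
  rw [SepBoost.Phi, map_add, map_one, map_sum, TypeA.Phi]
  congr 1
  refine Finset.sum_congr rfl fun μ _ => ?_
  rw [map_mul, H.ev_Nf, H.ev_ui, div_eq_mul_inv]

theorem ev_Phii : ev p S.Phii = (K.Phi p)⁻¹ := by
  rw [← H.ev_Phi]
  refine eq_inv_of_mul_eq_one_right ?_
  rw [← map_mul, S.Phi_mul, map_one]

theorem ev_A (k : Fin n) : ev p (S.A k) = K.A1 p (Sum.inr k) := by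
  rw [SepBoost.A, map_mul, H.ev_Phii, map_sum, TypeA.A1, Pi.smul_apply, smul_eq_mul,
    Finset.sum_apply]
  congr 1
  refine Finset.sum_congr rfl fun μ _ => ?_
  rw [map_mul, map_mul, H.ev_Nf, H.ev_ui, H.ev_sig, Pi.smul_apply, smul_eq_mul, TypeA.sigma,
    Sum.elim_inr, div_eq_mul_inv]

theorem ev_theta (μ k : Fin n) : ev p (S.theta μ k) = K.th p μ (Sum.inr k) := by
  rw [SepBoost.theta, map_sub, H.ev_sig, H.ev_A, TypeA.th, Pi.sub_apply, TypeA.sigma, Sum.elim_inr]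

theorem dlnPhi_eq (μ : Fin n) : K.dlnPhi p μ = ev p (S.pd μ S.phi) := by
  have := H.rep_phi.pd (Sum.inl μ) p
  rw [H.pd, ← this]; rfl

/-- σE₁ is diagonal, so in the coordinates x_μ the base block becomes diag(U_μ/X_μ); θ = σL
identifies the fibre block. -/
theorem gc_eq : H.frame.gc = fromBlocks
    (Matrix.diagonal fun μ => 4 * S.x μ ^ 2 * (S.Pi μ * S.u μ)) 0 0
    (S.thetaᵀ * Matrix.diagonal (fun μ => S.P μ * S.ui μ) * S.theta) := by
  have h1 : S.sig * S.E1 = Matrix.diagonal fun μ => 2 * S.x μ * S.Pi μ * S.u μ := by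
    ext μ ν
    rw [S.sig_mul_E1, diagonal_apply]
  have h2 : S.E1ᵀ * S.h * S.E1 = Matrix.diagonal fun μ => 4 * S.x μ ^ 2 * (S.Pi μ * S.u μ) := by
    calc S.E1ᵀ * S.h * S.E1 = (S.sig * S.E1)ᵀ * Matrix.diagonal (fun μ => S.P μ * S.ui μ)
          * (S.sig * S.E1) := by rw [S.h_eq, Matrix.transpose_mul]; noncomm_ring
      _ = _ := by
        rw [h1, diagonal_transpose, diagonal_mul_diagonal, diagonal_mul_diagonal]
        congr 1; funext μ
        linear_combination (4 * S.x μ ^ 2 * S.Pi μ * S.u μ) *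
          (S.P_mul_Pi μ * S.u μ * S.ui μ + S.u_mul_ui μ)
  have h3 : S.boost.G = S.thetaᵀ * Matrix.diagonal (fun μ => S.P μ * S.ui μ) * S.theta := by
    have : S.boost.h = S.h := rfl
    rw [S.theta_eq, BoostData.G, this, S.h_eq, Matrix.transpose_mul]; noncomm_ring
  have h4 : S.boost.Gm = fromBlocks S.h 0 0 S.boost.G := rfl
  have h5 : H.frame.EE = fromBlocks S.E1 0 0 1 := rfl
  rw [BoostData.Frame.gc, h4, h5, fromBlocks_transpose, fromBlocks_multiply, fromBlocks_multiply,
    ← h2, ← h3]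
  simp

theorem metric_eq : K.metric p = H.frame.gc.map (ev p) := by
  have hx := (H.mem p).1
  have hf : ∀ μ, K.f μ (xc (p : Idx n → ℝ) μ) = 2 * xc (p : Idx n → ℝ) μ := fun μ => by
    rw [H.eq]; rfl
  have hth : ∀ μ (i : Idx n), (TypeA.sigma (p : Idx n → ℝ) μ - K.A1 p) i = K.th p μ i :=
    fun _ _ => rfl
  rw [H.gc_eq, fromBlocks_map]
  ext i j
  rcases i with i | i <;> rcases j with j | j <;>
    simp only [TypeA.metric, hth, TypeA.th_inl, mul_zero, zero_mul, Finset.sum_const_zero, add_zero,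
      fromBlocks_apply₁₁, fromBlocks_apply₁₂, fromBlocks_apply₂₁, fromBlocks_apply₂₂, map_apply,
      Matrix.zero_apply, map_zero]
  · rw [diagonal_apply, Finset.sum_eq_single i]
    · by_cases h : i = j
      · subst h
        have hx' := hx i
        rw [if_pos rfl]
        simp only [map_mul, map_pow, H.ev_x, H.ev_Pi, H.ev_u, map_ofNat, cvec, Pi.single_eq_same,
          mul_one]
        rw [_root_.mul_inv, ← mul_assoc, ← mul_assoc, mul_inv_cancel₀ (by positivity), one_mul,
          div_eq_mul_inv, mul_comm]
      · have h' : (Sum.inl j : Idx n) ≠ Sum.inl i := fun e => h (Sum.inl_injective e).symm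
        rw [if_neg h, map_zero, cvec, Pi.single_eq_of_ne h', mul_zero, mul_zero]
    · intro μ _ hμ
      have h' : (Sum.inl i : Idx n) ≠ Sum.inl μ := fun e => hμ (Sum.inl_injective e).symm
      rw [cvec, Pi.single_eq_of_ne h', zero_mul, mul_zero]
    · simp
  · simp [cvec]
  · simp [cvec]
  · have h0 : ∀ μ, (cvec (Sum.inl μ) : Idx n → ℝ) (Sum.inr i) = 0 := fun μ => by simp [cvec]
    simp only [h0, zero_mul, mul_zero, Finset.sum_const_zero, zero_add, mul_apply (N := S.theta),
      mul_diagonal, transpose_apply, map_sum, map_mul, H.ev_theta, H.ev_P, H.ev_ui, hf]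
    exact Finset.sum_congr rfl fun μ _ => by ring

theorem Q_pos (μ : Fin n) : 0 < K.Q p μ := (H.mem p).2.2.1 μ

/-- The metric is CᵀC for the coframe matrix C, and it has an inverse over the ring. -/
theorem det_coframe_ne_zero : (K.coframe p).det ≠ 0 := by
  have h1 : ((H.frame.gci * H.frame.gc).map (ev p)).det
      = ((1 : Matrix (Idx n) (Idx n) (BasicRing W)).map (ev p)).det := by
    rw [H.frame.gci_mul_gc]
  have h2 : ((1 : Matrix (Idx n) (Idx n) (BasicRing W)).map (ev p)) = 1 :=
    Matrix.map_one _ (map_zero _) (map_one _)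
  rw [map_ev_mul, ← H.metric_eq, h2, Matrix.det_mul, Matrix.det_one,
    K.metric_eq_coframe (H.Q_pos p), Matrix.det_mul] at h1
  intro h0
  rw [h0, mul_zero, mul_zero] at h1
  exact zero_ne_one h1

theorem metric_posDef : (K.metric p).PosDef := by
  rw [K.metric_eq_coframe (H.Q_pos p)]
  have := (Matrix.PosDef.one (n := Idx n) (R := ℝ)).conjTranspose_mul_mul_same
    (B := K.coframe p) (Matrix.mulVec_injective_of_isUnit
      ((Matrix.isUnit_iff_isUnit_det _).mpr (isUnit_iff_ne_zero.mpr (H.det_coframe_ne_zero p))))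
  rw [Matrix.mul_one] at this
  exact this

theorem isRiemannianMetricOn : IsRiemannianMetricOn K.metric K.domain where
  isOpen := by rw [← H.carrier]; exact W.isOpen
  smooth i j := by
    rw [← H.carrier]
    exact ((H.frame.metricRep H.metric_eq).apply i j).contDiffOn
  posDef q hq := H.metric_posDef ⟨q, by rw [H.carrier]; exact hq⟩

theorem Jc_eq : H.frame.Jc = fromBlocks 0 (S.T1 * S.boost.L) (-(S.boost.Li * S.E1)) 0 := by
  have h4 : S.boost.Jm = fromBlocks 0 S.boost.L (-S.boost.Li) 0 := rfl
  have h5 : H.frame.EE = fromBlocks S.E1 0 0 1 := rfl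
  have h6 : H.frame.TT = fromBlocks S.T1 0 0 1 := rfl
  rw [BoostData.Frame.Jc, h4, h5, h6, fromBlocks_multiply, fromBlocks_multiply]
  simp

/-- The two structures are compared through the coframe, in which J_ε is `Jframe`. A common value s
= s⁻¹ of the ε_μ comes out as a scalar. -/
theorem J_eq {ε : Fin n → ℝ} {s : ℝ} (hs : s * s = 1) (hε : ∀ μ, ε μ = s) :
    K.J ε p = (s • H.frame.Jc).map (ev p) := by
  have hC := H.det_coframe_ne_zero p
  have hs' : s⁻¹ = s := inv_eq_of_mul_eq_one_right hs
  have h1 : TypeA.Jframe ε * K.coframe p = K.coframe p * (s • H.frame.Jc).map (ev p) := by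
    have hTL : ∀ μ k, (S.T1 * S.boost.L) μ k = half _ * (S.P μ * S.xi μ * S.ui μ) * S.theta μ k := by
      intro μ k
      rw [S.theta_eq, mul_apply, mul_apply, Finset.mul_sum]
      exact Finset.sum_congr rfl fun l _ => by rw [SepBoost.T1]; ring
    have hLE : ∀ μ ν, ∑ k, ev p (S.theta μ k) * ev p ((S.boost.Li * S.E1) k ν)
        = if μ = ν then ev p (2 * S.x μ * S.Pi μ * S.u μ) else 0 := by
      intro μ ν
      have : S.theta * (S.boost.Li * S.E1) = S.sig * S.E1 := by
        rw [S.theta_eq, Matrix.mul_assoc, ← Matrix.mul_assoc S.boost.L, BoostData.L_mul_Li,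
          Matrix.one_mul]
      have h2 := congrArg (ev p) (congrFun (congrFun this μ) ν)
      rw [S.sig_mul_E1, mul_apply, map_sum] at h2
      simp only [map_mul (ev p) (S.theta _ _)] at h2
      rw [h2]; split_ifs <;> simp
    have hx := (H.mem p).1
    have hf : ∀ μ, K.f μ (xc (p : Idx n → ℝ) μ) = 2 * xc (p : Idx n → ℝ) μ := fun μ => by
      rw [H.eq]; rfl
    have hq : ∀ μ, Real.sqrt (K.Q p μ) ≠ 0 := fun μ => (Real.sqrt_pos.mpr (H.Q_pos p μ)).ne'
    have hqq : ∀ μ, Real.sqrt (K.Q p μ) * Real.sqrt (K.Q p μ) = K.Q p μ :=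
      fun μ => Real.mul_self_sqrt (H.Q_pos p μ).le
    have hxi : ∀ μ, ev p (S.xi μ) = (xc (p : Idx n → ℝ) μ)⁻¹ := fun μ => by
      rw [← H.ev_x]
      refine eq_inv_of_mul_eq_one_right ?_
      rw [← map_mul, S.x_mul, map_one]
    -- P = 4x²X turns P/(2xU) into 2xQ.
    have e1 : ∀ μ, ev p (half _ * (S.P μ * S.xi μ * S.ui μ))
        = 2 * xc (p : Idx n → ℝ) μ * K.Q p μ := by
      intro μ
      have hx' := hx μ
      rw [map_mul, map_mul, map_mul, half, ev_algebraMap, H.ev_P, hxi, H.ev_ui, TypeA.Q]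
      field_simp
      ring
    have e2 : ∀ μ, ev p (2 * S.x μ * S.Pi μ * S.u μ)
        = (2 * xc (p : Idx n → ℝ) μ * K.Q p μ)⁻¹ := by
      intro μ
      have hx' := hx μ
      have hX : K.X μ (xc (p : Idx n → ℝ) μ) ≠ 0 := fun h => by
        have := H.Q_pos p μ
        rw [TypeA.Q, h, zero_div] at this
        exact lt_irrefl _ this
      rw [map_mul, map_mul, map_mul, map_ofNat, H.ev_x, H.ev_Pi, H.ev_u, TypeA.Q]
      field_simp
      norm_num
    rw [K.coframe_eq, TypeA.Jframe, H.Jc_eq, fromBlocks_smul, fromBlocks_map, fromBlocks_multiply,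
      fromBlocks_multiply]
    simp only [Matrix.zero_mul, Matrix.mul_zero, zero_add, add_zero, smul_zero, hε]
    have z0 : (0 : Matrix (Fin n) (Fin n) (BasicRing W)).map (ev p) = 0 := by ext; simp
    rw [z0]
    simp only [Matrix.mul_zero]
    congr 1
    · ext μ k
      rw [diagonal_mul, diagonal_mul, Matrix.of_apply, map_apply, Matrix.smul_apply, hTL, map_smul,
        map_mul, e1, H.ev_theta, hf, hs', smul_eq_mul]
      have e := (hqq μ).symm
      have hne := hq μ
      generalize Real.sqrt (K.Q p μ) = r at e hne ⊢
      rw [e]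
      field_simp
    · ext μ ν
      rw [diagonal_mul_diagonal, diagonal_apply, mul_apply]
      have e3 : ∀ k, (Matrix.of fun μ k => K.f μ (xc (p : Idx n → ℝ) μ) * Real.sqrt (K.Q p μ)
          * K.th p μ (Sum.inr k)) μ k * (s • -(S.boost.Li * S.E1)).map (ev p) k ν
          = -(s * K.f μ (xc (p : Idx n → ℝ) μ) * Real.sqrt (K.Q p μ)) *
            (ev p (S.theta μ k) * ev p ((S.boost.Li * S.E1) k ν)) := by
        intro k
        rw [Matrix.of_apply, map_apply, Matrix.smul_apply, Matrix.neg_apply, map_smul, map_neg,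
          H.ev_theta, smul_eq_mul]
        ring
      simp only [e3]
      rw [← Finset.mul_sum, hLE]
      split_ifs with h
      · subst h
        have e := (hqq μ).symm
        have hne := hq μ
        have hx' := hx μ
        rw [e2, hf]
        generalize Real.sqrt (K.Q p μ) = r at e hne ⊢
        rw [e]
        field_simp
      · ring
  rw [TypeA.J, TypeA.frame, Matrix.mul_assoc, h1, ← Matrix.mul_assoc,
    Matrix.nonsing_inv_mul _ (isUnit_iff_ne_zero.mpr hC), Matrix.one_mul]

end KtReal

end KtRealization

end

/-! ### Components of forms of low degree -/

noncomputable section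

section FormComponents

variable {ι : Type*} [Fintype ι] [DecidableEq ι]

theorem altSum_equiv {X Y V : Type*} [Fintype X] [DecidableEq X] [Fintype Y] [DecidableEq Y]
    (e : X ≃ Y) (f : (X → V) → ℝ) (v : Y → V) :
    altSum f (v ∘ e) = altSum (fun w => f (w ∘ e)) v := by
  rw [altSum, altSum, ← Equiv.sum_comp (Equiv.permCongr e)]
  refine Finset.sum_congr rfl fun σ _ => ?_
  rw [Equiv.Perm.sign_permCongr]
  congr 2
  funext x
  simp [Equiv.permCongr_apply]

theorem altSum_two {V : Type*} (f : (Fin 2 → V) → ℝ) (v : Fin 2 → V) :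
    altSum f v = f ![v 0, v 1] - f ![v 1, v 0] := by
  have hu : (Finset.univ : Finset (Equiv.Perm (Fin 2))) = {1, Equiv.swap 0 1} := by decide
  have h1 : v ∘ (1 : Equiv.Perm (Fin 2)) = ![v 0, v 1] := by funext i; fin_cases i <;> rfl
  have h2 : v ∘ Equiv.swap (0 : Fin 2) 1 = ![v 1, v 0] := by funext i; fin_cases i <;> rfl
  rw [altSum, hu, Finset.sum_pair (by decide), h1, h2, Equiv.Perm.sign_swap (by decide)]
  simp [sub_eq_add_neg]

theorem altSum_three {V : Type*} (f : (Fin 3 → V) → ℝ) (v : Fin 3 → V) :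
    altSum f v = f ![v 0, v 1, v 2] - f ![v 1, v 0, v 2] - f ![v 2, v 1, v 0] - f ![v 0, v 2, v 1]
      + f ![v 1, v 2, v 0] + f ![v 2, v 0, v 1] := by
  have hu : (Finset.univ : Finset (Equiv.Perm (Fin 3))) = {1, Equiv.swap 0 1, Equiv.swap 0 2,
      Equiv.swap 1 2, Equiv.swap 0 1 * Equiv.swap 1 2, Equiv.swap 1 2 * Equiv.swap 0 1} := by decide
  have h1 : v ∘ (1 : Equiv.Perm (Fin 3)) = ![v 0, v 1, v 2] := by funext i; fin_cases i <;> rfl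
  have h2 : v ∘ Equiv.swap (0 : Fin 3) 1 = ![v 1, v 0, v 2] := by funext i; fin_cases i <;> rfl
  have h3 : v ∘ Equiv.swap (0 : Fin 3) 2 = ![v 2, v 1, v 0] := by funext i; fin_cases i <;> rfl
  have h4 : v ∘ Equiv.swap (1 : Fin 3) 2 = ![v 0, v 2, v 1] := by funext i; fin_cases i <;> rfl
  have h5 : v ∘ (Equiv.swap (0 : Fin 3) 1 * Equiv.swap 1 2 : Equiv.Perm (Fin 3))
      = ![v 1, v 2, v 0] := by funext i; fin_cases i <;> rfl
  have h6 : v ∘ (Equiv.swap (1 : Fin 3) 2 * Equiv.swap 0 1 : Equiv.Perm (Fin 3))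
      = ![v 2, v 0, v 1] := by funext i; fin_cases i <;> rfl
  rw [altSum, hu, Finset.sum_insert (by decide), Finset.sum_insert (by decide),
    Finset.sum_insert (by decide), Finset.sum_insert (by decide), Finset.sum_insert (by decide),
    Finset.sum_singleton, h1, h2, h3, h4, h5, h6, Equiv.Perm.sign_mul, Equiv.Perm.sign_mul,
    Equiv.Perm.sign_swap (by decide), Equiv.Perm.sign_swap (by decide),
    Equiv.Perm.sign_swap (by decide)]
  simp
  ring

theorem DForm.swap_two (η : DForm ι 2) (u v : ι → ℝ) : η ![v, u] = -η ![u, v] := by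
  have h := η.toAlternatingMap.map_swap ![u, v] (i := 0) (j := 1) (by decide)
  have e : ![u, v] ∘ Equiv.swap (0 : Fin 2) 1 = ![v, u] := by funext i; fin_cases i <;> rfl
  rw [e] at h
  exact h

theorem wedge_one_one (α β : DForm ι 1) (u v : ι → ℝ) :
    wedge α β ![u, v] = α ![u] * β ![v] - α ![v] * β ![u] := by
  have h := wedge_eq_altSum α β ![u, v]
  rw [altSum_equiv, altSum_two] at h
  have e : ∀ (a b : ι → ℝ), (fun i : Fin 1 => (![a, b] ∘ (finSumFinEquiv : Fin 1 ⊕ Fin 1 ≃ Fin 2))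
      (Sum.inl i)) = ![a] ∧ (fun i : Fin 1 => (![a, b] ∘ (finSumFinEquiv : Fin 1 ⊕ Fin 1 ≃ Fin 2))
      (Sum.inr i)) = ![b] := fun a b => by
    constructor <;> funext i <;> fin_cases i <;> rfl
  simp only [(e _ _).1, (e _ _).2] at h
  simpa using h

theorem wedge_two_one (η : DForm ι 2) (γ : DForm ι 1) (u v w : ι → ℝ) :
    wedge η γ ![u, v, w] = η ![u, v] * γ ![w] - η ![u, w] * γ ![v] + η ![v, w] * γ ![u] := by
  have h := wedge_eq_altSum η γ ![u, v, w]
  rw [altSum_equiv, altSum_three] at h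
  have e : ∀ (a b c : ι → ℝ), (fun i : Fin 2 => (![a, b, c] ∘
      (finSumFinEquiv : Fin 2 ⊕ Fin 1 ≃ Fin 3)) (Sum.inl i)) = ![a, b] ∧
      (fun i : Fin 1 => (![a, b, c] ∘ (finSumFinEquiv : Fin 2 ⊕ Fin 1 ≃ Fin 3))
      (Sum.inr i)) = ![c] := fun a b c => by
    constructor <;> funext i <;> fin_cases i <;> rfl
  simp only [(e _ _ _).1, (e _ _ _).2] at h
  simp [Nat.factorial] at h
  rw [DForm.swap_two η u v, DForm.swap_two η u w, DForm.swap_two η v w] at h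
  linarith

theorem wedge_one_two (α : DForm ι 1) (η : DForm ι 2) (u v w : ι → ℝ) :
    wedge α η ![u, v, w] = α ![u] * η ![v, w] - α ![v] * η ![u, w] + α ![w] * η ![u, v] := by
  have h := wedge_eq_altSum α η ![u, v, w]
  rw [altSum_equiv, altSum_three] at h
  have e : ∀ (a b c : ι → ℝ), (fun i : Fin 1 => (![a, b, c] ∘
      (finSumFinEquiv : Fin 1 ⊕ Fin 2 ≃ Fin 3)) (Sum.inl i)) = ![a] ∧
      (fun i : Fin 2 => (![a, b, c] ∘ (finSumFinEquiv : Fin 1 ⊕ Fin 2 ≃ Fin 3))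
      (Sum.inr i)) = ![b, c] := fun a b c => by
    constructor <;> funext i <;> fin_cases i <;> rfl
  simp only [(e _ _ _).1, (e _ _ _).2] at h
  simp [Nat.factorial] at h
  rw [DForm.swap_two η u v, DForm.swap_two η u w, DForm.swap_two η v w] at h
  linarith

theorem oneForm_cvec (c : ι → ℝ) (i : ι) : oneForm c ![cvec i] = c i := by
  rw [oneForm, ContinuousAlternatingMap.ofSubsingleton_apply_apply]
  simp [cvec, Pi.single_apply]

theorem DForm.ext_cvec {k : ℕ} {α β : DForm ι k}
    (h : ∀ I : Fin k → ι, α (fun s => cvec (I s)) = β fun s => cvec (I s)) : α = β := by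
  have : α.toAlternatingMap = β.toAlternatingMap := by
    refine Module.Basis.ext_alternating (Pi.basisFun ℝ ι) fun I _ => ?_
    simpa [cvec] using h I
  exact ContinuousAlternatingMap.toAlternatingMap_injective this

theorem DForm.ext_one {α β : DForm ι 1} (h : ∀ i, α ![cvec i] = β ![cvec i]) : α = β :=
  DForm.ext_cvec fun I => by
    have : (fun s => (cvec (I s) : ι → ℝ)) = ![cvec (I 0)] := by funext s; fin_cases s; rfl
    rw [this, h]

theorem DForm.ext_two {α β : DForm ι 2}
    (h : ∀ i j, α ![cvec i, cvec j] = β ![cvec i, cvec j]) : α = β :=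
  DForm.ext_cvec fun I => by
    have : (fun s => (cvec (I s) : ι → ℝ)) = ![cvec (I 0), cvec (I 1)] := by
      funext s; fin_cases s <;> rfl
    rw [this, h]

theorem DForm.ext_three {α β : DForm ι 3} (h : ∀ i j k, α ![cvec i, cvec j, cvec k]
    = β ![cvec i, cvec j, cvec k]) : α = β :=
  DForm.ext_cvec fun I => by
    have : (fun s => (cvec (I s) : ι → ℝ)) = ![cvec (I 0), cvec (I 1), cvec (I 2)] := by
      funext s; fin_cases s <;> rfl
    rw [this, h]

/-- The form is a combination of constant forms with its components as coefficients. In degrees two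
and three the factors 1/2 and 1/6 compensate for summing over all index tuples. -/
theorem contDiffOn_one {Ω : Set (ι → ℝ)} {α : (ι → ℝ) → DForm ι 1}
    (h : ∀ i, ContDiffOn ℝ ∞ (fun p => α p ![cvec i]) Ω) : ContDiffOn ℝ ∞ α Ω := by
  have e : α = fun p => ∑ i, α p ![cvec i] • oneForm (cvec i) := by
    funext p
    refine DForm.ext_one fun j => ?_
    simp only [ContinuousAlternatingMap.sum_apply, ContinuousAlternatingMap.smul_apply,
      oneForm_cvec, smul_eq_mul]
    simp [cvec, Pi.single_apply]
  rw [e]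
  exact ContDiffOn.sum fun i _ => (h i).smul contDiffOn_const

theorem contDiffOn_two {Ω : Set (ι → ℝ)} {α : (ι → ℝ) → DForm ι 2}
    (h : ∀ i j, ContDiffOn ℝ ∞ (fun p => α p ![cvec i, cvec j]) Ω) : ContDiffOn ℝ ∞ α Ω := by
  have e : α = fun p => ∑ i, ∑ j, ((1 / 2) * α p ![cvec i, cvec j]) •
      wedge (oneForm (cvec i)) (oneForm (cvec j)) := by
    funext p
    refine DForm.ext_two fun i' j' => ?_
    have hs := DForm.swap_two (α p) (cvec i') (cvec j')
    simp only [ContinuousAlternatingMap.sum_apply, ContinuousAlternatingMap.smul_apply,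
      wedge_one_one, oneForm_cvec, smul_eq_mul, mul_sub, Finset.sum_sub_distrib]
    simp [cvec, Pi.single_apply]
    simp only [cvec] at hs
    rw [hs]; ring
  rw [e]
  exact ContDiffOn.sum fun i _ => ContDiffOn.sum fun j _ =>
    (contDiffOn_const.mul (h i j)).smul contDiffOn_const

theorem DForm.swap_three (η : DForm ι 3) (u v w : ι → ℝ) :
    η ![v, u, w] = -η ![u, v, w] ∧ η ![u, w, v] = -η ![u, v, w] := by
  constructor
  · have h := η.toAlternatingMap.map_swap ![u, v, w] (i := 0) (j := 1) (by decide)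
    have e : ![u, v, w] ∘ Equiv.swap (0 : Fin 3) 1 = ![v, u, w] := by
      funext i; fin_cases i <;> rfl
    rw [e] at h
    exact h
  · have h := η.toAlternatingMap.map_swap ![u, v, w] (i := 1) (j := 2) (by decide)
    have e : ![u, v, w] ∘ Equiv.swap (1 : Fin 3) 2 = ![u, w, v] := by
      funext i; fin_cases i <;> rfl
    rw [e] at h
    exact h

theorem contDiffOn_three {Ω : Set (ι → ℝ)} {α : (ι → ℝ) → DForm ι 3}
    (h : ∀ i j k, ContDiffOn ℝ ∞ (fun p => α p ![cvec i, cvec j, cvec k]) Ω) :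
    ContDiffOn ℝ ∞ α Ω := by
  have e : α = fun p => ∑ i, ∑ j, ∑ k, ((1 / 6) * α p ![cvec i, cvec j, cvec k]) •
      wedge (wedge (oneForm (cvec i)) (oneForm (cvec j))) (oneForm (cvec k)) := by
    funext p
    refine DForm.ext_three fun i' j' k' => ?_
    have s1 := fun u v w => (DForm.swap_three (α p) u v w).1
    have s2 := fun u v w => (DForm.swap_three (α p) u v w).2
    simp only [ContinuousAlternatingMap.sum_apply, ContinuousAlternatingMap.smul_apply,
      wedge_two_one, wedge_one_one, oneForm_cvec, smul_eq_mul, mul_add, mul_sub, sub_mul,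
      Finset.sum_add_distrib, Finset.sum_sub_distrib]
    simp [cvec, Pi.single_apply]
    have a1 := s1 (cvec i') (cvec j') (cvec k')
    have a2 := s2 (cvec i') (cvec j') (cvec k')
    have a3 := s2 (cvec j') (cvec i') (cvec k')
    have a4 := s1 (cvec i') (cvec k') (cvec j')
    have a5 := s2 (cvec k') (cvec i') (cvec j')
    simp only [cvec] at a1 a2 a3 a4 a5
    linarith
  rw [e]
  exact ContDiffOn.sum fun i _ => ContDiffOn.sum fun j _ => ContDiffOn.sum fun k _ =>
    (contDiffOn_const.mul (h i j k)).smul contDiffOn_const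

theorem extDeriv_cvec {k : ℕ} {η : (ι → ℝ) → DForm ι k} {p : ι → ℝ}
    (hη : DifferentiableAt ℝ η p) (I : Fin (k + 1) → ι) :
    extDeriv η p (fun s => cvec (I s)) = ∑ s : Fin (k + 1), (-1) ^ (s : ℕ) *
      pd (I s) (fun p => η p fun t => cvec (s.removeNth I t)) p := by
  rw [extDeriv_apply hη]
  refine Finset.sum_congr rfl fun s _ => ?_
  rw [zsmul_eq_mul, Int.cast_pow, Int.cast_neg, Int.cast_one]
  rfl

theorem extDeriv_one {α : (ι → ℝ) → DForm ι 1} {p : ι → ℝ} (hα : DifferentiableAt ℝ α p)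
    (i j : ι) : extDeriv α p ![cvec i, cvec j]
      = pd i (fun p => α p ![cvec j]) p - pd j (fun p => α p ![cvec i]) p := by
  have h := extDeriv_cvec hα ![i, j]
  have e : (fun s => (cvec (![i, j] s) : ι → ℝ)) = ![cvec i, cvec j] := by
    funext s; fin_cases s <;> rfl
  have e0 : (fun t => (cvec ((0 : Fin 2).removeNth ![i, j] t) : ι → ℝ)) = ![cvec j] := by
    funext s; fin_cases s; rfl
  have e1 : (fun t => (cvec ((1 : Fin 2).removeNth ![i, j] t) : ι → ℝ)) = ![cvec i] := by
    funext s; fin_cases s; rfl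
  rw [e, Fin.sum_univ_two, e0, e1] at h
  rw [h]
  simp [sub_eq_add_neg]

theorem extDeriv_two {α : (ι → ℝ) → DForm ι 2} {p : ι → ℝ} (hα : DifferentiableAt ℝ α p)
    (i j k : ι) : extDeriv α p ![cvec i, cvec j, cvec k]
      = pd i (fun p => α p ![cvec j, cvec k]) p - pd j (fun p => α p ![cvec i, cvec k]) p
        + pd k (fun p => α p ![cvec i, cvec j]) p := by
  have h := extDeriv_cvec hα ![i, j, k]
  have e : (fun s => (cvec (![i, j, k] s) : ι → ℝ)) = ![cvec i, cvec j, cvec k] := by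
    funext s; fin_cases s <;> rfl
  have e0 : (fun t => (cvec ((0 : Fin 3).removeNth ![i, j, k] t) : ι → ℝ)) = ![cvec j, cvec k] := by
    funext s; fin_cases s <;> rfl
  have e1 : (fun t => (cvec ((1 : Fin 3).removeNth ![i, j, k] t) : ι → ℝ)) = ![cvec i, cvec k] := by
    funext s; fin_cases s <;> rfl
  have e2 : (fun t => (cvec ((2 : Fin 3).removeNth ![i, j, k] t) : ι → ℝ)) = ![cvec i, cvec j] := by
    funext s; fin_cases s <;> rfl
  rw [e, Fin.sum_univ_three, e0, e1, e2] at h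
  rw [h]
  simp [sub_eq_add_neg]

end FormComponents

end

/-! ### The torsion as −dA ∧ τ -/

noncomputable section

section GaugeFields

open Matrix

namespace BoostData

variable {κ R : Type*} [Fintype κ] [DecidableEq κ] [CommRing R] [Algebra ℝ R]
  (S : BoostData κ R)

/-- The components of the one-form `τ` with `H = -dA ∧ τ`. -/
def tau (k : κ) : R := S.h S.z k - S.h S.z S.z * S.A k

theorem mul_L_apply (M : Matrix κ κ R) (k l : κ) :
    (M * S.L) k l = M k l - M k S.z * S.A l := by
  rw [L, Matrix.mul_sub, Matrix.mul_one, Matrix.sub_apply, mul_apply]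
  simp [N]

theorem LT_mul_apply (M : Matrix κ κ R) (k l : κ) :
    (S.Lᵀ * M) k l = M k l - S.A k * M S.z l := by
  have := S.mul_L_apply Mᵀ l k
  rw [← Matrix.transpose_apply (M := Mᵀ * S.L), Matrix.transpose_mul, Matrix.transpose_transpose]
    at this
  rw [this, transpose_apply, transpose_apply, mul_comm]

theorem mul_e_mul_apply (M N : Matrix κ κ R) (k l : κ) :
    (M * S.e * N) k l = algebraMap ℝ R S.a * S.Phii * (M k S.z * N S.z l) := by
  rw [e, Matrix.mul_smul, Matrix.smul_mul, Matrix.smul_apply, smul_eq_mul]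
  congr 1
  rw [mul_apply, Finset.sum_eq_single S.z]
  · rw [Matrix.mul_single_apply_same, mul_one]
  · intro j _ hj
    rw [Matrix.mul_single_apply_of_ne _ _ _ _ _ hj, zero_mul]
  · simp

theorem h_apply_symm (i j : κ) : S.h i j = S.h j i := by
  conv_lhs => rw [← S.symm, transpose_apply]

/-- As e has rank one, h e p_j is the product of column z of h with a/Φ times row z of p_j;
conjugation by L turns the column into τ and the row into ∂_j A. -/
theorem H_apply (j k l : κ) :
    S.H j k l = S.tau k * S.d j (S.A l) - S.d j (S.A k) * S.tau l := by
  rw [H, mul_L_apply, LT_mul_apply, LT_mul_apply, Matrix.sub_apply, Matrix.sub_apply,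
    Matrix.sub_apply, Matrix.sub_apply, mul_e_mul_apply, mul_e_mul_apply, mul_e_mul_apply,
    mul_e_mul_apply, mul_e_mul_apply, mul_e_mul_apply, mul_e_mul_apply, mul_e_mul_apply, d_A, d_A,
    tau, tau, S.p_apply_symm j k S.z, S.h_apply_symm k S.z]
  ring

/-- Substitute Φ = a h_zz + c in Φ A_k = a h_zk + χ_k. -/
theorem a_tau (k : κ) : algebraMap ℝ R S.a * S.tau k
    = algebraMap ℝ R S.c * S.A k - algebraMap ℝ R (S.chi k) := by
  rw [tau]
  linear_combination S.A k * S.Phi_eq - S.A_eq k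

end BoostData

namespace BoostData.Frame

open BasicRing

variable {κ : Type*} [Fintype κ] [DecidableEq κ] {W : BasicDomain (κ ⊕ κ)}
  {S : BoostData κ (BasicRing W)} (P : S.Frame)

theorem D_inl (j : κ) (f : BasicRing W) : D (Sum.inl j) f = ∑ k, P.E k j * S.d k f := by
  rw [frameDer_inv (D (W := W)) P.TE (Sum.inl j) f, TT, P.der, Fintype.sum_sum_type]
  simp [EE, blockFrame]

theorem D_inr (P : S.Frame) (j : κ) (f : BasicRing W) : D (Sum.inr j) f = 0 := by
  rw [frameDer_inv (D (W := W)) P.TE (Sum.inr j) f, TT, P.der, Fintype.sum_sum_type]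
  simp [EE, blockFrame]

/-- The coordinate components of the gauge potential. -/
def Ac (S : BoostData κ (BasicRing W)) : κ ⊕ κ → BasicRing W := Sum.elim 0 S.A

/-- The coordinate components of `τ`. -/
def tauc (S : BoostData κ (BasicRing W)) : κ ⊕ κ → BasicRing W := Sum.elim 0 S.tau

/-- The components of `dA`. -/
def dAc (S : BoostData κ (BasicRing W)) (i j : κ ⊕ κ) : BasicRing W :=
  D i (Ac S j) - D j (Ac S i)

theorem Fc_apply (q : ℝ) (i j : κ ⊕ κ) : P.Fc q i j = algebraMap ℝ _ q * dAc S i j := by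
  have h : P.Fc q = fromBlocks 0 (P.Eᵀ * S.X q) (-((P.Eᵀ * S.X q)ᵀ)) 0 := by
    rw [Fc, EE, blockFrame, Fm, fromBlocks_transpose, fromBlocks_multiply, fromBlocks_multiply]
    simp
  have h1 : ∀ i j, (P.Eᵀ * S.X q) i j = algebraMap ℝ _ q * D (Sum.inl i) (S.A j) := fun i j => by
    rw [P.D_inl, mul_apply, Finset.mul_sum]
    exact Finset.sum_congr rfl fun k _ => by rw [transpose_apply, X]; ring
  rw [h]
  rcases i with i | i <;> rcases j with j | j
  · simp [dAc, Ac]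
  · rw [fromBlocks_apply₁₂, h1]; simp [dAc, Ac]
  · rw [fromBlocks_apply₂₁, Matrix.neg_apply, transpose_apply, h1]; simp [dAc, Ac, P.D_inr]; ring
  · simp [dAc, Ac, P.D_inr]

theorem Hc_apply (i j k : κ ⊕ κ) : P.Hc i j k
    = -(dAc S i j * tauc S k - dAc S i k * tauc S j + dAc S j k * tauc S i) := by
  have h1 : ∀ i k l, ∑ j, P.E j i * S.H j k l
      = S.tau k * D (Sum.inl i) (S.A l) - D (Sum.inl i) (S.A k) * S.tau l := fun i k l => by
    rw [P.D_inl, P.D_inl, Finset.mul_sum, Finset.sum_mul, ← Finset.sum_sub_distrib]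
    exact Finset.sum_congr rfl fun j _ => by rw [H_apply]; ring
  rcases i with i | i
  · have h : P.Hc (Sum.inl i) = fromBlocks 0 0 0 (∑ j, P.E j i • S.H j) := by
      rw [Hc, Fintype.sum_sum_type]
      have e2 : ∀ j, P.EE (Sum.inr j) (Sum.inl i) = 0 := fun j => rfl
      have e1 : ∀ j, P.EEᵀ * S.Hm (Sum.inl j) * P.EE = fromBlocks 0 0 0 (S.H j) := fun j => by
        rw [EE, blockFrame, Hm, fromBlocks_transpose]
        simp [fromBlocks_multiply]
      simp only [e1, e2, zero_smul, Finset.sum_const_zero, add_zero]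
      ext (a | a) (b | b) <;> simp [Matrix.sum_apply, EE, blockFrame]
    rw [h]
    rcases j with j | j <;> rcases k with k | k
    · simp [dAc, Ac, tauc]
    · simp [dAc, Ac, tauc]
    · simp [dAc, Ac, tauc]
    · have := h1 i j k
      simp only [fromBlocks_apply₂₂, Matrix.sum_apply, Matrix.smul_apply, smul_eq_mul, this]
      simp [dAc, Ac, tauc]; ring
  · have h : P.Hc (Sum.inr i) = fromBlocks 0 (P.Eᵀ * S.Z i) (-((P.Eᵀ * S.Z i)ᵀ)) 0 := by
      rw [Hc, Fintype.sum_sum_type]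
      have e2 : ∀ j, P.EE (Sum.inl j) (Sum.inr i) = 0 := fun j => rfl
      have e3 : ∀ j, P.EE (Sum.inr j) (Sum.inr i) = if j = i then 1 else 0 := fun j => by
        simp [EE, blockFrame, Matrix.one_apply]
      simp only [e2, e3, zero_smul, Finset.sum_const_zero, zero_add, ite_smul, one_smul,
        Finset.sum_ite_eq', Finset.mem_univ, if_true]
      rw [EE, blockFrame, Hm, fromBlocks_transpose]
      simp [fromBlocks_multiply]
    have h2 : ∀ j k, (P.Eᵀ * S.Z i) j k
        = D (Sum.inl j) (S.A i) * S.tau k - S.tau i * D (Sum.inl j) (S.A k) := fun j k => by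
      have e : (P.Eᵀ * S.Z i) j k = -∑ l, P.E l j * S.H l i k := by
        rw [mul_apply, ← Finset.sum_neg_distrib]
        exact Finset.sum_congr rfl fun l _ => by rw [transpose_apply, Z]; ring
      rw [e, h1]; ring
    rw [h]
    rcases j with j | j <;> rcases k with k | k
    · simp [dAc, Ac, tauc]
    · rw [fromBlocks_apply₁₂, h2]; simp [dAc, Ac, tauc, P.D_inr]; ring
    · rw [fromBlocks_apply₂₁, Matrix.neg_apply, transpose_apply, h2]
      simp [dAc, Ac, tauc, P.D_inr]; ring
    · simp [dAc, Ac, tauc, P.D_inr]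

end BoostData.Frame

end GaugeFields

end

/-! ### Coordinate components of F and H for the family -/

noncomputable section

section KtForms

open Matrix BasicRing BoostData.Frame

namespace KtReal

variable {n : ℕ} {W : BasicDomain (Idx n)} {S : SepBoost n (BasicRing W)} {K : TypeA n}

/-- The factors √Q_μ of e^μ and e^μ̂ cancel. -/
theorem sqrt_coframe (H : KtReal S K) (p : W.carrier) (μ : Fin n) (i j : Idx n) :
    K.coframe p (Sum.inl μ) i * K.coframe p (Sum.inr μ) j
      = 2 * xc (p : Idx n → ℝ) μ * (cvec (Sum.inl μ) i * K.th p μ j) := by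
  have hq : Real.sqrt (K.Q p μ) ≠ 0 := (Real.sqrt_pos.mpr (H.Q_pos p μ)).ne'
  have hf : K.f μ (xc (p : Idx n → ℝ) μ) = 2 * xc (p : Idx n → ℝ) μ := by rw [H.eq]; rfl
  simp only [TypeA.coframe, Sum.elim_inl, Sum.elim_inr, Pi.smul_apply, smul_eq_mul, hf, TypeA.th]
  field_simp

theorem ev_D_Ac (H : KtReal S K) (p : W.carrier) (i j : Idx n) :
    ev p (D i (Ac S.boost j)) = ∑ μ, K.dlnPhi p μ * (cvec (Sum.inl μ) i * K.th p μ j) := by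
  rcases j with j | j
  · simp [Ac, TypeA.th_inl]
  · rcases i with i | i
    · rw [Finset.sum_eq_single i]
      · have h1 : D (Sum.inl i) (Ac S.boost (Sum.inr j)) = S.pd i (S.A j) := by rw [H.pd]; rfl
        rw [h1, S.pd_A, map_mul, ← H.dlnPhi_eq, ← H.ev_theta, SepBoost.theta]
        simp [cvec]
      · intro μ _ hμ
        have h' : (Sum.inl i : Idx n) ≠ Sum.inl μ := fun e => hμ (Sum.inl_injective e).symm
        rw [cvec, Pi.single_eq_of_ne h', zero_mul, mul_zero]
      · simp
    · rw [H.frame.D_inr]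
      simp [cvec]

theorem ktF_apply (H : KtReal S K) (q : ℝ) (p : W.carrier) (i j : Idx n) :
    ktF q K p ![cvec i, cvec j] = ev p (H.frame.Fc q i j) := by
  rw [Fc_apply, dAc, map_mul, ev_algebraMap, map_sub, H.ev_D_Ac, H.ev_D_Ac, ktF,
    ContinuousAlternatingMap.smul_apply, smul_eq_mul, ContinuousAlternatingMap.sum_apply,
    ← Finset.sum_sub_distrib]
  congr 1
  refine Finset.sum_congr rfl fun μ _ => ?_
  have hx := (H.mem p).1 μ
  rw [ContinuousAlternatingMap.smul_apply, smul_eq_mul, wedge_one_one, TypeA.e, TypeA.ehat,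
    oneForm_cvec, oneForm_cvec, oneForm_cvec, oneForm_cvec, H.sqrt_coframe, H.sqrt_coframe]
  field_simp

/-- Since σ_νz = 1, h_zk − h_zz A_k = Σ_ν (P_ν/U_ν)(σ_νk − A_k). -/
theorem ev_tauc (H : KtReal S K) (p : W.carrier) (k : Idx n) :
    ev p (tauc S.boost k) = ∑ ν, 4 * xc (p : Idx n → ℝ) ν ^ 2 * K.Q p ν * K.th p ν k := by
  rcases k with k | k
  · simp [tauc, TypeA.th_inl]
  · have h1 : tauc S.boost (Sum.inr k) = ∑ ν, S.P ν * S.ui ν * S.theta ν k := by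
      have : tauc S.boost (Sum.inr k) = S.h S.z k - S.h S.z S.z * S.A k := rfl
      rw [this, SepBoost.h, SepBoost.h, Finset.sum_mul, ← Finset.sum_sub_distrib]
      refine Finset.sum_congr rfl fun ν _ => ?_
      rw [S.sig_z, SepBoost.theta]; ring
    rw [h1, map_sum]
    refine Finset.sum_congr rfl fun ν _ => ?_
    rw [map_mul, map_mul, H.ev_P, H.ev_ui, H.ev_theta, TypeA.Q, div_eq_mul_inv]; ring

theorem ktH_apply (H : KtReal S K) (p : W.carrier) (i j k : Idx n) :
    ktH K p ![cvec i, cvec j, cvec k] = ev p (H.frame.Hc i j k) := by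
  have hw : ∀ μ ν, ((xc (p : Idx n → ℝ) ν * K.dlnPhi p μ / xc (p : Idx n → ℝ) μ) *
      Real.sqrt (K.Q p ν)) * wedge (wedge (K.e p μ) (K.ehat p μ)) (K.ehat p ν)
        ![cvec i, cvec j, cvec k] = K.dlnPhi p μ * (4 * xc (p : Idx n → ℝ) ν ^ 2 * K.Q p ν) *
      ((cvec (Sum.inl μ) i * K.th p μ j - cvec (Sum.inl μ) j * K.th p μ i) * K.th p ν k
      - (cvec (Sum.inl μ) i * K.th p μ k - cvec (Sum.inl μ) k * K.th p μ i) * K.th p ν j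
      + (cvec (Sum.inl μ) j * K.th p μ k - cvec (Sum.inl μ) k * K.th p μ j) * K.th p ν i) := by
    intro μ ν
    have hx := (H.mem p).1 μ
    have hf : K.f ν (xc (p : Idx n → ℝ) ν) = 2 * xc (p : Idx n → ℝ) ν := by rw [H.eq]; rfl
    have hq := (Real.mul_self_sqrt (H.Q_pos p ν).le).symm
    have he : ∀ l, K.ehat p ν ![cvec l]
        = 2 * xc (p : Idx n → ℝ) ν * Real.sqrt (K.Q p ν) * K.th p ν l := fun l => by
      rw [TypeA.ehat, oneForm_cvec]
      simp only [TypeA.coframe, Sum.elim_inr, Pi.smul_apply, smul_eq_mul, hf, TypeA.th]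
    have h2 : ∀ l l', wedge (K.e p μ) (K.ehat p μ) ![cvec l, cvec l'] = 2 * xc (p : Idx n → ℝ) μ *
        (cvec (Sum.inl μ) l * K.th p μ l' - cvec (Sum.inl μ) l' * K.th p μ l) := fun l l' => by
      rw [wedge_one_one, TypeA.e, TypeA.ehat, oneForm_cvec, oneForm_cvec, oneForm_cvec,
        oneForm_cvec, H.sqrt_coframe, H.sqrt_coframe]; ring
    rw [wedge_two_one, he, he, he, h2, h2, h2]
    generalize Real.sqrt (K.Q p ν) = r at hq ⊢
    rw [hq]
    field_simp
    ring
  rw [Hc_apply, map_neg, map_add, map_sub, map_mul, map_mul, map_mul, dAc, dAc, dAc, map_sub,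
    map_sub, map_sub]
  simp only [H.ev_D_Ac, H.ev_tauc]
  rw [ktH, ContinuousAlternatingMap.neg_apply, ContinuousAlternatingMap.sum_apply]
  simp only [← Finset.sum_sub_distrib, Finset.sum_mul_sum]
  simp only [← Finset.sum_add_distrib]
  congr 1
  refine Finset.sum_congr rfl fun μ _ => ?_
  rw [ContinuousAlternatingMap.sum_apply, ← Finset.add_sum_erase _ _ (Finset.mem_univ μ)]
  -- In dA ∧ τ the index ν runs over all values; the term ν = μ vanishes because θ_μ then occurs
  -- twice.
  have h0 : ∀ (A B C : ℝ), A = 0 → B = C → B = A + C := fun A B C h h' => by rw [h, h', zero_add]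
  refine h0 _ _ _ (by ring) (Finset.sum_congr rfl fun ν _ => ?_)
  rw [ContinuousAlternatingMap.smul_apply, smul_eq_mul, hw]
  ring

theorem formMat_ktF (H : KtReal S K) (q : ℝ) (p : W.carrier) :
    formMat (ktF q K p) = (H.frame.Fc q).map (ev p) := by
  ext i j; exact H.ktF_apply q p i j

theorem formMat₃_ktH (H : KtReal S K) (p : W.carrier) (i : Idx n) :
    formMat₃ (ktH K p) i = (H.frame.Hc i).map (ev p) := by
  ext j k; exact H.ktH_apply p i j k

theorem contDiffOn_ktF (H : KtReal S K) (q : ℝ) : ContDiffOn ℝ ∞ (ktF q K) W.carrier :=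
  contDiffOn_two fun i j => Rep.contDiffOn (r := H.frame.Fc q i j) fun p => H.ktF_apply q p i j

theorem contDiffOn_ktH (H : KtReal S K) : ContDiffOn ℝ ∞ (ktH K) W.carrier :=
  contDiffOn_three fun i j k =>
    Rep.contDiffOn (r := H.frame.Hc i j k) fun p => H.ktH_apply p i j k

end KtReal

end KtForms

end

/-! ### The solution of heterotic supergravity -/

noncomputable section

section HeteroticSolution

open Matrix BasicRing BoostData.Frame

namespace KtReal

variable {n : ℕ} {W : BasicDomain (Idx n)} {S : SepBoost n (BasicRing W)} {K : TypeA n}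

theorem rep_A1 (H : KtReal S K) (i : Idx n) : Rep (fun p => K.A1 p i) (Ac S.boost i) := fun p => by
  rcases i with i | i
  · simp [Ac, TypeA.A1_inl]
  · exact (H.ev_A p i).symm

theorem rep_gauge (H : KtReal S K) (q : ℝ) (i : Idx n) :
    Rep (fun p => (q • oneForm (K.A1 p)) ![cvec i]) (algebraMap ℝ _ q * Ac S.boost i) := fun p => by
  dsimp only
  rw [ContinuousAlternatingMap.smul_apply, oneForm_cvec, map_mul, ev_algebraMap, smul_eq_mul]
  exact congrArg (q * ·) (H.rep_A1 i p)

theorem contDiffOn_gauge (H : KtReal S K) (q : ℝ) :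
    ContDiffOn ℝ ∞ (fun p => q • oneForm (K.A1 p)) W.carrier :=
  contDiffOn_one fun i => (H.rep_gauge q i).contDiffOn

theorem differentiableAt_of_contDiffOn {E : Type*} [NormedAddCommGroup E] [NormedSpace ℝ E]
    {f : (Idx n → ℝ) → E} (h : ContDiffOn ℝ ∞ f W.carrier) (p : W.carrier) :
    DifferentiableAt ℝ f p :=
  (h.differentiableOn (by norm_num)).differentiableAt (W.isOpen.mem_nhds p.2)

theorem extDeriv_gauge (H : KtReal S K) (q : ℝ) (p : W.carrier) (i j : Idx n) :
    extDeriv (fun p => q • oneForm (K.A1 p)) p ![cvec i, cvec j] = ev p (H.frame.Fc q i j) := by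
  rw [extDeriv_one (differentiableAt_of_contDiffOn (H.contDiffOn_gauge q) p),
    (H.rep_gauge q j).pd i p, (H.rep_gauge q i).pd j p, Fc_apply, dAc]
  simp [Derivation.leibniz, mul_sub]

/-- The two-form potential `a⁻¹ A ∧ χ` of the torsion. -/
def potential (S : SepBoost n (BasicRing W)) (K : TypeA n) (p : Idx n → ℝ) : DForm (Idx n) 2 :=
  S.a⁻¹ • wedge (oneForm (K.A1 p)) (oneForm (Sum.elim 0 S.chi))

theorem rep_potential (H : KtReal S K) (i j : Idx n) :
    Rep (fun p => potential S K p ![cvec i, cvec j])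
      (algebraMap ℝ _ S.a⁻¹ * (Ac S.boost i * algebraMap ℝ _ ((Sum.elim 0 S.chi : Idx n → ℝ) j)
        - Ac S.boost j * algebraMap ℝ _ ((Sum.elim 0 S.chi : Idx n → ℝ) i))) := fun p => by
  dsimp only [potential]
  rw [ContinuousAlternatingMap.smul_apply, wedge_one_one, oneForm_cvec, oneForm_cvec,
    oneForm_cvec, oneForm_cvec, map_mul, ev_algebraMap, map_sub, map_mul, map_mul, ev_algebraMap,
    ev_algebraMap, smul_eq_mul]
  have h1 : K.A1 p i = _ := H.rep_A1 i p
  have h2 : K.A1 p j = _ := H.rep_A1 j p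
  rw [h1, h2]

theorem contDiffOn_potential (H : KtReal S K) : ContDiffOn ℝ ∞ (potential S K) W.carrier :=
  contDiffOn_two fun i j => (H.rep_potential i j).contDiffOn

/-- For a = 0 the condition on q would make Φ vanish. -/
theorem a_ne_zero (H : KtReal S K) {q : ℝ} (hq : S.kap = S.a * q ^ 2) (p : W.carrier) :
    S.a ≠ 0 := fun h0 => by
  have h := H.ev_Phi p
  rw [S.Phi_eq, hq, h0] at h
  simp at h
  exact (H.mem p).2.2.2.ne h

/-- H = −dA_(1) ∧ τ with τ = q²A_(1) − a⁻¹χ and χ constant: the term in χ is d(a⁻¹A_(1) ∧ χ), and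
the other is −q²A_(1) ∧ dA_(1). -/
theorem ktH_eq (H : KtReal S K) {q : ℝ} (hq : S.kap = S.a * q ^ 2) (p : W.carrier) :
    ktH K p = extDeriv (potential S K) p
      - wedge (q • oneForm (K.A1 p)) (extDeriv (fun p => q • oneForm (K.A1 p)) p) := by
  have ha := H.a_ne_zero hq p
  have ht : ∀ k, ev p (tauc S.boost k)
      = q ^ 2 * ev p (Ac S.boost k) - S.a⁻¹ * (Sum.elim 0 S.chi : Idx n → ℝ) k := fun k => by
    rcases k with k | k
    · simp [tauc, Ac]
    · have := congrArg (ev p) (S.boost.a_tau k)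
      rw [map_mul, map_sub, map_mul, ev_algebraMap, ev_algebraMap, ev_algebraMap] at this
      have h2 : S.a * ev p (tauc S.boost (Sum.inr k))
          = S.kap * ev p (Ac S.boost (Sum.inr k)) - S.chi k := this
      rw [hq] at h2
      field_simp
      rw [mul_comm, h2, Sum.elim_inr]
      ring
  have hg : ∀ i, (q • oneForm (K.A1 p)) ![cvec i] = q * ev p (Ac S.boost i) := fun i =>
    (H.rep_gauge q i p).trans (by rw [map_mul, ev_algebraMap])
  refine DForm.ext_three fun i j k => ?_
  rw [ContinuousAlternatingMap.sub_apply, wedge_one_two, H.extDeriv_gauge, H.extDeriv_gauge,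
    H.extDeriv_gauge, hg, hg, hg,
    extDeriv_two (differentiableAt_of_contDiffOn H.contDiffOn_potential p),
    (H.rep_potential j k).pd i p, (H.rep_potential i k).pd j p, (H.rep_potential i j).pd k p,
    H.ktH_apply, Hc_apply, Fc_apply, Fc_apply, Fc_apply, dAc, dAc, dAc]
  simp only [Derivation.leibniz, Derivation.map_algebraMap, map_sub, map_add, map_neg, map_mul,
    smul_eq_mul, mul_zero, add_zero, zero_add, ev_algebraMap]
  rw [ht i, ht j, ht k]
  ring

theorem isAbelianHeteroticSolution (H : KtReal S K) (o : Fin (n + n) ≃ Idx n) {q : ℝ}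
    (hq : S.kap = S.a * q ^ 2) :
    IsAbelianHeteroticSolution o K.domain K.metric (ktphi K) (fun p => q • oneForm (K.A1 p))
      (potential S K) (ktF q K) (ktH K) := by
  have hn := S.two_le
  have hpos : ∀ p ∈ W.carrier, 0 < (K.metric p).det := fun p hp => (H.metric_posDef ⟨p, hp⟩).det_pos
  have hm : ∀ p ∈ K.domain, p ∈ W.carrier := fun p hp => by rwa [H.carrier]
  exact
  { three_le := by omega
    metric := H.isRiemannianMetricOn
    smooth_φ := by rw [← H.carrier]; exact H.rep_phi.contDiffOn
    smooth_A := by rw [← H.carrier]; exact H.contDiffOn_gauge q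
    smooth_B := by rw [← H.carrier]; exact H.contDiffOn_potential
    smooth_F := by rw [← H.carrier]; exact H.contDiffOn_ktF q
    smooth_H := by rw [← H.carrier]; exact H.contDiffOn_ktH
    strength_F := fun p hp => DForm.ext_two fun i j =>
      (H.ktF_apply q ⟨p, hm p hp⟩ i j).trans (H.extDeriv_gauge q ⟨p, hm p hp⟩ i j).symm
    strength_H := fun p hp => H.ktH_eq hq ⟨p, hm p hp⟩
    einstein := fun p hp a b => H.frame.einstein hq H.metric_eq H.rep_phi (H.formMat_ktF q)
      H.formMat₃_ktH ⟨p, hm p hp⟩ a b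
    maxwell := fun m h p hp => H.frame.maxwell H.metric_eq hpos H.rep_phi (H.formMat_ktF q)
      H.formMat₃_ktH o m _ h ⟨p, hm p hp⟩
    threeForm := fun m h p hp => H.frame.threeForm H.metric_eq hpos H.rep_phi
      H.formMat₃_ktH o m h ⟨p, hm p hp⟩
    dilaton := fun p hp => H.frame.dilaton hq H.metric_eq H.rep_phi (H.formMat_ktF q)
      H.formMat₃_ktH ⟨p, hm p hp⟩ }

end KtReal

end HeteroticSolution

end

/-! ### Integrability from closed coframes -/

noncomputable section

section ClosedCoframes

open Matrix

variable {ι : Type*} [Fintype ι] [DecidableEq ι]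

theorem fderiv_eq_sum_pd (f : (ι → ℝ) → ℝ) (p v : ι → ℝ) :
    fderiv ℝ f p v = ∑ i, v i * pd i f p := by
  conv_lhs => rw [show v = ∑ i, v i • cvec i by simpa [cvec] using pi_eq_sum_univ' v]
  simp [pd]

theorem differentiableAt_mulVec {C : (ι → ℝ) → Matrix ι ι ℝ} {X : (ι → ℝ) → ι → ℝ} {p : ι → ℝ}
    (hC : ∀ a j, DifferentiableAt ℝ (fun q => C q a j) p) (hX : DifferentiableAt ℝ X p) :
    DifferentiableAt ℝ (fun q => C q *ᵥ X q) p :=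
  differentiableAt_pi.mpr fun a => by
    simp only [mulVec, dotProduct]
    exact DifferentiableAt.fun_sum fun j _ => (hC a j).mul (differentiableAt_pi.mp hX j)

theorem fderiv_pi_apply {X : (ι → ℝ) → ι → ℝ} {p : ι → ℝ} (hX : DifferentiableAt ℝ X p)
    (v : ι → ℝ) (a : ι) : fderiv ℝ X p v a = fderiv ℝ (fun q => X q a) p v := by
  have := (hasFDerivAt_pi'.mp hX.hasFDerivAt a).fderiv
  rw [this]; rfl

theorem fderiv_mulVec {C : (ι → ℝ) → Matrix ι ι ℝ} {X : (ι → ℝ) → ι → ℝ} {p : ι → ℝ}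
    (hC : ∀ a j, DifferentiableAt ℝ (fun q => C q a j) p) (hX : DifferentiableAt ℝ X p)
    (v : ι → ℝ) (a : ι) : fderiv ℝ (fun q => C q *ᵥ X q) p v a
      = (C p *ᵥ fderiv ℝ X p v) a + ∑ i, ∑ j, pd i (fun q => C q a j) p * v i * X p j := by
  have h : HasFDerivAt (fun q => (C q *ᵥ X q) a) (∑ j, (C p a j • fderiv ℝ (fun q => X q j) p
      + X p j • fderiv ℝ (fun q => C q a j) p)) p := by
    simp only [mulVec, dotProduct]
    exact HasFDerivAt.fun_sum fun j _ =>
      (hC a j).hasFDerivAt.mul (differentiableAt_pi.mp hX j).hasFDerivAt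
  rw [fderiv_pi_apply (differentiableAt_mulVec hC hX), h.fderiv, Finset.sum_comm,
    ContinuousLinearMap.sum_apply, mulVec, dotProduct, ← Finset.sum_add_distrib]
  refine Finset.sum_congr rfl fun j _ => ?_
  rw [ContinuousLinearMap.add_apply, ContinuousLinearMap.smul_apply, ContinuousLinearMap.smul_apply,
    fderiv_pi_apply hX, fderiv_eq_sum_pd (fun q => C q a j), smul_eq_mul, smul_eq_mul,
    Finset.mul_sum]
  congr 1
  exact Finset.sum_congr rfl fun i _ => by ring

/-- The bracket in a closed coframe. -/
theorem mulVec_lieBracket {C : (ι → ℝ) → Matrix ι ι ℝ} {X Y : (ι → ℝ) → ι → ℝ} {p : ι → ℝ}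
    (hC : ∀ a j, DifferentiableAt ℝ (fun q => C q a j) p)
    (hc : ∀ a i j, pd i (fun q => C q a j) p = pd j (fun q => C q a i) p)
    (hX : DifferentiableAt ℝ X p) (hY : DifferentiableAt ℝ Y p) :
    C p *ᵥ VectorField.lieBracket ℝ X Y p
      = fderiv ℝ (fun q => C q *ᵥ Y q) p (X p) - fderiv ℝ (fun q => C q *ᵥ X q) p (Y p) := by
  ext a
  rw [Pi.sub_apply, fderiv_mulVec hC hX, fderiv_mulVec hC hY, VectorField.lieBracket,
    Matrix.mulVec_sub, Pi.sub_apply]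
  have : ∑ i, ∑ j, pd i (fun q => C q a j) p * X p i * Y p j
      = ∑ i, ∑ j, pd i (fun q => C q a j) p * Y p i * X p j := by
    rw [Finset.sum_comm]
    refine Finset.sum_congr rfl fun i _ => Finset.sum_congr rfl fun j _ => ?_
    rw [hc a j i]; ring
  rw [this]; ring

theorem fderiv_const_mulVec (M : Matrix ι ι ℝ) {X : (ι → ℝ) → ι → ℝ} {p : ι → ℝ}
    (hX : DifferentiableAt ℝ X p) (v : ι → ℝ) :
    fderiv ℝ (fun q => M *ᵥ X q) p v = M *ᵥ fderiv ℝ X p v := by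
  ext a
  rw [fderiv_mulVec (C := fun _ => M) (fun _ _ => differentiableAt_const _) hX]
  have : ∀ i j, pd i (fun _ : ι → ℝ => M a j) p = 0 := fun i j => by simp [pd]
  simp [this]

/-- An almost complex structure that is constant in a closed coframe is integrable. -/
theorem nijenhuis_eq_zero {Ω : Set (ι → ℝ)} (hΩ : IsOpen Ω) {C Ci J : (ι → ℝ) → Matrix ι ι ℝ}
    {M : Matrix ι ι ℝ} (hM : M * M = -1)
    (hC : ∀ p ∈ Ω, ∀ a j, DifferentiableAt ℝ (fun q => C q a j) p)
    (hc : ∀ p ∈ Ω, ∀ a i j, pd i (fun q => C q a j) p = pd j (fun q => C q a i) p)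
    (hi : ∀ p ∈ Ω, Ci p * C p = 1) (hJ : ∀ p ∈ Ω, ∀ a j, DifferentiableAt ℝ (fun q => J q a j) p)
    (h : ∀ p ∈ Ω, C p * J p = M * C p) {X Y : (ι → ℝ) → ι → ℝ} {p : ι → ℝ} (hp : p ∈ Ω)
    (hX : DifferentiableAt ℝ X p) (hY : DifferentiableAt ℝ Y p) : nijenhuis J X Y p = 0 := by
  have hJX := differentiableAt_mulVec (hJ p hp) hX
  have hJY := differentiableAt_mulVec (hJ p hp) hY
  have hd : ∀ {Z : (ι → ℝ) → ι → ℝ}, DifferentiableAt ℝ Z p → ∀ v,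
      fderiv ℝ (fun q => C q *ᵥ (J q *ᵥ Z q)) p v = M *ᵥ fderiv ℝ (fun q => C q *ᵥ Z q) p v := by
    intro Z hZ v
    rw [← fderiv_const_mulVec M (differentiableAt_mulVec (hC p hp) hZ)]
    congr 1
    refine Filter.EventuallyEq.fderiv_eq ?_
    filter_upwards [hΩ.mem_nhds hp] with q hq
    rw [mulVec_mulVec, mulVec_mulVec, h q hq]
  have hm : ∀ v, C p *ᵥ (J p *ᵥ v) = M *ᵥ (C p *ᵥ v) := fun v => by
    rw [mulVec_mulVec, mulVec_mulVec, h p hp]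
  have hMM : ∀ v, M *ᵥ (M *ᵥ v) = -v := fun v => by
    rw [mulVec_mulVec, hM, neg_mulVec, one_mulVec]
  -- In a closed coframe a bracket is a difference of directional derivatives of components. As J
  -- acts by the constant matrix M with M² = −1, the four brackets cancel.
  have key : C p *ᵥ nijenhuis J X Y p = 0 := by
    rw [nijenhuis, Matrix.mulVec_sub, Matrix.mulVec_sub, Matrix.mulVec_sub, hm, hm,
      mulVec_lieBracket (hC p hp) (hc p hp) hJX hJY, mulVec_lieBracket (hC p hp) (hc p hp) hX hY,
      mulVec_lieBracket (hC p hp) (hc p hp) hX hJY, mulVec_lieBracket (hC p hp) (hc p hp) hJX hY,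
      hd hX, hd hX, hd hY, hd hY, Matrix.mulVec_sub, Matrix.mulVec_sub, hMM, hMM]
    abel
  rw [← one_mulVec (nijenhuis J X Y p), ← hi p hp, ← mulVec_mulVec, key, mulVec_zero]

end ClosedCoframes

/-! ### Complex structure, Bismut connection and Ricci form of the family -/

section KtComplex

open Matrix BasicRing BoostData

namespace KtReal

variable {n : ℕ} {W : BasicDomain (Idx n)} {S : SepBoost n (BasicRing W)} {K : TypeA n}

/-- A closed coframe in which the complex structure is constant. -/
def complexCoframe (S : SepBoost n (BasicRing W)) : Matrix (Idx n) (Idx n) (BasicRing W) :=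
  blockFrame (S.boost.Li * S.E1)

theorem complexCoframe_closed (H : KtReal S K) (i j a : Idx n) :
    D i (complexCoframe S a j) = D j (complexCoframe S a i) := by
  have h0 : ∀ (k : Fin n) f, D (W := W) (Sum.inr k) f = 0 := H.frame.D_inr
  rcases a with a | a <;> rcases i with i | i <;> rcases j with j | j <;>
    simp [complexCoframe, blockFrame, h0, Matrix.one_apply, apply_ite]
  by_cases h : i = j
  · rw [h]
  · have h1 := S.isSeparated_Li_E1 a i j h
    have h2 := S.isSeparated_Li_E1 a j i (Ne.symm h)
    rw [H.pd] at h1 h2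
    rw [h1, h2]

/-- L⁻¹E₁ is inverse to T₁L, the upper right block of J, so the blocks of J become constant in this
coframe. -/
theorem complexCoframe_mul_Jc (H : KtReal S K) :
    complexCoframe S * H.frame.Jc = fromBlocks 0 1 (-1) 0 * complexCoframe S := by
  have h1 : S.boost.Li * S.E1 * (S.T1 * S.boost.L) = 1 := by
    calc S.boost.Li * S.E1 * (S.T1 * S.boost.L) = S.boost.Li * (S.E1 * S.T1) * S.boost.L := by
          noncomm_ring
      _ = 1 := by rw [S.E1_mul_T1, Matrix.mul_one, BoostData.Li_mul_L]
  rw [H.Jc_eq, complexCoframe, blockFrame, fromBlocks_multiply, fromBlocks_multiply, h1]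
  simp

theorem complexCoframe_inv (S : SepBoost n (BasicRing W)) :
    blockFrame (S.T1 * S.boost.L) * complexCoframe S = 1 := by
  refine blockFrame_inv ?_
  calc S.T1 * S.boost.L * (S.boost.Li * S.E1) = S.T1 * (S.boost.L * S.boost.Li) * S.E1 := by
        noncomm_ring
    _ = 1 := by rw [BoostData.L_mul_Li, Matrix.mul_one]; exact mul_eq_one_comm.mp S.E1_mul_T1

theorem isComplexStructureOn (H : KtReal S K) {ε : Fin n → ℝ} {s : ℝ} (hs : s * s = 1)
    (hε : ∀ μ, ε μ = s) : IsComplexStructureOn (K.J ε) K.domain := by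
  have hJ := fun p => H.J_eq p hs hε
  have hr : ∀ i j, Rep (fun p => K.J ε p i j) ((s • H.frame.Jc) i j) := fun i j p =>
    congrFun (congrFun (hJ p) i) j
  rw [← H.carrier]
  refine ⟨fun i j => (hr i j).contDiffOn, fun p hp => ?_, fun X Y hX hY p hp => ?_⟩
  · rw [hJ ⟨p, hp⟩, ← map_ev_mul, Matrix.smul_mul, Matrix.mul_smul, smul_smul, hs, one_smul,
      H.frame.Jc_sq]
    ext i j
    simp [Matrix.one_apply, apply_ite]
  · have hC : ∀ a j, Rep (fun q => (complexCoframe S a j).lift q) (complexCoframe S a j) :=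
      fun a j => rep_lift _
    have hCm : ∀ p : W.carrier, (Matrix.of fun a j => (complexCoframe S a j).lift p)
        = (complexCoframe S).map (ev p) := fun p => by ext a j; exact hC a j p
    refine nijenhuis_eq_zero (Ω := W.carrier) W.isOpen (M := s • fromBlocks 0 1 (-1) 0)
      (C := fun q => Matrix.of fun a j => (complexCoframe S a j).lift q)
      (Ci := fun q => Matrix.of fun a j => (blockFrame (S.T1 * S.boost.L) a j).lift q) ?_
      (fun p hp a j => differentiableAt_of_contDiffOn (hC a j).contDiffOn ⟨p, hp⟩)
      (fun p hp a i j => ?_) (fun p hp => ?_)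
      (fun p hp a j => differentiableAt_of_contDiffOn (hr a j).contDiffOn ⟨p, hp⟩)
      (fun p hp => ?_) hp (differentiableAt_of_contDiffOn hX ⟨p, hp⟩)
      (differentiableAt_of_contDiffOn hY ⟨p, hp⟩)
    · rw [Matrix.smul_mul, Matrix.mul_smul, smul_smul, hs, one_smul, fromBlocks_multiply,
        ← fromBlocks_one, fromBlocks_neg]
      simp
    · exact ((hC a j).pd i ⟨p, hp⟩).trans
        ((congrArg _ (H.complexCoframe_closed i j a)).trans ((hC a i).pd j ⟨p, hp⟩).symm)
    · have h1 : (Matrix.of fun a j => (blockFrame (S.T1 * S.boost.L) a j).lift p)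
        = (blockFrame (S.T1 * S.boost.L)).map (ev ⟨p, hp⟩) := by
        ext a j; exact rep_lift (W := W) _ ⟨p, hp⟩
      refine (congrArg₂ (· * ·) h1 (hCm ⟨p, hp⟩)).trans ?_
      rw [← map_ev_mul, complexCoframe_inv]
      exact Matrix.map_one _ (map_zero _) (map_one _)
    · show (Matrix.of fun a j => (complexCoframe S a j).lift p) * _ = _ * (Matrix.of fun a j => (complexCoframe S a j).lift p)
      rw [hCm ⟨p, hp⟩, hJ ⟨p, hp⟩, ← map_ev_mul, Matrix.mul_smul, H.complexCoframe_mul_Jc]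
      have h2 : (fromBlocks 0 1 (-1) 0 : Matrix (Idx n) (Idx n) ℝ)
          = (fromBlocks 0 1 (-1) 0 : Matrix (Idx n) (Idx n) (BasicRing W)).map (ev ⟨p, hp⟩) := by
        ext (i | i) (j | j) <;> simp [Matrix.one_apply, apply_ite]
      rw [h2, Matrix.smul_mul, ← map_ev_mul]
      ext i j
      rw [map_apply, Matrix.smul_apply, map_smul, Matrix.smul_apply, map_apply]

theorem isKahlerWithTorsion (H : KtReal S K) {ε : Fin n → ℝ} {s : ℝ} (hs : s * s = 1)
    (hε : ∀ μ, ε μ = s) : IsKahlerWithTorsion K.domain K.metric (K.J ε) (ktH K) := by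
  have hJ := fun p => H.J_eq p hs hε
  have hm : ∀ p ∈ K.domain, p ∈ W.carrier := fun p hp => by rwa [H.carrier]
  refine ⟨H.isRiemannianMetricOn, H.isComplexStructureOn hs hε, fun p hp => ?_, ?_,
    fun p hp i j k => H.frame.parallel_g H.metric_eq H.formMat₃_ktH ⟨p, hm p hp⟩ i j k,
    fun p hp i j k => H.frame.parallel_J H.metric_eq H.formMat₃_ktH hJ ⟨p, hm p hp⟩ i j k⟩
  · rw [hJ ⟨p, hm p hp⟩, H.metric_eq ⟨p, hm p hp⟩, ← Matrix.transpose_map, ← map_ev_mul, ← map_ev_mul,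
      Matrix.transpose_smul, Matrix.smul_mul, Matrix.smul_mul, Matrix.mul_smul, smul_smul, hs,
      one_smul, H.frame.Jc_hermitian]
  · rw [← H.carrier]; exact H.contDiffOn_ktH

/-- The constant ell in the distinguished direction is n c_n. -/
theorem ricciForm_eq_zero (H : KtReal S K) {ε : Fin n → ℝ} {s : ℝ} (hs : s * s = 1)
    (hε : ∀ μ, ε μ = s) (hc : S.c n = 0) (p : W.carrier) (i j : Idx n) :
    ricciForm K.metric (K.J ε) (ktH K) p i j = 0 :=
  H.frame.ricciForm_eq_zero H.metric_eq H.formMat₃_ktH hs (fun p => H.J_eq p hs hε)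
    (by show S.ell S.z = 0; simp [SepBoost.ell, SepBoost.z, hc]) p i j

/-- As σ_μz = 1, `sum_poly_sig` in the direction z sums the polynomial part of N_μ/U_μ to b_{n−1} +
b_n e_1. -/
theorem Phi_eq (H : KtReal S K) (p : W.carrier) : K.Phi p = 1 + S.b (n - 1)
    + S.b n * ∑ μ, xc (p : Idx n → ℝ) μ ^ 2 + S.a * ∑ μ, S.m μ / Ufun (p : Idx n → ℝ) μ := by
  have hn := S.two_le
  have h1 : S.Phi = 1 + (∑ μ, S.poly S.b μ * S.ui μ * S.sig μ S.z)
      + algebraMap ℝ _ S.a * ∑ μ, algebraMap ℝ _ (S.m μ) * S.ui μ := by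
    rw [SepBoost.Phi, add_assoc, Finset.mul_sum, ← Finset.sum_add_distrib]
    congr 1
    exact Finset.sum_congr rfl fun μ _ => by rw [SepBoost.Nf, map_mul, S.sig_z]; ring
  rw [← H.ev_Phi, h1, S.sum_poly_sig, if_neg (by simp only [SepBoost.z]; omega)]
  have he : S.e ((S.z : ℕ) + 1) = ∑ μ, S.y μ := by
    simp [SepCoords.e, esym, SepBoost.z, Finset.powersetCard_one]
  rw [he]
  simp [SepBoost.z, map_add, map_sum, H.ev_y, H.ev_ui, div_eq_mul_inv, add_assoc]

end KtReal

end KtComplex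

/-- The realisation of the family. -/
theorem ktReal {n : ℕ} (hn : 2 ≤ n) {a : ℝ} {b c : ℕ → ℝ} {m : Fin n → ℝ} (hb : b n = a * c n) :
    KtReal (Kt.sep (m := m) hn hb) (ktData n a b c m) where
  eq := rfl
  carrier := rfl
  pd := rfl
  dirs := Kt.inr_mem a b c m
  ev_x _ _ := rfl
  rep_phi p := by
    refine Eq.trans ?_ (BasicRing.ev_log _ Kt.Phi_ne p).symm
    rw [Kt.ev_Phi, ktphi]

theorem mainTheorem8 (n : ℕ) (hn : 2 ≤ n) (o : Fin (n + n) ≃ Idx n)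
    (ε : Fin n → ℝ) (hε : (∀ μ, ε μ = 1) ∨ (∀ μ, ε μ = -1))
    (a : ℝ) (b c : ℕ → ℝ) (m : Fin n → ℝ) (hb : b n = a * c n)
    (S : TypeA n) (hS : S = ktData n a b c m) :
    -- the closed form of `Φ`
    (∀ p ∈ S.domain, S.Phi p =
      1 + b (n - 1) + b n * ∑ μ, xc p μ ^ 2 + a * ∑ μ, m μ / Ufun p μ) ∧
    -- the canonical coframe is orthonormal
    (∀ p ∈ S.domain, S.metric p = (S.coframe p).transpose * S.coframe p) ∧
    -- `H` is the Bismut torsion of `(g, J_ε)`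
    IsKahlerWithTorsion S.domain S.metric (S.J ε) (ktH S) ∧
    -- the fields solve the field equations of abelian heterotic supergravity
    (∀ q : ℝ, 1 + b (n - 1) = a * c (n - 1) + a * q ^ 2 →
      ∃ B : (Idx n → ℝ) → DForm (Idx n) 2,
        IsAbelianHeteroticSolution o S.domain S.metric (ktphi S)
          (fun p => q • oneForm (S.A1 p)) B (ktF q S) (ktH S)) ∧
    -- for `c_n = 0` the metric is Calabi–Yau with torsion
    (c n = 0 → IsCalabiYauWithTorsion S.domain S.metric (S.J ε) (ktH S)) := by
  subst hS
  have H := ktReal (m := m) hn hb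
  -- All ε_μ are the same sign s, which enters below only through s² = 1.
  obtain ⟨s, hs, hεs⟩ : ∃ s : ℝ, s * s = 1 ∧ ∀ μ, ε μ = s :=
    hε.elim (fun h => ⟨1, by norm_num, h⟩) fun h => ⟨-1, by norm_num, h⟩
  refine ⟨fun p hp => H.Phi_eq ⟨p, hp⟩, fun p hp => TypeA.metric_eq_coframe _ hp.2.2.1,
    H.isKahlerWithTorsion hs hεs, fun q hq => ⟨_, H.isAbelianHeteroticSolution o (q := q) ?_⟩,
    fun hc => ⟨H.isKahlerWithTorsion hs hεs, fun p hp i j =>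
      H.ricciForm_eq_zero hs hεs hc ⟨p, hp⟩ i j⟩⟩
  -- The left side is the constant κ in Φ = a h_00 + κ.
  show 1 + b (n - 1) - a * c (n - 1) = a * q ^ 2
  linarith

end
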